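/- Let $\sigma(r)=\frac1{1+e^{-r}}$, let $\mathrm{Ai}$ be the Airy function, let $$K^{\mathrm{Ai}}(u,v)=\frac{\mathrm{Ai}(u)\mathrm{Ai}'(v)-\mathrm{Ai}'(u)\mathrm{Ai}(v)}{u-v}\qquad(\text{extended by continuity to } u=v)$$ be the Airy kernel, and for $s\in\mathbb R$, $T>0$ let $$Q(s,T)=\det\bigl(1-\sigma(T^{1/3}(x+s))K^{\mathrm{Ai}}(x,y)\bigr)$$ be the Fredholm determinant on the real line (the Fredholm series converges absolutely and $Q(s,T)>0$). Write $a(\zeta)=(1-\sigma(T^{1/3}(\zeta+s)))^{-1}=1+e^{T^{1/3}(\zeta+s)}$, an entire function of $\zeta$. For $s,\zeta_0\in\mathbb R$ and $T>0$ consider the following Riemann-Hilbert (RH) problem for a $2\times2$ matrix-valued function $\Psi(\zeta)=\Psi(\zeta;s,T,\zeta_0)$. (a) $\Psi$ is analytic on $\mathbb C\setminus\Gamma$, where $\Gamma=\zeta_0+(\mathbb R\cup i\mathbb R)$; the real line is oriented from left to right and the two vertical rays $\zeta_0+i\mathbb R^{\pm}$ are oriented towards $\zeta_0$. (b) $\Psi$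 has continuous boundary values $\Psi_+$ (from the left side of the oriented contour) and $\Psi_-$ (from the right side) on $\Gamma\setminus\{\zeta_0\}$, with $$\Psi_+=\Psi_-\begin{pmatrix}1&0\\a&1\end{pmatrix}\ \text{on }\zeta_0+i\mathbb R^{\pm},\qquad \Psi_+=\Psi_-\begin{pmatrix}0&1-\sigma(T^{1/3}(\zeta+s))\\-a&0\end{pmatrix}\ \text{for }\zeta<\zeta_0,$$ $$\Psi_+=\Psi_-\begin{pmatrix}1&1-\sigma(T^{1/3}(\zeta+s))\\0&1\end{pmatrix}\ \text{for }\zeta>\zeta_0.$$ (c) As $\zeta\to\infty$, $\Psi(\zeta)=\bigl(I+\mathcal O(\zeta^{-1})\bigr)\zeta^{\frac14\sigma_3}A^{-1}e^{-\frac23\zeta^{3/2}\sigma_3}$, with principal branches, $A=(I+i\sigma_1)/\sqrt2$, $\sigma_1=\begin{pmatrix}0&1\\1&0\end{pmatrix}$, $\sigma_3=\begin{pmatrix}1&0\\0&-1\end{pmatrix}$. (d) $\Psi$ remains bounded as $\zeta\to\zeta_0$. Theorem. For all $s,\zeta_0\in\mathbb R$ and $T>0$ this RH problem has a unique solution $\Psi$.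 Moreover, define, for $\zeta\in\mathbb R\setminus\{\zeta_0\}$, with $\Psi_+$ the boundary value from the upper half-plane, $$\widehat\Psi(\zeta)=\begin{cases}\Psi_+(\zeta),&\zeta>\zeta_0,\\ \Psi_+(\zeta)\begin{pmatrix}1&0\\a(\zeta)&1\end{pmatrix},&\zeta<\zeta_0.\end{cases}$$ Then $\widehat\Psi$ is invertible and differentiable on $\mathbb R\setminus\{\zeta_0\}$ and, for any choice of $\zeta_0\in\mathbb R$, with $'$ denoting the derivative with respect to $\zeta$ for $\widehat\Psi$ and the derivative of $\sigma$ for $\sigma'$, $$\partial_T\log Q(s,T)=-\frac1{6\pi i\,T^{2/3}}\int_{\mathbb R}(\zeta+s)\,\sigma'(T^{1/3}(\zeta+s))\,\bigl(\widehat\Psi^{-1}\widehat\Psi'\bigr)_{2,1}(\zeta;s,T,\zeta_0)\,d\zeta,$$ $$\partial_s\log Q(s,T)=-\frac{T^{1/3}}{2\pi i}\int_{\mathbb R}\sigma'(T^{1/3}(\zeta+s))\,\bigl(\widehat\Psi^{-1}\widehat\Psi'\bigr)_{2,1}(\zeta;s,T,\zeta_0)\,d\zeta,$$ where both integrals converge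 absolutely. -/

import Mathlib

open Filter Topology MeasureTheory

noncomputable section

/- The Airy function. -/

/-- The integrand `exp (t ^ 3 / 3 - z * t)` of the contour integral of the Airy function, on the
vertical line `t = 1 + i y`. -/
def airyIntegrand (z : ℂ) (y : ℝ) : ℂ :=
  Complex.exp ((1 + Complex.I * y) ^ 3 / 3 - z * (1 + Complex.I * y))

/-- The (entire) Airy function `Ai z = (2 π i)⁻¹ ∫ exp (t ^ 3 / 3 - z t) dt`, the integral being
taken upwards along the line `Re t = 1`, where it converges absolutely. -/
def airyAiC (z : ℂ) : ℂ :=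
  (1 / (2 * Real.pi) : ℂ) * ∫ y : ℝ, airyIntegrand z y

/-- The Airy function on the real line. -/
def airyAi (x : ℝ) : ℝ := (airyAiC x).re

theorem norm_airyIntegrand (z : ℂ) (y : ℝ) :
    ‖airyIntegrand z y‖ = Real.exp (1 / 3 - y ^ 2 - z.re + z.im * y) := by
  rw [airyIntegrand, Complex.norm_exp]
  congr 1
  have h : (1 + Complex.I * y) ^ 3 / 3 - z * (1 + Complex.I * y)
      = ((1 / 3 - y ^ 2 : ℝ) : ℂ) + ((y - y ^ 3 / 3 : ℝ) : ℂ) * Complex.I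
        - z * (1 + Complex.I * y) := by
    push_cast
    linear_combination ((y : ℂ) ^ 2 + Complex.I * (y : ℂ) ^ 3 / 3) * Complex.I_sq
  rw [h]
  simp only [Complex.add_re, Complex.sub_re, Complex.mul_re, Complex.ofReal_re, Complex.ofReal_im,
    Complex.I_re, Complex.I_im, Complex.one_re, Complex.add_im, Complex.one_im, Complex.mul_im]
  ring

theorem integrable_airyIntegrand (z : ℂ) : Integrable (airyIntegrand z) := by
  have hc : Continuous (airyIntegrand z) := by
    unfold airyIntegrand
    fun_prop
  have hg : Integrable fun y : ℝ =>
      Real.exp (1 / 3 - z.re + z.im ^ 2 / 2) * Real.exp (-(1 / 2) * y ^ 2) :=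
    (integrable_exp_neg_mul_sq (by norm_num : (0 : ℝ) < 1 / 2)).const_mul _
  refine hg.mono' hc.aestronglyMeasurable (Eventually.of_forall fun y => ?_)
  rw [norm_airyIntegrand, ← Real.exp_add]
  apply Real.exp_le_exp.mpr
  nlinarith [sq_nonneg (y - z.im)]

/-- `Ai` takes real values on the real line. -/
theorem ofReal_airyAi (x : ℝ) : ((airyAi x : ℝ) : ℂ) = airyAiC x := by
  have h1 : ∀ y : ℝ, (starRingEnd ℂ) (airyIntegrand x y) = airyIntegrand x (-y) := by
    intro y
    unfold airyIntegrand
    rw [← Complex.exp_conj]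
    congr 1
    simp [map_ofNat]
  apply Complex.conj_eq_iff_re.mp
  unfold airyAiC
  rw [map_mul, ← integral_conj]
  simp_rw [h1]
  rw [integral_neg_eq_self (airyIntegrand x) volume]
  congr 1
  simp [map_ofNat]

/- The Airy kernel, the Fredholm determinant, and `Q`. -/

/-- The Airy kernel; on the diagonal the quotient is replaced by its limit. -/
def airyKernel (u v : ℝ) : ℝ :=
  if u = v then deriv airyAi u ^ 2 - u * airyAi u ^ 2
  else (airyAi u * deriv airyAi v - deriv airyAi u * airyAi v) / (u - v)

/-- The determinant of the matrix `(K (x i) (x j))`. -/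
def kernelDet (K : ℝ → ℝ → ℝ) (n : ℕ) (x : Fin n → ℝ) : ℝ :=
  (Matrix.of fun i j => K (x i) (x j)).det

/-- Absolute convergence of all integrals in the Fredholm series of `K`, and of the series. -/
def FredholmConverges (K : ℝ → ℝ → ℝ) : Prop :=
  (∀ n : ℕ, Integrable (kernelDet K n)) ∧
    Summable fun n : ℕ => (1 / (n.factorial : ℝ)) * ∫ x : Fin n → ℝ, |kernelDet K n x|

/-- The Fredholm determinant `det (1 - K)` of the integral operator on the real line with
kernel `K`, given by the Fredholm series. -/
def fredholmDet (K : ℝ → ℝ → ℝ) : ℝ :=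
  ∑' n : ℕ, ((-1) ^ n / (n.factorial : ℝ)) * ∫ x : Fin n → ℝ, kernelDet K n x

/-- The kernel `σ (T ^ (1/3) (x + s)) * K_Ai (x, y)`, where `σ r = 1 / (1 + exp (-r))` is
`Real.sigmoid`. -/
def deformedAiryKernel (s T : ℝ) (x y : ℝ) : ℝ :=
  Real.sigmoid (T ^ (1 / 3 : ℝ) * (x + s)) * airyKernel x y

/-- `Q (s, T)`. -/
def airyQ (s T : ℝ) : ℝ := fredholmDet (deformedAiryKernel s T)

/- The jump functions. -/

/-- `σ` as a function of a complex variable. -/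
def sigmaC (w : ℂ) : ℂ := 1 / (1 + Complex.exp (-w))

/-- The entire function `(1 - σ w)⁻¹ = 1 + exp w`, see `invOneSubSigma_eq`. -/
def invOneSubSigma (w : ℂ) : ℂ := 1 + Complex.exp w

theorem sigmaC_ofReal (x : ℝ) : sigmaC x = (Real.sigmoid x : ℝ) := by
  simp [sigmaC, Real.sigmoid_def]

/-- `invOneSubSigma` is `(1 - σ)⁻¹` away from the poles of `σ` (where it is its continuous
extension). -/
theorem invOneSubSigma_eq (w : ℂ) (hw : 1 + Complex.exp (-w) ≠ 0) :
    invOneSubSigma w = (1 - sigmaC w)⁻¹ := by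
  have h0 : Complex.exp (-w) ≠ 0 := Complex.exp_ne_zero _
  have h1 : 1 - sigmaC w = Complex.exp (-w) / (1 + Complex.exp (-w)) := by
    unfold sigmaC
    field_simp
    ring
  have h2 : Complex.exp w * Complex.exp (-w) = 1 := by
    rw [← Complex.exp_add]
    simp
  rw [h1, inv_div, eq_div_iff h0, invOneSubSigma]
  linear_combination h2

/-- The rescaled argument `T ^ (1/3) (ζ + s)`. -/
def scaledArg (s T : ℝ) (z : ℂ) : ℂ := ((T ^ (1 / 3 : ℝ) : ℝ) : ℂ) * (z + s)

/-- The jump matrix on the two vertical rays. -/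
def jumpVert (s T : ℝ) (z : ℂ) : Matrix (Fin 2) (Fin 2) ℂ :=
  !![1, 0; invOneSubSigma (scaledArg s T z), 1]

/-- The jump matrix on the left part of the real line. -/
def jumpLeft (s T : ℝ) (z : ℂ) : Matrix (Fin 2) (Fin 2) ℂ :=
  !![0, 1 - sigmaC (scaledArg s T z); -invOneSubSigma (scaledArg s T z), 0]

/-- The jump matrix on the right part of the real line. -/
def jumpRight (s T : ℝ) (z : ℂ) : Matrix (Fin 2) (Fin 2) ℂ :=
  !![1, 1 - sigmaC (scaledArg s T z); 0, 1]

/- The Riemann-Hilbert problem. -/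

/-- The contour `Γ = ζ₀ + (ℝ ∪ i ℝ)`. -/
def crossContour (ζ₀ : ℝ) : Set ℂ := {z | z.im = 0 ∨ z.re = ζ₀}

/-- `Ψ` has continuous boundary values `Ψ₊`, `Ψ₋` on the arc `γ` from the two sides given by the
half-planes `plus` and `minus`, and they satisfy `Ψ₊ = Ψ₋ J`. -/
def HasJump (Ψ : ℂ → Matrix (Fin 2) (Fin 2) ℂ) (γ plus minus : Set ℂ)
    (J : ℂ → Matrix (Fin 2) (Fin 2) ℂ) : Prop :=
  ∃ Ψp Ψm : ℂ → Matrix (Fin 2) (Fin 2) ℂ,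
    ContinuousOn Ψp γ ∧ ContinuousOn Ψm γ ∧
    (∀ z ∈ γ, Tendsto Ψ (𝓝[plus] z) (𝓝 (Ψp z))) ∧
    (∀ z ∈ γ, Tendsto Ψ (𝓝[minus] z) (𝓝 (Ψm z))) ∧
    ∀ z ∈ γ, Ψp z = Ψm z * J z

/-- The matrix `A = (I + i σ₁) / √2`. -/
def matA : Matrix (Fin 2) (Fin 2) ℂ :=
  (1 / (Real.sqrt 2 : ℂ)) • (1 + Complex.I • !![0, 1; 1, 0])

/-- The leading behaviour `ζ ^ (σ₃ / 4) A⁻¹ exp (-(2/3) ζ ^ (3/2) σ₃)`, principal branches. -/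
def leadingAsymp (z : ℂ) : Matrix (Fin 2) (Fin 2) ℂ :=
  !![z ^ (1 / 4 : ℂ), 0; 0, z ^ (-(1 / 4) : ℂ)] * matA⁻¹ *
    !![Complex.exp (-(2 / 3) * z ^ (3 / 2 : ℂ)), 0; 0, Complex.exp ((2 / 3) * z ^ (3 / 2 : ℂ))]

/-- `Ψ` solves the Riemann-Hilbert problem with parameters `s`, `T`, `ζ₀`. Only the values of `Ψ`
off the contour matter. The `+` side of an oriented arc is its left side: the real line is oriented
from left to right, and the two vertical rays are oriented towards `ζ₀`. -/
structure IsRHSolution (s T ζ₀ : ℝ) (Ψ : ℂ → Matrix (Fin 2) (Fin 2) ℂ) : Prop where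
  analytic : ∀ i j, DifferentiableOn ℂ (fun z => Ψ z i j) (crossContour ζ₀)ᶜ
  jump_up : HasJump Ψ {z | z.re = ζ₀ ∧ 0 < z.im} {w | ζ₀ < w.re} {w | w.re < ζ₀} (jumpVert s T)
  jump_down : HasJump Ψ {z | z.re = ζ₀ ∧ z.im < 0} {w | w.re < ζ₀} {w | ζ₀ < w.re} (jumpVert s T)
  jump_left : HasJump Ψ {z | z.im = 0 ∧ z.re < ζ₀} {w | 0 < w.im} {w | w.im < 0} (jumpLeft s T)
  jump_right : HasJump Ψ {z | z.im = 0 ∧ ζ₀ < z.re} {w | 0 < w.im} {w | w.im < 0} (jumpRight s T)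
  asymptotics : ∃ E : ℂ → Matrix (Fin 2) (Fin 2) ℂ,
    (∀ i j, (fun z => E z i j) =O[Bornology.cobounded ℂ ⊓ 𝓟 (crossContour ζ₀)ᶜ] fun z => z⁻¹) ∧
    ∀ᶠ z in Bornology.cobounded ℂ ⊓ 𝓟 (crossContour ζ₀)ᶜ, Ψ z = (1 + E z) * leadingAsymp z
  bounded : ∃ C : ℝ, ∀ᶠ z in 𝓝[(crossContour ζ₀)ᶜ] (ζ₀ : ℂ), ∀ i j, ‖Ψ z i j‖ ≤ C

/-- `Ψp` is the boundary value of `Ψ` from the upper (`+`) side on the real line minus `ζ₀`. -/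
def IsUpperBoundaryValue (ζ₀ : ℝ) (Ψ : ℂ → Matrix (Fin 2) (Fin 2) ℂ)
    (Ψp : ℝ → Matrix (Fin 2) (Fin 2) ℂ) : Prop :=
  ∀ x : ℝ, x ≠ ζ₀ → Tendsto Ψ (𝓝[{w : ℂ | 0 < w.im}] (x : ℂ)) (𝓝 (Ψp x))

/-- The function `Ψ̂` on the real line built from `Ψ₊` (its value at `ζ₀` is immaterial). -/
def hatPsi (s T ζ₀ : ℝ) (Ψp : ℝ → Matrix (Fin 2) (Fin 2) ℂ) (x : ℝ) :
    Matrix (Fin 2) (Fin 2) ℂ :=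
  if ζ₀ < x then Ψp x else Ψp x * jumpVert s T x

/-- The `(2,1)` entry of `F⁻¹ F'`. -/
def invMulDeriv21 (F : ℝ → Matrix (Fin 2) (Fin 2) ℂ) (x : ℝ) : ℂ :=
  ((F x)⁻¹ * Matrix.of fun i j => deriv (fun t => F t i j) x) 1 0

/-- The integrand `(ζ + s) σ'(T ^ (1/3) (ζ + s)) (F⁻¹ F')₂₁ (ζ)`. -/
def integrandT (s T : ℝ) (F : ℝ → Matrix (Fin 2) (Fin 2) ℂ) (x : ℝ) : ℂ :=
  (((x + s) * deriv Real.sigmoid (T ^ (1 / 3 : ℝ) * (x + s)) : ℝ) : ℂ) * invMulDeriv21 F x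

/-- The integrand `σ'(T ^ (1/3) (ζ + s)) (F⁻¹ F')₂₁ (ζ)`. -/
def integrandS (s T : ℝ) (F : ℝ → Matrix (Fin 2) (Fin 2) ℂ) (x : ℝ) : ℂ :=
  ((deriv Real.sigmoid (T ^ (1 / 3 : ℝ) * (x + s)) : ℝ) : ℂ) * invMulDeriv21 F x

end

/-! Let a(x) be the function t ↦ Ai(x+t) in L²(0,∞) and w(x) = σ(T^{1/3}(x+s)). The Airy equation
makes the Airy kernel a Gram kernel, K(x,y) = ⟨a(x),a(y)⟩ (`airyKernel_eq_integral`,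
`inner_airyVec`). Hence Q is the Fredholm determinant of the operator B = ∫ w(x) a(x)⊗a(x) dx on
L²(0,∞), and all operator theory happens there instead of on the real line.

Hadamard's inequality for Gram determinants (`abs_gramDet_le`) gives convergence of the series.
Laplace expansion of bordered Gram determinants gives Fredholm's formula for det(1−B)·(1−B)⁻¹
(`tsum_minorOp`). Termwise differentiation then yields ∂ log Q = −∫ ∂w(x) L(x,x) dx with L(x,y) =
⟨a(x),(1−B)⁻¹a(y)⟩ (`hasDerivAt_fredSeries`, `hasDerivAt_log_airyQ`). Invertibility and Q > 0 come
from ‖B‖ < 1: Bessel's inequality ∫⟨a(x),u⟩² dx ≤ ‖u‖², proved by Fourier transform, combines with w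
< 1, the monotonicity of w and the decay of Ai at +∞ (`norm_traceOp_lt_one`, `fredSeries_pos`).

The kernel L is integrable in the sense of Its, Izergin, Korepin and Slavnov. With the dressed
functions G₀ = (1−Kw)⁻¹Ai and G₁ = (1−Kw)⁻¹Ai', one has (x−y)L(x,y) = G₀(x)G₁(y) − G₁(x)G₀(y)
(`sub_mul_airyL`), so L(x,x) = G₁G₀' − G₀G₁'. Both dressed functions extend to entire functions.

The RH solution is built explicitly. In the right upper sector Ψ = YΦ, where Y is the identity plus
Cauchy transforms of σ G_k Ai^{(l)} and Φ is the Airy model matrix. In the left upper sector it is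
multiplied by the inverse vertical jump, and the lower half-plane is filled by the symmetry σ₃
conj(Ψ(conj z)) σ₃. Since σ is analytic near the real line, the Cauchy integrals are taken along a
line slightly below it, so boundary values are plain values of analytic functions and Plemelj's
formula is a residue computation (`StripHolo.cauchyLine_sub`). The jumps on the real line follow
from that formula, the integral equations for G₀ and G₁, the connection formula and the Wronskian
(`sectorRight_jump`). The behaviour at infinity follows from steepest descent for Ai and its
rotations; in the left sector the extra exponential in 1 + e^{T^{1/3}(ζ+s)} multiplies a term that
stays negligible (`exists_airyPhi_asymptotics`).

Uniqueness is Liouville's theorem: the quotient of two solutions has no jumps, is bounded near ζ₀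
and tends to the identity (`eq_of_no_jump`). Consequently Ψ̂ is YΦ on both sides of ζ₀. Its first
column on the real line is −√(2π)(G₁, iG₀), so (Ψ̂⁻¹Ψ̂')₂₁ = 2πi L(x,x) (`invMulDeriv21_hatPsi`).
Inserting this in the formula for ∂ log Q gives both identities, with no trace of ζ₀. -/

open Filter Topology MeasureTheory
noncomputable section

/- Shifting horizontal lines of integration. -/

/-- The integrals of a function holomorphic on a closed horizontal strip, and tending to `0` at its
ends, over the two boundary lines agree in the principal value sense. -/
theorem tendsto_sub_integral_horizontal {F : ℂ → ℂ} {a b : ℝ} (hab : a ≤ b)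
    (hd : DifferentiableOn ℂ F {z | z.im ∈ Set.Icc a b}) {M : ℝ → ℝ}
    (hM : ∀ x : ℝ, ∀ y ∈ Set.Icc a b, ‖F (x + y * Complex.I)‖ ≤ M x)
    (h1 : Tendsto M atTop (𝓝 0)) (h2 : Tendsto M atBot (𝓝 0)) :
    Tendsto (fun R : ℝ => (∫ x in (-R)..R, F (x + a * Complex.I)) -
      ∫ x in (-R)..R, F (x + b * Complex.I)) atTop (𝓝 0) := by
  -- Cauchy's theorem on the rectangle [−R,R] × [a,b] leaves only the two vertical sides.
  have key : ∀ R : ℝ, (∫ x in (-R)..R, F (x + a * Complex.I)) -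
      (∫ x in (-R)..R, F (x + b * Complex.I)) =
      -(Complex.I * ∫ y in a..b, F (R + y * Complex.I)) +
        Complex.I * ∫ y in a..b, F ((-R : ℝ) + y * Complex.I) := by
    intro R
    have := Complex.integral_boundary_rect_eq_zero_of_differentiableOn F
      (⟨-R, a⟩ : ℂ) (⟨R, b⟩ : ℂ) (hd.mono fun z hz => by
        have := hz.2
        simpa [Set.uIcc_of_le hab] using this)
    simp only [smul_eq_mul] at this
    linear_combination this
  rw [tendsto_zero_iff_norm_tendsto_zero]
  have hlim : Tendsto (fun R : ℝ => M R * |b - a| + M (-R) * |b - a|) atTop (𝓝 0) := by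
    simpa using (h1.mul_const |b - a|).add
      ((h2.comp tendsto_neg_atTop_atBot).mul_const |b - a|)
  refine squeeze_zero (fun _ => norm_nonneg _) (fun R => ?_) hlim
  rw [key R]
  refine (norm_add_le _ _).trans (add_le_add ?_ ?_)
  · rw [norm_neg, norm_mul, Complex.norm_I, one_mul]
    refine intervalIntegral.norm_integral_le_of_norm_le_const fun y hy => hM R y ?_
    rw [Set.uIoc_of_le hab] at hy
    exact ⟨hy.1.le, hy.2⟩
  · rw [norm_mul, Complex.norm_I, one_mul]
    refine intervalIntegral.norm_integral_le_of_norm_le_const fun y hy => hM (-R) y ?_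
    rw [Set.uIoc_of_le hab] at hy
    exact ⟨hy.1.le, hy.2⟩

theorem integral_horizontal_eq {F : ℂ → ℂ} {a b : ℝ} (hab : a ≤ b)
    (hd : DifferentiableOn ℂ F {z | z.im ∈ Set.Icc a b}) {M : ℝ → ℝ}
    (hM : ∀ x : ℝ, ∀ y ∈ Set.Icc a b, ‖F (x + y * Complex.I)‖ ≤ M x)
    (h1 : Tendsto M atTop (𝓝 0)) (h2 : Tendsto M atBot (𝓝 0))
    (ha : Integrable fun x : ℝ => F (x + a * Complex.I))
    (hb : Integrable fun x : ℝ => F (x + b * Complex.I)) :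
    ∫ x : ℝ, F (x + a * Complex.I) = ∫ x : ℝ, F (x + b * Complex.I) := by
  have h := tendsto_sub_integral_horizontal hab hd hM h1 h2
  have h3 := (intervalIntegral_tendsto_integral ha tendsto_neg_atTop_atBot tendsto_id).sub
    (intervalIntegral_tendsto_integral hb tendsto_neg_atTop_atBot tendsto_id)
  exact sub_eq_zero.mp (tendsto_nhds_unique h3 h)

/- The Airy function and its derivatives as contour integrals. -/

/-- The function `exp (t ^ 3 / 3 - z t)`. -/
def airyExp (z t : ℂ) : ℂ := Complex.exp (t ^ 3 / 3 - z * t)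

theorem norm_airyExp (z : ℂ) (c y : ℝ) :
    ‖airyExp z (c + Complex.I * y)‖ =
      Real.exp (c ^ 3 / 3 - c * y ^ 2 - c * z.re + z.im * y) := by
  rw [airyExp, Complex.norm_exp]
  congr 1
  have h : (c + Complex.I * y) ^ 3 / 3 - z * (c + Complex.I * y)
      = ((c ^ 3 / 3 - c * y ^ 2 : ℝ) : ℂ) + ((c ^ 2 * y - y ^ 3 / 3 : ℝ) : ℂ) * Complex.I
        - z * (c + Complex.I * y) := by
    push_cast
    linear_combination (c * (y : ℂ) ^ 2 + Complex.I * (y : ℂ) ^ 3 / 3) * Complex.I_sq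
  rw [h]
  simp only [Complex.add_re, Complex.sub_re, Complex.mul_re, Complex.ofReal_re, Complex.ofReal_im,
    Complex.I_re, Complex.I_im, Complex.add_im, Complex.mul_im]
  ring

/-- The integrand of the `k`-th derivative of the Airy function. -/
def airyKer (k : ℕ) (z : ℂ) (c y : ℝ) : ℂ :=
  (-(c + Complex.I * y)) ^ k * airyExp z (c + Complex.I * y)

theorem continuous_airyKer (k : ℕ) (z : ℂ) (c : ℝ) : Continuous (airyKer k z c) := by
  unfold airyKer airyExp
  fun_prop

/-- On Re t = c the real part of t³/3 supplies −c y², a Gaussian that beats the polynomial factor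
and the linear term from Im z. Uniformity for c in [a, b] is what shifting the line requires. -/
theorem norm_airyKer_le (k : ℕ) (z : ℂ) {a b c A : ℝ} (ha : 0 < a) (hac : a ≤ c) (hcb : c ≤ b)
    (hA : |z.im| ≤ A) (y : ℝ) :
    ‖airyKer k z c y‖ ≤ k.factorial *
      Real.exp (b + b ^ 3 / 3 - c * z.re + (A + 1) ^ 2 / (2 * a)) * Real.exp (-(a / 2) * y ^ 2) := by
  have hc : 0 < c := ha.trans_le hac
  have h1 : ‖-(c + Complex.I * y : ℂ)‖ ≤ c + |y| := by
    rw [norm_neg]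
    refine (norm_add_le _ _).trans ?_
    simp [abs_of_pos hc]
  have h2 : ‖-(c + Complex.I * y : ℂ)‖ ^ k ≤ k.factorial * Real.exp (c + |y|) := by
    have := Real.pow_div_factorial_le_exp (c + |y|) (by positivity) k
    rw [div_le_iff₀ (by positivity)] at this
    calc _ ≤ (c + |y|) ^ k := pow_le_pow_left₀ (norm_nonneg _) h1 k
      _ ≤ _ := by linarith
  unfold airyKer
  rw [norm_mul, norm_pow, norm_airyExp]
  refine (mul_le_mul_of_nonneg_right h2 (Real.exp_pos _).le).trans ?_
  rw [mul_assoc, mul_assoc, ← Real.exp_add, ← Real.exp_add]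
  refine mul_le_mul_of_nonneg_left (Real.exp_le_exp.mpr ?_) (by positivity)
  have h3 : c ^ 3 ≤ b ^ 3 := pow_le_pow_left₀ hc.le hcb 3
  have h4 : a * y ^ 2 ≤ c * y ^ 2 := mul_le_mul_of_nonneg_right hac (sq_nonneg _)
  have h5 : z.im * y ≤ A * |y| := by
    calc z.im * y ≤ |z.im * y| := le_abs_self _
      _ = |z.im| * |y| := abs_mul _ _
      _ ≤ _ := mul_le_mul_of_nonneg_right hA (abs_nonneg _)
  -- AM-GM: half of the Gaussian absorbs the linear growth. The extra unit in A + 1 comes from the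
  -- polynomial factor, bounded by an exponential of |y|.
  have h6 : (A + 1) * |y| ≤ (A + 1) ^ 2 / (2 * a) + a / 2 * y ^ 2 := by
    have : (A + 1) ^ 2 / (2 * a) + a / 2 * y ^ 2 - (A + 1) * |y| =
        ((A + 1) - a * |y|) ^ 2 / (2 * a) := by
      rw [← sq_abs y]
      field_simp
      ring
    have h7 : 0 ≤ ((A + 1) - a * |y|) ^ 2 / (2 * a) := by positivity
    linarith
  nlinarith

theorem integrable_airyKer (k : ℕ) (z : ℂ) {c : ℝ} (hc : 0 < c) : Integrable (airyKer k z c) := by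
  exact ((integrable_exp_neg_mul_sq (half_pos hc)).const_mul _).mono'
    (continuous_airyKer k z c).aestronglyMeasurable
    (Eventually.of_forall (norm_airyKer_le k z hc le_rfl le_rfl le_rfl))

/-- The `k`-th derivative of the Airy function. -/
def airyD (k : ℕ) (z : ℂ) : ℂ := (1 / (2 * Real.pi) : ℂ) * ∫ y : ℝ, airyKer k z 1 y

theorem airyD_zero : airyD 0 = airyAiC := by
  ext z
  simp [airyD, airyAiC, airyKer, airyExp, airyIntegrand]

theorem tendsto_gaussian_atTop {a : ℝ} (ha : 0 < a) (C : ℝ) :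
    Tendsto (fun y : ℝ => C * Real.exp (-a * y ^ 2)) atTop (𝓝 0) := by
  have h : Tendsto (fun y : ℝ => -a * y ^ 2) atTop atBot :=
    (tendsto_pow_atTop two_ne_zero).const_mul_atTop_of_neg (neg_neg_of_pos ha)
  simpa using (Real.tendsto_exp_atBot.comp h).const_mul C

theorem tendsto_gaussian_atBot {a : ℝ} (ha : 0 < a) (C : ℝ) :
    Tendsto (fun y : ℝ => C * Real.exp (-a * y ^ 2)) atBot (𝓝 0) := by
  simpa [Function.comp_def] using (tendsto_gaussian_atTop ha C).comp tendsto_neg_atBot_atTop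

/-- The rotation ζ ↦ −iζ turns the vertical lines into horizontal ones, up to the reflection y ↦ −y.
-/
theorem integral_airyKer_eq (k : ℕ) (z : ℂ) {a b : ℝ} (ha : 0 < a) (hab : a ≤ b) :
    ∫ y : ℝ, airyKer k z a y = ∫ y : ℝ, airyKer k z b y := by
  set F : ℂ → ℂ := fun ζ => (-(-Complex.I * ζ)) ^ k * airyExp z (-Complex.I * ζ) with hF
  have hFc : ∀ x c : ℝ, F (x + c * Complex.I) = airyKer k z c (-x) := by
    intro x c
    have : -Complex.I * (x + c * Complex.I) = c + Complex.I * ((-x : ℝ) : ℂ) := by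
      push_cast
      linear_combination (-(c : ℂ)) * Complex.I_sq
    simp only [hF, this, airyKer]
  have h := integral_horizontal_eq (F := F) hab
    (by
      apply Differentiable.differentiableOn
      unfold F airyExp
      fun_prop)
    (M := fun x => k.factorial *
      Real.exp (b + b ^ 3 / 3 + b * |z.re| + (|z.im| + 1) ^ 2 / (2 * a)) *
        Real.exp (-(a / 2) * x ^ 2))
    (fun x c hc => by
      rw [hFc]
      refine (norm_airyKer_le k z ha hc.1 hc.2 le_rfl (-x)).trans ?_
      rw [neg_sq]
      gcongr
      have : -(c * z.re) ≤ b * |z.re| := by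
        calc -(c * z.re) = c * (-z.re) := by ring
          _ ≤ c * |z.re| := mul_le_mul_of_nonneg_left (neg_le_abs _) (ha.le.trans hc.1)
          _ ≤ _ := mul_le_mul_of_nonneg_right hc.2 (abs_nonneg _)
      linarith)
    (tendsto_gaussian_atTop (half_pos ha) _) (tendsto_gaussian_atBot (half_pos ha) _)
    (by simpa only [hFc] using (integrable_airyKer k z ha).comp_neg)
    (by simpa only [hFc] using (integrable_airyKer k z (ha.trans_le hab)).comp_neg)
  simp only [hFc] at h
  rwa [integral_neg_eq_self (airyKer k z a) volume,
    integral_neg_eq_self (airyKer k z b) volume] at h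

theorem airyD_eq (k : ℕ) (z : ℂ) {c : ℝ} (hc : 0 < c) :
    airyD k z = (1 / (2 * Real.pi) : ℂ) * ∫ y : ℝ, airyKer k z c y := by
  rw [airyD]
  rcases le_total c 1 with h | h
  · rw [integral_airyKer_eq k z hc h]
  · rw [integral_airyKer_eq k z one_pos h]

/-- The rate c is free because the line Re t = c may be chosen at will. This one statement contains
both the superexponential decay at +∞ and the subexponential growth at −∞, uniformly in strips. -/
theorem exists_norm_airyD_le (k : ℕ) {c : ℝ} (hc : 0 < c) (A : ℝ) :
    ∃ C : ℝ, 0 < C ∧ ∀ z : ℂ, |z.im| ≤ A → ‖airyD k z‖ ≤ C * Real.exp (-c * z.re) := by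
  set J : ℝ := ∫ y : ℝ, Real.exp (-(c / 2) * y ^ 2)
  have hJ : 0 ≤ J := integral_nonneg fun y => (Real.exp_pos _).le
  refine ⟨1 / (2 * Real.pi) * (k.factorial * Real.exp (c + c ^ 3 / 3 + (A + 1) ^ 2 / (2 * c))) *
    (J + 1), by positivity, fun z hz => ?_⟩
  rw [airyD_eq k z hc, norm_mul]
  have h1 : ‖(1 / (2 * Real.pi) : ℂ)‖ = 1 / (2 * Real.pi) := by
    rw [show (1 / (2 * Real.pi) : ℂ) = ((1 / (2 * Real.pi) : ℝ) : ℂ) by push_cast; rfl,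
      Complex.norm_real, Real.norm_of_nonneg (by positivity)]
  have h2 : ‖∫ y : ℝ, airyKer k z c y‖ ≤ k.factorial *
      Real.exp (c + c ^ 3 / 3 - c * z.re + (A + 1) ^ 2 / (2 * c)) * J := by
    rw [← integral_const_mul]
    exact norm_integral_le_of_norm_le ((integrable_exp_neg_mul_sq (half_pos hc)).const_mul _)
      (Eventually.of_forall fun y => norm_airyKer_le k z hc le_rfl le_rfl hz y)
  rw [h1]
  calc _ ≤ 1 / (2 * Real.pi) * (k.factorial *
      Real.exp (c + c ^ 3 / 3 - c * z.re + (A + 1) ^ 2 / (2 * c)) * (J + 1)) := by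
        gcongr
        refine h2.trans ?_
        gcongr
        linarith
    _ = _ := by
      rw [show c + c ^ 3 / 3 - c * z.re + (A + 1) ^ 2 / (2 * c) =
        (c + c ^ 3 / 3 + (A + 1) ^ 2 / (2 * c)) + -c * z.re by ring, Real.exp_add]
      ring

theorem hasDerivAt_airyD (k : ℕ) (z : ℂ) : HasDerivAt (airyD k) (airyD (k + 1) z) z := by
  unfold airyD
  refine HasDerivAt.const_mul _ ?_
  refine (hasDerivAt_integral_of_dominated_loc_of_deriv_le
    (F := fun z y => airyKer k z 1 y) (F' := fun z y => airyKer (k + 1) z 1 y)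
    (bound := fun y => (k + 1).factorial *
      Real.exp (1 + 1 ^ 3 / 3 - (z.re - 1) + ((|z.im| + 1) + 1) ^ 2 / (2 * 1)) *
        Real.exp (-(1 / 2) * y ^ 2))
    (Metric.ball_mem_nhds z one_pos)
    (Eventually.of_forall fun w => (continuous_airyKer k w 1).aestronglyMeasurable)
    (integrable_airyKer k z one_pos)
    (continuous_airyKer (k + 1) z 1).aestronglyMeasurable
    (Eventually.of_forall fun y w hw => ?_)
    ((integrable_exp_neg_mul_sq (by norm_num)).const_mul _)
    (Eventually.of_forall fun y w hw => ?_)).2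
  · have hw' : ‖w - z‖ < 1 := by simpa [dist_eq_norm] using hw
    have h1 : |w.re - z.re| < 1 := (Complex.abs_re_le_norm (w - z)).trans_lt hw'
    have h2 : |w.im - z.im| < 1 := (Complex.abs_im_le_norm (w - z)).trans_lt hw'
    have h3 : |w.im| ≤ |z.im| + 1 := by
      have := abs_sub_abs_le_abs_sub w.im z.im
      linarith
    refine (norm_airyKer_le (k + 1) w one_pos le_rfl le_rfl h3 y).trans ?_
    gcongr
    rw [abs_lt] at h1
    linarith
  · unfold airyKer airyExp
    have h : HasDerivAt (fun w : ℂ => ((1 : ℝ) + Complex.I * y : ℂ) ^ 3 / 3 -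
        w * ((1 : ℝ) + Complex.I * y : ℂ)) (-((1 : ℝ) + Complex.I * y : ℂ)) w := by
      simpa using ((hasDerivAt_id w).mul_const ((1 : ℝ) + Complex.I * y : ℂ)).const_sub
        (((1 : ℝ) + Complex.I * y : ℂ) ^ 3 / 3)
    refine (h.cexp.const_mul _).congr_deriv ?_
    rw [pow_succ]
    ring

theorem differentiable_airyD (k : ℕ) : Differentiable ℂ (airyD k) := fun z =>
  (hasDerivAt_airyD k z).differentiableAt

/-- The Airy equation. -/
theorem airyD_two (z : ℂ) : airyD 2 z = z * airyD 0 z := by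
  have hsub : airyD 2 z - z * airyD 0 z = (1 / (2 * Real.pi) : ℂ) *
      ∫ y : ℝ, (airyKer 2 z 1 y - z * airyKer 0 z 1 y) := by
    rw [integral_sub (integrable_airyKer 2 z one_pos)
      ((integrable_airyKer 0 z one_pos).const_mul z), integral_const_mul]
    unfold airyD
    ring
  -- t² − z is the derivative of the exponent, so the integrand is a total derivative in y; the
  -- factor −i accounts for dt = i dy.
  have hder : ∀ y : ℝ, HasDerivAt (fun y : ℝ => -Complex.I * airyKer 0 z 1 y)
      (airyKer 2 z 1 y - z * airyKer 0 z 1 y) y := by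
    intro y
    have h0 : HasDerivAt (fun y : ℝ => ((1 : ℝ) : ℂ) + Complex.I * (y : ℂ)) Complex.I y := by
      simpa using (((hasDerivAt_id y).ofReal_comp).const_mul Complex.I).const_add (((1 : ℝ) : ℂ))
    have h1 := (((h0.pow 3).div_const 3).sub (h0.const_mul z)).cexp.const_mul (-Complex.I)
    unfold airyKer airyExp
    simp only [pow_zero, one_mul]
    refine h1.congr_deriv ?_
    simp only [Pi.pow_apply]
    norm_num
    linear_combination (-((1 + Complex.I * y) ^ 2 - z) *
      Complex.exp ((1 + Complex.I * y) ^ 3 / 3 - z * (1 + Complex.I * y))) * Complex.I_sq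
  have hlim : ∀ l : Filter ℝ, Tendsto (fun y : ℝ => (Nat.factorial 0) *
      Real.exp (1 + 1 ^ 3 / 3 - 1 * z.re + (|z.im| + 1) ^ 2 / (2 * 1)) *
        Real.exp (-(1 / 2) * y ^ 2)) l (𝓝 0) →
      Tendsto (fun y : ℝ => -Complex.I * airyKer 0 z 1 y) l (𝓝 0) := by
    intro l hl
    have : Tendsto (fun y : ℝ => airyKer 0 z 1 y) l (𝓝 0) :=
      squeeze_zero_norm (fun y => norm_airyKer_le 0 z one_pos le_rfl le_rfl le_rfl y) hl
    simpa using this.const_mul (-Complex.I)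
  have := integral_of_hasDerivAt_of_tendsto hder
    ((integrable_airyKer 2 z one_pos).sub ((integrable_airyKer 0 z one_pos).const_mul z))
    (hlim _ (tendsto_gaussian_atBot (by norm_num) _))
    (hlim _ (tendsto_gaussian_atTop (by norm_num) _))
  rw [this] at hsub
  simpa [sub_eq_zero] using hsub

theorem conj_airyD (k : ℕ) (z : ℂ) :
    (starRingEnd ℂ) (airyD k z) = airyD k ((starRingEnd ℂ) z) := by
  have h1 : ∀ y : ℝ, (starRingEnd ℂ) (airyKer k z 1 y) =
      airyKer k ((starRingEnd ℂ) z) 1 (-y) := by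
    intro y
    unfold airyKer airyExp
    rw [map_mul, ← Complex.exp_conj]
    simp [map_ofNat]
  unfold airyD
  rw [map_mul, ← integral_conj]
  simp_rw [h1]
  rw [integral_neg_eq_self (airyKer k ((starRingEnd ℂ) z) 1) volume]
  congr 1
  simp [map_ofNat]

/-- A solution of the Airy equation with vanishing initial data is zero. -/
theorem airy_eq_zero_of_initial {S S' : ℂ → ℂ} (h1 : ∀ z, HasDerivAt S (S' z) z)
    (h2 : ∀ z, HasDerivAt S' (z * S z) z) (h3 : S 0 = 0) (h4 : S' 0 = 0) (z : ℂ) : S z = 0 := by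
  -- The pair (S, S') is followed along the segment from 0 to z, where Grönwall's inequality with
  -- zero initial value applies.
  set f : ℝ → ℂ × ℂ := fun r => (S (r * z), S' (r * z)) with hf
  have hr : ∀ r : ℝ, HasDerivAt (fun r : ℝ => (r : ℂ) * z) z r := fun r => by
    simpa using ((hasDerivAt_id r).ofReal_comp).mul_const z
  have hd : ∀ r : ℝ, HasDerivAt f (S' (r * z) * z, (r * z * S (r * z)) * z) r := fun r =>
    ((h1 (r * z)).comp r (hr r)).prodMk ((h2 (r * z)).comp r (hr r))
  have hb := norm_le_gronwallBound_of_norm_deriv_right_le (f := f)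
    (f' := fun r => (S' (r * z) * z, (r * z * S (r * z)) * z)) (δ := 0)
    (K := ‖z‖ + ‖z‖ * ‖z‖) (ε := 0) (a := 0) (b := 1)
    (fun r _ => (hd r).continuousAt.continuousWithinAt)
    (fun r _ => (hd r).hasDerivWithinAt) (by simp [hf, h3, h4])
    (fun r hr => by
      rw [add_zero]
      have a1 : ‖S (r * z)‖ ≤ ‖f r‖ := norm_fst_le (f r)
      have a2 : ‖S' (r * z)‖ ≤ ‖f r‖ := norm_snd_le (f r)
      refine max_le ?_ ?_
      · rw [norm_mul]
        nlinarith [norm_nonneg z, norm_nonneg (f r), mul_nonneg (norm_nonneg z) (norm_nonneg z),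
          mul_nonneg (mul_nonneg (norm_nonneg z) (norm_nonneg z)) (norm_nonneg (f r))]
      · simp only [norm_mul, Complex.norm_real, Real.norm_of_nonneg hr.1]
        have : r * ‖z‖ * ‖S (r * z)‖ * ‖z‖ ≤ 1 * ‖z‖ * ‖f r‖ * ‖z‖ := by
          gcongr
          exact hr.2.le
        nlinarith [norm_nonneg z, norm_nonneg (f r), mul_nonneg (norm_nonneg z) (norm_nonneg (f r))])
    1 (by simp)
  have : ‖S z‖ ≤ 0 := by
    have a1 : ‖S ((1 : ℝ) * z)‖ ≤ ‖f 1‖ := norm_fst_le (f 1)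
    simp only [Complex.ofReal_one, one_mul] at a1
    refine a1.trans (hb.trans ?_)
    simp [gronwallBound_ε0]
  simpa using this

/-- The three-term connection formula. -/
theorem airyD_zero_connection {ω : ℂ} (h : 1 + ω + ω ^ 2 = 0) (z : ℂ) :
    airyD 0 z + ω * airyD 0 (ω * z) + ω ^ 2 * airyD 0 (ω ^ 2 * z) = 0 := by
  have h3 : ω ^ 3 = 1 := by linear_combination (ω - 1) * h
  have hc : ∀ (k : ℕ) (c z : ℂ), HasDerivAt (fun z => airyD k (c * z)) (airyD (k + 1) (c * z) * c) z :=
    fun k c z => (hasDerivAt_airyD k (c * z)).comp z (by simpa using (hasDerivAt_id z).const_mul c)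
  -- The sum solves the Airy equation because ω³ = 1, and its initial data are multiples of 1 + ω +
  -- ω².
  refine airy_eq_zero_of_initial
    (S := fun z => airyD 0 z + ω * airyD 0 (ω * z) + ω ^ 2 * airyD 0 (ω ^ 2 * z))
    (S' := fun z => airyD 1 z + ω ^ 2 * airyD 1 (ω * z) + ω * airyD 1 (ω ^ 2 * z))
    (fun z => ?_) (fun z => ?_) ?_ ?_ z
  · refine (((hasDerivAt_airyD 0 z).add ((hc 0 ω z).const_mul ω)).add
      ((hc 0 (ω ^ 2) z).const_mul (ω ^ 2))).congr_deriv ?_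
    linear_combination (ω * airyD 1 (ω ^ 2 * z)) * h3
  · refine (((hasDerivAt_airyD 1 z).add ((hc 1 ω z).const_mul (ω ^ 2))).add
      ((hc 1 (ω ^ 2) z).const_mul ω)).congr_deriv ?_
    simp only [airyD_two, Nat.reduceAdd]
    linear_combination (ω * z * airyD 0 (ω * z) + ω ^ 2 * z * airyD 0 (ω ^ 2 * z)) * h3
  · simp only [mul_zero]
    linear_combination airyD 0 0 * h
  · simp only [mul_zero]
    linear_combination airyD 1 0 * h
end

noncomputable section

/- Asymptotics of the Airy function. -/

/-- Symmetrising in y turns the cubic phase into a cosine or sine, which removes its first-order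
contribution. -/
theorem integral_eq_integral_even_part {f : ℝ → ℂ} (hf : Integrable f) :
    ∫ y, f y = ∫ y, (f y + f (-y)) / 2 := by
  rw [integral_div, integral_add hf hf.comp_neg, integral_neg_eq_self f volume]
  ring

/-- The integrand in the steepest descent representation of the `k`-th derivative. -/
def airySaddle (k : ℕ) (m : ℂ) (y : ℝ) : ℂ :=
  (-(m ^ 2 + Complex.I * y)) ^ k * Complex.exp (-m ^ 2 * y ^ 2 - Complex.I * y ^ 3 / 3)

/-- The saddle of t³/3 − m⁴t is t = m², and the Taylor expansion there is exact: t = m² + iy gives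
−(2/3)m⁶ − m²y² − iy³/3. The vertical line through the saddle is Re t = Re m², recentred by Im m².
-/
theorem airyKer_eq_airySaddle (k : ℕ) (m : ℂ) (y : ℝ) :
    airyKer k (m ^ 4) (m ^ 2).re (y + (m ^ 2).im) =
      Complex.exp (-(2 / 3) * m ^ 6) * airySaddle k m y := by
  have h : (((m ^ 2).re : ℝ) : ℂ) + Complex.I * ((y + (m ^ 2).im : ℝ) : ℂ) =
      m ^ 2 + Complex.I * y := by
    conv_rhs => rw [← Complex.re_add_im (m ^ 2)]
    push_cast
    ring
  rw [airyKer, h, airyExp, airySaddle, mul_left_comm, ← Complex.exp_add]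
  congr 2
  linear_combination (m ^ 2 * y ^ 2 + Complex.I * y ^ 3 / 3) * Complex.I_sq

theorem airyD_pow_four (k : ℕ) {m : ℂ} (hm : 0 < (m ^ 2).re) :
    airyD k (m ^ 4) =
      (1 / (2 * Real.pi) : ℂ) * (Complex.exp (-(2 / 3) * m ^ 6) * ∫ y, airySaddle k m y) := by
  rw [airyD_eq k _ hm, ← integral_add_right_eq_self _ (m ^ 2).im]
  simp_rw [airyKer_eq_airySaddle]
  rw [integral_const_mul]

theorem integrable_airySaddle (k : ℕ) {m : ℂ} (hm : 0 < (m ^ 2).re) :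
    Integrable (airySaddle k m) := by
  have h := (integrable_airyKer k (m ^ 4) hm).comp_add_right (m ^ 2).im
  simp_rw [airyKer_eq_airySaddle] at h
  have h2 := h.const_mul (Complex.exp (-(2 / 3) * m ^ 6))⁻¹
  simpa [← mul_assoc, Complex.exp_ne_zero] using h2

theorem integrable_pow_mul_gaussian (k : ℕ) {b : ℝ} (hb : 0 < b) :
    Integrable fun y : ℝ => y ^ k * Real.exp (-b * y ^ 2) := by
  have := integrable_rpow_mul_exp_neg_mul_sq hb (s := k)
    (by have := k.cast_nonneg (α := ℝ); linarith)
  simpa using this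

/-- The substitution u = r y; with r = ‖m‖ it produces the powers of ‖m‖ in the error terms. -/
theorem integral_pow_mul_gaussian_scale (k : ℕ) (κ : ℝ) {r : ℝ} (hr : 0 < r) :
    ∫ y : ℝ, y ^ k * Real.exp (-(κ * r ^ 2) * y ^ 2) =
      (∫ u : ℝ, u ^ k * Real.exp (-κ * u ^ 2)) / r ^ (k + 1) := by
  have h := Measure.integral_comp_mul_left (fun u : ℝ => u ^ k * Real.exp (-κ * u ^ 2)) r
  have h2 : ∀ y : ℝ, y ^ k * Real.exp (-(κ * r ^ 2) * y ^ 2) =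
      (r ^ k)⁻¹ * ((r * y) ^ k * Real.exp (-κ * (r * y) ^ 2)) := by
    intro y
    rw [mul_pow]
    field_simp
  simp_rw [h2]
  rw [integral_const_mul, h, abs_of_pos (inv_pos.mpr hr), smul_eq_mul, pow_succ]
  field_simp

theorem norm_gaussian_le {κ : ℝ} {m : ℂ} (hκ : κ * ‖m‖ ^ 2 ≤ (m ^ 2).re) (y : ℝ) :
    ‖Complex.exp (-m ^ 2 * y ^ 2)‖ ≤ Real.exp (-(κ * ‖m‖ ^ 2) * y ^ 2) := by
  rw [Complex.norm_exp]
  refine Real.exp_le_exp.mpr ?_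
  have : (-m ^ 2 * (y : ℂ) ^ 2).re = -((m ^ 2).re * y ^ 2) := by
    rw [show -m ^ 2 * (y : ℂ) ^ 2 = -(m ^ 2 * ((y ^ 2 : ℝ) : ℂ)) by push_cast; ring,
      Complex.neg_re, Complex.re_mul_ofReal]
  rw [this]
  nlinarith [mul_le_mul_of_nonneg_right hκ (sq_nonneg y)]

/-- The point is the branch: √(π/m²) equals √π/m because Re m > 0. -/
theorem integral_gaussian_sq {m : ℂ} (h1 : 0 < m.re) (h2 : 0 < (m ^ 2).re) :
    ∫ y : ℝ, Complex.exp (-m ^ 2 * y ^ 2) = (Real.sqrt Real.pi : ℂ) / m := by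
  have h0 : m ≠ 0 := by
    rintro rfl
    simp at h1
  have h := integral_gaussian_complex h2
  rw [h]
  have h3 : (Real.pi : ℂ) / m ^ 2 = ((Real.sqrt Real.pi : ℂ) / m) ^ 2 := by
    rw [div_pow, ← Complex.ofReal_pow, Real.sq_sqrt Real.pi_pos.le]
  have hre : 0 < ((Real.sqrt Real.pi : ℂ) / m).re := by
    rw [div_eq_mul_inv, Complex.re_ofReal_mul, Complex.inv_re]
    have := Complex.normSq_pos.mpr h0
    have := Real.sqrt_pos.mpr Real.pi_pos
    positivity
  rw [h3]
  have := Complex.sq_cpow_two_inv hre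
  rwa [one_div]

/-- After symmetrisation the integrand differs from the Gaussian by the factor cos(y³/3) − 1, at
most y⁶/18 in size. The sixth moment of a Gaussian of width 1/‖m‖ gives ‖m‖⁻⁷. -/
theorem exists_norm_integral_airySaddle_zero_sub_le {κ : ℝ} (hκ : 0 < κ) :
    ∃ C : ℝ, ∀ m : ℂ, 0 < m.re → κ * ‖m‖ ^ 2 ≤ (m ^ 2).re →
      ‖(∫ y, airySaddle 0 m y) - (Real.sqrt Real.pi : ℂ) / m‖ ≤ C / ‖m‖ ^ 7 := by
  refine ⟨(1 / 18) * ∫ u : ℝ, u ^ 6 * Real.exp (-κ * u ^ 2), fun m h1 h2 => ?_⟩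
  have hm0 : m ≠ 0 := by
    rintro rfl
    simp at h1
  have hm : 0 < ‖m‖ := norm_pos_iff.mpr hm0
  have hre : 0 < (m ^ 2).re := lt_of_lt_of_le (by positivity) h2
  have hint := integrable_airySaddle 0 hre
  have hg : Integrable fun y : ℝ => Complex.exp (-m ^ 2 * y ^ 2) := by
    simpa using integrable_cexp_neg_mul_sq hre
  rw [integral_eq_integral_even_part hint, ← integral_gaussian_sq h1 hre,
    ← integral_sub (f := fun y => (airySaddle 0 m y + airySaddle 0 m (-y)) / 2)
      ((hint.add hint.comp_neg).div_const 2) hg]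
  have hb : Integrable fun y : ℝ => (1 / 18) * (y ^ 6 * Real.exp (-(κ * ‖m‖ ^ 2) * y ^ 2)) :=
    (integrable_pow_mul_gaussian 6 (by positivity)).const_mul _
  refine (norm_integral_le_of_norm_le hb (Eventually.of_forall fun y => ?_)).trans ?_
  · have : (airySaddle 0 m y + airySaddle 0 m (-y)) / 2 - Complex.exp (-m ^ 2 * y ^ 2) =
        Complex.exp (-m ^ 2 * y ^ 2) * ((Real.cos (y ^ 3 / 3) - 1 : ℝ) : ℂ) := by
      simp only [airySaddle, pow_zero, one_mul]
      push_cast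
      rw [Complex.cos, show -m ^ 2 * (y : ℂ) ^ 2 - Complex.I * (y : ℂ) ^ 3 / 3 =
        -m ^ 2 * (y : ℂ) ^ 2 + -((y : ℂ) ^ 3 / 3) * Complex.I by ring,
        show -m ^ 2 * (-y : ℂ) ^ 2 - Complex.I * (-y : ℂ) ^ 3 / 3 =
        -m ^ 2 * (y : ℂ) ^ 2 + ((y : ℂ) ^ 3 / 3) * Complex.I by ring,
        Complex.exp_add, Complex.exp_add]
      ring
    rw [this, norm_mul, Complex.norm_real, Real.norm_eq_abs]
    have hcos : |Real.cos (y ^ 3 / 3) - 1| ≤ (1 / 18) * y ^ 6 := by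
      rw [abs_le]
      have e1 := Real.one_sub_sq_div_two_le_cos (x := y ^ 3 / 3)
      have e2 := Real.cos_le_one (y ^ 3 / 3)
      have e3 : (y ^ 3 / 3) ^ 2 / 2 = (1 / 18) * y ^ 6 := by ring
      have e4 : 0 ≤ y ^ 6 := by positivity
      constructor <;> nlinarith
    calc _ ≤ Real.exp (-(κ * ‖m‖ ^ 2) * y ^ 2) * ((1 / 18) * y ^ 6) :=
          mul_le_mul (norm_gaussian_le h2 y) hcos (abs_nonneg _) (Real.exp_pos _).le
      _ = _ := by ring
  · rw [integral_const_mul, integral_pow_mul_gaussian_scale 6 κ hm, ← mul_div_assoc]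

/-- The prefactor −(m² + iy) splits: −m² reduces to the case k = 0, while iy pairs with the odd part
sin(y³/3), leaving a fourth moment. -/
theorem exists_norm_integral_airySaddle_one_add_le {κ : ℝ} (hκ : 0 < κ) :
    ∃ C : ℝ, ∀ m : ℂ, 0 < m.re → κ * ‖m‖ ^ 2 ≤ (m ^ 2).re →
      ‖(∫ y, airySaddle 1 m y) + (Real.sqrt Real.pi : ℂ) * m‖ ≤ C / ‖m‖ ^ 5 := by
  obtain ⟨C, hC⟩ := exists_norm_integral_airySaddle_zero_sub_le hκ
  refine ⟨C + (1 / 3) * ∫ u : ℝ, u ^ 4 * Real.exp (-κ * u ^ 2), fun m h1 h2 => ?_⟩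
  have hm0 : m ≠ 0 := by
    rintro rfl
    simp at h1
  have hm : 0 < ‖m‖ := norm_pos_iff.mpr hm0
  have hre : 0 < (m ^ 2).re := lt_of_lt_of_le (by positivity) h2
  have hint := integrable_airySaddle 1 hre
  have hint0 := integrable_airySaddle 0 hre
  have hsplit : (∫ y, airySaddle 1 m y) + (Real.sqrt Real.pi : ℂ) * m =
      -m ^ 2 * ((∫ y, airySaddle 0 m y) - (Real.sqrt Real.pi : ℂ) / m) +
        ∫ y, ((airySaddle 1 m y + m ^ 2 * airySaddle 0 m y) +
          (airySaddle 1 m (-y) + m ^ 2 * airySaddle 0 m (-y))) / 2 := by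
    rw [← integral_eq_integral_even_part (f := fun y => airySaddle 1 m y + m ^ 2 * airySaddle 0 m y)
      (hint.add (hint0.const_mul (m ^ 2))), integral_add hint (hint0.const_mul (m ^ 2)), integral_const_mul]
    field_simp
    ring
  rw [hsplit]
  have hb : Integrable fun y : ℝ => (1 / 3) * (y ^ 4 * Real.exp (-(κ * ‖m‖ ^ 2) * y ^ 2)) :=
    (integrable_pow_mul_gaussian 4 (by positivity)).const_mul _
  rw [add_div]
  refine (norm_add_le _ _).trans (add_le_add ?_ ?_)
  · rw [norm_mul, norm_neg, norm_pow]
    refine (mul_le_mul_of_nonneg_left (hC m h1 h2) (by positivity)).trans_eq ?_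
    field_simp
  · refine (norm_integral_le_of_norm_le hb (Eventually.of_forall fun y => ?_)).trans ?_
    · have : ((airySaddle 1 m y + m ^ 2 * airySaddle 0 m y) +
          (airySaddle 1 m (-y) + m ^ 2 * airySaddle 0 m (-y))) / 2 =
          Complex.exp (-m ^ 2 * y ^ 2) * ((-(y * Real.sin (y ^ 3 / 3)) : ℝ) : ℂ) := by
        simp only [airySaddle, pow_zero, one_mul, pow_one]
        push_cast
        rw [Complex.sin, show -m ^ 2 * (y : ℂ) ^ 2 - Complex.I * (y : ℂ) ^ 3 / 3 =
          -m ^ 2 * (y : ℂ) ^ 2 + -((y : ℂ) ^ 3 / 3) * Complex.I by ring,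
          show -m ^ 2 * (-y : ℂ) ^ 2 - Complex.I * (-y : ℂ) ^ 3 / 3 =
          -m ^ 2 * (y : ℂ) ^ 2 + ((y : ℂ) ^ 3 / 3) * Complex.I by ring,
          Complex.exp_add, Complex.exp_add]
        ring
      rw [this, norm_mul, Complex.norm_real, Real.norm_eq_abs, abs_neg, abs_mul]
      have hsin : |y| * |Real.sin (y ^ 3 / 3)| ≤ (1 / 3) * y ^ 4 := by
        have e1 : |Real.sin (y ^ 3 / 3)| ≤ |y ^ 3 / 3| := Real.abs_sin_le_abs
        calc _ ≤ |y| * |y ^ 3 / 3| := mul_le_mul_of_nonneg_left e1 (abs_nonneg _)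
          _ = |y ^ 4 / 3| := by rw [← abs_mul]; congr 1; ring
          _ = _ := by rw [abs_of_nonneg (by positivity)]; ring
      calc _ ≤ Real.exp (-(κ * ‖m‖ ^ 2) * y ^ 2) * ((1 / 3) * y ^ 4) :=
            mul_le_mul (norm_gaussian_le h2 y) hsin (by positivity) (Real.exp_pos _).le
        _ = _ := by ring
    · rw [integral_const_mul, integral_pow_mul_gaussian_scale 4 κ hm, ← mul_div_assoc]

/-- Leading asymptotics of `Ai`, in terms of the fourth root `m` of its argument. -/
theorem exists_airyD_zero_asymptotics {κ : ℝ} (hκ : 0 < κ) :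
    ∃ C : ℝ, ∀ m : ℂ, 0 < m.re → κ * ‖m‖ ^ 2 ≤ (m ^ 2).re →
      ‖2 * (Real.sqrt Real.pi : ℂ) * m * Complex.exp ((2 / 3) * m ^ 6) * airyD 0 (m ^ 4) - 1‖ ≤
        C / ‖m‖ ^ 6 := by
  obtain ⟨C, hC⟩ := exists_norm_integral_airySaddle_zero_sub_le hκ
  refine ⟨C / Real.sqrt Real.pi, fun m h1 h2 => ?_⟩
  have hm0 : m ≠ 0 := by
    rintro rfl
    simp at h1
  have hm : 0 < ‖m‖ := norm_pos_iff.mpr hm0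
  have hre : 0 < (m ^ 2).re := lt_of_lt_of_le (by positivity) h2
  have hp : 0 < Real.sqrt Real.pi := Real.sqrt_pos.mpr Real.pi_pos
  have hpc : (Real.sqrt Real.pi : ℂ) ≠ 0 := Complex.ofReal_ne_zero.mpr hp.ne'
  have hpi : (Real.pi : ℂ) = (Real.sqrt Real.pi : ℂ) ^ 2 := by
    rw [← Complex.ofReal_pow, Real.sq_sqrt Real.pi_pos.le]
  have : 2 * (Real.sqrt Real.pi : ℂ) * m * Complex.exp ((2 / 3) * m ^ 6) * airyD 0 (m ^ 4) - 1 =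
      m / Real.sqrt Real.pi * ((∫ y, airySaddle 0 m y) - (Real.sqrt Real.pi : ℂ) / m) := by
    rw [airyD_pow_four 0 hre, hpi, neg_mul, Complex.exp_neg]
    have := Complex.exp_ne_zero (2 / 3 * m ^ 6)
    field_simp
  rw [this, norm_mul, norm_div, Complex.norm_real, Real.norm_of_nonneg hp.le]
  refine (mul_le_mul_of_nonneg_left (hC m h1 h2) (by positivity)).trans_eq ?_
  field_simp

/-- Leading asymptotics of `Ai'`, in terms of the fourth root `m` of its argument. -/
theorem exists_airyD_one_asymptotics {κ : ℝ} (hκ : 0 < κ) :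
    ∃ C : ℝ, ∀ m : ℂ, 0 < m.re → κ * ‖m‖ ^ 2 ≤ (m ^ 2).re →
      ‖-(2 * (Real.sqrt Real.pi : ℂ) * m⁻¹ * Complex.exp ((2 / 3) * m ^ 6) * airyD 1 (m ^ 4)) - 1‖ ≤
        C / ‖m‖ ^ 6 := by
  obtain ⟨C, hC⟩ := exists_norm_integral_airySaddle_one_add_le hκ
  refine ⟨C / Real.sqrt Real.pi, fun m h1 h2 => ?_⟩
  have hm0 : m ≠ 0 := by
    rintro rfl
    simp at h1
  have hm : 0 < ‖m‖ := norm_pos_iff.mpr hm0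
  have hre : 0 < (m ^ 2).re := lt_of_lt_of_le (by positivity) h2
  have hp : 0 < Real.sqrt Real.pi := Real.sqrt_pos.mpr Real.pi_pos
  have hpc : (Real.sqrt Real.pi : ℂ) ≠ 0 := Complex.ofReal_ne_zero.mpr hp.ne'
  have hpi : (Real.pi : ℂ) = (Real.sqrt Real.pi : ℂ) ^ 2 := by
    rw [← Complex.ofReal_pow, Real.sq_sqrt Real.pi_pos.le]
  have : -(2 * (Real.sqrt Real.pi : ℂ) * m⁻¹ * Complex.exp ((2 / 3) * m ^ 6) * airyD 1 (m ^ 4)) - 1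
      = -(m⁻¹ / Real.sqrt Real.pi) *
        ((∫ y, airySaddle 1 m y) + (Real.sqrt Real.pi : ℂ) * m) := by
    rw [airyD_pow_four 1 hre, hpi, neg_mul, Complex.exp_neg]
    have := Complex.exp_ne_zero (2 / 3 * m ^ 6)
    field_simp
    ring
  rw [this, norm_mul, norm_neg, norm_div, norm_inv, Complex.norm_real, Real.norm_of_nonneg hp.le]
  refine (mul_le_mul_of_nonneg_left (hC m h1 h2) (by positivity)).trans_eq ?_
  field_simp
end

noncomputable section

/- Determinants of matrices of inner products. -/

section GramDet

variable {H : Type*} [NormedAddCommGroup H] [InnerProductSpace ℝ H]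

/-- The determinant of the matrix of inner products of two families. -/
def gramDet {n : ℕ} (u v : Fin n → H) : ℝ := (Matrix.of fun i j => inner ℝ (u i) (v j)).det

/-- Hadamard's inequality. -/
theorem abs_det_le_prod_norm {n : ℕ} (A : Matrix (Fin n) (Fin n) ℝ) :
    |A.det| ≤ ∏ i, ‖WithLp.toLp 2 (A i)‖ := by
  -- The volume form of an oriented Euclidean space is the determinant in an orthonormal basis, and
  -- its norm bound is Hadamard's inequality.
  have : Fact (Module.finrank ℝ (EuclideanSpace ℝ (Fin n)) = n) := ⟨by simp⟩
  set b := EuclideanSpace.basisFun (Fin n) ℝ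
  have h := b.toBasis.orientation.abs_volumeForm_apply_le fun i => WithLp.toLp 2 (A i)
  rw [Orientation.volumeForm_robust _ b rfl, Module.Basis.det_apply] at h
  convert h using 2
  rw [← Matrix.det_transpose]
  congr 1

theorem gramDet_eq_zero_of_not_linearIndependent {n : ℕ} {u : Fin n → H}
    (hu : ¬ LinearIndependent ℝ u) (v : Fin n → H) : gramDet u v = 0 := by
  rw [Fintype.not_linearIndependent_iff] at hu
  obtain ⟨g, hg, i, hi⟩ := hu
  refine Matrix.exists_vecMul_eq_zero_iff.mp ⟨g, fun h => hi (congrFun h i), ?_⟩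
  ext j
  have : inner ℝ (∑ i, g i • u i) (v j) = 0 := by rw [hg, inner_zero_left]
  simpa [Matrix.vecMul, dotProduct, sum_inner, inner_smul_left] using this

/-- In an orthonormal basis of the span of u, the Gram matrix is a product of two square coordinate
matrices. Hadamard bounds each determinant, and Bessel bounds the coordinates of v, of which only
the projection to the span matters. -/
theorem abs_gramDet_le {n : ℕ} (u v : Fin n → H) :
    |gramDet u v| ≤ (∏ i, ‖u i‖) * ∏ i, ‖v i‖ := by
  by_cases hu : LinearIndependent ℝ u
  swap
  · rw [gramDet_eq_zero_of_not_linearIndependent hu, abs_zero]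
    positivity
  have hfr : Module.finrank ℝ (Submodule.span ℝ (Set.range u)) = n := by
    simpa using finrank_span_eq_card hu
  have : FiniteDimensional ℝ (Submodule.span ℝ (Set.range u)) :=
    FiniteDimensional.span_of_finite ℝ (Set.finite_range u)
  set b := (stdOrthonormalBasis ℝ (Submodule.span ℝ (Set.range u))).reindex (finCongr hfr)
  have hb : Orthonormal ℝ fun k => (b k : H) := by
    have := b.orthonormal
    simpa [Function.comp_def] using this.comp_linearIsometry (Submodule.subtypeₗᵢ _)
  have hbes : ∀ x : H, ‖WithLp.toLp 2 (fun k => inner ℝ (b k : H) x)‖ ≤ ‖x‖ := by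
    intro x
    rw [EuclideanSpace.norm_eq, Real.sqrt_le_left (norm_nonneg x)]
    exact hb.sum_inner_products_le (s := Finset.univ) x
  have hexp : ∀ i (y : H), inner ℝ (u i) y = ∑ k, inner ℝ (b k : H) (u i) * inner ℝ (b k : H) y := by
    intro i y
    have h1 := b.sum_repr' ⟨u i, Submodule.subset_span ⟨i, rfl⟩⟩
    have h2 := congrArg (Subtype.val) h1
    simp only [Submodule.coe_sum, Submodule.coe_smul, Submodule.coe_inner] at h2
    conv_lhs => rw [← h2]
    simp [sum_inner, inner_smul_left]
  have hprod : (Matrix.of fun i j => inner ℝ (u i) (v j)) =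
      (Matrix.of fun i k => inner ℝ (b k : H) (u i)) *
        (Matrix.of fun j k => inner ℝ (b k : H) (v j)).transpose := by
    ext i j
    simp [Matrix.mul_apply, hexp i (v j)]
  rw [gramDet, hprod, Matrix.det_mul, Matrix.det_transpose, abs_mul]
  refine mul_le_mul ((abs_det_le_prod_norm _).trans ?_) ((abs_det_le_prod_norm _).trans ?_)
    (abs_nonneg _) (by positivity)
  · exact Finset.prod_le_prod (fun _ _ => norm_nonneg _) fun i _ => hbes (u i)
  · exact Finset.prod_le_prod (fun _ _ => norm_nonneg _) fun i _ => hbes (v i)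

theorem gramDet_comp_perm {n : ℕ} (u v : Fin n → H) (σ : Equiv.Perm (Fin n)) :
    gramDet (u ∘ σ) (v ∘ σ) = gramDet u v :=
  Matrix.det_submatrix_equiv_self σ (Matrix.of fun i j => inner ℝ (u i) (v j))

theorem gramDet_comp_perm_left {n : ℕ} (u v : Fin n → H) (σ : Equiv.Perm (Fin n)) :
    gramDet (u ∘ σ) v = (Equiv.Perm.sign σ : ℤ) * gramDet u v := by
  have := Matrix.det_permute σ (Matrix.of fun i j => inner ℝ (u i) (v j))
  simpa [gramDet, Matrix.submatrix] using this

/-- The cycle bringing k to the front acts on rows and columns simultaneously, so no sign appears.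
-/
theorem gramDet_cons_removeNth {n : ℕ} (u : Fin (n + 1) → H) (k : Fin (n + 1)) :
    gramDet (Fin.cons (u k) (k.removeNth u) : Fin (n + 1) → H) (Fin.cons (u k) (k.removeNth u)) =
      gramDet u u := by
  rw [Fin.cons_removeNth_eq_comp_cycleRange_symm, gramDet_comp_perm]

/-- Laplace expansion of a bordered determinant along the first row. -/
theorem gramDet_cons_cons {n : ℕ} (u v : H) (U V : Fin (n + 1) → H) :
    gramDet (Fin.cons u U : Fin (n + 2) → H) (Fin.cons v V) = inner ℝ u v * gramDet U V -
      ∑ k, inner ℝ u (V k) *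
        gramDet (Fin.cons (U k) (k.removeNth U) : Fin (n + 1) → H) (Fin.cons v (k.removeNth V)) := by
  rw [gramDet, Matrix.det_succ_row_zero, Fin.sum_univ_succ, sub_eq_add_neg, ← Finset.sum_neg_distrib]
  congr 1
  · simp only [Fin.val_zero, pow_zero, one_mul, Matrix.of_apply, Fin.cons_zero]
    congr 1
  · refine Finset.sum_congr rfl fun k _ => ?_
    have h1 : (Matrix.of fun i j => inner ℝ ((Fin.cons u U : Fin (n + 2) → H) i)
        ((Fin.cons v V : Fin (n + 2) → H) j)).submatrix Fin.succ (k.succ).succAbove =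
        Matrix.of fun i j => inner ℝ (U i) ((Fin.cons v (k.removeNth V) : Fin (n + 1) → H) j) := by
      ext i j
      refine Fin.cases ?_ (fun j => ?_) j
      · simp
      · simp [Fin.removeNth]
    -- Here only the rows are cycled, which costs the sign (−1)^k; it cancels the sign in the
    -- Laplace expansion up to the −1 of the off-by-one index.
    have h2 : gramDet U (Fin.cons v (k.removeNth V) : Fin (n + 1) → H) = (-1) ^ (k : ℕ) *
        gramDet (Fin.cons (U k) (k.removeNth U) : Fin (n + 1) → H) (Fin.cons v (k.removeNth V)) := by
      rw [Fin.cons_removeNth_eq_comp_cycleRange_symm U k, gramDet_comp_perm_left,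
        Equiv.Perm.sign_symm, Fin.sign_cycleRange, ← mul_assoc]
      push_cast
      rw [← mul_pow]
      simp
    rw [h1, ← gramDet, h2]
    simp only [Fin.val_succ, Matrix.of_apply, Fin.cons_zero, Fin.cons_succ]
    rw [show ((-1 : ℝ) ^ ((k : ℕ) + 1) * inner ℝ u (V k) * ((-1) ^ (k : ℕ) *
      gramDet (Fin.cons (U k) (k.removeNth U) : Fin (n + 1) → H) (Fin.cons v (k.removeNth V)))) =
      (((-1 : ℝ) ^ (k : ℕ) * (-1) ^ (k : ℕ))) * -(inner ℝ u (V k) *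
      gramDet (Fin.cons (U k) (k.removeNth U) : Fin (n + 1) → H) (Fin.cons v (k.removeNth V))) by
        ring, ← mul_pow]
    simp

theorem continuous_gramDet {X : Type*} [TopologicalSpace X] {n : ℕ} {u v : X → Fin n → H}
    (hu : Continuous u) (hv : Continuous v) : Continuous fun x => gramDet (u x) (v x) := by
  unfold gramDet
  refine Continuous.matrix_det (continuous_matrix fun i j => ?_)
  exact ((continuous_apply i).comp hu).inner ((continuous_apply j).comp hv)

end GramDet

/-- Integrating a symmetrised function of `n + 1` variables. -/
theorem integral_sum_removeNth {n : ℕ} {φ : ℝ × (Fin n → ℝ) → ℝ} (hφ : Integrable φ) :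
    ∫ x : Fin (n + 1) → ℝ, ∑ k, φ (x k, k.removeNth x) =
      (n + 1) * ∫ z : ℝ, ∫ y : Fin n → ℝ, φ (z, y) := by
  have hmp : ∀ k : Fin (n + 1), MeasurePreserving
      (fun x : Fin (n + 1) → ℝ => (x k, k.removeNth x)) volume volume := fun k =>
    volume_preserving_piFinSuccAbove (fun _ => ℝ) k
  have hemb : ∀ k : Fin (n + 1), MeasurableEmbedding
      (fun x : Fin (n + 1) → ℝ => (x k, k.removeNth x)) := fun k =>
    (MeasurableEquiv.piFinSuccAbove (fun _ => ℝ) k).measurableEmbedding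
  rw [integral_finsetSum _ (f := fun k x => φ (x k, k.removeNth x)) fun k _ =>
    ((hmp k).integrable_comp_emb (hemb k)).mpr hφ]
  have : ∀ k : Fin (n + 1), ∫ x : Fin (n + 1) → ℝ, φ (x k, k.removeNth x) =
      ∫ z : ℝ, ∫ y : Fin n → ℝ, φ (z, y) := by
    intro k
    rw [(hmp k).integral_comp (hemb k) φ]
    exact integral_prod φ hφ
  simp [this]
end

noncomputable section

/- The Fredholm determinant of the operator `∫ w(x) a(x) ⊗ a(x) dx` on a Hilbert space. -/

section Fredholm

set_option linter.unusedSectionVars false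

variable {H : Type*} [NormedAddCommGroup H] [InnerProductSpace ℝ H]

/-- The integrand of the `n`-th term of the Fredholm series. -/
def fredIntegrand (w : ℝ → ℝ) (a : ℝ → H) (n : ℕ) (x : Fin n → ℝ) : ℝ :=
  (∏ i, w (x i)) * gramDet (a ∘ x) (a ∘ x)

/-- The integrand of the `n`-th term of the bordered Fredholm series. -/
def fredIntegrandBordered (w : ℝ → ℝ) (a : ℝ → H) (n : ℕ) (u v : H) (x : Fin n → ℝ) : ℝ :=
  (∏ i, w (x i)) * gramDet (Fin.cons u (a ∘ x) : Fin (n + 1) → H) (Fin.cons v (a ∘ x))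

variable {w : ℝ → ℝ} {a : ℝ → H}

theorem continuous_fredIntegrand (hw : Continuous w) (ha : Continuous a) (n : ℕ) :
    Continuous (fredIntegrand w a n) := by
  have h : Continuous fun x : Fin n → ℝ => a ∘ x :=
    continuous_pi fun i => ha.comp (continuous_apply i)
  exact (continuous_finsetProd _ fun i _ => hw.comp (continuous_apply i)).mul
    (continuous_gramDet h h)

theorem continuous_cons_comp {X : Type*} [TopologicalSpace X] {n : ℕ} (ha : Continuous a)
    {f : X → H} (hf : Continuous f) {g : X → Fin n → ℝ} (hg : Continuous g) :
    Continuous fun x => (Fin.cons (f x) (a ∘ g x) : Fin (n + 1) → H) := by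
  refine continuous_pi fun i => ?_
  refine Fin.cases ?_ (fun i => ?_) i
  · simpa using hf
  · simpa [Function.comp_def] using ha.comp ((continuous_apply i).comp hg)

theorem continuous_fredIntegrandBordered (hw : Continuous w) (ha : Continuous a) (n : ℕ) (u v : H) :
    Continuous (fredIntegrandBordered w a n u v) :=
  (continuous_finsetProd _ fun i _ => hw.comp (continuous_apply i)).mul
    (continuous_gramDet (continuous_cons_comp ha continuous_const continuous_id)
      (continuous_cons_comp ha continuous_const continuous_id))

theorem abs_fredIntegrand_le (n : ℕ) (x : Fin n → ℝ) :
    |fredIntegrand w a n x| ≤ ∏ i, |w (x i)| * ‖a (x i)‖ ^ 2 := by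
  rw [fredIntegrand, abs_mul, Finset.abs_prod, Finset.prod_mul_distrib]
  refine mul_le_mul_of_nonneg_left ((abs_gramDet_le _ _).trans_eq ?_) (by positivity)
  rw [← Finset.prod_mul_distrib]
  simp [sq]

theorem abs_fredIntegrandBordered_le (n : ℕ) (u v : H) (x : Fin n → ℝ) :
    |fredIntegrandBordered w a n u v x| ≤ ‖u‖ * ‖v‖ * ∏ i, |w (x i)| * ‖a (x i)‖ ^ 2 := by
  rw [fredIntegrandBordered, abs_mul, Finset.abs_prod, Finset.prod_mul_distrib, mul_left_comm]
  refine mul_le_mul_of_nonneg_left ((abs_gramDet_le _ _).trans_eq ?_) (by positivity)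
  simp only [Fin.prod_univ_succ, Fin.cons_zero, Fin.cons_succ, Function.comp_apply,
    Finset.prod_pow]
  ring

theorem integrable_prod_weight {n : ℕ} {g : ℝ → ℝ} (hg : Integrable g) :
    Integrable fun x : Fin n → ℝ => ∏ i, g (x i) :=
  Integrable.fintype_prod (f := fun _ => g) fun _ => hg

theorem integrable_fredIntegrand (hw : Continuous w) (ha : Continuous a)
    (hN : Integrable fun x => |w x| * ‖a x‖ ^ 2) (n : ℕ) : Integrable (fredIntegrand w a n) :=
  (integrable_prod_weight hN).mono' (continuous_fredIntegrand hw ha n).aestronglyMeasurable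
    (Eventually.of_forall (abs_fredIntegrand_le n))

theorem integrable_fredIntegrandBordered (hw : Continuous w) (ha : Continuous a)
    (hN : Integrable fun x => |w x| * ‖a x‖ ^ 2) (n : ℕ) (u v : H) :
    Integrable (fredIntegrandBordered w a n u v) :=
  ((integrable_prod_weight hN).const_mul _).mono'
    (continuous_fredIntegrandBordered hw ha n u v).aestronglyMeasurable
    (Eventually.of_forall (abs_fredIntegrandBordered_le n u v))

variable (w a) in
/-- The trace `∫ |w(x)| ‖a(x)‖² dx`. -/
def fredTrace : ℝ := ∫ x, |w x| * ‖a x‖ ^ 2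

theorem fredTrace_nonneg : 0 ≤ fredTrace w a := integral_nonneg fun x => by positivity

theorem integral_prod_weight (n : ℕ) :
    ∫ x : Fin n → ℝ, ∏ i, |w (x i)| * ‖a (x i)‖ ^ 2 = fredTrace w a ^ n := by
  have := integral_fintype_prod_volume_eq_pow (ι := Fin n) (fun x => |w x| * ‖a x‖ ^ 2)
  simpa [fredTrace] using this

theorem integral_abs_fredIntegrand_le (hw : Continuous w) (ha : Continuous a)
    (hN : Integrable fun x => |w x| * ‖a x‖ ^ 2) (n : ℕ) :
    ∫ x, |fredIntegrand w a n x| ≤ fredTrace w a ^ n := by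
  rw [← integral_prod_weight]
  exact integral_mono (integrable_fredIntegrand hw ha hN n).abs (integrable_prod_weight hN)
    (abs_fredIntegrand_le n)

variable (w a) in
/-- The `n`-th term of the Fredholm series, without its coefficient. -/
def fredTerm (n : ℕ) : ℝ := ∫ x, fredIntegrand w a n x

theorem abs_fredTerm_le (hw : Continuous w) (ha : Continuous a)
    (hN : Integrable fun x => |w x| * ‖a x‖ ^ 2) (n : ℕ) :
    |fredTerm w a n| ≤ fredTrace w a ^ n :=
  abs_integral_le_integral_abs.trans (integral_abs_fredIntegrand_le hw ha hN n)

/-- The domain of the zeroth terms is a single point of mass one, so these terms are 1 and, in the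
bordered series, ⟨u,v⟩. -/
theorem volume_real_univ_fin_zero : (volume : Measure (Fin 0 → ℝ)).real Set.univ = 1 := by
  rw [Measure.real, Measure.volume_pi_eq_dirac]
  simp

theorem fredTerm_zero : fredTerm w a 0 = 1 := by
  simp [fredTerm, fredIntegrand, gramDet, volume_real_univ_fin_zero]

/-- The coefficient `(-1) ^ n / n!`. -/
def fredCoeff (n : ℕ) : ℝ := (-1) ^ n / n.factorial

theorem abs_fredCoeff (n : ℕ) : |fredCoeff n| = 1 / n.factorial := by
  simp [fredCoeff, abs_div]

theorem fredCoeff_succ (n : ℕ) : fredCoeff (n + 1) * (n + 1) = -fredCoeff n := by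
  unfold fredCoeff
  rw [Nat.factorial_succ, pow_succ]
  push_cast
  field_simp

variable (w a) in
/-- The Fredholm determinant. -/
def fredSeries : ℝ := ∑' n, fredCoeff n * fredTerm w a n

theorem summable_fredSeries (hw : Continuous w) (ha : Continuous a)
    (hN : Integrable fun x => |w x| * ‖a x‖ ^ 2) :
    Summable fun n => fredCoeff n * fredTerm w a n := by
  refine Summable.of_norm_bounded (Real.summable_pow_div_factorial (fredTrace w a)) fun n => ?_
  rw [norm_mul, Real.norm_eq_abs, Real.norm_eq_abs, abs_fredCoeff, one_div, mul_comm, div_eq_mul_inv]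
  exact mul_le_mul_of_nonneg_right (abs_fredTerm_le hw ha hN n) (by positivity)

variable (w a) in
/-- The operator `∫ w(x) a(x) ⊗ a(x) dx`. -/
def traceOp : H →L[ℝ] H := ∫ x, w x • InnerProductSpace.rankOne ℝ (a x) (a x)

theorem continuous_rankOne (ha : Continuous a) :
    Continuous fun x => InnerProductSpace.rankOne ℝ (a x) (a x) :=
  ((InnerProductSpace.rankOne ℝ).continuous.comp ha).clm_apply ha

theorem integrable_traceOp (hw : Continuous w) (ha : Continuous a)
    (hN : Integrable fun x => |w x| * ‖a x‖ ^ 2) :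
    Integrable fun x => w x • InnerProductSpace.rankOne ℝ (a x) (a x) := by
  refine hN.mono' (hw.smul (continuous_rankOne ha)).aestronglyMeasurable
    (Eventually.of_forall fun x => ?_)
  rw [norm_smul, InnerProductSpace.norm_rankOne, Real.norm_eq_abs, sq]

theorem traceOp_apply (hw : Continuous w) (ha : Continuous a)
    (hN : Integrable fun x => |w x| * ‖a x‖ ^ 2) (u : H) :
    traceOp w a u = ∫ x, (w x * inner ℝ (a x) u) • a x := by
  rw [traceOp, ContinuousLinearMap.integral_apply (integrable_traceOp hw ha hN)]
  simp [mul_smul]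

theorem integrable_weight_smul (hw : Continuous w) (ha : Continuous a)
    (hN : Integrable fun x => |w x| * ‖a x‖ ^ 2) (u : H) :
    Integrable fun x => (w x * inner ℝ (a x) u) • a x := by
  refine (hN.mul_const ‖u‖).mono' (by fun_prop) (Eventually.of_forall fun x => ?_)
  rw [norm_smul, norm_mul, Real.norm_eq_abs]
  calc _ ≤ |w x| * (‖a x‖ * ‖u‖) * ‖a x‖ := by
        gcongr
        exact norm_inner_le_norm _ _
    _ = _ := by ring

theorem inner_traceOp [CompleteSpace H] (hw : Continuous w) (ha : Continuous a)
    (hN : Integrable fun x => |w x| * ‖a x‖ ^ 2) (u v : H) :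
    inner ℝ u (traceOp w a v) = ∫ x, w x * inner ℝ u (a x) * inner ℝ (a x) v := by
  rw [traceOp_apply hw ha hN, ← integral_inner (integrable_weight_smul hw ha hN v)]
  congr 1
  ext x
  rw [inner_smul_right]
  ring

variable (w a) in
/-- The operators whose forms are the terms of the bordered Fredholm series. -/
def minorOp : ℕ → H →L[ℝ] H
  | 0 => ContinuousLinearMap.id ℝ H
  | n + 1 => fredTerm w a (n + 1) • ContinuousLinearMap.id ℝ H -
      ((n : ℝ) + 1) • (traceOp w a ∘L minorOp n)

/-- Expand along the bordering row: the corner gives ⟨u,v⟩ times the unbordered term, and the other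
n + 1 terms are the same function with different variables singled out. Each integrates to ⟨u,
B·(previous operator) v⟩, which is the recursion defining `minorOp`. -/
theorem integral_fredIntegrandBordered [CompleteSpace H] (hw : Continuous w) (ha : Continuous a)
    (hN : Integrable fun x => |w x| * ‖a x‖ ^ 2) (n : ℕ) (u v : H) :
    ∫ x, fredIntegrandBordered w a n u v x = inner ℝ u (minorOp w a n v) := by
  induction n generalizing u v with
  | zero => simp [fredIntegrandBordered, gramDet, minorOp, volume_real_univ_fin_zero]
  | succ n ih =>
    set φ : ℝ × (Fin n → ℝ) → ℝ := fun p => w p.1 * inner ℝ u (a p.1) *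
      fredIntegrandBordered w a n (a p.1) v p.2 with hφdef
    have hφ : Integrable φ := by
      have hb : Integrable fun p : ℝ × (Fin n → ℝ) =>
          (|w p.1| * ‖a p.1‖ ^ 2) * (‖u‖ * ‖v‖ * ∏ i, |w (p.2 i)| * ‖a (p.2 i)‖ ^ 2) :=
        Integrable.mul_prod hN ((integrable_prod_weight hN).const_mul _)
      refine hb.mono' ?_ (Eventually.of_forall fun p => ?_)
      · refine Continuous.aestronglyMeasurable ?_
        have h1 : Continuous fun p : ℝ × (Fin n → ℝ) => ∏ i, w (p.2 i) :=
          continuous_finsetProd _ fun i _ =>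
            hw.comp ((continuous_apply i).comp continuous_snd)
        have h2 := continuous_gramDet
          (continuous_cons_comp ha (ha.comp continuous_fst)
            (continuous_snd (X := ℝ) (Y := Fin n → ℝ)))
          (continuous_cons_comp ha (continuous_const (y := v)) continuous_snd)
        have h3 : Continuous fun p : ℝ × (Fin n → ℝ) => w p.1 * inner ℝ u (a p.1) := by fun_prop
        exact h3.mul (h1.mul h2)
      · rw [Real.norm_eq_abs, hφdef, abs_mul, abs_mul]
        calc _ ≤ |w p.1| * (‖u‖ * ‖a p.1‖) *
              (‖a p.1‖ * ‖v‖ * ∏ i, |w (p.2 i)| * ‖a (p.2 i)‖ ^ 2) := by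
              gcongr
              · exact abs_real_inner_le_norm _ _
              · exact abs_fredIntegrandBordered_le n _ v _
          _ = _ := by ring
    have hexp : ∀ x : Fin (n + 1) → ℝ, fredIntegrandBordered w a (n + 1) u v x =
        inner ℝ u v * fredIntegrand w a (n + 1) x - ∑ k, φ (x k, k.removeNth x) := by
      intro x
      rw [fredIntegrandBordered, gramDet_cons_cons, mul_sub, Finset.mul_sum, fredIntegrand]
      congr 1
      · ring
      · refine Finset.sum_congr rfl fun k _ => ?_
        have : k.removeNth (a ∘ x) = a ∘ k.removeNth x := rfl
        simp only [hφdef]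
        rw [Fin.prod_univ_succAbove _ k, fredIntegrandBordered, this]
        simp only [Function.comp_apply, Fin.removeNth]
        ring
    simp_rw [hexp]
    rw [integral_sub ((integrable_fredIntegrand hw ha hN (n + 1)).const_mul _),
      integral_const_mul, integral_sum_removeNth hφ]
    · simp only [hφdef, integral_const_mul, ih]
      rw [← inner_traceOp hw ha hN, minorOp]
      simp only [_root_.sub_apply, _root_.smul_apply,
        ContinuousLinearMap.comp_apply, ContinuousLinearMap.id_apply, inner_sub_right,
        inner_smul_right, fredTerm]
      ring
    · exact integrable_finsetSum _ fun k _ =>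
        (volume_preserving_piFinSuccAbove (fun _ => ℝ) k).integrable_comp_emb
          (MeasurableEquiv.piFinSuccAbove (fun _ => ℝ) k).measurableEmbedding |>.mpr hφ

/-- Hadamard bounds the bilinear form; taking u to be the image of v turns this into an operator
norm bound. -/
theorem norm_minorOp_le [CompleteSpace H] (hw : Continuous w) (ha : Continuous a)
    (hN : Integrable fun x => |w x| * ‖a x‖ ^ 2) (n : ℕ) :
    ‖minorOp w a n‖ ≤ fredTrace w a ^ n := by
  refine ContinuousLinearMap.opNorm_le_bound _ (pow_nonneg fredTrace_nonneg n) fun v => ?_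
  have h : ∀ u, inner ℝ u (minorOp w a n v) ≤ ‖u‖ * (fredTrace w a ^ n * ‖v‖) := by
    intro u
    rw [← integral_fredIntegrandBordered hw ha hN]
    refine (le_abs_self _).trans (abs_integral_le_integral_abs.trans ?_)
    refine (integral_mono (integrable_fredIntegrandBordered hw ha hN n u v).abs
      ((integrable_prod_weight hN).const_mul _) (abs_fredIntegrandBordered_le n u v)).trans_eq ?_
    rw [integral_const_mul, integral_prod_weight]
    ring
  have h1 := h (minorOp w a n v)
  rw [real_inner_self_eq_norm_sq, sq] at h1
  rcases (norm_nonneg (minorOp w a n v)).eq_or_lt with h0 | h0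
  · rw [← h0]
    exact mul_nonneg (pow_nonneg fredTrace_nonneg n) (norm_nonneg v)
  · exact le_of_mul_le_mul_left h1 h0

theorem summable_norm_minorOp [CompleteSpace H] (hw : Continuous w) (ha : Continuous a)
    (hN : Integrable fun x => |w x| * ‖a x‖ ^ 2) :
    Summable fun n => ‖fredCoeff n • minorOp w a n‖ := by
  refine Summable.of_nonneg_of_le (fun _ => norm_nonneg _) (fun n => ?_)
    (Real.summable_pow_div_factorial (fredTrace w a))
  rw [norm_smul, Real.norm_eq_abs, abs_fredCoeff, one_div, mul_comm, div_eq_mul_inv]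
  exact mul_le_mul_of_nonneg_right (norm_minorOp_le hw ha hN n) (by positivity)

/-- Fredholm's formula for the resolvent. -/
theorem tsum_minorOp [CompleteSpace H] (hw : Continuous w) (ha : Continuous a)
    (hN : Integrable fun x => |w x| * ‖a x‖ ^ 2) {R : H →L[ℝ] H}
    (hR : R ∘L (ContinuousLinearMap.id ℝ H - traceOp w a) = ContinuousLinearMap.id ℝ H) :
    ∑' n, fredCoeff n • minorOp w a n = fredSeries w a • R := by
  have hs : Summable fun n => fredCoeff n • minorOp w a n :=
    (summable_norm_minorOp hw ha hN).of_norm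
  set Δ := ∑' n, fredCoeff n • minorOp w a n with hΔ
  have hsD := summable_fredSeries hw ha hN
  -- Multiplied by the coefficients and summed, the recursion reads Δ = D + BΔ, that is, (1 − B)Δ =
  -- D.
  have h1 : Δ = fredSeries w a • ContinuousLinearMap.id ℝ H + traceOp w a ∘L Δ := by
    have e1 : traceOp w a ∘L Δ = ∑' n, fredCoeff n • (traceOp w a ∘L minorOp w a n) := by
      have := ((ContinuousLinearMap.compL ℝ H H H (traceOp w a)).map_tsum hs)
      simpa using this
    have hs1 : Summable fun n => fredCoeff n • (traceOp w a ∘L minorOp w a n) := by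
      have := hs.mapL (ContinuousLinearMap.compL ℝ H H H (traceOp w a))
      simpa using this
    have e2 : fredSeries w a • ContinuousLinearMap.id ℝ H =
        ∑' n, (fredCoeff n * fredTerm w a n) • ContinuousLinearMap.id ℝ H :=
      (hsD.tsum_smul_const _).symm
    have hs2 := hsD.smul_const (ContinuousLinearMap.id ℝ H)
    rw [e1, e2, hΔ, hs.tsum_eq_zero_add, hs2.tsum_eq_zero_add, add_assoc,
      ← ((summable_nat_add_iff 1).mpr hs2).tsum_add hs1]
    congr 1
    · simp [minorOp, fredTerm_zero]
    · congr 1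
      ext1 n
      rw [minorOp, smul_sub, smul_smul, smul_smul, fredCoeff_succ, neg_smul, sub_neg_eq_add]
  have h2 : (ContinuousLinearMap.id ℝ H - traceOp w a) ∘L Δ =
      fredSeries w a • ContinuousLinearMap.id ℝ H := by
    rw [ContinuousLinearMap.sub_comp, ContinuousLinearMap.id_comp]
    exact sub_eq_of_eq_add h1
  calc Δ = (R ∘L (ContinuousLinearMap.id ℝ H - traceOp w a)) ∘L Δ := by rw [hR]; rfl
    _ = R ∘L ((ContinuousLinearMap.id ℝ H - traceOp w a) ∘L Δ) := rfl
    _ = _ := by rw [h2, ContinuousLinearMap.comp_smul, ContinuousLinearMap.comp_id]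

end Fredholm
end

noncomputable section

/-! ### Differentiation in a parameter and positivity of Fredholm determinants. -/

section FredholmDeriv

set_option linter.unusedSectionVars false

variable {H : Type*} [NormedAddCommGroup H] [InnerProductSpace ℝ H] {a : ℝ → H}

theorem integrable_weight_of_le (ha : Continuous a) {v W : ℝ → ℝ} (hv : Continuous v)
    (hb : ∀ x, |v x| ≤ W x) (hW : Integrable fun x => W x * ‖a x‖ ^ 2) :
    Integrable fun x => |v x| * ‖a x‖ ^ 2 :=
  hW.mono' (by fun_prop) (Eventually.of_forall fun x => by
    rw [Real.norm_of_nonneg (by positivity)]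
    exact mul_le_mul_of_nonneg_right (hb x) (by positivity))

theorem integral_weight_le (ha : Continuous a) {v W : ℝ → ℝ} (hv : Continuous v)
    (hb : ∀ x, |v x| ≤ W x) (hW : Integrable fun x => W x * ‖a x‖ ^ 2) :
    ∫ x, |v x| * ‖a x‖ ^ 2 ≤ ∫ x, W x * ‖a x‖ ^ 2 :=
  integral_mono (integrable_weight_of_le ha hv hb hW) hW fun x =>
    mul_le_mul_of_nonneg_right (hb x) (by positivity)

theorem norm_weight_inner_le {v W : ℝ → ℝ} (hb : ∀ x, |v x| ≤ W x) (S : H →L[ℝ] H) (x : ℝ) :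
    ‖v x * inner ℝ (a x) (S (a x))‖ ≤ ‖S‖ * (W x * ‖a x‖ ^ 2) := by
  rw [norm_mul, Real.norm_eq_abs]
  calc _ ≤ W x * (‖a x‖ * (‖S‖ * ‖a x‖)) := by
        refine mul_le_mul (hb x) ((norm_inner_le_norm _ _).trans ?_) (norm_nonneg _)
          ((abs_nonneg _).trans (hb x))
        exact mul_le_mul_of_nonneg_left (S.le_opNorm _) (norm_nonneg _)
    _ = _ := by ring

theorem integrable_weight_inner (ha : Continuous a) {v W : ℝ → ℝ} (hv : Continuous v)
    (hb : ∀ x, |v x| ≤ W x) (hW : Integrable fun x => W x * ‖a x‖ ^ 2) (S : H →L[ℝ] H) :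
    Integrable fun x => v x * inner ℝ (a x) (S (a x)) :=
  (hW.const_mul ‖S‖).mono' (by fun_prop) (Eventually.of_forall (norm_weight_inner_le hb S))

variable {w w' : ℝ → ℝ → ℝ} {W : ℝ → ℝ} {p₀ r : ℝ}

/-- Differentiating the product of weights singles out one variable z. Moving it to the front of the
Gram determinant gives a determinant bordered twice by a(z), and all n + 1 choices of variable
integrate to the same value. -/
theorem hasDerivAt_fredTerm_succ [CompleteSpace H] (ha : Continuous a)
    (hw : ∀ p, Continuous (w p)) (hw' : ∀ p, Continuous (w' p))
    (hd : ∀ p ∈ Metric.ball p₀ r, ∀ x, HasDerivAt (fun p => w p x) (w' p x) p)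
    (hb : ∀ p ∈ Metric.ball p₀ r, ∀ x, |w p x| ≤ W x)
    (hb' : ∀ p ∈ Metric.ball p₀ r, ∀ x, |w' p x| ≤ W x)
    (hW : Integrable fun x => W x * ‖a x‖ ^ 2) (n : ℕ) {p : ℝ} (hp : p ∈ Metric.ball p₀ r) :
    HasDerivAt (fun p => fredTerm (w p) a (n + 1))
      ((n + 1) * ∫ z, w' p z * inner ℝ (a z) (minorOp (w p) a n (a z))) p := by
  have hW0 : ∀ x, 0 ≤ W x := fun x => (abs_nonneg _).trans (hb p hp x)
  have hN : ∀ q ∈ Metric.ball p₀ r, Integrable fun x => |w q x| * ‖a x‖ ^ 2 := fun q hq =>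
    integrable_weight_of_le ha (hw q) (hb q hq) hW
  set φ : ℝ → ℝ × (Fin n → ℝ) → ℝ := fun q z => w' q z.1 *
    fredIntegrandBordered (w q) a n (a z.1) (a z.1) z.2 with hφdef
  have hφc : ∀ q, Continuous (φ q) := by
    intro q
    have h1 : Continuous fun z : ℝ × (Fin n → ℝ) => ∏ i, w q (z.2 i) :=
      continuous_finsetProd _ fun i _ =>
        (hw q).comp ((continuous_apply i).comp continuous_snd)
    have h2 := continuous_gramDet
      (continuous_cons_comp ha (ha.comp continuous_fst) (continuous_snd (X := ℝ) (Y := Fin n → ℝ)))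
      (continuous_cons_comp ha (ha.comp continuous_fst) continuous_snd)
    exact ((hw' q).comp continuous_fst).mul (h1.mul h2)
  have hφb : ∀ q ∈ Metric.ball p₀ r, ∀ z, ‖φ q z‖ ≤ (W z.1 * ‖a z.1‖ ^ 2) *
      ∏ i, W (z.2 i) * ‖a (z.2 i)‖ ^ 2 := by
    intro q hq z
    rw [hφdef, Real.norm_eq_abs, abs_mul]
    calc _ ≤ W z.1 * (‖a z.1‖ * ‖a z.1‖ * ∏ i, |w q (z.2 i)| * ‖a (z.2 i)‖ ^ 2) := by
          refine mul_le_mul (hb' q hq _) (abs_fredIntegrandBordered_le n _ _ _) (abs_nonneg _)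
            (hW0 _)
      _ ≤ W z.1 * (‖a z.1‖ * ‖a z.1‖ * ∏ i, W (z.2 i) * ‖a (z.2 i)‖ ^ 2) := by
          have := hW0 z.1
          gcongr with i
          exact hb q hq _
      _ = _ := by ring
  have hφi : ∀ q ∈ Metric.ball p₀ r, Integrable (φ q) := fun q hq =>
    (Integrable.mul_prod hW (integrable_prod_weight hW)).mono' (hφc q).aestronglyMeasurable
      (Eventually.of_forall (hφb q hq))
  have hder : ∀ q ∈ Metric.ball p₀ r, ∀ x : Fin (n + 1) → ℝ,
      HasDerivAt (fun q => fredIntegrand (w q) a (n + 1) x) (∑ k, φ q (x k, k.removeNth x)) q := by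
    intro q hq x
    have h1 := (HasDerivAt.finsetProd (u := Finset.univ) (f := fun (k : Fin (n + 1)) q => w q (x k))
      (f' := fun k => w' q (x k)) (fun k _ => hd q hq (x k))).mul_const (gramDet (a ∘ x) (a ∘ x))
    have h0 : (fun q => fredIntegrand (w q) a (n + 1) x) =
        fun q => (∏ i, fun q => w q (x i)) q * gramDet (a ∘ x) (a ∘ x) := by
      ext q
      simp [fredIntegrand]
    rw [h0]
    refine h1.congr_deriv (Eq.symm ?_)
    rw [Finset.sum_mul]
    refine Finset.sum_congr rfl fun k _ => ?_
    have h2 : (Finset.univ.erase k) = Finset.univ.image k.succAbove := by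
      rw [Fin.image_succAbove_univ]
      ext j
      simp
    rw [h2, Finset.prod_image fun i _ j _ h => Fin.succAbove_right_injective h]
    have h3 := gramDet_cons_removeNth (a ∘ x) k
    have : k.removeNth (a ∘ x) = a ∘ k.removeNth x := rfl
    rw [this] at h3
    simp only [hφdef, fredIntegrandBordered]
    simp only [Function.comp_apply] at h3
    rw [h3]
    simp only [Fin.removeNth, smul_eq_mul]
    ring
  have hsumb : ∀ q ∈ Metric.ball p₀ r, ∀ x : Fin (n + 1) → ℝ, ‖∑ k, φ q (x k, k.removeNth x)‖ ≤
      (n + 1) * ∏ i, W (x i) * ‖a (x i)‖ ^ 2 := by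
    intro q hq x
    refine (norm_sum_le _ _).trans ((Finset.sum_le_sum fun k _ => hφb q hq _).trans_eq ?_)
    have : ∀ k : Fin (n + 1), (W (x k) * ‖a (x k)‖ ^ 2) *
        ∏ i, W (k.removeNth x i) * ‖a (k.removeNth x i)‖ ^ 2 = ∏ i, W (x i) * ‖a (x i)‖ ^ 2 := by
      intro k
      rw [Fin.prod_univ_succAbove _ k]
      rfl
    simp [this]
  have hmeas : Continuous fun x : Fin (n + 1) → ℝ => ∑ k, φ p (x k, k.removeNth x) :=
    continuous_finsetSum _ fun k _ => (hφc p).comp ((continuous_apply k).prodMk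
      (continuous_pi fun i => continuous_apply _))
  have := (hasDerivAt_integral_of_dominated_loc_of_deriv_le
    (F := fun q x => fredIntegrand (w q) a (n + 1) x)
    (F' := fun q x => ∑ k, φ q (x k, k.removeNth x))
    (bound := fun x => (n + 1) * ∏ i, W (x i) * ‖a (x i)‖ ^ 2)
    (Metric.isOpen_ball.mem_nhds hp)
    (Eventually.of_forall fun q => (continuous_fredIntegrand (hw q) ha _).aestronglyMeasurable)
    (integrable_fredIntegrand (hw p) ha (hN p hp) (n + 1)) hmeas.aestronglyMeasurable
    (Eventually.of_forall fun x q hq => hsumb q hq x)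
    ((integrable_prod_weight hW).const_mul _)
    (Eventually.of_forall fun x q hq => hder q hq x)).2
  refine this.congr_deriv ?_
  rw [integral_sum_removeNth (hφi p hp)]
  simp only [hφdef, integral_const_mul, integral_fredIntegrandBordered (hw p) ha (hN p hp)]

/-- The derivative of a Fredholm determinant with respect to a parameter. -/
theorem hasDerivAt_fredSeries [CompleteSpace H] (ha : Continuous a) (hr : 0 < r)
    (hw : ∀ p, Continuous (w p)) (hw' : ∀ p, Continuous (w' p))
    (hd : ∀ p ∈ Metric.ball p₀ r, ∀ x, HasDerivAt (fun p => w p x) (w' p x) p)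
    (hb : ∀ p ∈ Metric.ball p₀ r, ∀ x, |w p x| ≤ W x)
    (hb' : ∀ p ∈ Metric.ball p₀ r, ∀ x, |w' p x| ≤ W x)
    (hW : Integrable fun x => W x * ‖a x‖ ^ 2) {R : H →L[ℝ] H}
    (hR : R * (1 - traceOp (w p₀) a) = 1) :
    HasDerivAt (fun p => fredSeries (w p) a)
      (-(fredSeries (w p₀) a * ∫ x, w' p₀ x * inner ℝ (a x) (R (a x)))) p₀ := by
  have hp₀ : p₀ ∈ Metric.ball p₀ r := Metric.mem_ball_self hr
  set N : ℝ := ∫ x, W x * ‖a x‖ ^ 2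
  have hN : ∀ q ∈ Metric.ball p₀ r, Integrable fun x => |w q x| * ‖a x‖ ^ 2 := fun q hq =>
    integrable_weight_of_le ha (hw q) (hb q hq) hW
  have hNle : ∀ q ∈ Metric.ball p₀ r, fredTrace (w q) a ≤ N := fun q hq =>
    integral_weight_le ha (hw q) (hb q hq) hW
  have hN0 : 0 ≤ N := fredTrace_nonneg.trans (hNle p₀ hp₀)
  set F : ℝ → ℕ → ℝ → ℝ := fun q n z =>
    -fredCoeff n * (w' q z * inner ℝ (a z) (minorOp (w q) a n (a z))) with hF
  have hFi : ∀ q ∈ Metric.ball p₀ r, ∀ n, Integrable (F q n) := fun q hq n =>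
    (integrable_weight_inner ha (hw' q) (hb' q hq) hW _).const_mul _
  have hFb : ∀ q ∈ Metric.ball p₀ r, ∀ n z,
      ‖F q n z‖ ≤ N ^ n / n.factorial * (W z * ‖a z‖ ^ 2) := by
    intro q hq n z
    have h1 := norm_weight_inner_le (a := a) (hb' q hq) (minorOp (w q) a n) z
    have h2 : ‖minorOp (w q) a n‖ ≤ N ^ n := (norm_minorOp_le (hw q) ha (hN q hq) n).trans
      (pow_le_pow_left₀ fredTrace_nonneg (hNle q hq) n)
    have hWz : 0 ≤ W z * ‖a z‖ ^ 2 := mul_nonneg ((abs_nonneg _).trans (hb q hq z)) (by positivity)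
    rw [hF, norm_mul, norm_neg, Real.norm_eq_abs (fredCoeff n), abs_fredCoeff]
    calc _ ≤ 1 / (n.factorial : ℝ) * (N ^ n * (W z * ‖a z‖ ^ 2)) := by
          gcongr
          exact h1.trans (mul_le_mul_of_nonneg_right h2 hWz)
      _ = _ := by ring
  have hFib : ∀ q ∈ Metric.ball p₀ r, ∀ n, ∫ z, ‖F q n z‖ ≤ N ^ n / n.factorial * N := by
    intro q hq n
    rw [← integral_const_mul]
    exact integral_mono (hFi q hq n).norm (hW.const_mul _) (hFb q hq n)
  have hsum : Summable fun n : ℕ => N ^ n / n.factorial * N :=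
    (Real.summable_pow_div_factorial N).mul_right N
  -- The zeroth term of the series is constant, so the derivative series starts at index 1; hence
  -- the shift by one here and in the majorant.
  set g' : ℕ → ℝ → ℝ := fun n q => Nat.casesOn n 0 fun n => ∫ z, F q n z with hg'
  set u : ℕ → ℝ := fun n => Nat.casesOn n 0 fun n => N ^ n / n.factorial * N with hu
  have husum : Summable u := (summable_nat_add_iff 1).mp (by simpa [hu] using hsum)
  have hmain := hasDerivAt_tsum_of_isPreconnected (g := fun n p => fredCoeff n * fredTerm (w p) a n)
    (g' := g') husum Metric.isOpen_ball (convex_ball p₀ r).isPreconnected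
    (fun n q hq => by
      cases n with
      | zero =>
        simp only [fredTerm_zero]
        exact hasDerivAt_const _ _
      | succ n =>
        refine ((hasDerivAt_fredTerm_succ ha hw hw' hd hb hb' hW n hq).const_mul
          (fredCoeff (n + 1))).congr_deriv ?_
        simp only [hg', hF, integral_const_mul]
        rw [← mul_assoc, fredCoeff_succ])
    (fun n q hq => by
      cases n with
      | zero => simp [hg', hu]
      | succ n => exact (norm_integral_le_integral_norm _).trans (hFib q hq n))
    hp₀ (summable_fredSeries (hw p₀) ha (hN p₀ hp₀)) hp₀
  refine hmain.congr_deriv ?_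
  have hg's : Summable fun n => g' n p₀ :=
    Summable.of_norm_bounded husum fun n => by
      cases n with
      | zero => simp [hg', hu]
      | succ n => exact (norm_integral_le_integral_norm _).trans (hFib p₀ hp₀ n)
  have hsw := hasSum_integral_of_summable_integral_norm (hFi p₀ hp₀)
    (Summable.of_nonneg_of_le (fun n => integral_nonneg fun z => norm_nonneg _) (hFib p₀ hp₀) hsum)
  rw [hg's.tsum_eq_zero_add, show g' 0 p₀ = 0 from rfl, zero_add,
    show ∑' n, g' (n + 1) p₀ = ∑' n, ∫ z, F p₀ n z from rfl, hsw.tsum_eq, ← neg_mul,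
    ← integral_const_mul]
  refine integral_congr_ae (Eventually.of_forall fun z => ?_)
  have hms := (summable_norm_minorOp (hw p₀) ha (hN p₀ hp₀)).of_norm
  have hT := tsum_minorOp (hw p₀) ha (hN p₀ hp₀) (R := R) hR
  -- Fredholm's formula is evaluated through the functional S ↦ ⟨a(z), S a(z)⟩, which commutes with
  -- the operator-norm convergent sum.
  set ℓ : (H →L[ℝ] H) →L[ℝ] ℝ :=
    (innerSL ℝ (a z)).comp (ContinuousLinearMap.apply ℝ H (a z)) with hℓ
  have h1 := ℓ.map_tsum hms
  rw [hT] at h1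
  simp only [map_smul, smul_eq_mul] at h1
  have h2 : ∀ n, F p₀ n z = (-w' p₀ z) * (fredCoeff n * ℓ (minorOp (w p₀) a n)) := by
    intro n
    simp only [hF, hℓ, ContinuousLinearMap.comp_apply, ContinuousLinearMap.apply_apply,
      innerSL_apply_apply]
    ring
  simp only [h2]
  rw [tsum_mul_left, ← h1]
  simp only [hℓ, ContinuousLinearMap.comp_apply, ContinuousLinearMap.apply_apply,
      innerSL_apply_apply]
  ring

theorem fredSeries_zero : fredSeries (fun _ => 0) a = 1 := by
  rw [fredSeries, tsum_eq_single 0]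
  · simp [fredTerm_zero, fredCoeff]
  · intro n hn
    obtain ⟨m, rfl⟩ := Nat.exists_eq_succ_of_ne_zero hn
    simp [fredTerm, fredIntegrand]

/-- A left inverse of `1 - B` is bounded in terms of the norm of `B`. -/
theorem norm_le_of_mul_one_sub_eq_one {B R : H →L[ℝ] H} {θ : ℝ} (hB : ‖B‖ ≤ θ) (hθ : θ < 1)
    (hR : R * (1 - B) = 1) : ‖R‖ ≤ 1 / (1 - θ) := by
  have h1 : R = 1 + R * B := by
    rw [mul_sub, mul_one] at hR
    exact eq_add_of_sub_eq hR
  have h2 : ‖R‖ ≤ 1 + ‖R‖ * θ := by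
    calc ‖R‖ = ‖1 + R * B‖ := by rw [← h1]
      _ ≤ ‖(1 : H →L[ℝ] H)‖ + ‖R * B‖ := norm_add_le _ _
      _ ≤ _ := add_le_add ContinuousLinearMap.norm_id_le
        ((norm_mul_le _ _).trans (mul_le_mul_of_nonneg_left hB (norm_nonneg _)))
  rw [le_div_iff₀ (by linarith)]
  linarith

/-- The Fredholm determinant of a positive operator of norm less than one is positive. -/
theorem fredSeries_pos [CompleteSpace H] (ha : Continuous a) {v : ℝ → ℝ} (hv : Continuous v)
    (hv0 : ∀ x, 0 ≤ v x) (hV : Integrable fun x => v x * ‖a x‖ ^ 2) (hB : ‖traceOp v a‖ < 1) :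
    0 < fredSeries v a := by
  set f : ℝ → ℝ := fun l => fredSeries (fun x => l * v x) a with hf
  set N : ℝ := ∫ x, v x * ‖a x‖ ^ 2
  have hN0 : 0 ≤ N := integral_nonneg fun x => mul_nonneg (hv0 x) (by positivity)
  -- A bound for the logarithmic derivative of f: the trace times a bound for the resolvent of lB,
  -- uniform in l ∈ [0,1].
  set K : ℝ := N * (1 / (1 - ‖traceOp v a‖))
  have hder : ∀ l ∈ Set.Icc (0 : ℝ) 1, ∃ f', HasDerivAt f f' l ∧ |f'| ≤ K * |f l| := by
    intro l hl
    have hBl : traceOp (fun x => l * v x) a = l • traceOp v a := by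
      simp only [traceOp, mul_smul]
      exact integral_smul l _
    have hnorm : ‖traceOp (fun x => l * v x) a‖ ≤ ‖traceOp v a‖ := by
      rw [hBl, norm_smul, Real.norm_of_nonneg hl.1]
      exact mul_le_of_le_one_left (norm_nonneg _) hl.2
    set U := Units.oneSub _ (hnorm.trans_lt hB) with hU
    have hR : (↑U⁻¹ : H →L[ℝ] H) * (1 - traceOp (fun x => l * v x) a) = 1 := U.inv_mul
    refine ⟨_, hasDerivAt_fredSeries (w := fun l x => l * v x) (w' := fun _ x => v x)
      (W := fun x => 2 * v x) ha one_pos (fun p => hv.const_mul p) (fun _ => hv)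
      (fun p _ x => by simpa using (hasDerivAt_id p).mul_const (v x)) (fun p hp x => ?_)
      (fun p hp x => ?_) (by simpa [mul_assoc] using hV.const_mul 2) hR, ?_⟩
    -- The factor 2 in the majorant covers all p within distance 1 of a point of [0,1].
    · rw [abs_mul, abs_of_nonneg (hv0 x)]
      refine mul_le_mul_of_nonneg_right ?_ (hv0 x)
      have h1 : |p - l| < 1 := by simpa [Real.dist_eq] using hp
      rw [abs_lt] at h1
      rw [abs_le]
      constructor <;> linarith [hl.1, hl.2]
    · rw [abs_of_nonneg (hv0 x)]
      linarith [hv0 x]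
    · rw [abs_neg, abs_mul, mul_comm]
      refine mul_le_mul_of_nonneg_right ?_ (abs_nonneg _)
      have h2 : ∀ x, ‖v x * inner ℝ (a x) ((↑U⁻¹ : H →L[ℝ] H) (a x))‖ ≤
          ‖(↑U⁻¹ : H →L[ℝ] H)‖ * (v x * ‖a x‖ ^ 2) :=
        norm_weight_inner_le (fun x => (abs_of_nonneg (hv0 x)).le) _
      refine (norm_integral_le_of_norm_le (hV.const_mul _) (Eventually.of_forall h2)).trans ?_
      rw [integral_const_mul, mul_comm]
      exact mul_le_mul_of_nonneg_left (norm_le_of_mul_one_sub_eq_one hnorm hB hR) hN0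
  -- Since |f'| ≤ K|f|, a zero at l would propagate backwards by Grönwall to l = 0, where f = 1.
  have hne : ∀ l ∈ Set.Icc (0 : ℝ) 1, f l ≠ 0 := by
    intro l hl h0
    choose! f' hf' hK using hder
    have hmem : ∀ t ∈ Set.Icc (0 : ℝ) l, l - t ∈ Set.Icc (0 : ℝ) 1 := fun t ht =>
      ⟨by linarith [ht.2], by linarith [ht.1, hl.2]⟩
    have hd : ∀ t ∈ Set.Icc (0 : ℝ) l, HasDerivAt (fun t => f (l - t)) (-f' (l - t)) t := by
      intro t ht
      have := (hf' _ (hmem t ht)).comp t ((hasDerivAt_id t).const_sub l)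
      simpa [Function.comp_def] using this
    have hg := norm_le_gronwallBound_of_norm_deriv_right_le (f := fun t => f (l - t))
      (f' := fun t => -f' (l - t)) (δ := 0) (K := K) (ε := 0) (a := 0) (b := l)
      (fun t ht => (hd t ht).continuousAt.continuousWithinAt)
      (fun t ht => (hd t ⟨ht.1, ht.2.le⟩).hasDerivWithinAt) (by simp [h0])
      (fun t ht => by
        rw [add_zero, norm_neg]
        exact hK _ (hmem t ⟨ht.1, ht.2.le⟩)) l ⟨hl.1, le_rfl⟩
    have hf0 : f 0 = 1 := by simp [hf, fredSeries_zero]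
    simp [gronwallBound_ε0, hf0] at hg
    linarith
  by_contra hneg
  have hf1 : f 1 ≤ 0 := by simpa [hf] using not_lt.mp hneg
  have hf0 : f 0 = 1 := by simp [hf, fredSeries_zero]
  have hc : ContinuousOn f (Set.Icc 0 1) := fun l hl => by
    obtain ⟨f', h, -⟩ := hder l hl
    exact h.continuousAt.continuousWithinAt
  obtain ⟨l, hl, hl0⟩ := intermediate_value_Icc' zero_le_one hc ⟨hf1, by rw [hf0]; exact zero_le_one⟩
  exact hne l hl hl0

end FredholmDeriv
end

noncomputable section

/- Bessel's inequality for the Fourier transform. -/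

/-- The Fourier transform without normalisation. -/
def fourierExp (g : ℝ → ℂ) (x : ℝ) : ℂ := ∫ y : ℝ, g y * Complex.exp (-Complex.I * x * y)

theorem norm_exp_neg_I_mul (x y : ℝ) : ‖Complex.exp (-Complex.I * x * y)‖ = 1 := by
  rw [Complex.norm_exp]
  simp

theorem norm_mul_fourier_phase (g : ℝ → ℂ) (x y : ℝ) :
    ‖g y * Complex.exp (-Complex.I * x * y)‖ = ‖g y‖ := by
  rw [norm_mul, norm_exp_neg_I_mul, mul_one]

theorem integrable_mul_fourier_phase {g : ℝ → ℂ} (hg : Integrable g) (x : ℝ) :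
    Integrable fun y : ℝ => g y * Complex.exp (-Complex.I * x * y) :=
  hg.norm.mono' (hg.aestronglyMeasurable.mul (by fun_prop))
    (Eventually.of_forall fun y => (norm_mul_fourier_phase g x y).le)

theorem continuous_fourierExp {g : ℝ → ℂ} (hg : Integrable g) : Continuous (fourierExp g) := by
  refine continuous_of_dominated (bound := fun y => ‖g y‖)
    (fun x => (integrable_mul_fourier_phase hg x).aestronglyMeasurable)
    (fun x => Eventually.of_forall fun y => (norm_mul_fourier_phase g x y).le) hg.norm
    (Eventually.of_forall fun y => by fun_prop)

theorem norm_fourierExp_le {g : ℝ → ℂ} (x : ℝ) :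
    ‖fourierExp g x‖ ≤ ∫ y, ‖g y‖ :=
  (norm_integral_le_integral_norm _).trans_eq (by simp_rw [norm_mul_fourier_phase])

theorem integral_gaussian_fourier {ε : ℝ} (hε : 0 < ε) (r : ℝ) :
    ∫ x : ℝ, Complex.exp (-ε * x ^ 2) * Complex.exp (-Complex.I * x * r) =
      ((Real.sqrt (Real.pi / ε) * Real.exp (-(1 / (4 * ε)) * r ^ 2) : ℝ) : ℂ) := by
  have h := fourierIntegral_gaussian (b := (ε : ℂ)) (by simpa using hε) (-(r : ℂ))
  have h2 : ∀ x : ℝ, Complex.exp (-ε * x ^ 2) * Complex.exp (-Complex.I * x * r) =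
      Complex.exp (Complex.I * -(r : ℂ) * x) * Complex.exp (-ε * x ^ 2) := by
    intro x
    rw [mul_comm]
    congr 2
    ring
  simp_rw [h2]
  rw [h, Real.sqrt_eq_rpow]
  push_cast
  rw [Complex.ofReal_cpow (by positivity)]
  push_cast
  congr 2
  field_simp

theorem integral_gaussian_kernel {ε : ℝ} (hε : 0 < ε) :
    ∫ r : ℝ, Real.sqrt (Real.pi / ε) * Real.exp (-(1 / (4 * ε)) * r ^ 2) = 2 * Real.pi := by
  rw [integral_const_mul, integral_gaussian, ← Real.sqrt_mul (by positivity)]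
  rw [show Real.pi / ε * (Real.pi / (1 / (4 * ε))) = (2 * Real.pi) ^ 2 by field_simp; norm_num]
  exact Real.sqrt_sq (by positivity)

/-- The Gaussian makes Fubini legitimate and turns the integral into ∬ g(p) conj(g(q)) G(p−q) with a
positive even kernel G of mass 2π. The inequality 2|g(p)||g(q)| ≤ |g(p)|² + |g(q)|² finishes; no
Plancherel theorem is needed. -/
theorem integral_norm_fourierExp_sq_mul_gaussian_le {g : ℝ → ℂ} (hg : Integrable g)
    (hg2 : Integrable fun y => ‖g y‖ ^ 2) {ε : ℝ} (hε : 0 < ε) :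
    ∫ x : ℝ, ‖fourierExp g x‖ ^ 2 * Real.exp (-ε * x ^ 2) ≤ 2 * Real.pi * ∫ y, ‖g y‖ ^ 2 := by
  set G : ℝ → ℝ := fun r => Real.sqrt (Real.pi / ε) * Real.exp (-(1 / (4 * ε)) * r ^ 2) with hG
  have hGi : Integrable G :=
    (integrable_exp_neg_mul_sq (by positivity : (0 : ℝ) < 1 / (4 * ε))).const_mul _
  have hG0 : ∀ r, 0 ≤ G r := fun r => by positivity
  have hGn : ∀ r, G (-r) = G r := fun r => by simp [hG]
  set Φ : ℝ × ℝ → ℂ := fun p => g p.1 * (starRingEnd ℂ) (g p.2) with hΦ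
  have hgc : Integrable fun y => (starRingEnd ℂ) (g y) :=
    hg.norm.mono' (Complex.continuous_conj.comp_aestronglyMeasurable hg.aestronglyMeasurable)
      (Eventually.of_forall fun y => by simp)
  have hΦi : Integrable Φ := Integrable.mul_prod hg hgc
  have hsq : ∀ x : ℝ, ((‖fourierExp g x‖ ^ 2 : ℝ) : ℂ) =
      ∫ p : ℝ × ℝ, Φ p * Complex.exp (-Complex.I * x * ((p.1 - p.2 : ℝ) : ℂ)) := by
    intro x
    rw [← Complex.normSq_eq_norm_sq, ← Complex.mul_conj]
    nth_rewrite 2 [fourierExp]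
    rw [fourierExp, ← integral_conj, ← integral_prod_mul]
    congr 1
    ext p
    simp only [hΦ, map_mul, ← Complex.exp_conj]
    rw [mul_mul_mul_comm, ← Complex.exp_add]
    congr 2
    simp
    ring
  have hcomb : ((∫ x : ℝ, ‖fourierExp g x‖ ^ 2 * Real.exp (-ε * x ^ 2) : ℝ) : ℂ) =
      ∫ p : ℝ × ℝ, Φ p * (G (p.1 - p.2) : ℂ) := by
    rw [← integral_complex_ofReal]
    have e1 : ∀ x : ℝ, ((‖fourierExp g x‖ ^ 2 * Real.exp (-ε * x ^ 2) : ℝ) : ℂ) =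
        ∫ p : ℝ × ℝ, Complex.exp (-ε * x ^ 2) *
          (Φ p * Complex.exp (-Complex.I * x * ((p.1 - p.2 : ℝ) : ℂ))) := by
      intro x
      rw [integral_const_mul, ← hsq]
      push_cast
      ring
    have hexp : Integrable fun x : ℝ => Complex.exp (-ε * x ^ 2) :=
      integrable_cexp_neg_mul_sq (by simpa using hε)
    simp_rw [e1]
    rw [integral_integral_swap]
    · congr 1
      ext p
      simp_rw [hG, ← integral_gaussian_fourier hε, ← integral_const_mul]
      congr 1
      ext x
      ring
    · have := Integrable.mul_prod hexp hΦi
      refine this.norm.mono' ?_ (Eventually.of_forall fun q => ?_)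
      · have h3 : Continuous fun q : ℝ × (ℝ × ℝ) =>
            Complex.exp (-Complex.I * q.1 * ((q.2.1 - q.2.2 : ℝ) : ℂ)) := by fun_prop
        refine (this.aestronglyMeasurable.mul h3.aestronglyMeasurable).congr
          (Eventually.of_forall fun q => ?_)
        simp [Function.uncurry, mul_assoc]
      · simp only [Function.uncurry, norm_mul, norm_exp_neg_I_mul, mul_one]
        exact le_rfl
  have hint : Integrable fun p : ℝ × ℝ => ‖g p.2‖ ^ 2 * G (p.1 - p.2) :=
    Integrable.convolution_integrand (ContinuousLinearMap.mul ℝ ℝ) hg2 hGi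
  have hint' : Integrable fun p : ℝ × ℝ => ‖g p.1‖ ^ 2 * G (p.1 - p.2) := by
    have := hint.swap
    refine this.congr (Eventually.of_forall fun p => ?_)
    simp only [Function.comp_apply, Prod.fst_swap, Prod.snd_swap]
    rw [← hGn, neg_sub]
  have hval : ∫ p : ℝ × ℝ, ‖g p.2‖ ^ 2 * G (p.1 - p.2) = 2 * Real.pi * ∫ y, ‖g y‖ ^ 2 := by
    rw [Measure.volume_eq_prod, integral_prod_symm _ hint]
    simp_rw [integral_const_mul, integral_sub_right_eq_self]
    rw [integral_mul_const, integral_gaussian_kernel hε, mul_comm]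
  have hval' : ∫ p : ℝ × ℝ, ‖g p.1‖ ^ 2 * G (p.1 - p.2) = 2 * Real.pi * ∫ y, ‖g y‖ ^ 2 := by
    rw [Measure.volume_eq_prod, integral_prod _ hint']
    simp_rw [integral_const_mul, integral_sub_left_eq_self G volume]
    rw [integral_mul_const, integral_gaussian_kernel hε, mul_comm]
  have hnn : 0 ≤ ∫ x : ℝ, ‖fourierExp g x‖ ^ 2 * Real.exp (-ε * x ^ 2) :=
    integral_nonneg fun x => by positivity
  rw [← Real.norm_of_nonneg hnn, ← Complex.norm_real, hcomb]
  have hb : Integrable fun p : ℝ × ℝ =>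
      (‖g p.2‖ ^ 2 * G (p.1 - p.2) + ‖g p.1‖ ^ 2 * G (p.1 - p.2)) / 2 :=
    (hint.add hint').div_const 2
  refine (norm_integral_le_of_norm_le hb (Eventually.of_forall fun p => ?_)).trans ?_
  · rw [norm_mul, Complex.norm_real, Real.norm_of_nonneg (hG0 _), hΦ, norm_mul, RCLike.norm_conj]
    have := hG0 (p.1 - p.2)
    nlinarith [mul_nonneg (sq_nonneg (‖g p.1‖ - ‖g p.2‖)) this]
  · rw [integral_div, integral_add hint hint', hval, hval']
    linarith

/-- Bessel's inequality for the Fourier transform. -/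
theorem lintegral_fourierExp_sq_le {g : ℝ → ℂ} (hg : Integrable g)
    (hg2 : Integrable fun y => ‖g y‖ ^ 2) :
    ∫⁻ x : ℝ, ENNReal.ofReal (‖fourierExp g x‖ ^ 2) ≤
      ENNReal.ofReal (2 * Real.pi * ∫ y, ‖g y‖ ^ 2) := by
  have hc := continuous_fourierExp hg
  set F : ℕ → ℝ → ENNReal := fun n x =>
    ENNReal.ofReal (‖fourierExp g x‖ ^ 2 * Real.exp (-(1 / ((n : ℝ) + 1)) * x ^ 2)) with hF
  have hlim : ∀ x : ℝ, Tendsto (fun n => F n x) atTop (𝓝 (ENNReal.ofReal (‖fourierExp g x‖ ^ 2))) := by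
    intro x
    have h1 : Tendsto (fun n : ℕ => -(1 / ((n : ℝ) + 1)) * x ^ 2) atTop (𝓝 (-0 * x ^ 2)) :=
      tendsto_one_div_add_atTop_nhds_zero_nat.neg.mul_const _
    have h2 := ((Real.continuous_exp.tendsto _).comp h1).const_mul (‖fourierExp g x‖ ^ 2)
    simp only [neg_zero, zero_mul, Real.exp_zero, mul_one] at h2
    exact (ENNReal.continuous_ofReal.tendsto _).comp h2
  -- Fatou's lemma as the Gaussian regularisation is removed.
  calc _ = ∫⁻ x, liminf (fun n => F n x) atTop := by
        congr 1
        ext x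
        exact (hlim x).liminf_eq.symm
    _ ≤ liminf (fun n => ∫⁻ x, F n x) atTop := lintegral_liminf_le fun n => by fun_prop
    _ ≤ liminf (fun _ : ℕ => ENNReal.ofReal (2 * Real.pi * ∫ y, ‖g y‖ ^ 2)) atTop := by
        refine liminf_le_liminf (Eventually.of_forall fun n => ?_)
        have hn : (0 : ℝ) < 1 / ((n : ℝ) + 1) := by positivity
        have hi : Integrable fun x : ℝ =>
            ‖fourierExp g x‖ ^ 2 * Real.exp (-(1 / ((n : ℝ) + 1)) * x ^ 2) := by
          refine ((integrable_exp_neg_mul_sq hn).const_mul ((∫ y, ‖g y‖) ^ 2)).mono'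
            (by fun_prop) (Eventually.of_forall fun x => ?_)
          rw [Real.norm_of_nonneg (by positivity)]
          gcongr
          exact norm_fourierExp_le x
        rw [hF, ← ofReal_integral_eq_lintegral_ofReal hi (Eventually.of_forall fun x => by positivity)]
        exact ENNReal.ofReal_le_ofReal (integral_norm_fourierExp_sq_mul_gaussian_le hg hg2 hn)
    _ = _ := by simp
end

noncomputable section

/- The Airy function and its derivatives on the real line. -/

/-- The `k`-th derivative of the Airy function on the real line. -/
def airyR (k : ℕ) (x : ℝ) : ℝ := (airyD k x).re

theorem ofReal_airyR (k : ℕ) (x : ℝ) : ((airyR k x : ℝ) : ℂ) = airyD k x :=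
  Complex.conj_eq_iff_re.mp (by rw [conj_airyD, Complex.conj_ofReal])

theorem airyR_zero : airyR 0 = airyAi := by
  ext x
  rw [airyR, airyAi, airyD_zero]

theorem hasDerivAt_airyR (k : ℕ) (x : ℝ) : HasDerivAt (airyR k) (airyR (k + 1) x) x :=
  (hasDerivAt_airyD k (x : ℂ)).real_of_complex

theorem continuous_airyR (k : ℕ) : Continuous (airyR k) :=
  continuous_iff_continuousAt.mpr fun x => (hasDerivAt_airyR k x).continuousAt

theorem deriv_airyAi (x : ℝ) : deriv airyAi x = airyR 1 x := by
  rw [← airyR_zero]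
  exact (hasDerivAt_airyR 0 x).deriv

theorem airyR_two (x : ℝ) : airyR 2 x = x * airyR 0 x := by
  rw [airyR, airyD_two, airyR, Complex.re_ofReal_mul]

theorem exists_abs_airyR_le (k : ℕ) {c : ℝ} (hc : 0 < c) :
    ∃ C : ℝ, 0 < C ∧ ∀ x : ℝ, |airyR k x| ≤ C * Real.exp (-c * x) := by
  obtain ⟨C, hC, h⟩ := exists_norm_airyD_le k hc 0
  refine ⟨C, hC, fun x => (Complex.abs_re_le_norm _).trans ?_⟩
  simpa using h x (by simp)

theorem tendsto_airyR_atTop (k : ℕ) : Tendsto (airyR k) atTop (𝓝 0) := by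
  obtain ⟨C, -, h⟩ := exists_abs_airyR_le k one_pos
  refine squeeze_zero_norm h ?_
  have := (Real.tendsto_exp_neg_atTop_nhds_zero).const_mul C
  simpa using this

theorem tendsto_self_mul_airyR_atTop (k : ℕ) : Tendsto (fun x => x * airyR k x) atTop (𝓝 0) := by
  obtain ⟨C, -, h⟩ := exists_abs_airyR_le k one_pos
  have h1 : ∀ᶠ x : ℝ in atTop, ‖x * airyR k x‖ ≤ C * (x ^ 1 * Real.exp (-x)) := by
    filter_upwards [eventually_ge_atTop 0] with x hx
    rw [norm_mul, Real.norm_of_nonneg hx, Real.norm_eq_abs]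
    calc _ ≤ x * (C * Real.exp (-1 * x)) := mul_le_mul_of_nonneg_left (h x) hx
      _ = _ := by ring_nf
  refine squeeze_zero_norm' h1 ?_
  simpa using (Real.tendsto_pow_mul_exp_neg_atTop_nhds_zero 1).const_mul C

theorem integrableOn_airyR_mul (x y : ℝ) :
    IntegrableOn (fun t => airyR 0 (x + t) * airyR 0 (y + t)) (Set.Ioi 0) := by
  obtain ⟨C, hC, h⟩ := exists_abs_airyR_le 0 one_pos
  have hi : IntegrableOn (fun t : ℝ => (C * Real.exp (-x)) * (C * Real.exp (-y)) * Real.exp (-2 * t))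
      (Set.Ioi 0) := (integrableOn_exp_mul_Ioi (by norm_num) 0).const_mul _
  have hc : Continuous fun t => airyR 0 (x + t) * airyR 0 (y + t) :=
    ((continuous_airyR 0).comp (by fun_prop)).mul ((continuous_airyR 0).comp (by fun_prop))
  refine hi.mono' hc.aestronglyMeasurable (Eventually.of_forall fun t => ?_)
  rw [norm_mul]
  calc _ ≤ (C * Real.exp (-1 * (x + t))) * (C * Real.exp (-1 * (y + t))) :=
        mul_le_mul (h _) (h _) (abs_nonneg _) (by positivity)
    _ = _ := by
      rw [show -1 * (x + t) = -x + -t by ring, show -1 * (y + t) = -y + -t by ring,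
        show -2 * t = -t + -t by ring]
      simp only [Real.exp_add]
      ring

/-- By the Airy equation, the t-derivative of the numerator at (x+t, y+t) is (y−x)Ai(x+t)Ai(y+t);
integrate from 0 to ∞. On the diagonal the primitive is Ai'² − (x+t)Ai². -/
theorem airyKernel_eq_integral (x y : ℝ) :
    airyKernel x y = ∫ t in Set.Ioi 0, airyR 0 (x + t) * airyR 0 (y + t) := by
  have hd : ∀ (k : ℕ) (x t : ℝ), HasDerivAt (fun t => airyR k (x + t)) (airyR (k + 1) (x + t)) t :=
    fun k x t => (hasDerivAt_airyR k (x + t)).comp_const_add x t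
  have hl : ∀ (k : ℕ) (x : ℝ), Tendsto (fun t => airyR k (x + t)) atTop (𝓝 0) := fun k x =>
    (tendsto_airyR_atTop k).comp (tendsto_atTop_add_const_left _ x tendsto_id)
  unfold airyKernel
  split_ifs with hxy
  · subst hxy
    have h1 : ∀ t : ℝ, HasDerivAt
        (fun t => airyR 1 (x + t) ^ 2 - (x + t) * airyR 0 (x + t) ^ 2)
        (-(airyR 0 (x + t) * airyR 0 (x + t))) t := by
      intro t
      have h0 : HasDerivAt (fun t : ℝ => x + t) 1 t := (hasDerivAt_id t).const_add x
      refine (((hd 1 x t).pow 2).sub (h0.mul ((hd 0 x t).pow 2))).congr_deriv ?_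
      simp only [Pi.pow_apply, airyR_two, Nat.reduceAdd]
      push_cast
      ring
    have hlim : Tendsto (fun t => airyR 1 (x + t) ^ 2 - (x + t) * airyR 0 (x + t) ^ 2) atTop
        (𝓝 0) := by
      have h2 := (tendsto_self_mul_airyR_atTop 0).comp
        (tendsto_atTop_add_const_left atTop x tendsto_id)
      have := ((hl 1 x).pow 2).sub (h2.mul (hl 0 x))
      simp only [Function.comp_def, id] at this
      convert this using 2
      · ring
      · norm_num
    have := integral_Ioi_of_hasDerivAt_of_tendsto' (fun t _ => h1 t)
      (integrableOn_airyR_mul x x).neg hlim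
    rw [integral_neg] at this
    rw [deriv_airyAi, ← airyR_zero]
    simp only [add_zero] at this
    linarith
  · have hne : x - y ≠ 0 := sub_ne_zero.mpr hxy
    have h1 : ∀ t : ℝ, HasDerivAt
        (fun t => airyR 0 (x + t) * airyR 1 (y + t) - airyR 1 (x + t) * airyR 0 (y + t))
        ((y - x) * (airyR 0 (x + t) * airyR 0 (y + t))) t := by
      intro t
      refine (((hd 0 x t).mul (hd 1 y t)).sub ((hd 1 x t).mul (hd 0 y t))).congr_deriv ?_
      simp only [airyR_two, Nat.reduceAdd]
      ring
    have hlim : Tendsto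
        (fun t => airyR 0 (x + t) * airyR 1 (y + t) - airyR 1 (x + t) * airyR 0 (y + t)) atTop
        (𝓝 0) := by
      simpa using ((hl 0 x).mul (hl 1 y)).sub ((hl 1 x).mul (hl 0 y))
    have := integral_Ioi_of_hasDerivAt_of_tendsto' (fun t _ => h1 t)
      ((integrableOn_airyR_mul x y).const_mul _) hlim
    rw [integral_const_mul] at this
    rw [deriv_airyAi, deriv_airyAi, ← airyR_zero, div_eq_iff hne]
    simp only [add_zero] at this
    linarith

/- The Airy functions `t ↦ Ai (x + t)` in `L²(0, ∞)`. -/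

/-- The Hilbert space `L²(0, ∞)`. -/
abbrev HalfLineL2 : Type := Lp ℝ 2 (volume.restrict (Set.Ioi (0 : ℝ)))

theorem memLp_airyR_add (x : ℝ) :
    MemLp (fun t => airyR 0 (x + t)) 2 (volume.restrict (Set.Ioi (0 : ℝ))) := by
  have hc : Continuous fun t => airyR 0 (x + t) := (continuous_airyR 0).comp (by fun_prop)
  rw [memLp_two_iff_integrable_sq hc.aestronglyMeasurable]
  simp only [sq]
  exact integrableOn_airyR_mul x x

/-- The function `t ↦ Ai (x + t)` as an element of `L²(0, ∞)`. -/
def airyVec (x : ℝ) : HalfLineL2 := (memLp_airyR_add x).toLp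

theorem inner_airyVec_left (x : ℝ) (u : HalfLineL2) :
    inner ℝ (airyVec x) u = ∫ t in Set.Ioi 0, airyR 0 (x + t) * u t := by
  rw [L2.inner_def]
  refine integral_congr_ae ?_
  filter_upwards [(memLp_airyR_add x).coeFn_toLp] with t ht
  rw [airyVec, ht]
  simp [mul_comm]

/-- The link to the abstract Fredholm theory: K is the Gram kernel of the vectors a(x). -/
theorem inner_airyVec (x y : ℝ) : inner ℝ (airyVec x) (airyVec y) = airyKernel x y := by
  rw [inner_airyVec_left, airyKernel_eq_integral]
  refine integral_congr_ae ?_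
  filter_upwards [(memLp_airyR_add y).coeFn_toLp] with t ht
  rw [airyVec, ht]

theorem norm_airyVec_sq (x : ℝ) : ‖airyVec x‖ ^ 2 = airyKernel x x := by
  rw [← real_inner_self_eq_norm_sq, inner_airyVec]

theorem continuous_airyVec : Continuous airyVec := by
  rw [continuous_iff_continuousAt]
  intro x
  obtain ⟨C, hC, h⟩ := exists_abs_airyR_le 0 one_pos
  have hnorm : ∀ y, ‖airyVec y - airyVec x‖ ^ 2 =
      ∫ t in Set.Ioi 0, (airyR 0 (y + t) - airyR 0 (x + t)) ^ 2 := by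
    intro y
    have hsub : airyVec y - airyVec x = ((memLp_airyR_add y).sub (memLp_airyR_add x)).toLp :=
      (MemLp.toLp_sub _ _).symm
    rw [← real_inner_self_eq_norm_sq, L2.inner_def, hsub]
    refine integral_congr_ae ?_
    filter_upwards [((memLp_airyR_add y).sub (memLp_airyR_add x)).coeFn_toLp] with t ht
    rw [ht]
    simp [sq]
  have hlim : Tendsto (fun y => ∫ t in Set.Ioi 0, (airyR 0 (y + t) - airyR 0 (x + t)) ^ 2)
      (𝓝 x) (𝓝 (∫ t in Set.Ioi (0 : ℝ), 0)) := by
    refine tendsto_integral_filter_of_dominated_convergence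
      (fun t => (2 * (C * Real.exp (1 - x))) ^ 2 * Real.exp (-2 * t))
      (Eventually.of_forall fun y => ?_) ?_ ?_ (Eventually.of_forall fun t => ?_)
    · have hc : Continuous fun t => (airyR 0 (y + t) - airyR 0 (x + t)) ^ 2 :=
        (((continuous_airyR 0).comp (by fun_prop)).sub
          ((continuous_airyR 0).comp (by fun_prop))).pow 2
      exact hc.aestronglyMeasurable
    · filter_upwards [Metric.ball_mem_nhds x one_pos] with y hy
      refine Eventually.of_forall fun t => ?_
      have hy' : |y - x| < 1 := by simpa [Real.dist_eq] using hy
      rw [abs_lt] at hy'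
      have e1 : |airyR 0 (y + t)| ≤ C * Real.exp (1 - x) * Real.exp (-t) := by
        rw [mul_assoc, ← Real.exp_add]
        exact (h _).trans (mul_le_mul_of_nonneg_left (Real.exp_le_exp.mpr (by linarith)) hC.le)
      have e2 : |airyR 0 (x + t)| ≤ C * Real.exp (1 - x) * Real.exp (-t) := by
        rw [mul_assoc, ← Real.exp_add]
        exact (h _).trans (mul_le_mul_of_nonneg_left (Real.exp_le_exp.mpr (by linarith)) hC.le)
      have e3 : |airyR 0 (y + t) - airyR 0 (x + t)| ≤
          2 * (C * Real.exp (1 - x)) * Real.exp (-t) :=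
        (abs_sub _ _).trans (by linarith)
      rw [Real.norm_of_nonneg (sq_nonneg _), ← sq_abs, show -2 * t = -t + -t by ring, Real.exp_add]
      calc _ ≤ (2 * (C * Real.exp (1 - x)) * Real.exp (-t)) ^ 2 :=
            pow_le_pow_left₀ (abs_nonneg _) e3 2
        _ = _ := by ring
    · exact (integrableOn_exp_mul_Ioi (by norm_num) 0).const_mul _
    · have hc : Continuous fun y => (airyR 0 (y + t) - airyR 0 (x + t)) ^ 2 :=
        (((continuous_airyR 0).comp (by fun_prop)).sub continuous_const).pow 2
      simpa using hc.tendsto x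
  simp only [integral_zero] at hlim
  rw [ContinuousAt, tendsto_iff_norm_sub_tendsto_zero]
  have h2 : Tendsto (fun y => ‖airyVec y - airyVec x‖ ^ 2) (𝓝 x) (𝓝 0) := by
    simpa only [hnorm] using hlim
  have h3 := (Real.continuous_sqrt.tendsto 0).comp h2
  simpa [Function.comp_def, Real.sqrt_sq] using h3

theorem exists_norm_airyVec_sq_le {c : ℝ} (hc : 0 < c) :
    ∃ C : ℝ, 0 < C ∧ ∀ x : ℝ, ‖airyVec x‖ ^ 2 ≤ C * Real.exp (-2 * c * x) := by
  obtain ⟨C, hC, h⟩ := exists_abs_airyR_le 0 hc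
  refine ⟨C ^ 2 / (2 * c), by positivity, fun x => ?_⟩
  rw [norm_airyVec_sq, airyKernel_eq_integral]
  have hi : IntegrableOn (fun t : ℝ => C ^ 2 * Real.exp (-2 * c * x) * Real.exp (-(2 * c) * t))
      (Set.Ioi 0) := (integrableOn_exp_mul_Ioi (by linarith) 0).const_mul _
  refine (integral_mono (integrableOn_airyR_mul x x) hi fun t => ?_).trans_eq ?_
  · have h1 := h (x + t)
    calc airyR 0 (x + t) * airyR 0 (x + t) = |airyR 0 (x + t)| * |airyR 0 (x + t)| :=
          (abs_mul_abs_self _).symm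
      _ ≤ (C * Real.exp (-c * (x + t))) * (C * Real.exp (-c * (x + t))) :=
          mul_le_mul h1 h1 (abs_nonneg _) (by positivity)
      _ = C ^ 2 * (Real.exp (-c * (x + t)) * Real.exp (-c * (x + t))) := by ring
      _ = _ := by
        rw [← Real.exp_add, mul_assoc, ← Real.exp_add]
        congr 2
        ring
  · rw [integral_const_mul, integral_exp_mul_Ioi (by linarith)]
    simp
    field_simp

/- Bessel's inequality for the family `airyVec`. -/

/-- On the line Re t = c, the contour integral for Ai(r) is e^{−cr} times a Fourier integral whose
density does not depend on r. -/
theorem ofReal_exp_mul_airyR {c : ℝ} (hc : 0 < c) (r : ℝ) :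
    ((Real.exp (c * r) * airyR 0 r : ℝ) : ℂ) =
      (1 / (2 * Real.pi) : ℂ) * fourierExp (airyKer 0 0 c) r := by
  rw [Complex.ofReal_mul, ofReal_airyR, airyD_eq 0 _ hc, mul_left_comm, fourierExp,
    ← integral_const_mul]
  congr 2
  ext y
  simp only [airyKer, airyExp, pow_zero, one_mul, Complex.ofReal_exp, ← Complex.exp_add]
  congr 1
  push_cast
  ring

/-- This bound tends to 1 as c → 0, which is why Bessel's inequality ends with constant exactly 1.
-/
theorem norm_airyKer_zero_zero_le {c : ℝ} (hc : 0 < c) (y : ℝ) :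
    ‖airyKer 0 0 c y‖ ≤ Real.exp (c ^ 3 / 3) := by
  simp only [airyKer, pow_zero, one_mul, norm_airyExp]
  refine Real.exp_le_exp.mpr ?_
  simp
  positivity

/-- The function `u (t) exp (-c t)` on the half line, extended by zero. -/
def halfLineDamped (u : HalfLineL2) (c t : ℝ) : ℂ :=
  Set.indicator (Set.Ioi 0) (fun t => ((Real.exp (-c * t) * u t : ℝ) : ℂ)) t

theorem integrableOn_sq_halfLine (u : HalfLineL2) :
    IntegrableOn (fun t => (u t) ^ 2) (Set.Ioi 0) :=
  (memLp_two_iff_integrable_sq (Lp.aestronglyMeasurable u)).mp (Lp.memLp u)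

theorem norm_sq_halfLine (u : HalfLineL2) : ‖u‖ ^ 2 = ∫ t in Set.Ioi 0, (u t) ^ 2 := by
  rw [← real_inner_self_eq_norm_sq, L2.inner_def]
  simp [sq]

theorem integrable_halfLineDamped (u : HalfLineL2) {c : ℝ} (hc : 0 < c) :
    Integrable (halfLineDamped u c) := by
  have h1 : MemLp (fun t : ℝ => Real.exp (-c * t)) 2 (volume.restrict (Set.Ioi (0 : ℝ))) := by
    rw [memLp_two_iff_integrable_sq (by fun_prop)]
    refine (integrableOn_exp_mul_Ioi (by linarith : -(2 * c) < 0) 0).congr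
      (Eventually.of_forall fun t => ?_)
    simp only [← Real.exp_nat_mul]
    congr 1
    push_cast
    ring
  have h2 : IntegrableOn (fun t => ((Real.exp (-c * t) * u t : ℝ) : ℂ)) (Set.Ioi 0) :=
    (MemLp.integrable_mul h1 (Lp.memLp u)).ofReal
  exact h2.integrable_indicator measurableSet_Ioi

theorem norm_halfLineDamped_sq_le (u : HalfLineL2) {c : ℝ} (hc : 0 < c) (t : ℝ) :
    ‖halfLineDamped u c t‖ ^ 2 ≤ Set.indicator (Set.Ioi 0) (fun t => (u t) ^ 2) t := by
  unfold halfLineDamped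
  by_cases ht : t ∈ Set.Ioi (0 : ℝ)
  · rw [Set.indicator_of_mem ht, Set.indicator_of_mem ht, Complex.norm_real, Real.norm_eq_abs,
      sq_abs, mul_pow]
    have : Real.exp (-c * t) ≤ 1 := Real.exp_le_one_iff.mpr (by nlinarith [Set.mem_Ioi.mp ht])
    have h2 : Real.exp (-c * t) ^ 2 ≤ 1 := pow_le_one₀ (Real.exp_pos _).le this
    nlinarith [sq_nonneg (u t)]
  · simp [Set.indicator_of_notMem ht]

theorem integrable_norm_halfLineDamped_sq (u : HalfLineL2) {c : ℝ} (hc : 0 < c) :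
    Integrable fun t => ‖halfLineDamped u c t‖ ^ 2 :=
  ((integrableOn_sq_halfLine u).integrable_indicator measurableSet_Ioi).mono'
    ((integrable_halfLineDamped u hc).aestronglyMeasurable.norm.pow 2)
    (Eventually.of_forall fun t => by
      rw [Real.norm_of_nonneg (by positivity)]
      exact norm_halfLineDamped_sq_le u hc t)

theorem integral_norm_halfLineDamped_sq_le (u : HalfLineL2) {c : ℝ} (hc : 0 < c) :
    ∫ t, ‖halfLineDamped u c t‖ ^ 2 ≤ ‖u‖ ^ 2 := by
  rw [norm_sq_halfLine, ← integral_indicator measurableSet_Ioi]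
  exact integral_mono (integrable_norm_halfLineDamped_sq u hc)
    ((integrableOn_sq_halfLine u).integrable_indicator measurableSet_Ioi)
    (norm_halfLineDamped_sq_le u hc)

/-- ⟨a(x),u⟩ is a correlation of Ai with u. Writing e^{cx} = e^{c(x+t)}e^{−ct} damps both factors
into integrable ones, and the correlation becomes the Fourier transform of a product. -/
theorem ofReal_exp_mul_inner_airyVec (u : HalfLineL2) {c : ℝ} (hc : 0 < c) (x : ℝ) :
    ((Real.exp (c * x) * inner ℝ (airyVec x) u : ℝ) : ℂ) = (1 / (2 * Real.pi) : ℂ) *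
      fourierExp (fun y => airyKer 0 0 c y * fourierExp (halfLineDamped u c) y) x := by
  have hu := integrable_halfLineDamped u hc
  have hh := integrable_airyKer 0 0 hc
  have h1 : ((Real.exp (c * x) * inner ℝ (airyVec x) u : ℝ) : ℂ) =
      ∫ t, ((Real.exp (c * (x + t)) * airyR 0 (x + t) : ℝ) : ℂ) * halfLineDamped u c t := by
    rw [inner_airyVec_left, ← integral_const_mul, ← integral_complex_ofReal,
      ← integral_indicator measurableSet_Ioi]
    congr 1
    ext t
    unfold halfLineDamped
    by_cases ht : t ∈ Set.Ioi (0 : ℝ)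
    · rw [Set.indicator_of_mem ht, Set.indicator_of_mem ht, ← Complex.ofReal_mul]
      congr 1
      rw [show c * x = c * (x + t) + -c * t by ring, Real.exp_add]
      ring
    · simp [Set.indicator_of_notMem ht]
  rw [h1]
  simp_rw [ofReal_exp_mul_airyR hc, mul_assoc]
  rw [integral_const_mul]
  congr 1
  simp only [fourierExp]
  simp_rw [← integral_mul_const, ← integral_const_mul]
  rw [integral_integral_swap]
  · congr 1
    ext y
    rw [← integral_mul_const]
    congr 1
    ext t
    rw [show -Complex.I * ((x + t : ℝ) : ℂ) * y = -Complex.I * x * y + -Complex.I * y * t by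
      push_cast; ring, Complex.exp_add]
    ring
  · have := Integrable.mul_prod hu hh
    refine this.norm.mono' ?_ (Eventually.of_forall fun q => ?_)
    · have h3 : Continuous fun q : ℝ × ℝ => Complex.exp (-Complex.I * ((x + q.1 : ℝ) : ℂ) * q.2) := by
        fun_prop
      refine (this.aestronglyMeasurable.mul h3.aestronglyMeasurable).congr
        (Eventually.of_forall fun q => ?_)
      simp only [Function.uncurry, Pi.mul_apply]
      ring
    · simp only [Function.uncurry, norm_mul]
      rw [show -Complex.I * ((x + q.1 : ℝ) : ℂ) * (q.2 : ℂ) = -Complex.I * ((x + q.1 : ℝ) : ℂ) * q.2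
        from rfl, norm_exp_neg_I_mul]
      simp [mul_comm]

/-- Bessel for the Fourier transform is used twice, once for the outer transform and once for the
damped u; the two factors 2π cancel (1/(2π))². -/
theorem lintegral_exp_mul_inner_airyVec_sq_le (u : HalfLineL2) {c : ℝ} (hc : 0 < c) :
    ∫⁻ x : ℝ, ENNReal.ofReal ((Real.exp (c * x) * inner ℝ (airyVec x) u) ^ 2) ≤
      ENNReal.ofReal (Real.exp (c ^ 3 / 3) ^ 2 * ‖u‖ ^ 2) := by
  have hu := integrable_halfLineDamped u hc
  have hu2 := integrable_norm_halfLineDamped_sq u hc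
  set g : ℝ → ℂ := fun y => airyKer 0 0 c y * fourierExp (halfLineDamped u c) y with hg
  set M : ℝ := ∫ t, ‖halfLineDamped u c t‖
  have hgi : Integrable g := by
    refine ((integrable_airyKer 0 0 hc).norm.mul_const M).mono'
      ((integrable_airyKer 0 0 hc).aestronglyMeasurable.mul
        (continuous_fourierExp hu).aestronglyMeasurable) (Eventually.of_forall fun y => ?_)
    rw [hg, norm_mul]
    exact mul_le_mul_of_nonneg_left (norm_fourierExp_le y) (norm_nonneg _)
  have hgb : ∀ y, ‖g y‖ ^ 2 ≤ Real.exp (c ^ 3 / 3) ^ 2 * ‖fourierExp (halfLineDamped u c) y‖ ^ 2 := by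
    intro y
    rw [hg, norm_mul, mul_pow]
    gcongr
    exact norm_airyKer_zero_zero_le hc y
  have hF2 : Integrable fun y => ‖fourierExp (halfLineDamped u c) y‖ ^ 2 := by
    refine ⟨((continuous_fourierExp hu).norm.pow 2).aestronglyMeasurable, ?_⟩
    rw [hasFiniteIntegral_iff_ofReal (Eventually.of_forall fun y => by positivity)]
    exact (lintegral_fourierExp_sq_le hu hu2).trans_lt ENNReal.ofReal_lt_top
  have hg2 : Integrable fun y => ‖g y‖ ^ 2 :=
    (hF2.const_mul (Real.exp (c ^ 3 / 3) ^ 2)).mono' (hgi.aestronglyMeasurable.norm.pow 2)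
      (Eventually.of_forall fun y => by
        rw [Real.norm_of_nonneg (by positivity)]
        exact hgb y)
  have hint : ∫ y, ‖g y‖ ^ 2 ≤ Real.exp (c ^ 3 / 3) ^ 2 * (2 * Real.pi * ‖u‖ ^ 2) := by
    refine (integral_mono hg2 (hF2.const_mul _) hgb).trans ?_
    rw [integral_const_mul]
    refine mul_le_mul_of_nonneg_left ?_ (by positivity)
    have h3 : ∫ y, ‖fourierExp (halfLineDamped u c) y‖ ^ 2 ≤
        2 * Real.pi * ∫ t, ‖halfLineDamped u c t‖ ^ 2 := by
      have h4 := lintegral_fourierExp_sq_le hu hu2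
      rw [← ofReal_integral_eq_lintegral_ofReal hF2 (Eventually.of_forall fun y => by positivity)]
        at h4
      exact (ENNReal.ofReal_le_ofReal_iff (by positivity)).mp h4
    exact h3.trans (mul_le_mul_of_nonneg_left (integral_norm_halfLineDamped_sq_le u hc)
      (by positivity))
  have hpt : ∀ x : ℝ, ENNReal.ofReal ((Real.exp (c * x) * inner ℝ (airyVec x) u) ^ 2) =
      ENNReal.ofReal ((1 / (2 * Real.pi)) ^ 2) * ENNReal.ofReal (‖fourierExp g x‖ ^ 2) := by
    intro x
    rw [← ENNReal.ofReal_mul (by positivity)]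
    congr 1
    rw [← sq_abs, ← Real.norm_eq_abs, ← Complex.norm_real, ofReal_exp_mul_inner_airyVec u hc x,
      norm_mul, mul_pow, show (1 / (2 * Real.pi) : ℂ) = ((1 / (2 * Real.pi) : ℝ) : ℂ) by
        push_cast; rfl, Complex.norm_real, Real.norm_eq_abs, sq_abs]
  simp_rw [hpt]
  rw [lintegral_const_mul' _ _ ENNReal.ofReal_ne_top]
  refine (mul_le_mul_right (lintegral_fourierExp_sq_le hgi hg2) _).trans ?_
  rw [← ENNReal.ofReal_mul (by positivity)]
  refine ENNReal.ofReal_le_ofReal ?_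
  calc _ ≤ (1 / (2 * Real.pi)) ^ 2 * (2 * Real.pi *
        (Real.exp (c ^ 3 / 3) ^ 2 * (2 * Real.pi * ‖u‖ ^ 2))) := by gcongr
    _ = _ := by field_simp

/-- Fatou's lemma along c = 1/(n+1) → 0 removes the damping. -/
theorem lintegral_inner_airyVec_sq_le (u : HalfLineL2) :
    ∫⁻ x : ℝ, ENNReal.ofReal ((inner ℝ (airyVec x) u) ^ 2) ≤ ENNReal.ofReal (‖u‖ ^ 2) := by
  set c : ℕ → ℝ := fun n => 1 / ((n : ℝ) + 1) with hc
  have hc0 : ∀ n, 0 < c n := fun n => by positivity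
  have hcl : Tendsto c atTop (𝓝 0) := tendsto_one_div_add_atTop_nhds_zero_nat
  set F : ℕ → ℝ → ENNReal := fun n x =>
    ENNReal.ofReal ((Real.exp (c n * x) * inner ℝ (airyVec x) u) ^ 2) with hF
  have hcont : Continuous fun x => inner ℝ (airyVec x) u :=
    continuous_airyVec.inner continuous_const
  have hlim : ∀ x : ℝ, Tendsto (fun n => F n x) atTop
      (𝓝 (ENNReal.ofReal ((inner ℝ (airyVec x) u) ^ 2))) := by
    intro x
    have h1 := (Real.continuous_exp.tendsto _).comp (hcl.mul_const x)
    have h2 := (h1.mul_const (inner ℝ (airyVec x) u)).pow 2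
    simp only [zero_mul, Real.exp_zero, one_mul] at h2
    exact (ENNReal.continuous_ofReal.tendsto _).comp h2
  have hR : Tendsto (fun n => ENNReal.ofReal (Real.exp (c n ^ 3 / 3) ^ 2 * ‖u‖ ^ 2)) atTop
      (𝓝 (ENNReal.ofReal (‖u‖ ^ 2))) := by
    have h1 := (Real.continuous_exp.tendsto _).comp ((hcl.pow 3).div_const 3)
    have h2 := (h1.pow 2).mul_const (‖u‖ ^ 2)
    norm_num at h2
    exact (ENNReal.continuous_ofReal.tendsto _).comp h2
  calc _ = ∫⁻ x, liminf (fun n => F n x) atTop := by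
        congr 1
        ext x
        exact (hlim x).liminf_eq.symm
    _ ≤ liminf (fun n => ∫⁻ x, F n x) atTop := lintegral_liminf_le fun n => by
        have : Continuous (F n) := ENNReal.continuous_ofReal.comp (by fun_prop)
        exact this.measurable
    _ ≤ liminf (fun n => ENNReal.ofReal (Real.exp (c n ^ 3 / 3) ^ 2 * ‖u‖ ^ 2)) atTop :=
        liminf_le_liminf (Eventually.of_forall fun n =>
          lintegral_exp_mul_inner_airyVec_sq_le u (hc0 n))
    _ = _ := hR.liminf_eq

theorem integrable_inner_airyVec_sq (u : HalfLineL2) :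
    Integrable fun x => (inner ℝ (airyVec x) u) ^ 2 := by
  refine ⟨((continuous_airyVec.inner continuous_const).pow 2).aestronglyMeasurable, ?_⟩
  rw [hasFiniteIntegral_iff_ofReal (Eventually.of_forall fun y => by positivity)]
  exact (lintegral_inner_airyVec_sq_le u).trans_lt ENNReal.ofReal_lt_top

/-- Bessel's inequality for the shifted Airy functions. -/
theorem integral_inner_airyVec_sq_le (u : HalfLineL2) :
    ∫ x, (inner ℝ (airyVec x) u) ^ 2 ≤ ‖u‖ ^ 2 := by
  have h4 := lintegral_inner_airyVec_sq_le u
  rw [← ofReal_integral_eq_lintegral_ofReal (integrable_inner_airyVec_sq u)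
    (Eventually.of_forall fun y => by positivity)] at h4
  exact (ENNReal.ofReal_le_ofReal_iff (by positivity)).mp h4
end

noncomputable section

/- Functions of subexponential growth at `-∞` and superexponential decay at `+∞`. -/

/-- `f` is bounded by a multiple of `exp (-c x)` for every `c > 0`. -/
def ExpDecay {E : Type*} [Norm E] (f : ℝ → E) : Prop :=
  ∀ c : ℝ, 0 < c → ∃ C : ℝ, 0 ≤ C ∧ ∀ x, ‖f x‖ ≤ C * Real.exp (-c * x)

theorem expDecay_airyR (k : ℕ) : ExpDecay (airyR k) := fun _ hc =>
  let ⟨C, hC, h⟩ := exists_abs_airyR_le k hc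
  ⟨C, hC.le, h⟩

theorem expDecay_airyVec : ExpDecay airyVec := by
  intro c hc
  obtain ⟨C, hC, h⟩ := exists_norm_airyVec_sq_le hc
  refine ⟨Real.sqrt C, Real.sqrt_nonneg _, fun x => ?_⟩
  rw [← Real.sqrt_sq (norm_nonneg (airyVec x))]
  refine (Real.sqrt_le_sqrt (h x)).trans_eq ?_
  rw [Real.sqrt_mul hC.le]
  congr 1
  rw [Real.sqrt_eq_iff_mul_self_eq (Real.exp_pos _).le (Real.exp_pos _).le, ← Real.exp_add]
  congr 1
  ring

theorem ExpDecay.of_norm_le_mul {E F G : Type*} [NormedAddCommGroup E] [NormedAddCommGroup F]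
    [NormedAddCommGroup G] {f : ℝ → E} {g : ℝ → F} {h : ℝ → G} (hf : ExpDecay f) (hg : ExpDecay g)
    (hb : ∀ x, ‖h x‖ ≤ ‖f x‖ * ‖g x‖) : ExpDecay h := by
  intro c hc
  obtain ⟨C, hC, h1⟩ := hf (c / 2) (half_pos hc)
  obtain ⟨D, hD, h2⟩ := hg (c / 2) (half_pos hc)
  refine ⟨C * D, mul_nonneg hC hD, fun x => (hb x).trans ?_⟩
  refine (mul_le_mul (h1 x) (h2 x) (norm_nonneg _) (by positivity)).trans_eq ?_
  rw [mul_mul_mul_comm, ← Real.exp_add]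
  congr 2
  ring

theorem ExpDecay.of_norm_le_const_mul {E F : Type*} [Norm E] [Norm F]
    {f : ℝ → E} {h : ℝ → F} (hf : ExpDecay f) {A : ℝ} (hA : 0 ≤ A)
    (hb : ∀ x, ‖h x‖ ≤ A * ‖f x‖) : ExpDecay h := by
  intro c hc
  obtain ⟨C, hC, h1⟩ := hf c hc
  refine ⟨A * C, mul_nonneg hA hC, fun x => (hb x).trans ?_⟩
  rw [mul_assoc]
  exact mul_le_mul_of_nonneg_left (h1 x) hA

theorem ExpDecay.add {E : Type*} [SeminormedAddCommGroup E] {f g : ℝ → E} (hf : ExpDecay f)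
    (hg : ExpDecay g) : ExpDecay fun x => f x + g x := by
  intro c hc
  obtain ⟨C, hC, h1⟩ := hf c hc
  obtain ⟨D, hD, h2⟩ := hg c hc
  refine ⟨C + D, add_nonneg hC hD, fun x => (norm_add_le _ _).trans ?_⟩
  rw [add_mul]
  exact add_le_add (h1 x) (h2 x)

theorem ExpDecay.mul {f g : ℝ → ℝ} (hf : ExpDecay f) (hg : ExpDecay g) :
    ExpDecay fun x => f x * g x :=
  hf.of_norm_le_mul hg fun _ => (norm_mul _ _).le

theorem ExpDecay.inner_const {H : Type*} [NormedAddCommGroup H] [InnerProductSpace ℝ H]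
    {f : ℝ → H} (hf : ExpDecay f) (u : H) : ExpDecay fun x => inner ℝ (f x) u :=
  hf.of_norm_le_const_mul (norm_nonneg u) fun _ =>
    (norm_inner_le_norm _ _).trans_eq (mul_comm _ _)

/-- The linear factor costs an arbitrarily small exponential of |x|. On the left this is paid by
taking the rate c/2, on the right by the faster decay at rate 2c. -/
theorem ExpDecay.sub_const_mul {f : ℝ → ℝ} (hf : ExpDecay f) (y : ℝ) :
    ExpDecay fun x => (x - y) * f x := by
  intro c hc
  obtain ⟨C, hC, h1⟩ := hf (c / 2) (half_pos hc)
  obtain ⟨D, hD, h2⟩ := hf (2 * c) (by positivity)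
  have key : ∀ r : ℝ, 0 ≤ r → ∀ d : ℝ, 0 < d → r ≤ 1 / d * Real.exp (d * r) := by
    intro r _ d hd
    have := Real.add_one_le_exp (d * r)
    rw [div_mul_eq_mul_div, le_div_iff₀ hd]
    nlinarith
  refine ⟨max (C * (1 / (c / 2) * Real.exp (c / 2 * |y|)))
    (D * (1 / c * Real.exp (c * |y|))), le_max_of_le_left (by positivity), fun x => ?_⟩
  have hxy : |x - y| ≤ |x| + |y| := abs_sub x y
  rw [norm_mul, Real.norm_eq_abs]
  rcases le_total x 0 with hx | hx
  · calc |x - y| * ‖f x‖ ≤ (1 / (c / 2) * Real.exp (c / 2 * (|x| + |y|))) *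
          (C * Real.exp (-(c / 2) * x)) :=
          mul_le_mul (hxy.trans (key _ (by positivity) _ (half_pos hc))) (h1 x) (norm_nonneg _)
            (by positivity)
      _ = (C * (1 / (c / 2) * Real.exp (c / 2 * |y|))) * Real.exp (-c * x) := by
          rw [abs_of_nonpos hx, show -c * x = c / 2 * -x + -(c / 2) * x by ring, Real.exp_add,
            mul_add, Real.exp_add]
          ring
      _ ≤ _ := mul_le_mul_of_nonneg_right (le_max_left _ _) (Real.exp_pos _).le
  · calc |x - y| * ‖f x‖ ≤ (1 / c * Real.exp (c * (|x| + |y|))) *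
          (D * Real.exp (-(2 * c) * x)) :=
          mul_le_mul (hxy.trans (key _ (by positivity) _ hc)) (h2 x) (norm_nonneg _)
            (by positivity)
      _ = (D * (1 / c * Real.exp (c * |y|))) * Real.exp (-c * x) := by
          rw [abs_of_nonneg hx, show -c * x = c * x + -(2 * c) * x by ring, Real.exp_add,
            mul_add, Real.exp_add]
          ring
      _ ≤ _ := mul_le_mul_of_nonneg_right (le_max_right _ _) (Real.exp_pos _).le

theorem integrable_exp_neg_mul_abs {κ : ℝ} (hκ : 0 < κ) :
    Integrable fun x : ℝ => Real.exp (-κ * |x|) := by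
  rw [← integrableOn_univ, ← Set.Iic_union_Ioi (a := (0 : ℝ)), integrableOn_union]
  constructor
  · refine (integrableOn_exp_mul_Iic hκ 0).congr_fun (fun x hx => ?_) measurableSet_Iic
    simp only
    rw [abs_of_nonpos hx]
    ring_nf
  · refine (integrableOn_exp_mul_Ioi (neg_neg_of_pos hκ) 0).congr_fun (fun x hx => ?_)
      measurableSet_Ioi
    simp only
    rw [abs_of_pos hx]

/-- The product of `f` with a weight bounded by `exp (κ x)` decays exponentially. -/
theorem ExpDecay.exists_mul_le {E : Type*} [NormedAddCommGroup E] {f : ℝ → E} (hf : ExpDecay f)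
    {κ A : ℝ} (hκ : 0 < κ) (hA : 0 ≤ A) :
    ∃ C : ℝ, 0 ≤ C ∧ ∀ x W, |W| ≤ A * Real.exp (κ * x) →
      |W| * ‖f x‖ ≤ C * Real.exp (-(κ / 2) * |x|) := by
  obtain ⟨C, hC, h1⟩ := hf (κ / 2) (half_pos hκ)
  obtain ⟨D, hD, h2⟩ := hf (2 * κ) (by positivity)
  refine ⟨max (A * C) (A * D), le_max_of_le_left (mul_nonneg hA hC), fun x W hW => ?_⟩
  rcases le_total x 0 with hx | hx
  · calc |W| * ‖f x‖ ≤ (A * Real.exp (κ * x)) * (C * Real.exp (-(κ / 2) * x)) :=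
          mul_le_mul hW (h1 x) (norm_nonneg _) (by positivity)
      _ = (A * C) * Real.exp (-(κ / 2) * |x|) := by
          rw [mul_mul_mul_comm, ← Real.exp_add, abs_of_nonpos hx]
          congr 2
          ring
      _ ≤ _ := mul_le_mul_of_nonneg_right (le_max_left _ _) (Real.exp_pos _).le
  · calc |W| * ‖f x‖ ≤ (A * Real.exp (κ * x)) * (D * Real.exp (-(2 * κ) * x)) :=
          mul_le_mul hW (h2 x) (norm_nonneg _) (by positivity)
      _ = (A * D) * Real.exp (-κ * x) := by
          rw [mul_mul_mul_comm, ← Real.exp_add]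
          congr 2
          ring
      _ ≤ (A * D) * Real.exp (-(κ / 2) * |x|) := by
          refine mul_le_mul_of_nonneg_left (Real.exp_le_exp.mpr ?_) (mul_nonneg hA hD)
          rw [abs_of_nonneg hx]
          nlinarith
      _ ≤ _ := mul_le_mul_of_nonneg_right (le_max_right _ _) (Real.exp_pos _).le

theorem ExpDecay.integrable_smul {E : Type*} [NormedAddCommGroup E] [NormedSpace ℝ E] {f : ℝ → E}
    (hf : ExpDecay f) (hfc : Continuous f) {κ A : ℝ} (hκ : 0 < κ) (hA : 0 ≤ A) {w : ℝ → ℝ}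
    (hw : Continuous w) (hwb : ∀ x, |w x| ≤ A * Real.exp (κ * x)) :
    Integrable fun x => w x • f x := by
  obtain ⟨C, -, h⟩ := hf.exists_mul_le hκ hA
  refine ((integrable_exp_neg_mul_abs (half_pos hκ)).const_mul C).mono'
    (hw.smul hfc).aestronglyMeasurable (Eventually.of_forall fun x => ?_)
  rw [norm_smul, Real.norm_eq_abs]
  exact h x (w x) (hwb x)

theorem expDecay_norm_airyVec_sq : ExpDecay fun x => ‖airyVec x‖ ^ 2 :=
  expDecay_airyVec.of_norm_le_mul expDecay_airyVec fun x => by simp [sq]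

theorem continuous_norm_airyVec_sq : Continuous fun x => ‖airyVec x‖ ^ 2 :=
  continuous_airyVec.norm.pow 2

/- A contraction estimate. -/

theorem inner_traceOp_comm {H : Type*} [NormedAddCommGroup H] [InnerProductSpace ℝ H]
    [CompleteSpace H] {w : ℝ → ℝ} {a : ℝ → H} (hw : Continuous w) (ha : Continuous a)
    (hN : Integrable fun x => |w x| * ‖a x‖ ^ 2) (u v : H) :
    inner ℝ u (traceOp w a v) = inner ℝ (traceOp w a u) v := by
  rw [real_inner_comm v, inner_traceOp hw ha hN, inner_traceOp hw ha hN]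
  congr 1
  ext x
  rw [real_inner_comm u, real_inner_comm v]
  ring

/-- Monotonicity bounds w by w(L) left of L, where Bessel controls the form. Right of L only w ≤ 1
is used, and the excess 1 − w(L) is weighted by the tail ε < 1 of the trace. -/
theorem norm_traceOp_lt_one {H : Type*} [NormedAddCommGroup H] [InnerProductSpace ℝ H]
    [CompleteSpace H] {w : ℝ → ℝ} {a : ℝ → H} (hw : Continuous w) (ha : Continuous a)
    (hN : Integrable fun x => |w x| * ‖a x‖ ^ 2) (h0 : ∀ x, 0 ≤ w x) (h1 : ∀ x, w x < 1)
    (hmono : Monotone w) (hi : ∀ u, Integrable fun x => (inner ℝ (a x) u) ^ 2)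
    (hb : ∀ u, ∫ x, (inner ℝ (a x) u) ^ 2 ≤ ‖u‖ ^ 2) {L : ℝ}
    (hLi : IntegrableOn (fun x => ‖a x‖ ^ 2) (Set.Ioi L))
    (hL : ∫ x in Set.Ioi L, ‖a x‖ ^ 2 < 1) : ‖traceOp w a‖ < 1 := by
  set ε := ∫ x in Set.Ioi L, ‖a x‖ ^ 2
  -- A convex combination of 1 and ε < 1; the weight w(L) on 1 is strictly below 1, hence θ < 1.
  set θ := w L + (1 - w L) * ε with hθ
  have hε : 0 ≤ ε := integral_nonneg fun x => by positivity
  have hθ1 : θ < 1 := by nlinarith [h1 L]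
  have hθ0 : 0 ≤ θ := add_nonneg (h0 L) (mul_nonneg (by linarith [h1 L]) hε)
  have hquad : ∀ u, inner ℝ u (traceOp w a u) ≤ θ * ‖u‖ ^ 2 := by
    intro u
    have hi1 : Integrable fun x => w L * (inner ℝ (a x) u) ^ 2 := (hi u).const_mul _
    have hi2 : Integrable fun x => (1 - w L) * Set.indicator (Set.Ioi L)
        (fun x => ‖a x‖ ^ 2 * ‖u‖ ^ 2) x :=
      (IntegrableOn.integrable_indicator (hLi.mul_const _) measurableSet_Ioi).const_mul _
    have hi3 : Integrable fun x => w x * inner ℝ u (a x) * inner ℝ (a x) u := by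
      refine (hi u).mono' (by fun_prop) (Eventually.of_forall fun x => ?_)
      rw [real_inner_comm u, mul_assoc, norm_mul, Real.norm_of_nonneg (h0 x), ← sq,
        Real.norm_of_nonneg (sq_nonneg _)]
      exact mul_le_of_le_one_left (sq_nonneg _) (h1 x).le
    rw [inner_traceOp hw ha hN]
    calc _ ≤ ∫ x, (w L * (inner ℝ (a x) u) ^ 2 + (1 - w L) * Set.indicator (Set.Ioi L)
          (fun x => ‖a x‖ ^ 2 * ‖u‖ ^ 2) x) := by
          refine integral_mono hi3 (hi1.add hi2) fun x => ?_
          simp only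
          rw [real_inner_comm (a x) u, mul_assoc, ← sq]
          by_cases hx : x ∈ Set.Ioi L
          · rw [Set.indicator_of_mem hx, ← mul_pow]
            have h3 : (inner ℝ (a x) u) ^ 2 ≤ (‖a x‖ * ‖u‖) ^ 2 := by
              rw [← sq_abs]
              exact pow_le_pow_left₀ (abs_nonneg _) (abs_real_inner_le_norm _ _) 2
            have h4 := mul_le_mul_of_nonneg_left h3 (by linarith [h1 L] : 0 ≤ 1 - w L)
            nlinarith [mul_le_mul_of_nonneg_right (h1 x).le (sq_nonneg (inner ℝ (a x) u))]
          · rw [Set.indicator_of_notMem hx, mul_zero, add_zero]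
            exact mul_le_mul_of_nonneg_right (hmono (not_lt.mp hx)) (sq_nonneg _)
      _ = w L * (∫ x, (inner ℝ (a x) u) ^ 2) + (1 - w L) * (ε * ‖u‖ ^ 2) := by
          rw [integral_add hi1 hi2, integral_const_mul, integral_const_mul,
            integral_indicator measurableSet_Ioi, integral_mul_const]
      _ ≤ w L * ‖u‖ ^ 2 + (1 - w L) * (ε * ‖u‖ ^ 2) := by
          gcongr
          · exact h0 L
          · exact hb u
      _ = _ := by rw [hθ]; ring
  have hpos : ∀ u, 0 ≤ inner ℝ u (traceOp w a u) := by
    intro u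
    rw [inner_traceOp hw ha hN]
    refine integral_nonneg fun x => ?_
    rw [real_inner_comm u, mul_assoc]
    exact mul_nonneg (h0 x) (mul_self_nonneg _)
  -- Positivity of the form at u − v, with symmetry, bounds the off-diagonal values by the quadratic
  -- form.
  have hbil : ∀ u v, 2 * inner ℝ u (traceOp w a v) ≤ θ * ‖u‖ ^ 2 + θ * ‖v‖ ^ 2 := by
    intro u v
    have h2 := hpos (u - v)
    have h3 := hquad u
    have h4 := hquad v
    rw [map_sub, inner_sub_left, inner_sub_right, inner_sub_right] at h2
    have h5 : inner ℝ v (traceOp w a u) = inner ℝ u (traceOp w a v) := by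
      rw [inner_traceOp_comm hw ha hN, real_inner_comm]
    linarith
  refine lt_of_le_of_lt (ContinuousLinearMap.opNorm_le_bound _ hθ0 fun v => ?_) hθ1
  rcases (norm_nonneg (traceOp w a v)).eq_or_lt with hz | hz
  · rw [← hz]
    positivity
  rcases (norm_nonneg v).eq_or_lt with hv | hv
  · rw [norm_eq_zero.mp hv.symm]
    simp
  -- The multiple of Bv with norm ‖v‖ balances the two sides, so the form bound becomes ‖Bv‖ ≤ θ‖v‖.
  have h6 := hbil ((‖v‖ / ‖traceOp w a v‖) • traceOp w a v) v
  rw [inner_smul_left, norm_smul, real_inner_self_eq_norm_sq, Real.norm_of_nonneg (by positivity)]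
    at h6
  simp only [conj_trivial] at h6
  have h7 : ‖v‖ / ‖traceOp w a v‖ * ‖traceOp w a v‖ ^ 2 = ‖v‖ * ‖traceOp w a v‖ := by
    field_simp
  have h8 : ‖v‖ / ‖traceOp w a v‖ * ‖traceOp w a v‖ = ‖v‖ := by field_simp
  rw [h7, h8] at h6
  have h9 : ‖v‖ * ‖traceOp w a v‖ ≤ ‖v‖ * (θ * ‖v‖) := by nlinarith
  exact le_of_mul_le_mul_left h9 hv

/-- With ‖a(x)‖² ≤ C e^{−2x}, the choice L = C works: the tail is at most C e^{−2C}/2 < 1. -/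
theorem exists_integral_norm_airyVec_sq_lt_one :
    ∃ L : ℝ, IntegrableOn (fun x => ‖airyVec x‖ ^ 2) (Set.Ioi L) ∧
      ∫ x in Set.Ioi L, ‖airyVec x‖ ^ 2 < 1 := by
  obtain ⟨C, hC, h⟩ := exists_norm_airyVec_sq_le one_pos
  have hi : ∀ L : ℝ, IntegrableOn (fun x : ℝ => C * Real.exp (-2 * 1 * x)) (Set.Ioi L) := fun L =>
    (integrableOn_exp_mul_Ioi (by norm_num) L).const_mul C
  have hI : ∀ L : ℝ, IntegrableOn (fun x => ‖airyVec x‖ ^ 2) (Set.Ioi L) := fun L =>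
    (hi L).mono' continuous_norm_airyVec_sq.aestronglyMeasurable (Eventually.of_forall fun x => by
      rw [Real.norm_of_nonneg (by positivity)]
      exact h x)
  refine ⟨C, hI C, ?_⟩
  refine (integral_mono (hI C) (hi C) h).trans_lt ?_
  rw [integral_const_mul, integral_exp_mul_Ioi (by norm_num)]
  have h2 : C < Real.exp (2 * C) := by
    have := Real.add_one_le_exp (2 * C)
    linarith
  rw [show -2 * 1 * C = -(2 * C) by ring, Real.exp_neg]
  have h3 : C * (Real.exp (2 * C))⁻¹ < 1 := by
    rw [← div_eq_mul_inv, div_lt_one (Real.exp_pos _)]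
    exact h2
  have h4 : 0 ≤ C * (Real.exp (2 * C))⁻¹ := by positivity
  rw [show C * (-(Real.exp (2 * C))⁻¹ / (-2 * 1)) = C * (Real.exp (2 * C))⁻¹ / 2 by ring]
  linarith

/- The weight, the operator and the Fredholm determinant. -/

/-- The weight `σ (T ^ (1/3) (x + s))`. -/
def airyWeight (s T x : ℝ) : ℝ := Real.sigmoid (T ^ (1 / 3 : ℝ) * (x + s))

theorem continuous_airyWeight (s T : ℝ) : Continuous (airyWeight s T) :=
  continuous_sigmoid.comp (by fun_prop)

theorem airyWeight_nonneg (s T x : ℝ) : 0 ≤ airyWeight s T x := Real.sigmoid_nonneg _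

/-- The rate κ may be smaller than τ, so one exponential serves a whole neighbourhood of parameters.
-/
theorem sigmoid_le_exp_mul {r κ τ : ℝ} (hκ : 0 ≤ κ) (h : κ ≤ τ) :
    Real.sigmoid (τ * r) ≤ Real.exp (κ * r) := by
  have h1 : Real.sigmoid (τ * r) ≤ Real.exp (τ * r) := by
    rw [Real.sigmoid_def, Real.exp_neg, inv_le_comm₀ (by positivity) (Real.exp_pos _)]
    linarith
  rcases le_total r 0 with hr | hr
  · exact h1.trans (Real.exp_le_exp.mpr (by nlinarith))
  · exact (Real.sigmoid_le_one _).trans (Real.one_le_exp (mul_nonneg hκ hr))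

theorem abs_airyWeight_le (s T x : ℝ) (hT : 0 < T) :
    |airyWeight s T x| ≤
      Real.exp (T ^ (1 / 3 : ℝ) * s) * Real.exp (T ^ (1 / 3 : ℝ) * x) := by
  rw [abs_of_nonneg (airyWeight_nonneg s T x), ← Real.exp_add]
  refine (sigmoid_le_exp_mul (Real.rpow_pos_of_pos hT _).le le_rfl).trans_eq ?_
  congr 1
  ring

theorem integrable_airyWeight_smul {E : Type*} [NormedAddCommGroup E] [NormedSpace ℝ E]
    {f : ℝ → E} (hf : ExpDecay f) (hfc : Continuous f) (s : ℝ) {T : ℝ} (hT : 0 < T) :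
    Integrable fun x => airyWeight s T x • f x :=
  hf.integrable_smul hfc (Real.rpow_pos_of_pos hT _) (Real.exp_pos _).le
    (continuous_airyWeight s T) fun x => abs_airyWeight_le s T x hT

theorem integrable_airyWeight_trace (s : ℝ) {T : ℝ} (hT : 0 < T) :
    Integrable fun x => |airyWeight s T x| * ‖airyVec x‖ ^ 2 := by
  simp_rw [abs_of_nonneg (airyWeight_nonneg s T _)]
  exact integrable_airyWeight_smul expDecay_norm_airyVec_sq continuous_norm_airyVec_sq s hT

/-- The weight multiplies rows, so it factors out of the determinant and leaves a Gram determinant.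
-/
theorem kernelDet_deformedAiryKernel (s T : ℝ) (n : ℕ) (x : Fin n → ℝ) :
    kernelDet (deformedAiryKernel s T) n x = fredIntegrand (airyWeight s T) airyVec n x := by
  unfold kernelDet fredIntegrand gramDet
  rw [← Matrix.det_mul_column]
  congr 2
  ext i j
  simp [deformedAiryKernel, airyWeight, inner_airyVec]

theorem fredholmConverges_deformedAiryKernel (s : ℝ) {T : ℝ} (hT : 0 < T) :
    FredholmConverges (deformedAiryKernel s T) := by
  have hN := integrable_airyWeight_trace s hT
  have hw := continuous_airyWeight s T
  refine ⟨fun n => ?_, ?_⟩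
  · exact (integrable_fredIntegrand hw continuous_airyVec hN n).congr
      (Eventually.of_forall fun x => (kernelDet_deformedAiryKernel s T n x).symm)
  · refine Summable.of_nonneg_of_le
      (fun n => mul_nonneg (by positivity) (integral_nonneg fun x => abs_nonneg _)) (fun n => ?_)
      (Real.summable_pow_div_factorial (fredTrace (airyWeight s T) airyVec))
    simp_rw [kernelDet_deformedAiryKernel]
    rw [one_div, mul_comm, div_eq_mul_inv]
    exact mul_le_mul_of_nonneg_right
      (integral_abs_fredIntegrand_le hw continuous_airyVec hN n) (by positivity)

theorem airyQ_eq_fredSeries (s T : ℝ) : airyQ s T = fredSeries (airyWeight s T) airyVec := by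
  unfold airyQ fredholmDet fredSeries fredTerm fredCoeff
  simp_rw [kernelDet_deformedAiryKernel]

/-- The operator whose Fredholm determinant is `Q`. -/
abbrev airyOp (s T : ℝ) : HalfLineL2 →L[ℝ] HalfLineL2 := traceOp (airyWeight s T) airyVec

theorem norm_airyOp_lt_one (s : ℝ) {T : ℝ} (hT : 0 < T) : ‖airyOp s T‖ < 1 := by
  obtain ⟨L, hLi, hL⟩ := exists_integral_norm_airyVec_sq_lt_one
  exact norm_traceOp_lt_one (continuous_airyWeight s T) continuous_airyVec
    (integrable_airyWeight_trace s hT) (airyWeight_nonneg s T) (fun x => Real.sigmoid_lt_one _)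
    (fun x y hxy => Real.sigmoid_le (mul_le_mul_of_nonneg_left (by linarith)
      (Real.rpow_nonneg hT.le _)))
    integrable_inner_airyVec_sq integral_inner_airyVec_sq_le hLi hL

theorem airyQ_pos (s : ℝ) {T : ℝ} (hT : 0 < T) : 0 < airyQ s T := by
  rw [airyQ_eq_fredSeries]
  refine fredSeries_pos continuous_airyVec (continuous_airyWeight s T) (airyWeight_nonneg s T) ?_
    (norm_airyOp_lt_one s hT)
  have := integrable_airyWeight_trace s hT
  simp_rw [abs_of_nonneg (airyWeight_nonneg s T _)] at this
  exact this

/-- The inverse of `1 - B`. -/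
def airyRes (s T : ℝ) : HalfLineL2 →L[ℝ] HalfLineL2 := Ring.inverse (1 - airyOp s T)

theorem isUnit_one_sub_airyOp (s : ℝ) {T : ℝ} (hT : 0 < T) : IsUnit (1 - airyOp s T) :=
  isUnit_one_sub_of_norm_lt_one (norm_airyOp_lt_one s hT)

theorem airyRes_mul (s : ℝ) {T : ℝ} (hT : 0 < T) : airyRes s T * (1 - airyOp s T) = 1 :=
  Ring.inverse_mul_cancel _ (isUnit_one_sub_airyOp s hT)

theorem mul_airyRes (s : ℝ) {T : ℝ} (hT : 0 < T) : (1 - airyOp s T) * airyRes s T = 1 :=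
  Ring.mul_inverse_cancel _ (isUnit_one_sub_airyOp s hT)

/-- The logarithmic derivative of `Q` along a curve of parameters. -/
theorem hasDerivAt_log_airyQ {σ θ : ℝ → ℝ} {w' : ℝ → ℝ → ℝ} {W : ℝ → ℝ} {p₀ r : ℝ} (hr : 0 < r)
    (hθ : 0 < θ p₀) (hw' : ∀ p, Continuous (w' p))
    (hd : ∀ p ∈ Metric.ball p₀ r, ∀ x, HasDerivAt (fun p => airyWeight (σ p) (θ p) x) (w' p x) p)
    (hb : ∀ p ∈ Metric.ball p₀ r, ∀ x, |airyWeight (σ p) (θ p) x| ≤ W x)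
    (hb' : ∀ p ∈ Metric.ball p₀ r, ∀ x, |w' p x| ≤ W x)
    (hW : Integrable fun x => W x * ‖airyVec x‖ ^ 2) :
    HasDerivAt (fun p => Real.log (airyQ (σ p) (θ p)))
      (-∫ x, w' p₀ x * inner ℝ (airyVec x) (airyRes (σ p₀) (θ p₀) (airyVec x))) p₀ := by
  have h := hasDerivAt_fredSeries continuous_airyVec hr
    (fun p => continuous_airyWeight (σ p) (θ p)) hw' hd hb hb' hW (airyRes_mul (σ p₀) hθ)
  simp_rw [← airyQ_eq_fredSeries] at h
  have hpos := airyQ_pos (σ p₀) hθ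
  refine (h.log hpos.ne').congr_deriv ?_
  field_simp
end

noncomputable section

/- The logarithmic derivatives of `Q` in terms of the resolvent kernel. -/

/-- The kernel of `(1 - K w)⁻¹ K`. -/
def airyL (s T x y : ℝ) : ℝ := inner ℝ (airyVec x) (airyRes s T (airyVec y))

theorem continuous_deriv_sigmoid : Continuous (deriv Real.sigmoid) := by
  rw [Real.deriv_sigmoid]
  exact continuous_sigmoid.mul (continuous_const.sub continuous_sigmoid)

theorem hasDerivAt_sigmoid' (x : ℝ) : HasDerivAt Real.sigmoid (deriv Real.sigmoid x) x :=
  (Real.hasDerivAt_sigmoid x).differentiableAt.hasDerivAt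

theorem deriv_sigmoid_nonneg (x : ℝ) : 0 ≤ deriv Real.sigmoid x := by
  rw [Real.deriv_sigmoid]
  exact mul_nonneg (Real.sigmoid_nonneg x) (by linarith [Real.sigmoid_le_one x])

theorem deriv_sigmoid_le (x : ℝ) : deriv Real.sigmoid x ≤ Real.sigmoid x := by
  rw [Real.deriv_sigmoid]
  exact mul_le_of_le_one_right (Real.sigmoid_nonneg x) (by linarith [Real.sigmoid_nonneg x])

theorem deriv_sigmoid_le_neg (x : ℝ) : deriv Real.sigmoid x ≤ Real.sigmoid (-x) := by
  rw [Real.deriv_sigmoid, Real.sigmoid_neg]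
  exact mul_le_of_le_one_left (by linarith [Real.sigmoid_le_one x]) (Real.sigmoid_le_one x)

theorem le_inv_mul_exp {r d : ℝ} (hd : 0 < d) : r ≤ 1 / d * Real.exp (d * r) := by
  have := Real.add_one_le_exp (d * r)
  rw [div_mul_eq_mul_div, le_div_iff₀ hd]
  nlinarith

/-- σ' is even and decays exponentially on both sides. For r ≤ 0 half of the rate absorbs |r|; for r
≥ 0 the product is bounded, and the exponential on the right is at least 1. -/
theorem abs_mul_deriv_sigmoid_le {r τ₁ τ : ℝ} (h1 : 0 < τ₁) (h : τ₁ ≤ τ) :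
    |r * deriv Real.sigmoid (τ * r)| ≤ 2 / τ₁ * Real.exp (τ₁ / 2 * r) := by
  rw [abs_mul, abs_of_nonneg (deriv_sigmoid_nonneg _)]
  rcases le_total r 0 with hr | hr
  · rw [abs_of_nonpos hr]
    have e1 : deriv Real.sigmoid (τ * r) ≤ Real.exp (τ₁ * r) :=
      (deriv_sigmoid_le _).trans (sigmoid_le_exp_mul h1.le h)
    have e2 := le_inv_mul_exp (r := -r) (half_pos h1)
    calc -r * deriv Real.sigmoid (τ * r) ≤ (1 / (τ₁ / 2) * Real.exp (τ₁ / 2 * -r)) *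
          Real.exp (τ₁ * r) :=
          mul_le_mul e2 e1 (deriv_sigmoid_nonneg _) (by positivity)
      _ = _ := by
        rw [mul_assoc, ← Real.exp_add]
        congr 1
        · field_simp
        · congr 1
          ring
  · rw [abs_of_nonneg hr]
    have e1 : deriv Real.sigmoid (τ * r) ≤ Real.exp (τ₁ * -r) := by
      refine (deriv_sigmoid_le_neg _).trans ?_
      rw [← mul_neg]
      rcases hr.eq_or_lt with h0 | h0
      · rw [← h0]
        simpa using Real.sigmoid_le_one 0
      · have h2 : Real.sigmoid (τ * -r) ≤ Real.exp (τ * -r) := sigmoid_le_exp_mul (by linarith) le_rfl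
        exact h2.trans (Real.exp_le_exp.mpr (by nlinarith))
    have e2 := le_inv_mul_exp (r := r) h1
    calc r * deriv Real.sigmoid (τ * r) ≤ (1 / τ₁ * Real.exp (τ₁ * r)) * Real.exp (τ₁ * -r) :=
          mul_le_mul e2 e1 (deriv_sigmoid_nonneg _) (by positivity)
      _ = 1 / τ₁ := by
        rw [mul_assoc, ← Real.exp_add]
        simp
      _ ≤ 2 / τ₁ * 1 := by
        rw [mul_one]
        gcongr
        norm_num
      _ ≤ _ := by
        gcongr
        exact Real.one_le_exp (by positivity)

theorem integrable_exp_mul_trace {κ A s : ℝ} (hκ : 0 < κ) (hA : 0 ≤ A) :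
    Integrable fun x => (A * Real.exp (κ * (x + s))) * ‖airyVec x‖ ^ 2 :=
  expDecay_norm_airyVec_sq.integrable_smul continuous_norm_airyVec_sq
    (w := fun x => A * Real.exp (κ * (x + s))) (A := A * Real.exp (κ * s)) hκ (by positivity)
    (by fun_prop) fun x => by
      rw [abs_of_nonneg (by positivity), mul_assoc, ← Real.exp_add]
      apply le_of_eq
      congr 2
      ring

theorem hasDerivAt_log_airyQ_s (s : ℝ) {T : ℝ} (hT : 0 < T) :
    Integrable (fun x => deriv Real.sigmoid (T ^ (1 / 3 : ℝ) * (x + s)) * airyL s T x x) ∧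
    HasDerivAt (fun r => Real.log (airyQ r T))
      (-(T ^ (1 / 3 : ℝ) *
        ∫ x, deriv Real.sigmoid (T ^ (1 / 3 : ℝ) * (x + s)) * airyL s T x x)) s := by
  set τ : ℝ := T ^ (1 / 3 : ℝ) with hτ
  have hτ0 : 0 < τ := Real.rpow_pos_of_pos hT _
  -- The shift s + 1 covers parameters within 1 of s; the factor 1 + τ covers both the weight and
  -- its derivative.
  set W : ℝ → ℝ := fun x => (1 + τ) * Real.exp (τ * (x + (s + 1))) with hWdef
  have hW : Integrable fun x => W x * ‖airyVec x‖ ^ 2 :=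
    integrable_exp_mul_trace hτ0 (by positivity)
  have hb0 : ∀ p ∈ Metric.ball s 1, ∀ x, Real.sigmoid (τ * (x + p)) ≤
      Real.exp (τ * (x + (s + 1))) := by
    intro p hp x
    refine (sigmoid_le_exp_mul hτ0.le le_rfl).trans (Real.exp_le_exp.mpr ?_)
    have : |p - s| < 1 := by simpa [Real.dist_eq] using hp
    rw [abs_lt] at this
    exact mul_le_mul_of_nonneg_left (by linarith) hτ0.le
  have hcs : ∀ p, Continuous fun x => deriv Real.sigmoid (τ * (x + p)) := fun p =>
    continuous_deriv_sigmoid.comp (by fun_prop)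
  have hbd : ∀ p ∈ Metric.ball s 1, ∀ x, |deriv Real.sigmoid (τ * (x + p))| ≤
      Real.exp (τ * (x + (s + 1))) := by
    intro p hp x
    rw [abs_of_nonneg (deriv_sigmoid_nonneg _)]
    exact (deriv_sigmoid_le _).trans (hb0 p hp x)
  have hs : s ∈ Metric.ball s 1 := Metric.mem_ball_self one_pos
  constructor
  · refine integrable_weight_inner continuous_airyVec (hcs s) (W := W) (fun x => ?_) hW (airyRes s T)
    refine (hbd s hs x).trans ?_
    rw [hWdef]
    exact le_mul_of_one_le_left (Real.exp_pos _).le (by linarith)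
  · have h := hasDerivAt_log_airyQ (σ := fun p => p) (θ := fun _ => T) (p₀ := s) (r := 1) (W := W)
      (w' := fun p x => τ * deriv Real.sigmoid (τ * (x + p))) one_pos hT
      (fun p => (hcs p).const_mul τ)
      (fun p _ x => by
        have h0 : HasDerivAt (fun p : ℝ => τ * (x + p)) τ p := by
          simpa using ((hasDerivAt_id p).const_add x).const_mul τ
        refine ((hasDerivAt_sigmoid' (τ * (x + p))).comp p h0).congr_deriv ?_
        ring)
      (fun p hp x => by
        rw [abs_of_nonneg (airyWeight_nonneg _ _ _)]
        refine (hb0 p hp x).trans ?_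
        rw [hWdef]
        exact le_mul_of_one_le_left (Real.exp_pos _).le (by linarith))
      (fun p hp x => by
        rw [abs_mul, abs_of_pos hτ0]
        refine (mul_le_mul_of_nonneg_left (hbd p hp x) hτ0.le).trans ?_
        rw [hWdef]
        exact mul_le_mul_of_nonneg_right (by linarith) (Real.exp_pos _).le) hW
    refine h.congr_deriv ?_
    rw [← integral_const_mul]
    simp only [airyL, mul_assoc]

theorem hasDerivAt_log_airyQ_T (s : ℝ) {T : ℝ} (hT : 0 < T) :
    Integrable (fun x =>
      ((x + s) * deriv Real.sigmoid (T ^ (1 / 3 : ℝ) * (x + s))) * airyL s T x x) ∧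
    HasDerivAt (fun t => Real.log (airyQ s t))
      (-(1 / (3 * T ^ (2 / 3 : ℝ)) *
        ∫ x, ((x + s) * deriv Real.sigmoid (T ^ (1 / 3 : ℝ) * (x + s))) * airyL s T x x)) T := by
  have hT2 : 0 < T / 2 := half_pos hT
  -- A lower bound for p^{1/3} over the ball of radius T/2 around T, so that the majorant is
  -- independent of p.
  set τ₁ : ℝ := (T / 2) ^ (1 / 3 : ℝ) with hτ₁
  have hτ0 : 0 < τ₁ := Real.rpow_pos_of_pos hT2 _
  -- The three summands dominate respectively the weight, its T-derivative, and the integrand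
  -- (x+s)σ' without the prefactor.
  set A : ℝ := 1 + 1 / 3 * (T / 2) ^ (-(2 / 3) : ℝ) * (2 / τ₁) + 2 / τ₁ with hA
  have hr0 : 0 < (T / 2) ^ (-(2 / 3) : ℝ) := Real.rpow_pos_of_pos hT2 _
  have hA1 : 1 ≤ A := by
    have : 0 < 1 / 3 * (T / 2) ^ (-(2 / 3) : ℝ) * (2 / τ₁) := by positivity
    have : 0 < 2 / τ₁ := by positivity
    linarith
  set W : ℝ → ℝ := fun x => A * Real.exp (τ₁ / 2 * (x + s)) with hWdef
  have hW : Integrable fun x => W x * ‖airyVec x‖ ^ 2 :=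
    integrable_exp_mul_trace (half_pos hτ0) (by linarith)
  have hball : ∀ p ∈ Metric.ball T (T / 2), T / 2 < p := by
    intro p hp
    have : |p - T| < T / 2 := by simpa [Real.dist_eq] using hp
    rw [abs_lt] at this
    linarith
  have hτp : ∀ p ∈ Metric.ball T (T / 2), τ₁ ≤ p ^ (1 / 3 : ℝ) := fun p hp =>
    Real.rpow_le_rpow hT2.le (hball p hp).le (by norm_num)
  have hcs : ∀ p : ℝ, Continuous fun x => (x + s) * deriv Real.sigmoid (p ^ (1 / 3 : ℝ) * (x + s)) :=
    fun p => (by fun_prop : Continuous fun x : ℝ => x + s).mul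
      (continuous_deriv_sigmoid.comp (by fun_prop))
  have hTm : T ∈ Metric.ball T (T / 2) := Metric.mem_ball_self hT2
  constructor
  · refine integrable_weight_inner continuous_airyVec (hcs T) (W := W) (fun x => ?_) hW (airyRes s T)
    refine (abs_mul_deriv_sigmoid_le hτ0 (hτp T hTm)).trans ?_
    rw [hWdef]
    refine mul_le_mul_of_nonneg_right ?_ (Real.exp_pos _).le
    have : 0 < 1 / 3 * (T / 2) ^ (-(2 / 3) : ℝ) * (2 / τ₁) := by positivity
    linarith
  · have h := hasDerivAt_log_airyQ (σ := fun _ => s) (θ := fun t => t) (p₀ := T) (r := T / 2)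
      (W := W) (w' := fun p x => (1 / 3 * p ^ (-(2 / 3) : ℝ)) *
        ((x + s) * deriv Real.sigmoid (p ^ (1 / 3 : ℝ) * (x + s)))) hT2 hT
      (fun p => (hcs p).const_mul _)
      (fun p hp x => by
        have hp0 : 0 < p := hT2.trans (hball p hp)
        have h0 : HasDerivAt (fun p : ℝ => p ^ (1 / 3 : ℝ) * (x + s))
            (1 / 3 * p ^ (-(2 / 3) : ℝ) * (x + s)) p := by
          have := (Real.hasDerivAt_rpow_const (x := p) (p := (1 / 3 : ℝ)) (Or.inl hp0.ne')).mul_const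
            (x + s)
          refine this.congr_deriv ?_
          norm_num
        refine ((hasDerivAt_sigmoid' (p ^ (1 / 3 : ℝ) * (x + s))).comp p h0).congr_deriv ?_
        ring)
      (fun p hp x => by
        rw [abs_of_nonneg (airyWeight_nonneg _ _ _)]
        refine (sigmoid_le_exp_mul (half_pos hτ0).le
          ((half_le_self hτ0.le).trans (hτp p hp))).trans ?_
        rw [hWdef]
        exact le_mul_of_one_le_left (Real.exp_pos _).le hA1)
      (fun p hp x => by
        have hp0 : 0 < p := hT2.trans (hball p hp)
        have hpr : p ^ (-(2 / 3) : ℝ) ≤ (T / 2) ^ (-(2 / 3) : ℝ) :=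
          Real.rpow_le_rpow_of_nonpos hT2 (hball p hp).le (by norm_num)
        have hpp : 0 < p ^ (-(2 / 3) : ℝ) := Real.rpow_pos_of_pos hp0 _
        rw [abs_mul, abs_of_pos (by positivity)]
        calc _ ≤ 1 / 3 * (T / 2) ^ (-(2 / 3) : ℝ) * (2 / τ₁ * Real.exp (τ₁ / 2 * (x + s))) :=
              mul_le_mul (by linarith) (abs_mul_deriv_sigmoid_le hτ0 (hτp p hp)) (abs_nonneg _)
                (by positivity)
          _ = (1 / 3 * (T / 2) ^ (-(2 / 3) : ℝ) * (2 / τ₁)) * Real.exp (τ₁ / 2 * (x + s)) := by ring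
          _ ≤ _ := by
            rw [hWdef]
            refine mul_le_mul_of_nonneg_right ?_ (Real.exp_pos _).le
            have : 0 < 2 / τ₁ := by positivity
            linarith) hW
    refine h.congr_deriv ?_
    rw [← integral_const_mul]
    congr 2
    ext x
    simp only [airyL]
    rw [Real.rpow_neg hT.le]
    field_simp

/- The functions `(1 - K w)⁻¹ Ai` and `(1 - K w)⁻¹ Ai'`. -/

section DressedAiry

variable {s T : ℝ}

/-- The vector `∫ w Ai^(k) a`. -/
def airySource (s T : ℝ) (k : ℕ) : HalfLineL2 :=
  ∫ x, airyWeight s T x • (airyR k x • airyVec x)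

theorem expDecay_airyR_smul_airyVec (k : ℕ) : ExpDecay fun x => airyR k x • airyVec x :=
  (expDecay_airyR k).of_norm_le_mul expDecay_airyVec fun _ => (norm_smul _ _).le

theorem inner_airySource (hT : 0 < T) (k : ℕ) (u : HalfLineL2) :
    inner ℝ u (airySource s T k) =
      ∫ x, airyWeight s T x * (airyR k x * inner ℝ u (airyVec x)) := by
  rw [airySource, ← integral_inner (integrable_airyWeight_smul (expDecay_airyR_smul_airyVec k)
    ((continuous_airyR k).smul continuous_airyVec) s hT)]
  simp only [inner_smul_right]

/-- The vector `(1 - B)⁻¹ ∫ w Ai^(k) a`. -/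
def dressedVec (s T : ℝ) (k : ℕ) : HalfLineL2 := airyRes s T (airySource s T k)

/-- The function `(1 - K w)⁻¹ Ai^(k)` on the real line. -/
def dressedR (s T : ℝ) (k : ℕ) (x : ℝ) : ℝ :=
  airyR k x + inner ℝ (airyVec x) (dressedVec s T k)

theorem airyRes_eq_add (hT : 0 < T) (u : HalfLineL2) :
    airyRes s T u = u + airyOp s T (airyRes s T u) := by
  have h : airyRes s T u - airyOp s T (airyRes s T u) = u :=
    DFunLike.congr_fun (mul_airyRes s hT) u
  exact eq_add_of_sub_eq h

/-- B is symmetric, so its resolvent is too. -/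
theorem inner_airyRes_comm (hT : 0 < T) (u v : HalfLineL2) :
    inner ℝ u (airyRes s T v) = inner ℝ (airyRes s T u) v := by
  have hc := inner_traceOp_comm (continuous_airyWeight s T) continuous_airyVec
    (integrable_airyWeight_trace s hT) (airyRes s T u) (airyRes s T v)
  have h1 := airyRes_eq_add (s := s) hT u
  have h2 := airyRes_eq_add (s := s) hT v
  have h3 : u = airyRes s T u - airyOp s T (airyRes s T u) := eq_sub_of_add_eq h1.symm
  have h4 : v = airyRes s T v - airyOp s T (airyRes s T v) := eq_sub_of_add_eq h2.symm
  calc inner ℝ u (airyRes s T v)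
      = inner ℝ (airyRes s T u - airyOp s T (airyRes s T u)) (airyRes s T v) := by rw [← h3]
    _ = inner ℝ (airyRes s T u) (airyRes s T v - airyOp s T (airyRes s T v)) := by
      rw [inner_sub_left, inner_sub_right, hc]
    _ = _ := by rw [← h4]

theorem expDecay_dressedR (s T : ℝ) (k : ℕ) : ExpDecay (dressedR s T k) :=
  (expDecay_airyR k).add (expDecay_airyVec.inner_const _)

theorem continuous_dressedR (s T : ℝ) (k : ℕ) : Continuous (dressedR s T k) :=
  (continuous_airyR k).add (continuous_airyVec.inner continuous_const)

theorem expDecay_airyKernel (x : ℝ) : ExpDecay fun y => airyKernel x y := by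
  have h : (fun y => airyKernel x y) = fun y => inner ℝ (airyVec y) (airyVec x) := by
    ext y
    rw [real_inner_comm, inner_airyVec]
  rw [h]
  exact expDecay_airyVec.inner_const _

theorem continuous_airyKernel (x : ℝ) : Continuous fun y => airyKernel x y := by
  simp_rw [← inner_airyVec]
  exact continuous_const.inner continuous_airyVec

theorem inner_airyVec_airyOp (hT : 0 < T) (x : ℝ) (u : HalfLineL2) :
    inner ℝ (airyVec x) (airyOp s T u) =
      ∫ y, airyWeight s T y * (airyKernel x y * inner ℝ (airyVec y) u) := by
  rw [inner_traceOp (continuous_airyWeight s T) continuous_airyVec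
    (integrable_airyWeight_trace s hT)]
  simp only [inner_airyVec, mul_assoc]

/-- The integral equation `(1 - K w) G = Ai^(k)`. -/
theorem dressedR_eq (hT : 0 < T) (k : ℕ) (x : ℝ) :
    dressedR s T k x = airyR k x +
      ∫ y, airyWeight s T y * (airyKernel x y * dressedR s T k y) := by
  have hK := expDecay_airyKernel x
  have hKc := continuous_airyKernel x
  have h1 := integrable_airyWeight_smul (hK.mul (expDecay_airyR k))
    (hKc.mul (continuous_airyR k)) s hT
  have h2 := integrable_airyWeight_smul (hK.mul (expDecay_airyVec.inner_const (dressedVec s T k)))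
    (hKc.mul (continuous_airyVec.inner continuous_const)) s hT
  conv_lhs => rw [dressedR, dressedVec, airyRes_eq_add hT, inner_add_right, inner_airySource hT,
    inner_airyVec_airyOp hT, ← dressedVec]
  simp only [smul_eq_mul] at h1 h2
  simp only [dressedR, mul_add]
  rw [integral_add h1 h2]
  simp only [inner_airyVec]
  congr 3
  ext y
  ring

theorem expDecay_airyL (s T y : ℝ) : ExpDecay fun x => airyL s T x y :=
  expDecay_airyVec.inner_const _

theorem continuous_airyL (s T y : ℝ) : Continuous fun x => airyL s T x y :=
  continuous_airyVec.inner continuous_const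

theorem airyL_eq (hT : 0 < T) (x y : ℝ) :
    airyL s T x y = airyKernel x y +
      ∫ z, airyWeight s T z * (airyKernel x z * airyL s T z y) := by
  rw [airyL, airyRes_eq_add hT, inner_add_right, inner_airyVec, inner_airyVec_airyOp hT]
  rfl

/-- The dual form of the equation for G_k: symmetry moves the resolvent from the source to a(y), so
that L acts on the undressed Ai^{(k)}. -/
theorem dressedR_eq_of_airyL (hT : 0 < T) (k : ℕ) (y : ℝ) :
    dressedR s T k y = airyR k y + ∫ z, airyWeight s T z * (airyR k z * airyL s T z y) := by
  rw [dressedR, dressedVec, inner_airyRes_comm hT, inner_airySource hT]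
  simp only [airyL, real_inner_comm]

theorem sub_mul_airyKernel (x y : ℝ) :
    (x - y) * airyKernel x y = airyR 0 x * airyR 1 y - airyR 1 x * airyR 0 y := by
  unfold airyKernel
  split_ifs with h
  · subst h
    ring
  · rw [deriv_airyAi, deriv_airyAi, ← airyR_zero]
    exact mul_div_cancel₀ _ (sub_ne_zero.mpr h)

/-- A continuous solution of the homogeneous equation `M = K w M` vanishes. -/
theorem eq_zero_of_eq_integral_airyKernel (hT : 0 < T) {M : ℝ → ℝ} (hM : ExpDecay M)
    (hMc : Continuous M)
    (h : ∀ x, M x = ∫ y, airyWeight s T y * (airyKernel x y * M y)) (x : ℝ) : M x = 0 := by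
  have hi := integrable_airyWeight_smul (f := fun y => M y • airyVec y)
    (hM.of_norm_le_mul expDecay_airyVec fun _ => (norm_smul _ _).le)
    (hMc.smul continuous_airyVec) s hT
  -- The equation says M(x) = ⟨a(x), ζ⟩; substituting this into ζ gives Bζ = ζ, hence ζ = 0.
  set ζ : HalfLineL2 := ∫ y, airyWeight s T y • (M y • airyVec y) with hζ
  have h1 : ∀ x, M x = inner ℝ (airyVec x) ζ := by
    intro x
    rw [h x, hζ, ← integral_inner hi]
    simp only [inner_smul_right, inner_airyVec]
    congr 1
    ext y
    ring
  have h2 : airyOp s T ζ = ζ := by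
    rw [traceOp_apply (continuous_airyWeight s T) continuous_airyVec
      (integrable_airyWeight_trace s hT)]
    simp only [← h1, mul_smul]
    rfl
  have h3 : ζ = 0 := by
    have h4 : airyRes s T (ζ - airyOp s T ζ) = ζ := DFunLike.congr_fun (airyRes_mul s hT) ζ
    rw [h2, sub_self, map_zero] at h4
    exact h4.symm
  rw [h1 x, h3, inner_zero_right]

/-- The kernel of `(1 - K w)⁻¹ K` is again integrable in the sense of Its, Izergin, Korepin and
Slavnov. -/
theorem sub_mul_airyL (hT : 0 < T) (x y : ℝ) :
    (x - y) * airyL s T x y =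
      dressedR s T 0 x * dressedR s T 1 y - dressedR s T 1 x * dressedR s T 0 y := by
  -- The defect of the claimed identity as a function of x. It is enough to check that it solves M =
  -- K w M.
  set M : ℝ → ℝ := fun x => (x - y) * airyL s T x y +
    (-dressedR s T 1 y * dressedR s T 0 x + dressedR s T 0 y * dressedR s T 1 x) with hMdef
  have hL := expDecay_airyL s T y
  have hLc := continuous_airyL s T y
  have hG : ∀ (c : ℝ) k, ExpDecay fun x => c * dressedR s T k x := fun c k =>
    (expDecay_dressedR s T k).of_norm_le_const_mul (abs_nonneg c) fun _ => (norm_mul _ _).le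
  have hM : ExpDecay M := (hL.sub_const_mul y).add ((hG _ 0).add (hG _ 1))
  have hsc : Continuous fun x : ℝ => (x - y) * airyL s T x y :=
    (by fun_prop : Continuous fun x : ℝ => x - y).mul hLc
  have hMc : Continuous M := hsc.add
    (((continuous_dressedR s T 0).const_mul _).add ((continuous_dressedR s T 1).const_mul _))
  have hz := eq_zero_of_eq_integral_airyKernel (s := s) hT hM hMc (fun x => ?_) x
  · simp only [hMdef] at hz
    linarith
  have hK := expDecay_airyKernel x
  have hKc := continuous_airyKernel x
  have iA : ∀ k, Integrable fun z => airyWeight s T z * (airyR k z * airyL s T z y) := fun k =>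
    integrable_airyWeight_smul ((expDecay_airyR k).mul hL) ((continuous_airyR k).mul hLc) s hT
  have iL : Integrable fun z => airyWeight s T z * (airyKernel x z * airyL s T z y) :=
    integrable_airyWeight_smul (hK.mul hL) (hKc.mul hLc) s hT
  have iS : Integrable fun z => airyWeight s T z * (airyKernel x z * ((z - y) * airyL s T z y)) :=
    integrable_airyWeight_smul (hK.mul (hL.sub_const_mul y)) (hKc.mul hsc) s hT
  have iG : ∀ k, Integrable fun z => airyWeight s T z * (airyKernel x z * dressedR s T k z) :=
    fun k => integrable_airyWeight_smul (hK.mul (expDecay_dressedR s T k))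
      (hKc.mul (continuous_dressedR s T k)) s hT
  have iC : ∀ a b : ℝ, Integrable fun z =>
      a * (airyWeight s T z * (airyKernel x z * dressedR s T 0 z)) +
        b * (airyWeight s T z * (airyKernel x z * dressedR s T 1 z)) := fun a b =>
    ((iG 0).const_mul a).add ((iG 1).const_mul b)
  have iD : ∀ a b : ℝ, Integrable fun z =>
      a * (airyWeight s T z * (airyR 1 z * airyL s T z y)) -
        b * (airyWeight s T z * (airyR 0 z * airyL s T z y)) := fun a b =>
    ((iA 1).const_mul a).sub ((iA 0).const_mul b)
  have e1 : ∫ z, airyWeight s T z * (airyKernel x z * M z) =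
      (∫ z, airyWeight s T z * (airyKernel x z * ((z - y) * airyL s T z y))) +
        (-dressedR s T 1 y * (dressedR s T 0 x - airyR 0 x) +
          dressedR s T 0 y * (dressedR s T 1 x - airyR 1 x)) := by
    rw [dressedR_eq hT 0 x, dressedR_eq hT 1 x, add_sub_cancel_left, add_sub_cancel_left,
      ← integral_const_mul, ← integral_const_mul, ← integral_add ((iG 0).const_mul _)
      ((iG 1).const_mul _), ← integral_add iS (iC (-dressedR s T 1 y) (dressedR s T 0 y))]
    congr 1
    ext z
    simp only [hMdef]
    ring
  -- Split x − y = (x − z) + (z − y). The first part replaces K by Airy products, whose integrals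
  -- against wL are G_k(y) − Ai^{(k)}(y) by the dual equation.
  have e2 : (x - y) * ∫ z, airyWeight s T z * (airyKernel x z * airyL s T z y) =
      (airyR 0 x * (dressedR s T 1 y - airyR 1 y) - airyR 1 x * (dressedR s T 0 y - airyR 0 y)) +
        ∫ z, airyWeight s T z * (airyKernel x z * ((z - y) * airyL s T z y)) := by
    rw [dressedR_eq_of_airyL hT 0 y, dressedR_eq_of_airyL hT 1 y, add_sub_cancel_left,
      add_sub_cancel_left, ← integral_const_mul, ← integral_const_mul, ← integral_const_mul,
      ← integral_sub ((iA 1).const_mul _) ((iA 0).const_mul _),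
      ← integral_add (iD (airyR 0 x) (airyR 1 x)) iS]
    congr 1
    ext z
    have := sub_mul_airyKernel x z
    linear_combination airyWeight s T z * airyL s T z y * this
  have e3 := sub_mul_airyKernel x y
  rw [e1]
  simp only [hMdef]
  rw [airyL_eq hT x y, mul_add, e2, e3]
  ring

end DressedAiry
end

noncomputable section

/- Analytic continuation of `(1 - K w)⁻¹ Ai` and `(1 - K w)⁻¹ Ai'`. -/

/-- Decay of a function of a complex variable in horizontal strips, faster than any exponential
towards `+∞` and growing at most like any exponential towards `-∞`. -/
def StripDecay (f : ℂ → ℂ) : Prop :=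
  ∀ A c : ℝ, 0 < c → ∃ C : ℝ, 0 ≤ C ∧ ∀ z : ℂ, |z.im| ≤ A → ‖f z‖ ≤ C * Real.exp (-c * z.re)

theorem stripDecay_airyD (k : ℕ) : StripDecay (airyD k) := fun A _ hc =>
  let ⟨C, hC, h⟩ := exists_norm_airyD_le k hc A
  ⟨C, hC.le, h⟩

theorem StripDecay.add {f g : ℂ → ℂ} (hf : StripDecay f) (hg : StripDecay g) :
    StripDecay fun z => f z + g z := by
  intro A c hc
  obtain ⟨C, hC, h⟩ := hf A c hc
  obtain ⟨D, hD, h'⟩ := hg A c hc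
  refine ⟨C + D, by positivity, fun z hz => (norm_add_le _ _).trans ?_⟩
  rw [add_mul]
  exact add_le_add (h z hz) (h' z hz)

theorem StripDecay.mul {f g : ℂ → ℂ} (hf : StripDecay f) (hg : StripDecay g) :
    StripDecay fun z => f z * g z := by
  intro A c hc
  obtain ⟨C, hC, h⟩ := hf A (c / 2) (half_pos hc)
  obtain ⟨D, hD, h'⟩ := hg A (c / 2) (half_pos hc)
  refine ⟨C * D, by positivity, fun z hz => (norm_mul_le _ _).trans ?_⟩
  calc ‖f z‖ * ‖g z‖ ≤ (C * Real.exp (-(c / 2) * z.re)) * (D * Real.exp (-(c / 2) * z.re)) :=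
        mul_le_mul (h z hz) (h' z hz) (norm_nonneg _) (by positivity)
    _ = C * D * (Real.exp (-(c / 2) * z.re) * Real.exp (-(c / 2) * z.re)) := by ring
    _ = _ := by
      rw [← Real.exp_add]
      congr 2
      ring

theorem integrableOn_exp_neg_mul_halfLine (u : HalfLineL2) {c : ℝ} (hc : 0 < c) :
    IntegrableOn (fun t => Real.exp (-c * t) * ‖u t‖) (Set.Ioi 0) := by
  have h1 : MemLp (fun t : ℝ => Real.exp (-c * t)) 2 (volume.restrict (Set.Ioi 0)) := by
    rw [memLp_two_iff_integrable_sq (by fun_prop)]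
    have h := exp_neg_integrableOn_Ioi 0 (by positivity : 0 < 2 * c)
    refine h.congr (ae_of_all _ fun t => ?_)
    simp only
    rw [← Real.exp_nat_mul]
    congr 1
    push_cast
    ring
  exact h1.integrable_mul (Lp.memLp u).norm

/-- The analytic function `∫ Ai^(k) (z + t) u(t) dt`, the integral being over the half-line. -/
def airyHalf (k : ℕ) (u : HalfLineL2) (z : ℂ) : ℂ :=
  ∫ t in Set.Ioi (0 : ℝ), airyD k (z + t) * (u t : ℂ)

theorem norm_airyD_add_mul_le {k : ℕ} {A c C : ℝ} (hC : 0 ≤ C)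
    (h : ∀ z : ℂ, |z.im| ≤ A → ‖airyD k z‖ ≤ C * Real.exp (-c * z.re)) (u : HalfLineL2) {z : ℂ}
    (hz : |z.im| ≤ A) (t : ℝ) :
    ‖airyD k (z + t) * (u t : ℂ)‖ ≤
      (C * Real.exp (-c * z.re)) * (Real.exp (-c * t) * ‖u t‖) := by
  rw [norm_mul, Complex.norm_real, ← mul_assoc]
  refine mul_le_mul_of_nonneg_right ?_ (norm_nonneg _)
  refine (h (z + t) (by simpa using hz)).trans ?_
  rw [mul_assoc, ← Real.exp_add]
  refine mul_le_mul_of_nonneg_left (Real.exp_le_exp.mpr ?_) hC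
  simp only [Complex.add_re, Complex.ofReal_re]
  linarith

theorem aestronglyMeasurable_airyD_add_mul (k : ℕ) (u : HalfLineL2) (z : ℂ) :
    AEStronglyMeasurable (fun t : ℝ => airyD k (z + t) * (u t : ℂ))
      (volume.restrict (Set.Ioi 0)) := by
  refine AEStronglyMeasurable.mul ?_ ?_
  · exact ((differentiable_airyD k).continuous.comp (by fun_prop)).aestronglyMeasurable
  · exact Complex.continuous_ofReal.comp_aestronglyMeasurable (Lp.aestronglyMeasurable u)

theorem stripDecay_airyHalf (k : ℕ) (u : HalfLineL2) : StripDecay (airyHalf k u) := by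
  intro A c hc
  obtain ⟨C, hC, h⟩ := exists_norm_airyD_le k hc A
  set I : ℝ := ∫ t in Set.Ioi 0, Real.exp (-c * t) * ‖u t‖ with hI
  have hI0 : 0 ≤ I := integral_nonneg fun t => by positivity
  refine ⟨C * I, by positivity, fun z hz => ?_⟩
  calc ‖airyHalf k u z‖ ≤ ∫ t in Set.Ioi 0,
        (C * Real.exp (-c * z.re)) * (Real.exp (-c * t) * ‖u t‖) :=
        norm_integral_le_of_norm_le ((integrableOn_exp_neg_mul_halfLine u hc).const_mul _)
          (ae_of_all _ fun t => norm_airyD_add_mul_le hC.le h u hz t)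
    _ = _ := by
      rw [integral_const_mul]
      ring

theorem hasDerivAt_airyHalf (k : ℕ) (u : HalfLineL2) (z : ℂ) :
    HasDerivAt (airyHalf k u) (airyHalf (k + 1) u z) z := by
  obtain ⟨C, hC, h⟩ := exists_norm_airyD_le k one_pos (|z.im| + 1)
  obtain ⟨D, hD, h'⟩ := exists_norm_airyD_le (k + 1) one_pos (|z.im| + 1)
  have hI := integrableOn_exp_neg_mul_halfLine u one_pos
  refine (hasDerivAt_integral_of_dominated_loc_of_deriv_le
    (F := fun z (t : ℝ) => airyD k (z + t) * (u t : ℂ))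
    (F' := fun z (t : ℝ) => airyD (k + 1) (z + t) * (u t : ℂ))
    (bound := fun t => (D * Real.exp (-1 * (z.re - 1))) * (Real.exp (-1 * t) * ‖u t‖))
    (Metric.ball_mem_nhds z one_pos) (Eventually.of_forall fun w =>
      aestronglyMeasurable_airyD_add_mul k u w) ?_ (aestronglyMeasurable_airyD_add_mul (k + 1) u z)
    ?_ (hI.const_mul _) (ae_of_all _ fun t w _ => ?_)).2
  · refine (hI.const_mul (C * Real.exp (-1 * z.re))).mono'
      (aestronglyMeasurable_airyD_add_mul k u z) ?_
    exact ae_of_all _ fun t => norm_airyD_add_mul_le hC.le h u (by linarith) t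
  · refine ae_of_all _ fun t w hw => ?_
    have hw' : ‖w - z‖ < 1 := by simpa [dist_eq_norm] using hw
    have him : |w.im| ≤ |z.im| + 1 := by
      have h1 := (Complex.abs_im_le_norm (w - z)).trans hw'.le
      have h2 := abs_add_le (w - z).im z.im
      simp only [Complex.sub_im, sub_add_cancel] at h1 h2
      linarith
    have hre : z.re - 1 ≤ w.re := by
      have h1 := (Complex.abs_re_le_norm (w - z)).trans hw'.le
      rw [Complex.sub_re, abs_le] at h1
      linarith
    refine (norm_airyD_add_mul_le hD.le h' u him t).trans ?_
    refine mul_le_mul_of_nonneg_right ?_ (by positivity)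
    exact mul_le_mul_of_nonneg_left (Real.exp_le_exp.mpr (by linarith)) hD.le
  · have h0 : HasDerivAt (fun w : ℂ => w + (t : ℂ)) 1 w := (hasDerivAt_id w).add_const _
    have h1 := ((hasDerivAt_airyD k (w + t)).comp w h0).mul_const (u t : ℂ)
    simpa using h1

theorem ofReal_inner_airyVec (u : HalfLineL2) (x : ℝ) :
    ((inner ℝ (airyVec x) u : ℝ) : ℂ) = airyHalf 0 u x := by
  rw [inner_airyVec_left, ← integral_complex_ofReal, airyHalf]
  congr 1
  ext t
  push_cast
  rw [ofReal_airyR]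
  push_cast
  rfl

/-- The entire function which extends `(1 - K w)⁻¹ Ai^(k)`. -/
def dressedC (s T : ℝ) (k : ℕ) (z : ℂ) : ℂ := airyD k z + airyHalf 0 (dressedVec s T k) z

theorem stripDecay_dressedC (s T : ℝ) (k : ℕ) : StripDecay (dressedC s T k) :=
  (stripDecay_airyD k).add (stripDecay_airyHalf 0 _)

theorem differentiable_dressedC (s T : ℝ) (k : ℕ) : Differentiable ℂ (dressedC s T k) :=
  (differentiable_airyD k).add fun z => (hasDerivAt_airyHalf 0 _ z).differentiableAt

theorem ofReal_dressedR (s T : ℝ) (k : ℕ) (x : ℝ) :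
    ((dressedR s T k x : ℝ) : ℂ) = dressedC s T k x := by
  rw [dressedR, Complex.ofReal_add, ofReal_airyR, ofReal_inner_airyVec, dressedC]

theorem hasDerivAt_dressedR (s T : ℝ) (k : ℕ) (x : ℝ) :
    HasDerivAt (dressedR s T k) (deriv (dressedC s T k) x).re x := by
  have h := ((differentiable_dressedC s T k) x).hasDerivAt.real_of_complex
  refine h.congr_of_eventuallyEq (Eventually.of_forall fun y => ?_)
  simp only [← ofReal_dressedR, Complex.ofReal_re]

theorem ofReal_re_deriv_dressedC (s T : ℝ) (k : ℕ) (x : ℝ) :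
    (((deriv (dressedC s T k) x).re : ℝ) : ℂ) = deriv (dressedC s T k) x := by
  have h1 := ((differentiable_dressedC s T k) x).hasDerivAt.comp_ofReal
  have h2 := (hasDerivAt_dressedR s T k x).ofReal_comp
  simp only [ofReal_dressedR] at h2
  exact h2.unique h1

/-- The right side of the integrable form vanishes at y = x, so dividing by y − x and letting y → x
produces its derivative. -/
theorem airyL_self {s T : ℝ} (hT : 0 < T) (x : ℝ) :
    airyL s T x x = dressedR s T 1 x * (deriv (dressedC s T 0) x).re -
      dressedR s T 0 x * (deriv (dressedC s T 1) x).re := by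
  have h0 := hasDerivAt_iff_tendsto_slope.mp (((hasDerivAt_dressedR s T 0 x).const_mul
    (dressedR s T 1 x)).sub ((hasDerivAt_dressedR s T 1 x).const_mul (dressedR s T 0 x)))
  have h1 : Tendsto (fun y => airyL s T y x) (𝓝[≠] x) (𝓝 (airyL s T x x)) :=
    ((continuous_airyL s T x).tendsto x).mono_left nhdsWithin_le_nhds
  refine tendsto_nhds_unique h1 (h0.congr' ?_)
  filter_upwards [self_mem_nhdsWithin] with y hy
  have hy' : y - x ≠ 0 := sub_ne_zero.mpr hy
  have := sub_mul_airyL (s := s) hT y x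
  rw [slope_def_field, div_eq_iff hy']
  simp only [Pi.sub_apply]
  linarith

/-- The diagonal of the resolvent kernel in terms of the analytic continuations. -/
theorem ofReal_airyL_self {s T : ℝ} (hT : 0 < T) (x : ℝ) :
    ((airyL s T x x : ℝ) : ℂ) = dressedC s T 1 x * deriv (dressedC s T 0) x -
      dressedC s T 0 x * deriv (dressedC s T 1) x := by
  rw [airyL_self hT]
  push_cast
  rw [ofReal_re_deriv_dressedC, ofReal_re_deriv_dressedC, ofReal_dressedR, ofReal_dressedR]

end

noncomputable section

/- Cauchy transforms of functions holomorphic in a horizontal strip. -/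

/-- The Cauchy transform of `g` along the horizontal line of height `b`. -/
def cauchyLine (g : ℂ → ℂ) (b : ℝ) (z : ℂ) : ℂ :=
  ∫ x : ℝ, g (x + b * Complex.I) / (x + b * Complex.I - z)

theorem abs_sub_le_norm_line_sub (x b : ℝ) (z : ℂ) :
    |b - z.im| ≤ ‖(x : ℂ) + b * Complex.I - z‖ := by
  simpa using Complex.abs_im_le_norm ((x : ℂ) + b * Complex.I - z)

theorem line_sub_ne_zero {b : ℝ} {z : ℂ} (h : z.im ≠ b) (x : ℝ) :
    (x : ℂ) + b * Complex.I - z ≠ 0 := by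
  rw [← norm_pos_iff]
  exact (abs_pos.mpr (sub_ne_zero.mpr h.symm)).trans_le (abs_sub_le_norm_line_sub x b z)

/-- Holomorphic functions in a strip around the real line which decay exponentially at its ends. -/
structure StripHolo (δ : ℝ) (g : ℂ → ℂ) : Prop where
  diff : DifferentiableOn ℂ g {z | |z.im| < δ}
  decay : ∃ κ C : ℝ, 0 < κ ∧ 0 ≤ C ∧ ∀ z : ℂ, |z.im| < δ → ‖g z‖ ≤ C * Real.exp (-κ * |z.re|)

theorem isOpen_strip (δ : ℝ) : IsOpen {z : ℂ | |z.im| < δ} :=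
  isOpen_lt (Complex.continuous_im.abs) continuous_const

theorem StripHolo.continuous_line {δ : ℝ} {g : ℂ → ℂ} (hg : StripHolo δ g) {b : ℝ} (hb : |b| < δ) :
    Continuous fun x : ℝ => g (x + b * Complex.I) :=
  hg.diff.continuousOn.comp_continuous (by fun_prop) fun x => by simpa using hb

theorem one_add_abs_mul_exp_le {κ : ℝ} (hκ : 0 < κ) (x : ℝ) :
    (1 + |x|) * Real.exp (-κ * |x|) ≤ (1 + 2 / κ) * Real.exp (-(κ / 2) * |x|) := by
  have h1 : 1 + |x| ≤ (1 + 2 / κ) * Real.exp (κ / 2 * |x|) := by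
    have h2 := Real.add_one_le_exp (κ / 2 * |x|)
    have h3 : |x| = 2 / κ * (κ / 2 * |x|) := by field_simp
    have h4 : 0 < 2 / κ := by positivity
    have h5 : 1 ≤ Real.exp (κ / 2 * |x|) := Real.one_le_exp (by positivity)
    nlinarith
  calc (1 + |x|) * Real.exp (-κ * |x|)
      ≤ ((1 + 2 / κ) * Real.exp (κ / 2 * |x|)) * Real.exp (-κ * |x|) := by gcongr
    _ = _ := by
      rw [mul_assoc, ← Real.exp_add]
      congr 2
      ring

theorem StripHolo.exists_norm_le_div {δ : ℝ} {g : ℂ → ℂ} (hg : StripHolo δ g) :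
    ∃ K : ℝ, ∀ z : ℂ, |z.im| < δ → ‖g z‖ ≤ K / (1 + |z.re|) := by
  obtain ⟨κ, C, hκ, hC, hdec⟩ := hg.decay
  refine ⟨C * (1 + 2 / κ), fun w hw => ?_⟩
  rw [le_div_iff₀ (by positivity)]
  calc _ ≤ (C * Real.exp (-κ * |w.re|)) * (1 + |w.re|) := by
        have := hdec w hw
        gcongr
    _ = C * ((1 + |w.re|) * Real.exp (-κ * |w.re|)) := by ring
    _ ≤ C * ((1 + 2 / κ) * Real.exp (-(κ / 2) * |w.re|)) :=
      mul_le_mul_of_nonneg_left (one_add_abs_mul_exp_le hκ _) hC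
    _ ≤ C * ((1 + 2 / κ) * 1) := by
      gcongr
      rw [Real.exp_le_one_iff]
      have := abs_nonneg w.re
      nlinarith
    _ = _ := by ring

theorem StripHolo.integrable_line {δ : ℝ} {g : ℂ → ℂ} (hg : StripHolo δ g) {b : ℝ} (hb : |b| < δ) :
    Integrable fun x : ℝ => (1 + |x|) * ‖g (x + b * Complex.I)‖ := by
  obtain ⟨κ, C, hκ, hC, h⟩ := hg.decay
  refine ((integrable_exp_neg_mul_abs (half_pos hκ)).const_mul (C * (1 + 2 / κ))).mono' ?_ ?_
  · exact ((by fun_prop : Continuous fun x : ℝ => 1 + |x|).mul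
      (hg.continuous_line hb).norm).aestronglyMeasurable
  · refine ae_of_all _ fun x => ?_
    rw [Real.norm_of_nonneg (by positivity)]
    have h1 := h (x + b * Complex.I) (by simpa using hb)
    simp only [Complex.add_re, Complex.ofReal_re, Complex.mul_re, Complex.I_re, mul_zero,
      Complex.ofReal_im, Complex.I_im, mul_one, sub_self, add_zero] at h1
    calc _ ≤ (1 + |x|) * (C * Real.exp (-κ * |x|)) := by gcongr
      _ = C * ((1 + |x|) * Real.exp (-κ * |x|)) := by ring
      _ ≤ C * ((1 + 2 / κ) * Real.exp (-(κ / 2) * |x|)) :=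
        mul_le_mul_of_nonneg_left (one_add_abs_mul_exp_le hκ x) hC
      _ = _ := by ring

theorem StripHolo.integrable_norm_line {δ : ℝ} {g : ℂ → ℂ} (hg : StripHolo δ g) {b : ℝ}
    (hb : |b| < δ) : Integrable fun x : ℝ => ‖g (x + b * Complex.I)‖ :=
  (hg.integrable_line hb).mono' (hg.continuous_line hb).norm.aestronglyMeasurable
    (ae_of_all _ fun x => by
      rw [norm_norm]
      exact le_mul_of_one_le_left (norm_nonneg _) (by linarith [abs_nonneg x]))

theorem StripHolo.integrable_div {δ : ℝ} {g : ℂ → ℂ} (hg : StripHolo δ g) {b : ℝ}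
    (hb : |b| < δ) {z : ℂ} (hz : z.im ≠ b) :
    Integrable fun x : ℝ => g (x + b * Complex.I) / (x + b * Complex.I - z) := by
  refine ((hg.integrable_norm_line hb).div_const |b - z.im|).mono' ?_ (ae_of_all _ fun x => ?_)
  · exact ((hg.continuous_line hb).div (by fun_prop)
      fun x => line_sub_ne_zero hz x).aestronglyMeasurable
  · rw [norm_div]
    exact div_le_div_of_nonneg_left (norm_nonneg _) (abs_pos.mpr (sub_ne_zero.mpr hz.symm))
      (abs_sub_le_norm_line_sub x b z)

theorem StripHolo.differentiableAt_cauchyLine {δ : ℝ} {g : ℂ → ℂ} (hg : StripHolo δ g) {b : ℝ}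
    (hb : |b| < δ) {z : ℂ} (hz : z.im ≠ b) : DifferentiableAt ℂ (cauchyLine g b) z := by
  set ε : ℝ := |b - z.im| / 2 with hε
  have hε0 : 0 < ε := half_pos (abs_pos.mpr (sub_ne_zero.mpr hz.symm))
  have hball : ∀ w ∈ Metric.ball z ε, ε ≤ |b - w.im| := by
    intro w hw
    have h1 : ‖w - z‖ < ε := by simpa [dist_eq_norm] using hw
    have h2 := (Complex.abs_im_le_norm (w - z)).trans h1.le
    rw [Complex.sub_im] at h2
    have h3 := abs_add_le (b - w.im) (w.im - z.im)
    rw [sub_add_sub_cancel] at h3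
    linarith
  have hne : ∀ w ∈ Metric.ball z ε, w.im ≠ b := fun w hw h => by
    have := hball w hw
    rw [h, sub_self, abs_zero] at this
    linarith
  refine (hasDerivAt_integral_of_dominated_loc_of_deriv_le
    (F := fun z (x : ℝ) => g (x + b * Complex.I) / (x + b * Complex.I - z))
    (F' := fun z (x : ℝ) => g (x + b * Complex.I) / (x + b * Complex.I - z) ^ 2)
    (bound := fun x : ℝ => ‖g (x + b * Complex.I)‖ / ε ^ 2)
    (Metric.ball_mem_nhds z hε0) ?_ (hg.integrable_div hb hz) ?_ ?_
    ((hg.integrable_norm_line hb).div_const _) (ae_of_all _ fun x w hw => ?_)).2.differentiableAt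
  · filter_upwards [Metric.ball_mem_nhds z hε0] with w hw
    exact (hg.integrable_div hb (hne w hw)).aestronglyMeasurable
  · exact ((hg.continuous_line hb).div (by fun_prop)
      fun x => pow_ne_zero _ (line_sub_ne_zero hz x)).aestronglyMeasurable
  · refine ae_of_all _ fun x w hw => ?_
    rw [norm_div, norm_pow]
    have := (hball w hw).trans (abs_sub_le_norm_line_sub x b w)
    gcongr
  · have h0 := line_sub_ne_zero (hne w hw) x
    have h1 : HasDerivAt (fun w : ℂ => (x : ℂ) + b * Complex.I - w) (-1) w :=
      (hasDerivAt_id w).const_sub _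
    refine ((hasDerivAt_const w (g (x + b * Complex.I))).div h1 h0).congr_deriv ?_
    ring

/-- Away from the line, |z|/|x + ib − z| is at most a constant times 1 + |x|, a weight that the
exponential decay of g absorbs. This gives the O(1/z) of the Cauchy transforms. -/
theorem StripHolo.exists_norm_mul_cauchyLine_le {δ : ℝ} {g : ℂ → ℂ} (hg : StripHolo δ g) {b : ℝ}
    (hb : |b| < δ) {ε : ℝ} (hε : 0 < ε) :
    ∃ C : ℝ, ∀ z : ℂ, ε ≤ |b - z.im| → ‖z * cauchyLine g b z‖ ≤ C := by
  refine ⟨∫ x : ℝ, (1 + (1 + |b|) / ε) * ((1 + |x|) * ‖g (x + b * Complex.I)‖), fun z hz => ?_⟩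
  rw [cauchyLine, ← integral_const_mul]
  refine norm_integral_le_of_norm_le ((hg.integrable_line hb).const_mul _)
    (ae_of_all _ fun x => ?_)
  set d : ℂ := (x : ℂ) + b * Complex.I - z with hd
  have hd0 : ε ≤ ‖d‖ := hz.trans (abs_sub_le_norm_line_sub x b z)
  have hdp : 0 < ‖d‖ := hε.trans_le hd0
  have h1 : ‖z‖ ≤ ‖d‖ + (|x| + |b|) := by
    have e : z = ((x : ℂ) + b * Complex.I) - d := by rw [hd]; ring
    rw [e]
    refine (norm_sub_le _ _).trans ?_
    have := norm_add_le (x : ℂ) (b * Complex.I)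
    simp only [Complex.norm_mul, Complex.norm_real, Complex.norm_I, mul_one, Real.norm_eq_abs]
      at this
    linarith
  have h2 : ‖z‖ / ‖d‖ ≤ (1 + (1 + |b|) / ε) * (1 + |x|) := by
    rw [div_le_iff₀ hdp]
    have h3 : |x| + |b| ≤ (1 + |b|) * (1 + |x|) := by
      nlinarith [abs_nonneg x, abs_nonneg b]
    have h4 : (1 + |b|) * (1 + |x|) ≤ (1 + |b|) / ε * (1 + |x|) * ‖d‖ := by
      have : (1 + |b|) * (1 + |x|) = (1 + |b|) / ε * (1 + |x|) * ε := by field_simp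
      rw [this]
      gcongr
    nlinarith [abs_nonneg x, hdp]
  calc ‖z * (g (x + b * Complex.I) / d)‖ = ‖z‖ / ‖d‖ * ‖g (x + b * Complex.I)‖ := by
        rw [norm_mul, norm_div]
        ring
    _ ≤ _ := by
      rw [← mul_assoc]
      gcongr

theorem integrable_inv_one_add_abs_sq : Integrable fun x : ℝ => ((1 + |x|) ^ 2)⁻¹ := by
  refine integrable_inv_one_add_sq.mono' ?_ (ae_of_all _ fun x => ?_)
  · exact (Continuous.inv₀ (by fun_prop) fun x => by positivity).aestronglyMeasurable
  · rw [Real.norm_of_nonneg (by positivity)]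
    refine inv_anti₀ (by positivity) ?_
    nlinarith [abs_nonneg x, sq_abs x]

/-- The line of integration of a Cauchy transform may be moved across a zero of the function. -/
theorem cauchyLine_eq_of_apply_eq_zero {δ K : ℝ} {F : ℂ → ℂ}
    (hF : DifferentiableOn ℂ F {z | |z.im| < δ})
    (hK : ∀ z : ℂ, |z.im| < δ → ‖F z‖ ≤ K / (1 + |z.re|)) {a b : ℝ} (hab : a ≤ b) (ha : -δ < a)
    (hb : b < δ) {z : ℂ} (hz : |z.im| < δ) (h0 : F z = 0) :
    cauchyLine F a z = cauchyLine F b z := by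
  have hS : {z : ℂ | |z.im| < δ} ∈ 𝓝 z := (isOpen_strip δ).mem_nhds hz
  -- The divided difference is holomorphic at z as well, because F(z) = 0 removes the pole, so the
  -- contour may cross z.
  set D : ℂ → ℂ := dslope F z with hD
  have hDd : DifferentiableOn ℂ D {z | |z.im| < δ} :=
    (Complex.differentiableOn_dslope hS).mpr hF
  have hDe : ∀ w, w ≠ z → D w = F w / (w - z) := by
    intro w hw
    rw [hD, dslope_of_ne _ hw, slope_def_field, h0, sub_zero]
  have hstrip : ∀ y ∈ Set.Icc a b, |y| < δ := fun y hy =>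
    abs_lt.mpr ⟨by linarith [hy.1], by linarith [hy.2]⟩
  have hK0 : 0 ≤ K := by
    have := (norm_nonneg _).trans (hK z hz)
    by_contra hneg
    exact absurd this (not_le.mpr (div_neg_of_neg_of_pos (not_le.mp hneg) (by positivity)))
  obtain ⟨K₁, hK₁⟩ : ∃ K₁, ∀ x : ℝ, |x - z.re| ≤ 1 → ∀ y ∈ Set.Icc a b,
      ‖D (x + y * Complex.I)‖ ≤ K₁ := by
    have hc : IsCompact (Set.Icc (z.re - 1) (z.re + 1) ×ˢ Set.Icc a b) :=
      isCompact_Icc.prod isCompact_Icc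
    have hcont : ContinuousOn (fun p : ℝ × ℝ => D (p.1 + p.2 * Complex.I))
        (Set.Icc (z.re - 1) (z.re + 1) ×ˢ Set.Icc a b) :=
      hDd.continuousOn.comp (by fun_prop) fun p hp => by
        simpa using hstrip p.2 hp.2
    obtain ⟨K₁, h⟩ := hc.exists_bound_of_continuousOn hcont
    refine ⟨K₁, fun x hx y hy => h (x, y) ⟨?_, hy⟩⟩
    rw [abs_le] at hx
    exact ⟨by linarith [hx.1], by linarith [hx.2]⟩
  set B : ℝ := 1 + |z.re| with hB
  have hB1 : 1 ≤ B := by simp [hB]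
  set K' : ℝ := |K₁| * (B + 1) ^ 2 + K * (B + 1) with hK'
  -- F decays like 1/(1+|x|) and the divisor supplies another such factor away from z; near z
  -- compactness is used. Quadratic decay makes the divided difference integrable.
  have hbound : ∀ x : ℝ, ∀ y ∈ Set.Icc a b, ‖D (x + y * Complex.I)‖ ≤ K' * ((1 + |x|) ^ 2)⁻¹ := by
    intro x y hy
    rw [← div_eq_mul_inv, le_div_iff₀ (by positivity)]
    rcases le_or_gt |x - z.re| 1 with hx | hx
    · have h1 : 1 + |x| ≤ B + 1 := by
        have := abs_add_le (x - z.re) z.re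
        rw [sub_add_cancel] at this
        linarith
      calc _ ≤ |K₁| * (B + 1) ^ 2 := by
            have := (hK₁ x hx y hy).trans (le_abs_self _)
            gcongr
        _ ≤ K' := by
          have : 0 ≤ K * (B + 1) := by positivity
          linarith
    · have hne : (x : ℂ) + y * Complex.I ≠ z := by
        rintro h
        have := congrArg Complex.re h
        simp only [Complex.add_re, Complex.ofReal_re, Complex.mul_re, Complex.I_re, mul_zero,
          Complex.ofReal_im, Complex.I_im, mul_one, sub_self, add_zero] at this
        rw [this, sub_self, abs_zero] at hx
        linarith
      have hn : |x - z.re| ≤ ‖(x : ℂ) + y * Complex.I - z‖ := by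
        simpa using Complex.abs_re_le_norm ((x : ℂ) + y * Complex.I - z)
      have h1 : 1 + |x| ≤ (B + 1) * |x - z.re| := by
        have := abs_add_le (x - z.re) z.re
        rw [sub_add_cancel] at this
        nlinarith [abs_nonneg z.re]
      have h2 := hK (x + y * Complex.I) (by simpa using hstrip y hy)
      simp only [Complex.add_re, Complex.ofReal_re, Complex.mul_re, Complex.I_re, mul_zero,
        Complex.ofReal_im, Complex.I_im, mul_one, sub_self, add_zero] at h2
      rw [le_div_iff₀ (by positivity)] at h2
      rw [hDe _ hne, norm_div, div_mul_eq_mul_div, div_le_iff₀ (by linarith)]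
      calc ‖F (x + y * Complex.I)‖ * (1 + |x|) ^ 2
          = (‖F (x + y * Complex.I)‖ * (1 + |x|)) * (1 + |x|) := by ring
        _ ≤ K * ((B + 1) * |x - z.re|) := by gcongr
        _ = (K * (B + 1)) * |x - z.re| := by ring
        _ ≤ K' * ‖(x : ℂ) + y * Complex.I - z‖ := by
          refine mul_le_mul ?_ hn (abs_nonneg _) (by positivity)
          have : 0 ≤ |K₁| * (B + 1) ^ 2 := by positivity
          linarith
  have hint : ∀ y ∈ Set.Icc a b, Integrable fun x : ℝ => D (x + y * Complex.I) := by
    intro y hy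
    refine (integrable_inv_one_add_abs_sq.const_mul K').mono' ?_
      (ae_of_all _ fun x => hbound x y hy)
    exact (hDd.continuousOn.comp_continuous (by fun_prop)
      fun x => by simpa using hstrip y hy).aestronglyMeasurable
  have hto : ∀ l : Filter ℝ, Tendsto (fun x : ℝ => |x|) l atTop →
      Tendsto (fun x : ℝ => K' * ((1 + |x|) ^ 2)⁻¹) l (𝓝 0) := by
    intro l hl
    have h1 : Tendsto (fun x : ℝ => (1 + |x|) ^ 2) l atTop :=
      (tendsto_pow_atTop two_ne_zero).comp (tendsto_atTop_add_const_left _ _ hl)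
    simpa using h1.inv_tendsto_atTop.const_mul K'
  have heq : ∀ y : ℝ, cauchyLine F y z = ∫ x : ℝ, D (x + y * Complex.I) := by
    intro y
    refine integral_congr_ae ?_
    have : ∀ᵐ x : ℝ, x ≠ z.re := by simp [ae_iff, measure_singleton]
    filter_upwards [this] with x hx
    refine (hDe _ fun h => hx ?_).symm
    simpa using congrArg Complex.re h
  rw [heq, heq]
  exact integral_horizontal_eq hab (hDd.mono fun w hw => hstrip _ hw) hbound
    (hto _ tendsto_abs_atTop_atTop) (hto _ tendsto_abs_atBot_atTop)
    (hint a ⟨le_rfl, hab⟩) (hint b ⟨hab, le_rfl⟩)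

theorem integral_poissonKernel {p : ℝ} (hp : p ≠ 0) :
    (Integrable fun x : ℝ => p / (x ^ 2 + p ^ 2)) ∧
      ∫ x : ℝ, p / (x ^ 2 + p ^ 2) = |p| / p * Real.pi := by
  have h : (fun x : ℝ => p / (x ^ 2 + p ^ 2)) = fun x => p⁻¹ * (1 + (x / p) ^ 2)⁻¹ := by
    ext x
    have h1 : x ^ 2 + p ^ 2 ≠ 0 := by positivity
    have h2 : 1 + (x / p) ^ 2 ≠ 0 := by positivity
    field_simp
    ring
  rw [h]
  constructor
  · exact (integrable_inv_one_add_sq.comp_div hp).const_mul _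
  · rw [integral_const_mul, Measure.integral_comp_div (fun x : ℝ => (1 + x ^ 2)⁻¹) p,
      integral_univ_inv_one_add_sq, smul_eq_mul]
    ring

/-- Neither term is integrable alone. In the difference, the real part is odd and integrates to
zero, while the imaginary part is a difference of Poisson kernels. -/
theorem integral_inv_sub_inv {p q : ℝ} (hp : p ≠ 0) (hq : q ≠ 0) :
    (Integrable fun x : ℝ => 1 / ((x : ℂ) + p * Complex.I) - 1 / ((x : ℂ) + q * Complex.I)) ∧
    ∫ x : ℝ, (1 / ((x : ℂ) + p * Complex.I) - 1 / ((x : ℂ) + q * Complex.I)) =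
      -(Complex.I * Real.pi) * ((|p| / p - |q| / q : ℝ) : ℂ) := by
  obtain ⟨ip, ep⟩ := integral_poissonKernel hp
  obtain ⟨iq, eq⟩ := integral_poissonKernel hq
  set A : ℝ → ℝ := fun x => x * (q ^ 2 - p ^ 2) / ((x ^ 2 + p ^ 2) * (x ^ 2 + q ^ 2)) with hA
  have iA : Integrable A := by
    refine (iq.norm.const_mul (|q ^ 2 - p ^ 2| / (2 * |p| * |q|))).mono' ?_ (ae_of_all _ fun x => ?_)
    · exact (Continuous.div (by fun_prop) (by fun_prop)
        fun x => by positivity).aestronglyMeasurable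
    · have h1 : |x| * (2 * |p|) ≤ x ^ 2 + p ^ 2 := by
        nlinarith [sq_nonneg (|x| - |p|), sq_abs x, sq_abs p]
      have h3 : 0 < |p| := abs_pos.mpr hp
      have h4 : 0 < |q| := abs_pos.mpr hq
      simp only [hA, norm_div, norm_mul, Real.norm_eq_abs]
      rw [abs_of_pos (by positivity : 0 < x ^ 2 + p ^ 2),
        abs_of_pos (by positivity : 0 < x ^ 2 + q ^ 2)]
      rw [div_mul_div_comm, div_le_div_iff₀ (by positivity) (by positivity)]
      have h5 : 0 ≤ |q ^ 2 - p ^ 2| * |q| * (x ^ 2 + q ^ 2) := by positivity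
      nlinarith
  have oA : ∫ x, A x = 0 := by
    have h := integral_neg_eq_self A volume
    have h2 : ∫ x, A (-x) = -∫ x, A x := by
      rw [← integral_neg]
      congr 1
      ext x
      simp only [hA]
      ring
    linarith
  have hx : ∀ (r : ℝ), r ≠ 0 → ∀ x : ℝ, (x : ℂ) ^ 2 + (r : ℂ) ^ 2 ≠ 0 := by
    intro r hr x
    have : x ^ 2 + r ^ 2 ≠ 0 := by positivity
    exact_mod_cast this
  have hinv : ∀ (r : ℝ), r ≠ 0 → ∀ x : ℝ, 1 / ((x : ℂ) + r * Complex.I) =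
      (x - r * Complex.I) / ((x : ℂ) ^ 2 + (r : ℂ) ^ 2) := by
    intro r hr x
    have h1 : (x : ℂ) + r * Complex.I ≠ 0 := by
      simpa using line_sub_ne_zero (z := 0) (b := r) (by simpa using hr.symm) x
    rw [div_eq_div_iff h1 (hx r hr x)]
    linear_combination (r : ℂ) ^ 2 * Complex.I_sq
  have hpt : ∀ x : ℝ, (1 / ((x : ℂ) + p * Complex.I) - 1 / ((x : ℂ) + q * Complex.I)) =
      ((A x : ℝ) : ℂ) - Complex.I * ((p / (x ^ 2 + p ^ 2) - q / (x ^ 2 + q ^ 2) : ℝ) : ℂ) := by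
    intro x
    rw [hinv p hp, hinv q hq]
    have h1 := hx p hp x
    have h2 := hx q hq x
    simp only [hA]
    push_cast
    field_simp
    ring
  simp_rw [hpt]
  refine ⟨iA.ofReal.sub ((ip.sub iq).ofReal.const_mul _), ?_⟩
  rw [integral_sub iA.ofReal ((ip.sub iq).ofReal.const_mul _), integral_const_mul,
    integral_complex_ofReal, integral_complex_ofReal, oA, integral_sub ip iq, ep, eq]
  push_cast
  ring

/-- The jump of the Cauchy transform, in terms of its continuations across the line. -/
theorem StripHolo.cauchyLine_sub {δ : ℝ} {g : ℂ → ℂ} (hg : StripHolo δ g) {a b : ℝ} (ha : -δ < a)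
    (hb : b < δ) {z : ℂ} (haz : a < z.im) (hzb : z.im < b) :
    cauchyLine g a z - cauchyLine g b z = 2 * Real.pi * Complex.I * g z := by
  have hz : |z.im| < δ := abs_lt.mpr ⟨by linarith, by linarith⟩
  have hδ : 0 < δ := (abs_nonneg _).trans_lt hz
  have ha' : |a| < δ := abs_lt.mpr ⟨ha, by linarith⟩
  have hb' : |b| < δ := abs_lt.mpr ⟨by linarith, hb⟩
  -- The auxiliary function h has its pole at z − ic; since |Im(w − z)| < 2δ, this value of c keeps
  -- the pole outside the strip.
  set c : ℝ := 2 * δ + 1 with hc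
  set h : ℂ → ℂ := fun w => c * Complex.I / (w - z + c * Complex.I) with hh
  have him : ∀ w : ℂ, |w.im| < δ → 1 ≤ (w - z + c * Complex.I).im := by
    intro w hw
    rw [abs_lt] at hw hz
    simp only [Complex.add_im, Complex.sub_im, Complex.mul_im, Complex.ofReal_re, Complex.I_im,
      mul_one, Complex.ofReal_im, Complex.I_re, mul_zero, add_zero]
    linarith [hw.1, hz.2]
  have hne : ∀ w : ℂ, |w.im| < δ → w - z + c * Complex.I ≠ 0 := by
    intro w hw h0
    have := him w hw
    rw [h0, Complex.zero_im] at this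
    linarith
  have hhz : h z = 1 := by
    simp only [hh, sub_self, zero_add]
    exact div_self (by simpa using hne z hz)
  have hhd : DifferentiableOn ℂ h {w | |w.im| < δ} :=
    DifferentiableOn.div (by fun_prop) (by fun_prop) hne
  have hhb : ∀ w : ℂ, |w.im| < δ → ‖h w‖ ≤ (c * (2 + |z.re|)) / (1 + |w.re|) := by
    intro w hw
    have h1 := (le_abs_self _).trans (Complex.abs_im_le_norm (w - z + c * Complex.I))
    have h2 := Complex.abs_re_le_norm (w - z + c * Complex.I)
    have h3 := him w hw
    simp only [Complex.add_re, Complex.sub_re, Complex.mul_re, Complex.ofReal_re, Complex.I_re,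
      mul_zero, Complex.ofReal_im, Complex.I_im, mul_one, sub_self, add_zero] at h2
    have h4 := abs_add_le (w.re - z.re) z.re
    rw [sub_add_cancel] at h4
    have h5 : 0 < ‖w - z + c * Complex.I‖ := by linarith
    rw [hh]
    simp only [norm_div, norm_mul, Complex.norm_real, Complex.norm_I, mul_one, Real.norm_eq_abs]
    rw [abs_of_pos (by linarith : 0 < c), div_le_div_iff₀ h5 (by positivity), mul_assoc]
    refine mul_le_mul_of_nonneg_left ?_ (by linarith)
    nlinarith [abs_nonneg z.re]
  obtain ⟨C, hgb⟩ := hg.exists_norm_le_div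
  -- g − g(z)h vanishes at z, so its Cauchy transforms along both lines agree and only the explicit
  -- transform of h remains.
  have key := cauchyLine_eq_of_apply_eq_zero (F := fun w => g w - g z * h w)
    (K := C + ‖g z‖ * (c * (2 + |z.re|)))
    (hg.diff.sub (hhd.const_mul _)) (fun w hw => by
      rw [add_div, mul_div_assoc ‖g z‖]
      refine (norm_sub_le _ _).trans (add_le_add (hgb w hw) ?_)
      rw [norm_mul]
      exact mul_le_mul_of_nonneg_left (hhb w hw) (norm_nonneg _))
    (haz.trans hzb).le ha hb hz (by rw [hhz]; ring)
  have hline : ∀ y : ℝ, |y| < δ → z.im ≠ y →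
      Integrable (fun x : ℝ => h (x + y * Complex.I) / (x + y * Complex.I - z)) ∧
      cauchyLine h y z = -(Complex.I * Real.pi) *
        ((|y - z.im| / (y - z.im) - 1 : ℝ) : ℂ) := by
    intro y hy hyz
    -- Partial fractions: ic/((w−z)(w−z+ic)) = 1/(w−z) − 1/(w−z+ic).
    have hpt : ∀ x : ℝ, h (x + y * Complex.I) / (x + y * Complex.I - z) =
        1 / (((x - z.re : ℝ) : ℂ) + ((y - z.im : ℝ) : ℂ) * Complex.I) -
        1 / (((x - z.re : ℝ) : ℂ) + ((y - z.im + c : ℝ) : ℂ) * Complex.I) := by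
      intro x
      have h1 : (((x - z.re : ℝ) : ℂ) + ((y - z.im : ℝ) : ℂ) * Complex.I) =
          x + y * Complex.I - z := by
        conv_rhs => rw [← Complex.re_add_im z]
        push_cast
        ring
      have h2 : (((x - z.re : ℝ) : ℂ) + ((y - z.im + c : ℝ) : ℂ) * Complex.I) =
          x + y * Complex.I - z + c * Complex.I := by
        rw [← h1]
        push_cast
        ring
      have h3 := line_sub_ne_zero hyz x
      have h4 := hne (x + y * Complex.I) (by simpa using hy)
      rw [h1, h2, hh]
      simp only
      rw [div_div, div_sub_div _ _ h3 h4, mul_comm (_ - z + _ : ℂ)]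
      congr 1
      ring
    have hq : 0 < y - z.im + c := by
      rw [abs_lt] at hy hz
      linarith [hy.1, hz.2]
    obtain ⟨hi, he⟩ := integral_inv_sub_inv (sub_ne_zero.mpr hyz.symm) hq.ne'
    constructor
    · simp_rw [hpt]
      exact hi.comp_sub_right z.re
    · rw [cauchyLine]
      simp_rw [hpt]
      rw [integral_sub_right_eq_self (fun x : ℝ => 1 / ((x : ℂ) + ((y - z.im : ℝ) : ℂ) * Complex.I) -
        1 / ((x : ℂ) + ((y - z.im + c : ℝ) : ℂ) * Complex.I)) z.re,
        he, abs_of_pos hq, div_self hq.ne']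
  obtain ⟨ia, ea⟩ := hline a ha' haz.ne'
  obtain ⟨ib, eb⟩ := hline b hb' hzb.ne
  have hsplit : ∀ y : ℝ, |y| < δ → z.im ≠ y →
      Integrable (fun x : ℝ => h (x + y * Complex.I) / (x + y * Complex.I - z)) →
      cauchyLine (fun w => g w - g z * h w) y z = cauchyLine g y z - g z * cauchyLine h y z := by
    intro y hy hyz hi
    simp only [cauchyLine]
    rw [← integral_const_mul, ← integral_sub (hg.integrable_div hy hyz) (hi.const_mul _)]
    congr 1
    ext x
    ring
  rw [hsplit a ha' haz.ne' ia, hsplit b hb' hzb.ne ib, ea, eb] at key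
  rw [abs_of_neg (by linarith : a - z.im < 0), abs_of_pos (by linarith : 0 < b - z.im),
    neg_div, div_self (by linarith : a - z.im ≠ 0), div_self (by linarith : b - z.im ≠ 0)] at key
  push_cast at key
  linear_combination key

end

noncomputable section

/- The solution of the Riemann-Hilbert problem on the real line attached to the integrable kernel
`σ K`. -/

/-- The width 1 is below π/2, so the cosine is nonnegative; the poles of σ, at odd multiples of πi,
stay away. -/
theorem re_exp_neg_nonneg {w : ℂ} (hw : |w.im| ≤ 1) : 0 ≤ (Complex.exp (-w)).re := by
  rw [Complex.exp_re]
  refine mul_nonneg (Real.exp_pos _).le (Real.cos_nonneg_of_mem_Icc ?_)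
  have := Real.pi_gt_three
  rw [abs_le] at hw
  rw [Complex.neg_im]
  exact ⟨by linarith [hw.2], by linarith [hw.1]⟩

theorem one_le_norm_one_add_exp_neg {w : ℂ} (hw : |w.im| ≤ 1) : 1 ≤ ‖1 + Complex.exp (-w)‖ := by
  have h := (le_abs_self _).trans (Complex.abs_re_le_norm (1 + Complex.exp (-w)))
  rw [Complex.add_re, Complex.one_re] at h
  linarith [re_exp_neg_nonneg hw]

theorem one_add_exp_neg_ne_zero {w : ℂ} (hw : |w.im| ≤ 1) : 1 + Complex.exp (-w) ≠ 0 :=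
  norm_pos_iff.mp (one_pos.trans_le (one_le_norm_one_add_exp_neg hw))

theorem norm_sigmaC_le_one {w : ℂ} (hw : |w.im| ≤ 1) : ‖sigmaC w‖ ≤ 1 := by
  rw [sigmaC, norm_div, norm_one]
  exact div_le_one_of_le₀ (one_le_norm_one_add_exp_neg hw) (norm_nonneg _)

/-- Since Re e^{−w} ≥ 0, adding 1 cannot decrease the modulus of e^{−w}. -/
theorem norm_sigmaC_le_exp {w : ℂ} (hw : |w.im| ≤ 1) : ‖sigmaC w‖ ≤ Real.exp w.re := by
  have h1 : Real.exp (-w.re) ≤ ‖1 + Complex.exp (-w)‖ := by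
    have h2 : ‖Complex.exp (-w)‖ = Real.exp (-w.re) := by rw [Complex.norm_exp, Complex.neg_re]
    rw [← h2]
    rw [← sq_le_sq₀ (norm_nonneg _) (norm_nonneg _), Complex.sq_norm, Complex.sq_norm,
      Complex.normSq_apply, Complex.normSq_apply, Complex.add_re, Complex.add_im, Complex.one_re,
      Complex.one_im]
    nlinarith [re_exp_neg_nonneg hw]
  rw [sigmaC, norm_div, norm_one, div_le_iff₀ (by linarith [one_le_norm_one_add_exp_neg hw])]
  calc 1 = Real.exp w.re * Real.exp (-w.re) := by rw [← Real.exp_add]; simp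
    _ ≤ _ := by gcongr

theorem differentiableAt_sigmaC {w : ℂ} (hw : |w.im| ≤ 1) : DifferentiableAt ℂ sigmaC w := by
  unfold sigmaC
  exact (differentiableAt_const _).div (by fun_prop) (one_add_exp_neg_ne_zero hw)

theorem scaledArg_re (s T : ℝ) (z : ℂ) :
    (scaledArg s T z).re = T ^ (1 / 3 : ℝ) * (z.re + s) := by
  simp [scaledArg, -one_div]

theorem scaledArg_im (s T : ℝ) (z : ℂ) : (scaledArg s T z).im = T ^ (1 / 3 : ℝ) * z.im := by
  simp [scaledArg, -one_div]

theorem scaledArg_ofReal (s T x : ℝ) :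
    scaledArg s T x = ((T ^ (1 / 3 : ℝ) * (x + s) : ℝ) : ℂ) := by
  simp [scaledArg, -one_div]

theorem sigmaC_scaledArg_ofReal (s T x : ℝ) :
    sigmaC (scaledArg s T x) = ((airyWeight s T x : ℝ) : ℂ) := by
  rw [scaledArg_ofReal, sigmaC_ofReal, airyWeight]

theorem conj_sigmaC (w : ℂ) : (starRingEnd ℂ) (sigmaC w) = sigmaC ((starRingEnd ℂ) w) := by
  simp [sigmaC, ← Complex.exp_conj]

theorem conj_scaledArg (s T : ℝ) (z : ℂ) :
    (starRingEnd ℂ) (scaledArg s T z) = scaledArg s T ((starRingEnd ℂ) z) := by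
  simp [scaledArg, -one_div]

theorem conj_invOneSubSigma (w : ℂ) :
    (starRingEnd ℂ) (invOneSubSigma w) = invOneSubSigma ((starRingEnd ℂ) w) := by
  simp [invOneSubSigma, ← Complex.exp_conj]

/-- The half-width of a strip in which `σ (T ^ (1/3) (z + s))` is holomorphic. -/
def sigmaStrip (T : ℝ) : ℝ := (T ^ (1 / 3 : ℝ))⁻¹

theorem sigmaStrip_pos {T : ℝ} (hT : 0 < T) : 0 < sigmaStrip T :=
  inv_pos.mpr (Real.rpow_pos_of_pos hT _)

theorem abs_scaledArg_im_le {s T : ℝ} (hT : 0 < T) {z : ℂ} (hz : |z.im| < sigmaStrip T) :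
    |(scaledArg s T z).im| ≤ 1 := by
  have hτ : 0 < T ^ (1 / 3 : ℝ) := Real.rpow_pos_of_pos hT _
  rw [scaledArg_im, abs_mul, abs_of_pos hτ]
  calc _ ≤ T ^ (1 / 3 : ℝ) * sigmaStrip T := by gcongr
    _ = 1 := mul_inv_cancel₀ hτ.ne'

/-- On the right f decays by itself; on the left σ decays at rate τ, twice the growth rate allowed
for f. -/
theorem stripHolo_sigma_mul (s : ℝ) {T : ℝ} (hT : 0 < T) {f : ℂ → ℂ} (hf : Differentiable ℂ f)
    (hfd : StripDecay f) :
    StripHolo (sigmaStrip T) fun z => sigmaC (scaledArg s T z) * f z := by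
  have hτ : 0 < T ^ (1 / 3 : ℝ) := Real.rpow_pos_of_pos hT _
  set τ := T ^ (1 / 3 : ℝ) with hτd
  constructor
  · intro z hz
    have h1 : DifferentiableAt ℂ (scaledArg s T) z := by
      unfold scaledArg
      fun_prop
    exact (((differentiableAt_sigmaC (abs_scaledArg_im_le hT hz)).comp z h1).mul
      (hf z)).differentiableWithinAt
  · obtain ⟨C, hC, h⟩ := hfd (sigmaStrip T) (τ / 2) (half_pos hτ)
    refine ⟨τ / 2, C * Real.exp (τ * |s|), half_pos hτ, by positivity, fun z hz => ?_⟩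
    have him := abs_scaledArg_im_le (s := s) hT hz
    rw [norm_mul]
    have hs : 0 ≤ τ * |s| := by positivity
    rcases le_total 0 z.re with hre | hre
    · calc _ ≤ 1 * (C * Real.exp (-(τ / 2) * z.re)) :=
            mul_le_mul (norm_sigmaC_le_one him) (h z hz.le) (norm_nonneg _) one_pos.le
        _ ≤ Real.exp (τ * |s|) * (C * Real.exp (-(τ / 2) * z.re)) := by
          gcongr
          exact Real.one_le_exp hs
        _ = _ := by
          rw [abs_of_nonneg hre]
          ring
    · calc _ ≤ Real.exp (τ * (z.re + s)) * (C * Real.exp (-(τ / 2) * z.re)) :=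
            mul_le_mul ((norm_sigmaC_le_exp him).trans_eq (by rw [scaledArg_re])) (h z hz.le)
              (norm_nonneg _) (Real.exp_pos _).le
        _ = C * (Real.exp (τ * (z.re + s)) * Real.exp (-(τ / 2) * z.re)) := by ring
        _ ≤ C * (Real.exp (τ * |s|) * Real.exp (-(τ / 2) * |z.re|)) := by
          rw [← Real.exp_add, ← Real.exp_add, abs_of_nonpos hre]
          refine mul_le_mul_of_nonneg_left (Real.exp_le_exp.mpr ?_) hC
          nlinarith [le_abs_self s]
        _ = _ := by ring

theorem StripDecay.const_mul {f : ℂ → ℂ} (hf : StripDecay f) (a : ℂ) :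
    StripDecay fun z => a * f z := by
  intro A c hc
  obtain ⟨C, hC, h⟩ := hf A c hc
  refine ⟨‖a‖ * C, by positivity, fun z hz => ?_⟩
  rw [norm_mul, mul_assoc]
  exact mul_le_mul_of_nonneg_left (h z hz) (norm_nonneg _)

theorem conj_airyHalf (k : ℕ) (u : HalfLineL2) (z : ℂ) :
    (starRingEnd ℂ) (airyHalf k u z) = airyHalf k u ((starRingEnd ℂ) z) := by
  rw [airyHalf, ← integral_conj, airyHalf]
  simp only [map_mul, conj_airyD, Complex.conj_ofReal, map_add]

theorem conj_dressedC (s T : ℝ) (k : ℕ) (z : ℂ) :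
    (starRingEnd ℂ) (dressedC s T k z) = dressedC s T k ((starRingEnd ℂ) z) := by
  rw [dressedC, map_add, conj_airyD, conj_airyHalf, dressedC]

/-- The densities of the Cauchy transforms in the solution of the Riemann-Hilbert problem. -/
def airyDensity (s T : ℝ) (k l : ℕ) (z : ℂ) : ℂ :=
  sigmaC (scaledArg s T z) * (dressedC s T k z * airyD l z)

/-- The Cauchy transforms of the densities, continued from the upper half-plane. -/
def airyCauchy (s T : ℝ) (k l : ℕ) (z : ℂ) : ℂ :=
  cauchyLine (airyDensity s T k l) (-(sigmaStrip T / 2)) z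

section

variable {s T : ℝ}

theorem stripHolo_airyDensity (s : ℝ) {T : ℝ} (hT : 0 < T) (k l : ℕ) :
    StripHolo (sigmaStrip T) (airyDensity s T k l) :=
  stripHolo_sigma_mul s hT ((differentiable_dressedC s T k).mul (differentiable_airyD l))
    ((stripDecay_dressedC s T k).mul (stripDecay_airyD l))

theorem abs_neg_half_sigmaStrip_lt (hT : 0 < T) : |-(sigmaStrip T / 2)| < sigmaStrip T := by
  have := sigmaStrip_pos hT
  rw [abs_neg, abs_of_pos (by linarith)]
  linarith

/-- The line of integration lies below the real axis, so the transform is holomorphic on the closed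
upper half-plane. Boundary values on the real line are then ordinary values. -/
theorem differentiableAt_airyCauchy (s : ℝ) (hT : 0 < T) (k l : ℕ) {z : ℂ} (hz : 0 ≤ z.im) :
    DifferentiableAt ℂ (airyCauchy s T k l) z :=
  (stripHolo_airyDensity s hT k l).differentiableAt_cauchyLine (abs_neg_half_sigmaStrip_lt hT)
    (by linarith [sigmaStrip_pos hT])

theorem exists_norm_mul_airyCauchy_le (s : ℝ) (hT : 0 < T) (k l : ℕ) :
    ∃ C : ℝ, ∀ z : ℂ, 0 ≤ z.im → ‖z * airyCauchy s T k l z‖ ≤ C := by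
  obtain ⟨C, h⟩ := (stripHolo_airyDensity s hT k l).exists_norm_mul_cauchyLine_le
    (abs_neg_half_sigmaStrip_lt hT) (half_pos (sigmaStrip_pos hT))
  refine ⟨C, fun z hz => h z ?_⟩
  have := sigmaStrip_pos hT
  rw [abs_of_neg (by linarith)]
  linarith

theorem conj_airyDensity (s T : ℝ) (k l : ℕ) (z : ℂ) :
    (starRingEnd ℂ) (airyDensity s T k l z) = airyDensity s T k l ((starRingEnd ℂ) z) := by
  simp only [airyDensity, map_mul, conj_sigmaC, conj_scaledArg, conj_dressedC, conj_airyD]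

/-- The densities are real on the real line, so reflection moves the line of integration to the
opposite height: the result is the continuation from below. -/
theorem conj_airyCauchy (s T : ℝ) (k l : ℕ) (z : ℂ) :
    (starRingEnd ℂ) (airyCauchy s T k l z) =
      cauchyLine (airyDensity s T k l) (sigmaStrip T / 2) ((starRingEnd ℂ) z) := by
  rw [airyCauchy, cauchyLine, ← integral_conj, cauchyLine]
  congr 1
  ext x
  rw [map_div₀, conj_airyDensity]
  simp [map_ofNat]

theorem airyCauchy_sub_conj (s : ℝ) (hT : 0 < T) (k l : ℕ) (x : ℝ) :
    airyCauchy s T k l x - (starRingEnd ℂ) (airyCauchy s T k l x) =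
      2 * Real.pi * Complex.I * airyDensity s T k l x := by
  have := sigmaStrip_pos hT
  rw [conj_airyCauchy, Complex.conj_ofReal]
  refine (stripHolo_airyDensity s hT k l).cauchyLine_sub ?_ ?_ ?_ ?_ <;>
    first
    | linarith
    | (rw [Complex.ofReal_im]; linarith)

/-- The integral equation for the dressed Airy functions in terms of Cauchy transforms. -/
theorem dressedC_eq_airyCauchy (s : ℝ) (hT : 0 < T) (k : ℕ) (x : ℝ) :
    dressedC s T k x = airyD k x - airyD 0 x * airyCauchy s T k 1 x +
      airyD 1 x * airyCauchy s T k 0 x := by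
  -- The combination of densities carrying the numerator of K(x,·). It vanishes at x, so the line
  -- can be moved onto the real axis without a principal value, where it becomes −∫ w K G_k.
  set F : ℂ → ℂ := fun z => sigmaC (scaledArg s T z) *
    (dressedC s T k z * (airyD 0 x * airyD 1 z + -airyD 1 x * airyD 0 z)) with hF
  have hFs : StripHolo (sigmaStrip T) F := stripHolo_sigma_mul s hT
    ((differentiable_dressedC s T k).mul (((differentiable_airyD 1).const_mul _).add
      ((differentiable_airyD 0).const_mul _)))
    ((stripDecay_dressedC s T k).mul (((stripDecay_airyD 1).const_mul _).add
      ((stripDecay_airyD 0).const_mul _)))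
  have hpos := sigmaStrip_pos hT
  obtain ⟨K, hK⟩ := hFs.exists_norm_le_div
  have h1 := cauchyLine_eq_of_apply_eq_zero hFs.diff hK (a := -(sigmaStrip T / 2)) (b := 0)
    (z := x) (by linarith) (by linarith) hpos (by simpa using hpos) (by rw [hF]; ring)
  have h2 : cauchyLine F 0 x =
      -∫ y : ℝ, ((airyWeight s T y * (airyKernel x y * dressedR s T k y) : ℝ) : ℂ) := by
    rw [cauchyLine, ← integral_neg]
    refine integral_congr_ae ?_
    have : ∀ᵐ y : ℝ, y ≠ x := by simp [ae_iff, measure_singleton]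
    filter_upwards [this] with y hy
    have hne : (y : ℂ) - x ≠ 0 := by
      rw [sub_ne_zero]
      exact_mod_cast hy
    have hk : ((x : ℂ) - y) * (airyKernel x y : ℂ) =
        airyD 0 x * airyD 1 y - airyD 1 x * airyD 0 y := by
      rw [← ofReal_airyR, ← ofReal_airyR, ← ofReal_airyR, ← ofReal_airyR]
      exact_mod_cast sub_mul_airyKernel x y
    simp only [hF, Complex.ofReal_zero, zero_mul, add_zero]
    rw [div_eq_iff hne, sigmaC_scaledArg_ofReal, ← ofReal_dressedR]
    push_cast
    linear_combination -(airyWeight s T y : ℂ) * (dressedR s T k y) * hk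
  have h3 : cauchyLine F (-(sigmaStrip T / 2)) x =
      airyD 0 x * airyCauchy s T k 1 x - airyD 1 x * airyCauchy s T k 0 x := by
    have hne : ((x : ℂ)).im ≠ -(sigmaStrip T / 2) := by
      rw [Complex.ofReal_im]
      linarith
    have hi := fun l => (stripHolo_airyDensity s hT k l).integrable_div
      (abs_neg_half_sigmaStrip_lt hT) hne
    simp only [airyCauchy, cauchyLine]
    rw [← integral_const_mul, ← integral_const_mul,
      ← integral_sub ((hi 1).const_mul _) ((hi 0).const_mul _)]
    congr 1
    ext y
    simp only [hF, airyDensity]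
    ring
  have h4 := congrArg (fun r : ℝ => (r : ℂ)) (dressedR_eq (s := s) hT k x)
  simp only [Complex.ofReal_add, ofReal_dressedR, ofReal_airyR] at h4
  rw [← integral_complex_ofReal] at h4
  rw [h4]
  linear_combination h2 + h1 - h3

end

end

noncomputable section

/- The model solution built from Airy functions. -/

/-- The primitive twelfth root of unity `exp (-i π / 6)`. -/
def rootEps : ℂ := (Real.sqrt 3 / 2 : ℝ) - Complex.I / 2

theorem rootEps_re : rootEps.re = Real.sqrt 3 / 2 := by simp [rootEps]

theorem rootEps_im : rootEps.im = -(1 / 2) := by simp [rootEps]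

theorem rootEps_sq : rootEps ^ 2 = 1 - Complex.I * rootEps := by
  have h3 : (Real.sqrt 3) ^ 2 = 3 := Real.sq_sqrt (by norm_num)
  have h : ((Real.sqrt 3 : ℝ) : ℂ) ^ 2 = 3 := by exact_mod_cast h3
  rw [rootEps]
  push_cast
  linear_combination (1 / 4 : ℂ) * h - (1 / 4 : ℂ) * Complex.I_sq

theorem rootEps_pow_three : rootEps ^ 3 = -Complex.I := by
  linear_combination (rootEps - Complex.I) * rootEps_sq + rootEps * Complex.I_sq

theorem rootEps_pow_six : rootEps ^ 6 = -1 := by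
  linear_combination (rootEps ^ 3 - Complex.I) * rootEps_pow_three + Complex.I_sq

theorem rootEps_pow_four : rootEps ^ 4 = -Complex.I * rootEps := by
  linear_combination rootEps * rootEps_pow_three

theorem rootEps_ne_zero : rootEps ≠ 0 := by
  intro h
  have := rootEps_pow_six
  rw [h] at this
  norm_num at this

theorem norm_rootEps : ‖rootEps‖ = 1 := by
  have h : ‖rootEps‖ ^ 6 = 1 := by rw [← norm_pow, rootEps_pow_six, norm_neg, norm_one]
  exact (pow_eq_one_iff_of_nonneg (norm_nonneg _) (by norm_num)).mp h

/-- The constant `√(2 π)`. -/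
def airyNorm : ℂ := (Real.sqrt 2 : ℝ) * (Real.sqrt Real.pi : ℝ)

theorem sqrt_two_sq : ((Real.sqrt 2 : ℝ) : ℂ) ^ 2 = 2 := by
  exact_mod_cast Real.sq_sqrt (by norm_num : (0 : ℝ) ≤ 2)

theorem sqrt_pi_sq : ((Real.sqrt Real.pi : ℝ) : ℂ) ^ 2 = Real.pi := by
  exact_mod_cast Real.sq_sqrt Real.pi_pos.le

theorem sqrt_two_ne_zero : ((Real.sqrt 2 : ℝ) : ℂ) ≠ 0 := by
  intro h
  have := sqrt_two_sq
  rw [h] at this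
  norm_num at this

theorem sqrt_pi_ne_zero : ((Real.sqrt Real.pi : ℝ) : ℂ) ≠ 0 := by
  exact_mod_cast (Real.sqrt_pos.mpr Real.pi_pos).ne'

theorem airyNorm_sq : airyNorm ^ 2 = 2 * Real.pi := by
  rw [airyNorm, mul_pow, sqrt_two_sq, sqrt_pi_sq]

theorem conj_airyNorm : (starRingEnd ℂ) airyNorm = airyNorm := by
  simp [airyNorm]

/-- The solution of the Airy equation which decays in the direction `exp (2 π i / 3)`. -/
def airyB (z : ℂ) : ℂ := airyNorm * rootEps * airyD 0 (rootEps ^ 4 * z)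

/-- The derivative of `airyB`. -/
def airyB' (z : ℂ) : ℂ := airyNorm * rootEps ^ 5 * airyD 1 (rootEps ^ 4 * z)

theorem hasDerivAt_airyD_const_mul (k : ℕ) (c z : ℂ) :
    HasDerivAt (fun z => airyD k (c * z)) (airyD (k + 1) (c * z) * c) z :=
  (hasDerivAt_airyD k (c * z)).comp z (by simpa using (hasDerivAt_id z).const_mul c)

theorem hasDerivAt_airyB (z : ℂ) : HasDerivAt airyB (airyB' z) z := by
  refine ((hasDerivAt_airyD_const_mul 0 (rootEps ^ 4) z).const_mul
    (airyNorm * rootEps)).congr_deriv ?_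
  rw [airyB']
  ring

theorem hasDerivAt_airyB' (z : ℂ) : HasDerivAt airyB' (z * airyB z) z := by
  refine ((hasDerivAt_airyD_const_mul 1 (rootEps ^ 4) z).const_mul
    (airyNorm * rootEps ^ 5)).congr_deriv ?_
  rw [airyB, airyD_two]
  linear_combination (airyNorm * rootEps * z * airyD 0 (rootEps ^ 4 * z) *
    (rootEps ^ 6 - 1)) * rootEps_pow_six

theorem one_add_rootEps : 1 + rootEps ^ 4 + (rootEps ^ 4) ^ 2 = 0 := by
  linear_combination rootEps_pow_four + (rootEps ^ 2) * rootEps_pow_six - rootEps_sq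

/-- The connection formula. -/
theorem airy_connection (z : ℂ) :
    -(airyNorm * Complex.I * airyD 0 z) - airyB z =
      -(airyNorm * Complex.I * rootEps ^ 2 * airyD 0 (rootEps ^ 8 * z)) := by
  have h := airyD_zero_connection one_add_rootEps z
  rw [← pow_mul] at h
  norm_num at h
  rw [airyB]
  linear_combination (-(airyNorm * Complex.I)) * h +
    (airyNorm * Complex.I * airyD 0 (rootEps ^ 4 * z)) * rootEps_pow_four -
    (airyNorm * rootEps * airyD 0 (rootEps ^ 4 * z)) * Complex.I_sq +
    (airyNorm * Complex.I * rootEps ^ 2 * airyD 0 (rootEps ^ 8 * z)) * rootEps_pow_six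

/-- The derivative of the connection formula, since both sides of that formula are the same
function. -/
theorem airy_connection_deriv (z : ℂ) :
    -(airyNorm * airyD 1 z) + Complex.I * airyB' z =
      airyNorm * rootEps ^ 4 * airyD 1 (rootEps ^ 8 * z) := by
  have h1 : HasDerivAt (fun z => -(airyNorm * Complex.I * airyD 0 z) - airyB z)
      (-(airyNorm * Complex.I * airyD 1 z) - airyB' z) z :=
    (((hasDerivAt_airyD 0 z).const_mul _).neg).sub (hasDerivAt_airyB z)
  have h2 : HasDerivAt (fun z => -(airyNorm * Complex.I * rootEps ^ 2 * airyD 0 (rootEps ^ 8 * z)))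
      (-(airyNorm * Complex.I * rootEps ^ 2 * (airyD 1 (rootEps ^ 8 * z) * rootEps ^ 8))) z :=
    ((hasDerivAt_airyD_const_mul 0 (rootEps ^ 8) z).const_mul _).neg
  simp_rw [airy_connection] at h1
  have h3 := h1.unique h2
  linear_combination (-Complex.I) * h3 - (airyNorm * airyD 1 z) * Complex.I_sq +
    (airyNorm * rootEps ^ 10 * airyD 1 (rootEps ^ 8 * z)) * Complex.I_sq -
    (airyNorm * rootEps ^ 4 * airyD 1 (rootEps ^ 8 * z)) * rootEps_pow_six

/-- On the unit circle conjugation is inversion, and iε² = ε⁻¹ because ε³ = −i; the polynomial form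
is convenient for algebra. -/
theorem conj_rootEps : (starRingEnd ℂ) rootEps = Complex.I * rootEps ^ 2 := by
  have h : (starRingEnd ℂ) rootEps = rootEps + Complex.I := by
    apply Complex.ext
    · rw [Complex.conj_re, Complex.add_re, rootEps_re, Complex.I_re, add_zero]
    · rw [Complex.conj_im, Complex.add_im, rootEps_im, Complex.I_im]
      norm_num
  rw [h, rootEps_sq]
  linear_combination rootEps * Complex.I_sq

theorem conj_rootEps_pow_four_mul (x : ℝ) :
    (starRingEnd ℂ) (rootEps ^ 4 * (x : ℂ)) = rootEps ^ 8 * x := by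
  rw [map_mul, map_pow, conj_rootEps, Complex.conj_ofReal]
  linear_combination (rootEps ^ 8 * x * (Complex.I ^ 2 - 1)) * Complex.I_sq

/-- The conjugate of `airyB` on the real line. -/
theorem conj_airyB (x : ℝ) :
    (starRingEnd ℂ) (airyB x) = airyB x + airyNorm * Complex.I * airyD 0 x := by
  have h := airy_connection x
  have h2 : (starRingEnd ℂ) (airyB x) =
      airyNorm * (Complex.I * rootEps ^ 2) * airyD 0 (rootEps ^ 8 * x) := by
    rw [airyB, map_mul, map_mul, conj_airyD, conj_rootEps_pow_four_mul, conj_airyNorm, conj_rootEps]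
  linear_combination h2 + h

theorem conj_airyB' (x : ℝ) :
    (starRingEnd ℂ) (airyB' x) = airyB' x + airyNorm * Complex.I * airyD 1 x := by
  have h := airy_connection_deriv x
  have h2 : (starRingEnd ℂ) (airyB' x) =
      airyNorm * (Complex.I * rootEps ^ 2) ^ 5 * airyD 1 (rootEps ^ 8 * x) := by
    rw [airyB', map_mul, map_mul, map_pow, conj_airyD, conj_rootEps_pow_four_mul, conj_airyNorm,
      conj_rootEps]
  linear_combination h2 + Complex.I * h - airyB' x * Complex.I_sq +
    (airyNorm * airyD 1 (rootEps ^ 8 * x) * Complex.I * rootEps ^ 4) * rootEps_pow_six +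
    (airyNorm * airyD 1 (rootEps ^ 8 * x) * Complex.I * rootEps ^ 10) *
      (Complex.I ^ 2 - 1) * Complex.I_sq

theorem airyNorm_div : airyNorm * (2 * (Real.sqrt Real.pi : ℂ))⁻¹ = ((Real.sqrt 2 : ℝ) : ℂ)⁻¹ := by
  have h1 := sqrt_two_ne_zero
  have h2 := sqrt_pi_ne_zero
  rw [airyNorm]
  field_simp
  exact sqrt_two_sq

/-- Asymptotics of `Ai` and `Ai'` at `m ^ 4`, solved for the functions. -/
theorem exists_airyD_asymptotics {κ : ℝ} (hκ : 0 < κ) :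
    ∃ C : ℝ, 0 ≤ C ∧ ∀ m : ℂ, 0 < m.re → κ * ‖m‖ ^ 2 ≤ (m ^ 2).re → ∃ α β : ℂ,
      ‖α‖ ≤ C / ‖m‖ ^ 6 ∧ ‖β‖ ≤ C / ‖m‖ ^ 6 ∧
      airyNorm * airyD 1 (m ^ 4) =
        -(((Real.sqrt 2 : ℝ) : ℂ)⁻¹ * m * Complex.exp (-(2 / 3) * m ^ 6) * (1 + α)) ∧
      airyNorm * airyD 0 (m ^ 4) =
        ((Real.sqrt 2 : ℝ) : ℂ)⁻¹ * m⁻¹ * Complex.exp (-(2 / 3) * m ^ 6) * (1 + β) := by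
  obtain ⟨C0, h0⟩ := exists_airyD_zero_asymptotics hκ
  obtain ⟨C1, h1⟩ := exists_airyD_one_asymptotics hκ
  refine ⟨max (max C0 C1) 0, le_max_right _ _, fun m hm hm2 =>
    ⟨_, _, (h1 m hm hm2).trans ?_, (h0 m hm hm2).trans ?_, ?_, ?_⟩⟩
  · gcongr
    exact (le_max_right _ _).trans (le_max_left _ _)
  · gcongr
    exact (le_max_left _ _).trans (le_max_left _ _)
  all_goals
    have hm0 : m ≠ 0 := by
      rintro rfl
      simp at hm
    have hp := sqrt_pi_ne_zero
    have he : Complex.exp (-(2 / 3) * m ^ 6) * Complex.exp (2 / 3 * m ^ 6) = 1 := by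
      rw [← Complex.exp_add]
      simp
    rw [add_sub_cancel, ← airyNorm_div]
    generalize Complex.exp (-(2 / 3) * m ^ 6) = e at he ⊢
    generalize Complex.exp (2 / 3 * m ^ 6) = e' at he ⊢
    field_simp
  · linear_combination -(airyNorm * airyD 1 (m ^ 4)) * he
  · linear_combination -(airyNorm * airyD 0 (m ^ 4)) * he

/-- Evaluate the asymptotics of Ai at mε: the sixth power changes sign, so the recessive exponential
of Ai becomes the dominant one. -/
theorem exists_airyB_asymptotics {κ : ℝ} (hκ : 0 < κ) :
    ∃ C : ℝ, 0 ≤ C ∧ ∀ m : ℂ, 0 < (m * rootEps).re → κ * ‖m‖ ^ 2 ≤ ((m * rootEps) ^ 2).re →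
      ∃ γ δ : ℂ, ‖γ‖ ≤ C / ‖m‖ ^ 6 ∧ ‖δ‖ ≤ C / ‖m‖ ^ 6 ∧
      airyB' (m ^ 4) = ((Real.sqrt 2 : ℝ) : ℂ)⁻¹ * m * Complex.exp (2 / 3 * m ^ 6) * (1 + γ) ∧
      airyB (m ^ 4) = ((Real.sqrt 2 : ℝ) : ℂ)⁻¹ * m⁻¹ * Complex.exp (2 / 3 * m ^ 6) * (1 + δ) := by
  obtain ⟨C, hC, h⟩ := exists_airyD_asymptotics hκ
  refine ⟨C, hC, fun m h1 h2 => ?_⟩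
  have hn : ‖m * rootEps‖ = ‖m‖ := by rw [norm_mul, norm_rootEps, mul_one]
  obtain ⟨γ, δ, hγ, hδ, e1, e2⟩ := h (m * rootEps) h1 (by rwa [hn])
  rw [hn] at hγ hδ
  have e4 : (m * rootEps) ^ 4 = rootEps ^ 4 * m ^ 4 := by ring
  have e6 : -(2 / 3) * (m * rootEps) ^ 6 = 2 / 3 * m ^ 6 := by
    linear_combination (-(2 / 3) * m ^ 6) * rootEps_pow_six
  rw [e4, e6] at e1 e2
  refine ⟨γ, δ, hγ, hδ, ?_, ?_⟩
  · rw [airyB']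
    linear_combination rootEps ^ 5 * e1 - (((Real.sqrt 2 : ℝ) : ℂ)⁻¹ * m *
      Complex.exp (2 / 3 * m ^ 6) * (1 + γ)) * rootEps_pow_six
  · rw [airyB]
    have h0 := rootEps_ne_zero
    have h3 : rootEps * (m * rootEps)⁻¹ = m⁻¹ := by
      rw [mul_inv, mul_left_comm, mul_inv_cancel₀ h0, mul_one]
    linear_combination rootEps * e2 + (((Real.sqrt 2 : ℝ) : ℂ)⁻¹ *
      Complex.exp (2 / 3 * m ^ 6) * (1 + δ)) * h3

/-- By the connection formula the combination is Ai rotated by ε⁸. At mε² the sixth power is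
unchanged, so the exponential matches that of Ai but in a sector containing arguments near π. -/
theorem exists_airy_connection_asymptotics {κ : ℝ} (hκ : 0 < κ) :
    ∃ C : ℝ, 0 ≤ C ∧ ∀ m : ℂ, 0 < (m * rootEps ^ 2).re →
      κ * ‖m‖ ^ 2 ≤ ((m * rootEps ^ 2) ^ 2).re →
      ∃ α β : ℂ, ‖α‖ ≤ C / ‖m‖ ^ 6 ∧ ‖β‖ ≤ C / ‖m‖ ^ 6 ∧
      -(airyNorm * airyD 1 (m ^ 4)) + Complex.I * airyB' (m ^ 4) =
        ((Real.sqrt 2 : ℝ) : ℂ)⁻¹ * m * Complex.exp (-(2 / 3) * m ^ 6) * (1 + α) ∧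
      -(airyNorm * Complex.I * airyD 0 (m ^ 4)) - airyB (m ^ 4) =
        -(Complex.I * ((Real.sqrt 2 : ℝ) : ℂ)⁻¹ * m⁻¹ * Complex.exp (-(2 / 3) * m ^ 6) *
          (1 + β)) := by
  obtain ⟨C, hC, h⟩ := exists_airyD_asymptotics hκ
  refine ⟨C, hC, fun m h1 h2 => ?_⟩
  have hn : ‖m * rootEps ^ 2‖ = ‖m‖ := by rw [norm_mul, norm_pow, norm_rootEps, one_pow, mul_one]
  obtain ⟨α, β, hα, hβ, e1, e2⟩ := h (m * rootEps ^ 2) h1 (by rwa [hn])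
  rw [hn] at hα hβ
  have e4 : (m * rootEps ^ 2) ^ 4 = rootEps ^ 8 * m ^ 4 := by ring
  have e6 : (m * rootEps ^ 2) ^ 6 = m ^ 6 := by
    linear_combination (m ^ 6 * (rootEps ^ 6 - 1)) * rootEps_pow_six
  rw [e4, e6] at e1 e2
  refine ⟨α, β, hα, hβ, ?_, ?_⟩
  · rw [airy_connection_deriv]
    linear_combination rootEps ^ 4 * e1 - (((Real.sqrt 2 : ℝ) : ℂ)⁻¹ * m *
      Complex.exp (-(2 / 3) * m ^ 6) * (1 + α)) * rootEps_pow_six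
  · rw [airy_connection]
    have h0 := rootEps_ne_zero
    have h3 : rootEps ^ 2 * (m * rootEps ^ 2)⁻¹ = m⁻¹ := by
      rw [mul_inv, mul_left_comm, mul_inv_cancel₀ (pow_ne_zero _ h0), mul_one]
    linear_combination (-Complex.I * rootEps ^ 2) * e2 - (Complex.I * ((Real.sqrt 2 : ℝ) : ℂ)⁻¹ *
      Complex.exp (-(2 / 3) * m ^ 6) * (1 + β)) * h3

theorem norm_one_add_mul_sub_le {a b : ℂ} {ε : ℝ} (ha : ‖a‖ ≤ ε) (hb : ‖b‖ ≤ ε) :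
    ‖(1 + a) * (1 + b) - 1‖ ≤ 2 * ε + ε * ε := by
  have h : (1 + a) * (1 + b) - 1 = a + b + a * b := by ring
  rw [h]
  have hε : 0 ≤ ε := (norm_nonneg _).trans ha
  refine (norm_add_le _ _).trans (add_le_add ((norm_add_le _ _).trans (by linarith)) ?_)
  rw [norm_mul]
  exact mul_le_mul ha hb (norm_nonneg _) hε

/-- The Wronskian of `Ai` and `airyB`. -/
theorem airy_wronskian (z : ℂ) :
    airyNorm * (airyD 0 z * airyB' z - airyD 1 z * airyB z) = 1 := by
  set W : ℂ → ℂ := fun z => airyNorm * (airyD 0 z * airyB' z - airyD 1 z * airyB z) with hW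
  -- The Airy equation has no first-order term, so the Wronskian is constant; its value is read off
  -- from the asymptotics at t⁴ as t → +∞.
  have hd : ∀ z, HasDerivAt W 0 z := by
    intro z
    refine ((((hasDerivAt_airyD 0 z).mul (hasDerivAt_airyB' z)).sub
      ((hasDerivAt_airyD 1 z).mul (hasDerivAt_airyB z))).const_mul airyNorm).congr_deriv ?_
    rw [airyD_two]
    ring
  have hconst : ∀ w, W w = W z := fun w =>
    is_const_of_deriv_eq_zero (fun z => (hd z).differentiableAt) (fun z => (hd z).deriv) w z
  obtain ⟨C, hC, hA⟩ := exists_airyD_asymptotics (κ := 1 / 2) (by norm_num)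
  obtain ⟨D, hD, hB⟩ := exists_airyB_asymptotics (κ := 1 / 2) (by norm_num)
  have hlim : Tendsto (fun t : ℝ => 2 * ((C + D) / t ^ 6) + (C + D) / t ^ 6 * ((C + D) / t ^ 6))
      atTop (𝓝 0) := by
    have h : Tendsto (fun t : ℝ => (C + D) / t ^ 6) atTop (𝓝 0) :=
      tendsto_const_nhds.div_atTop (tendsto_pow_atTop (by norm_num))
    simpa using (h.const_mul 2).add (h.mul h)
  have hle : ∀ᶠ t : ℝ in atTop, ‖W z - 1‖ ≤
      2 * ((C + D) / t ^ 6) + (C + D) / t ^ 6 * ((C + D) / t ^ 6) := by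
    filter_upwards [eventually_gt_atTop 0] with t ht
    have hn : ‖(t : ℂ)‖ = t := by rw [Complex.norm_real, Real.norm_of_nonneg ht.le]
    have hre : ((t * rootEps) ^ 2 : ℂ).re = 1 / 2 * t ^ 2 := by
      have : (t * rootEps : ℂ) ^ 2 = ((t ^ 2 : ℝ) : ℂ) * (1 - Complex.I * rootEps) := by
        rw [mul_pow, rootEps_sq]
        push_cast
        ring
      rw [this, Complex.re_ofReal_mul]
      simp [rootEps_im]
      ring
    obtain ⟨α, β, hα, hβ, e1, e2⟩ := hA t (by simpa using ht) (by
      rw [hn, ← Complex.ofReal_pow, Complex.ofReal_re]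
      nlinarith)
    obtain ⟨γ, δ, hγ, hδ, e3, e4⟩ := hB t (by
      rw [Complex.re_ofReal_mul, rootEps_re]
      positivity) (by rw [hn, hre])
    rw [hn] at hα hβ hγ hδ
    have ht6 : 0 < t ^ 6 := by positivity
    have hle : ∀ {x : ℂ}, (‖x‖ ≤ C / t ^ 6 ∨ ‖x‖ ≤ D / t ^ 6) → ‖x‖ ≤ (C + D) / t ^ 6 := by
      rintro x (h | h)
      · exact h.trans (by gcongr; linarith)
      · exact h.trans (by gcongr; linarith)
    have hE : Complex.exp (-(2 / 3) * (t : ℂ) ^ 6) * Complex.exp (2 / 3 * (t : ℂ) ^ 6) = 1 := by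
      rw [← Complex.exp_add]
      simp
    have ht0 : (t : ℂ) * (t : ℂ)⁻¹ = 1 := mul_inv_cancel₀ (by exact_mod_cast ht.ne')
    have hq : (((Real.sqrt 2 : ℝ) : ℂ)⁻¹) ^ 2 = 1 / 2 := by
      rw [inv_pow, sqrt_two_sq]
      norm_num
    have key : W z - 1 = 1 / 2 * ((1 + β) * (1 + γ) - 1) + 1 / 2 * ((1 + α) * (1 + δ) - 1) := by
      rw [← hconst ((t : ℂ) ^ 4)]
      have hs : W ((t : ℂ) ^ 4) = (airyNorm * airyD 0 ((t : ℂ) ^ 4)) * airyB' ((t : ℂ) ^ 4) -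
          (airyNorm * airyD 1 ((t : ℂ) ^ 4)) * airyB ((t : ℂ) ^ 4) := by
        simp only [hW]
        ring
      rw [hs, e1, e2, e3, e4]
      generalize Complex.exp (-(2 / 3) * (t : ℂ) ^ 6) = e at hE ⊢
      generalize Complex.exp (2 / 3 * (t : ℂ) ^ 6) = e' at hE ⊢
      generalize ((Real.sqrt 2 : ℝ) : ℂ)⁻¹ = q at hq ⊢
      generalize (t : ℂ)⁻¹ = u at ht0 ⊢
      linear_combination ((1 + β) * (1 + γ) + (1 + α) * (1 + δ)) *
        (hq * (e * e' * t * u) + 1 / 2 * hE * (t * u) + 1 / 2 * ht0)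
    rw [key]
    refine (norm_add_le _ _).trans ?_
    rw [norm_mul, norm_mul]
    have n1 := norm_one_add_mul_sub_le (hle (Or.inl hβ)) (hle (Or.inr hγ))
    have n2 := norm_one_add_mul_sub_le (hle (Or.inl hα)) (hle (Or.inr hδ))
    have n3 : ‖(1 / 2 : ℂ)‖ = 1 / 2 := by norm_num
    rw [n3]
    linarith
  have := ge_of_tendsto hlim hle
  exact sub_eq_zero.mp (norm_le_zero_iff.mp this)

end

noncomputable section

/- Asymptotics of the model solution. -/

theorem matA_inv : matA⁻¹ = !![((Real.sqrt 2 : ℝ) : ℂ)⁻¹, -(Complex.I * ((Real.sqrt 2 : ℝ) : ℂ)⁻¹);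
    -(Complex.I * ((Real.sqrt 2 : ℝ) : ℂ)⁻¹), ((Real.sqrt 2 : ℝ) : ℂ)⁻¹] := by
  apply Matrix.inv_eq_right_inv
  have h : (((Real.sqrt 2 : ℝ) : ℂ)⁻¹) ^ 2 = 1 / 2 := by
    rw [inv_pow, sqrt_two_sq]
    norm_num
  rw [matA, one_div]
  generalize ((Real.sqrt 2 : ℝ) : ℂ)⁻¹ = q at h
  ext i j
  fin_cases i <;> fin_cases j <;> simp [Matrix.mul_apply, Fin.sum_univ_two]
  · linear_combination 2 * h - q ^ 2 * Complex.I_sq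
  · ring
  · ring
  · linear_combination 2 * h - q ^ 2 * Complex.I_sq

/-- The matrix `leadingAsymp (m ^ 4)`. -/
def leadingModel (m : ℂ) : Matrix (Fin 2) (Fin 2) ℂ :=
  !![((Real.sqrt 2 : ℝ) : ℂ)⁻¹ * m * Complex.exp (-(2 / 3) * m ^ 6),
      -(Complex.I * ((Real.sqrt 2 : ℝ) : ℂ)⁻¹ * m * Complex.exp (2 / 3 * m ^ 6));
    -(Complex.I * ((Real.sqrt 2 : ℝ) : ℂ)⁻¹ * m⁻¹ * Complex.exp (-(2 / 3) * m ^ 6)),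
      ((Real.sqrt 2 : ℝ) : ℂ)⁻¹ * m⁻¹ * Complex.exp (2 / 3 * m ^ 6)]

theorem leadingAsymp_eq (z : ℂ) : leadingAsymp z = leadingModel (z ^ (1 / 4 : ℂ)) := by
  have h1 : z ^ (-(1 / 4) : ℂ) = (z ^ (1 / 4 : ℂ))⁻¹ := Complex.cpow_neg _ _
  have h2 : z ^ (3 / 2 : ℂ) = (z ^ (1 / 4 : ℂ)) ^ 6 := by
    rw [← Complex.cpow_nat_mul]
    norm_num
  rw [leadingAsymp, matA_inv, h1, h2, leadingModel]
  ext i j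
  fin_cases i <;> fin_cases j <;> simp [Matrix.mul_apply, Fin.sum_univ_two, -one_div] <;> ring

theorem cpow_quarter_pow_four (z : ℂ) : (z ^ (1 / 4 : ℂ)) ^ 4 = z := by
  have := Complex.cpow_nat_inv_pow z (n := 4) (by norm_num)
  convert this using 3
  norm_num

theorem norm_cpow_quarter_pow_four (z : ℂ) : ‖z ^ (1 / 4 : ℂ)‖ ^ 4 = ‖z‖ := by
  rw [← norm_pow, cpow_quarter_pow_four]

/-- In the closed upper half-plane the argument is in [0, π], so that of the principal fourth root
is in [0, π/4]. -/
theorem cpow_quarter_mem {z : ℂ} (hz : z ≠ 0) (him : 0 ≤ z.im) :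
    0 < (z ^ (1 / 4 : ℂ)).re ∧ 0 ≤ (z ^ (1 / 4 : ℂ)).im ∧
      (z ^ (1 / 4 : ℂ)).im ≤ (z ^ (1 / 4 : ℂ)).re := by
  have hpi := Real.pi_pos
  have h0 : 0 ≤ z.arg := Complex.arg_nonneg_iff.mpr him
  have h1 : z.arg ≤ Real.pi := Complex.arg_le_pi z
  have hre : (Complex.log z * (1 / 4)).im = z.arg / 4 := by
    have : Complex.log z * (1 / 4) = ((1 / 4 : ℝ) : ℂ) * Complex.log z := by
      push_cast
      ring
    rw [this, Complex.im_ofReal_mul, Complex.log_im]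
    ring
  rw [Complex.cpow_def_of_ne_zero hz, Complex.exp_re, Complex.exp_im, hre]
  have hE := Real.exp_pos (Complex.log z * (1 / 4)).re
  refine ⟨mul_pos hE (Real.cos_pos_of_mem_Ioo ⟨by linarith, by linarith⟩),
    mul_nonneg hE.le (Real.sin_nonneg_of_nonneg_of_le_pi (by linarith) (by linarith)),
    mul_le_mul_of_nonneg_left ?_ hE.le⟩
  rw [← Real.sin_pi_div_two_sub]
  exact Real.sin_le_sin_of_le_of_le_pi_div_two (by linarith) (by linarith) (by linarith)

/-- Relative errors of the entries become a left factor 1 + E. The rows scale like m and m⁻¹, so the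
off-diagonal of E may lose a factor m²; an entrywise error of order |m|⁻⁶ thus becomes |m|⁻⁴ =
1/|z|. -/
theorem exists_eq_one_add_mul_leadingModel {m α β γ δ : ℂ} {ε : ℝ} (hm : 1 ≤ ‖m‖)
    (hα : ‖α‖ ≤ ε) (hβ : ‖β‖ ≤ ε) (hγ : ‖γ‖ ≤ ε) (hδ : ‖δ‖ ≤ ε)
    {P : Matrix (Fin 2) (Fin 2) ℂ}
    (h00 : P 0 0 = ((Real.sqrt 2 : ℝ) : ℂ)⁻¹ * m * Complex.exp (-(2 / 3) * m ^ 6) * (1 + α))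
    (h01 : P 0 1 = -(Complex.I * ((Real.sqrt 2 : ℝ) : ℂ)⁻¹ * m * Complex.exp (2 / 3 * m ^ 6) *
      (1 + γ)))
    (h10 : P 1 0 = -(Complex.I * ((Real.sqrt 2 : ℝ) : ℂ)⁻¹ * m⁻¹ *
      Complex.exp (-(2 / 3) * m ^ 6) * (1 + β)))
    (h11 : P 1 1 = ((Real.sqrt 2 : ℝ) : ℂ)⁻¹ * m⁻¹ * Complex.exp (2 / 3 * m ^ 6) * (1 + δ)) :
    ∃ E : Matrix (Fin 2) (Fin 2) ℂ, P = (1 + E) * leadingModel m ∧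
      ∀ i j, ‖E i j‖ ≤ ε * ‖m‖ ^ 2 := by
  have hm0 : m ≠ 0 := norm_pos_iff.mp (by linarith)
  have hε : 0 ≤ ε := (norm_nonneg _).trans hα
  have hm2 : 1 ≤ ‖m‖ ^ 2 := one_le_pow₀ hm
  have hhalf : ‖(1 / 2 : ℂ)‖ = 1 / 2 := by norm_num
  have hadd : ∀ {x y : ℂ}, ‖x‖ ≤ ε → ‖y‖ ≤ ε → ‖1 / 2 * (x + y)‖ ≤ ε := by
    intro x y hx hy
    rw [norm_mul, hhalf]
    linarith [norm_add_le x y]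
  have hsub : ∀ {x y : ℂ}, ‖x‖ ≤ ε → ‖y‖ ≤ ε → ‖1 / 2 * (x - y)‖ ≤ ε := by
    intro x y hx hy
    rw [norm_mul, hhalf]
    linarith [norm_sub_le x y]
  refine ⟨!![1 / 2 * (α + γ), Complex.I * m ^ 2 * (1 / 2 * (α - γ));
    -(Complex.I * (m⁻¹) ^ 2 * (1 / 2 * (β - δ))), 1 / 2 * (β + δ)], ?_, ?_⟩
  · have hmi : m * m⁻¹ = 1 := mul_inv_cancel₀ hm0
    rw [leadingModel]
    generalize Complex.exp (-(2 / 3) * m ^ 6) = e at *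
    generalize Complex.exp (2 / 3 * m ^ 6) = e' at *
    generalize ((Real.sqrt 2 : ℝ) : ℂ)⁻¹ = q at *
    generalize m⁻¹ = u at *
    ext i j
    fin_cases i <;> fin_cases j <;>
      simp only [Matrix.mul_apply, Fin.sum_univ_two, Matrix.add_apply, Matrix.one_apply,
        Matrix.of_apply, Matrix.cons_val', Matrix.cons_val_zero, Matrix.cons_val_one,
        Fin.zero_eta, Fin.mk_one, Fin.isValue, Matrix.cons_val_fin_one, h00, h01, h10, h11,
        if_true, zero_ne_one, one_ne_zero, if_false]
    · linear_combination (1 / 2 * (α - γ) * q * e * m ^ 2 * u) * Complex.I_sq -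
        (1 / 2 * (α - γ) * q * e * m) * hmi
    · linear_combination -(1 / 2 * (α - γ) * q * e' * m * Complex.I) * hmi
    · linear_combination (1 / 2 * (β - δ) * q * e * u * Complex.I) * hmi
    · linear_combination -(1 / 2 * (β - δ) * q * e' * u ^ 2 * m) * Complex.I_sq +
        (1 / 2 * (β - δ) * q * e' * u) * hmi
  · have hle : ε ≤ ε * ‖m‖ ^ 2 := le_mul_of_one_le_right hε hm2
    have hmi : ‖m⁻¹‖ ^ 2 ≤ 1 := by
      rw [norm_inv]
      exact pow_le_one₀ (by positivity) (inv_le_one_of_one_le₀ hm)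
    intro i j
    fin_cases i <;> fin_cases j <;>
      simp only [Matrix.of_apply, Matrix.cons_val', Matrix.cons_val_zero, Matrix.cons_val_one,
        Fin.zero_eta, Fin.mk_one, Fin.isValue, Matrix.cons_val_fin_one]
    · exact (hadd hα hγ).trans hle
    · rw [norm_mul, norm_mul, Complex.norm_I, one_mul, norm_pow, mul_comm]
      exact mul_le_mul_of_nonneg_right (hsub hα hγ) (by positivity)
    · rw [norm_neg, norm_mul, norm_mul, Complex.norm_I, one_mul, norm_pow]
      refine ((mul_le_of_le_one_left (norm_nonneg _) hmi).trans (hsub hβ hδ)).trans hle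
    · exact (hadd hβ hδ).trans hle

/-- The model solution, continued from the upper half-plane, for `Re z > ζ₀`. -/
def airyPhi (z : ℂ) : Matrix (Fin 2) (Fin 2) ℂ :=
  !![-(airyNorm * airyD 1 z), -(Complex.I * airyB' z);
    -(airyNorm * Complex.I * airyD 0 z), airyB z]

/-- The inverse of the jump matrix on the vertical rays. -/
def jumpVertInv (s T : ℝ) (z : ℂ) : Matrix (Fin 2) (Fin 2) ℂ :=
  !![1, 0; -invOneSubSigma (scaledArg s T z), 1]

/-- Here p + iq = √z. If Re z ≤ −|z|/2 the term τ Re z decays and Re z^{3/2} ≤ 0. Otherwise Re z is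
bounded above, p ≥ 1/2, and Re z^{3/2} ≤ −|z|/4 does the work. -/
theorem exponent_le {τ s ζ₀ p q : ℝ} (hτ : 0 < τ) (hp : 0 ≤ p) (hx : p ^ 2 - q ^ 2 ≤ ζ₀)
    (h1 : 1 ≤ p ^ 2 + q ^ 2) (h2 : 4 * |ζ₀| ≤ p ^ 2 + q ^ 2) :
    τ * (p ^ 2 - q ^ 2 + s) + 4 / 3 * (p ^ 3 - 3 * p * q ^ 2) ≤
      τ * (|ζ₀| + |s|) - min (τ / 2) (1 / 3) * (p ^ 2 + q ^ 2) := by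
  have hs := le_abs_self s
  have hz := le_abs_self ζ₀
  have hz0 := abs_nonneg ζ₀
  rcases le_or_gt (p ^ 2 - q ^ 2) (-(p ^ 2 + q ^ 2) / 2) with hc | hc
  · have e1 : p ^ 3 - 3 * p * q ^ 2 ≤ 0 := by nlinarith [sq_nonneg q]
    have e2 : min (τ / 2) (1 / 3) * (p ^ 2 + q ^ 2) ≤ τ / 2 * (p ^ 2 + q ^ 2) := by
      gcongr
      exact min_le_left _ _
    nlinarith
  · have e0 : 1 / 2 ≤ p := by nlinarith
    have e1 : p ^ 3 - 3 * p * q ^ 2 ≤ -(p ^ 2 + q ^ 2) / 4 := by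
      have : p ^ 2 - 3 * q ^ 2 ≤ -(p ^ 2 + q ^ 2) / 2 := by linarith
      nlinarith
    have e2 : min (τ / 2) (1 / 3) * (p ^ 2 + q ^ 2) ≤ 1 / 3 * (p ^ 2 + q ^ 2) := by
      gcongr
      exact min_le_right _ _
    have e3 : τ * (p ^ 2 - q ^ 2 + s) ≤ τ * (|ζ₀| + |s|) := by gcongr; linarith
    linarith

/-- Only a power of |z| is needed afterwards, so the exponential decay is traded for it through r² ≤
(4/c²)e^{cr}. -/
theorem exists_exp_decay_le {τ s ζ₀ : ℝ} (hτ : 0 < τ) :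
    ∃ C : ℝ, 0 ≤ C ∧ ∀ p q : ℝ, 0 ≤ p → p ^ 2 - q ^ 2 ≤ ζ₀ → 1 ≤ p ^ 2 + q ^ 2 →
      4 * |ζ₀| ≤ p ^ 2 + q ^ 2 →
      Real.exp (τ * (p ^ 2 - q ^ 2 + s) + 4 / 3 * (p ^ 3 - 3 * p * q ^ 2)) ≤
        C / (p ^ 2 + q ^ 2) ^ 2 := by
  set c : ℝ := min (τ / 2) (1 / 3) with hc
  have hc0 : 0 < c := lt_min (half_pos hτ) (by norm_num)
  refine ⟨Real.exp (τ * (|ζ₀| + |s|)) * (4 / c ^ 2), by positivity, fun p q hp hx h1 h2 => ?_⟩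
  have hr : 0 < p ^ 2 + q ^ 2 := by linarith
  rw [le_div_iff₀ (by positivity)]
  have e1 : (p ^ 2 + q ^ 2) ^ 2 ≤ 4 / c ^ 2 * Real.exp (c * (p ^ 2 + q ^ 2)) := by
    have h3 := Real.add_one_le_exp (c / 2 * (p ^ 2 + q ^ 2))
    have h4 : (c / 2 * (p ^ 2 + q ^ 2)) ^ 2 ≤ Real.exp (c / 2 * (p ^ 2 + q ^ 2)) ^ 2 :=
      pow_le_pow_left₀ (by positivity) (by linarith) 2
    rw [← Real.exp_nat_mul] at h4
    have h5 : ((2 : ℕ) : ℝ) * (c / 2 * (p ^ 2 + q ^ 2)) = c * (p ^ 2 + q ^ 2) := by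
      push_cast
      ring
    rw [h5] at h4
    calc (p ^ 2 + q ^ 2) ^ 2 = 4 / c ^ 2 * (c / 2 * (p ^ 2 + q ^ 2)) ^ 2 := by
          field_simp
          ring
      _ ≤ _ := by gcongr
  calc _ ≤ Real.exp (τ * (|ζ₀| + |s|) - c * (p ^ 2 + q ^ 2)) *
        (4 / c ^ 2 * Real.exp (c * (p ^ 2 + q ^ 2))) := by
        gcongr
        exact exponent_le hτ hp hx h1 h2
    _ = _ := by
      rw [mul_left_comm, ← Real.exp_add]
      rw [sub_add_cancel]
      ring

/-- Square root coordinates on the upper half-plane. -/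
theorem quarter_coordinates {m : ℂ} (h0 : 0 < m.re) (h1 : 0 ≤ m.im) (h2 : m.im ≤ m.re) :
    0 ≤ (m ^ 2).re ∧ 0 ≤ (m ^ 2).im ∧ ‖m‖ ^ 4 = (m ^ 2).re ^ 2 + (m ^ 2).im ^ 2 ∧
    (m ^ 4).re = (m ^ 2).re ^ 2 - (m ^ 2).im ^ 2 ∧
    (m ^ 6).re = (m ^ 2).re ^ 3 - 3 * (m ^ 2).re * (m ^ 2).im ^ 2 := by
  refine ⟨?_, ?_, ?_, ?_, ?_⟩
  · simp only [sq, Complex.mul_re]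
    nlinarith
  · simp only [sq, Complex.mul_im]
    nlinarith
  · have : ‖m‖ ^ 4 = ‖m ^ 2‖ ^ 2 := by
      rw [norm_pow]
      ring
    rw [this, Complex.sq_norm, Complex.normSq_apply]
    ring
  · have : m ^ 4 = m ^ 2 * m ^ 2 := by ring
    rw [this, Complex.mul_re]
    ring
  · have : m ^ 6 = m ^ 2 * (m ^ 2 * m ^ 2) := by ring
    rw [this, Complex.mul_re, Complex.mul_re, Complex.mul_im]
    ring

theorem mul_rootEps_sq_re (m : ℂ) :
    ((m * rootEps) ^ 2).re = (m ^ 2).re / 2 + Real.sqrt 3 / 2 * (m ^ 2).im := by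
  rw [mul_pow, rootEps_sq, Complex.mul_re]
  simp [rootEps_re, rootEps_im]
  ring

theorem mul_rootEps_pow_four_re (m : ℂ) :
    ((m * rootEps ^ 2) ^ 2).re = -(m ^ 2).re / 2 + Real.sqrt 3 / 2 * (m ^ 2).im := by
  have : (m * rootEps ^ 2) ^ 2 = m ^ 2 * (-Complex.I * rootEps) := by
    linear_combination m ^ 2 * rootEps_pow_four
  rw [this, Complex.mul_re]
  simp [rootEps_re, rootEps_im]
  ring

theorem mul_rootEps_sq_re' (m : ℂ) :
    (m * rootEps ^ 2).re = m.re / 2 + Real.sqrt 3 / 2 * m.im := by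
  rw [rootEps_sq, Complex.mul_re]
  simp [rootEps_re, rootEps_im]
  ring

theorem mul_rootEps_re (m : ℂ) :
    (m * rootEps).re = Real.sqrt 3 / 2 * m.re + m.im / 2 := by
  rw [Complex.mul_re, rootEps_re, rootEps_im]
  ring

end

/-! ### Asymptotics of the Airy model in the two upper sectors. -/

noncomputable section

/-- Writing the vertical jump entry as 1 + e^{T^{1/3}(z+s)}, the 1 turns Ai into the third Airy
function by the connection formula, and the exponential leaves a perturbation proportional to the
second column. -/
theorem airyPhi_mul_jumpVertInv (s T : ℝ) (z : ℂ) :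
    airyPhi z * jumpVertInv s T z =
      !![(-(airyNorm * airyD 1 z) + Complex.I * airyB' z) +
          Complex.I * Complex.exp (scaledArg s T z) * airyB' z, -(Complex.I * airyB' z);
        (-(airyNorm * Complex.I * airyD 0 z) - airyB z) -
          Complex.exp (scaledArg s T z) * airyB z, airyB z] := by
  rw [airyPhi, jumpVertInv, invOneSubSigma]
  ext i j
  fin_cases i <;> fin_cases j <;> simp [Matrix.mul_apply, Fin.sum_univ_two] <;> ring

/-- Three Airy solutions share the work: the second column uses the rotated function throughout, and
the first uses Ai on the right and the third Airy function on the left. The condition |z| ≥ 4|ζ₀|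
puts √z well inside the sector where each expansion holds, with common constant κ = 1/10. -/
theorem exists_airyPhi_asymptotics (s ζ₀ : ℝ) {T : ℝ} (hT : 0 < T) :
    ∃ C R : ℝ, 1 ≤ R ∧ 0 ≤ C ∧ ∀ z : ℂ, 0 < z.im → R ≤ ‖z‖ →
      (ζ₀ < z.re → ∃ E : Matrix (Fin 2) (Fin 2) ℂ, airyPhi z = (1 + E) * leadingAsymp z ∧
        ∀ i j, ‖E i j‖ ≤ C / ‖z‖) ∧
      (z.re ≤ ζ₀ → ∃ E : Matrix (Fin 2) (Fin 2) ℂ,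
        airyPhi z * jumpVertInv s T z = (1 + E) * leadingAsymp z ∧ ∀ i j, ‖E i j‖ ≤ C / ‖z‖) := by
  set τ : ℝ := T ^ (1 / 3 : ℝ) with hτ
  have hτ0 : 0 < τ := Real.rpow_pos_of_pos hT _
  have hκ : (0 : ℝ) < 1 / 10 := by norm_num
  obtain ⟨C₁, hC₁, h₁⟩ := exists_airyD_asymptotics hκ
  obtain ⟨C₂, hC₂, h₂⟩ := exists_airyB_asymptotics hκ
  obtain ⟨C₃, hC₃, h₃⟩ := exists_airy_connection_asymptotics hκ
  obtain ⟨C₄, hC₄, h₄⟩ := exists_exp_decay_le (s := s) (ζ₀ := ζ₀) hτ0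
  set C : ℝ := C₁ + C₂ + C₃ + C₄ * (1 + C₂) with hC
  have hC0 : 0 ≤ C := by positivity
  have hCC : 0 ≤ C₄ * (1 + C₂) := by positivity
  refine ⟨C, max 1 (4 * |ζ₀|), le_max_left _ _, hC0, fun z him hR => ?_⟩
  have hR1 : 1 ≤ ‖z‖ := (le_max_left _ _).trans hR
  have hR2 : 4 * |ζ₀| ≤ ‖z‖ := (le_max_right _ _).trans hR
  have hz0 : z ≠ 0 := norm_pos_iff.mp (by linarith)
  obtain ⟨hm1, hm2, hm3⟩ := cpow_quarter_mem hz0 him.le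
  have hm4 := cpow_quarter_pow_four z
  have hmn := norm_cpow_quarter_pow_four z
  rw [leadingAsymp_eq]
  generalize z ^ (1 / 4 : ℂ) = m at *
  obtain ⟨hp, hq, hr, hx, h6⟩ := quarter_coordinates hm1 hm2 hm3
  set p : ℝ := (m ^ 2).re with hpd
  set q : ℝ := (m ^ 2).im with hqd
  have hnorm : 1 ≤ ‖m‖ := by
    by_contra hlt
    push Not at hlt
    have := pow_lt_one₀ (norm_nonneg m) hlt (n := 4) (by norm_num)
    linarith
  rw [hm4] at hx
  set n : ℝ := ‖m‖ ^ 2 with hn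
  have hn0 : 0 ≤ n := by positivity
  have hn2 : n ^ 2 = p ^ 2 + q ^ 2 := by
    rw [← hr, hn]
    ring
  have hn4 : n ^ 2 = ‖z‖ := by
    rw [← hmn, hn]
    ring
  have hs3 : 17 / 10 ≤ Real.sqrt 3 := Real.le_sqrt_of_sq_le (by norm_num)
  have hsq : 17 / 10 * q ≤ Real.sqrt 3 * q := mul_le_mul_of_nonneg_right hs3 hq
  have hCdiv : ∀ {x : ℂ} {D : ℝ}, ‖x‖ ≤ D / ‖m‖ ^ 6 → D ≤ C → ‖x‖ ≤ C / ‖m‖ ^ 6 :=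
    fun h hD => h.trans (by gcongr)
  have hfin : C / ‖m‖ ^ 6 * ‖m‖ ^ 2 = C / ‖z‖ := by
    have : ‖m‖ ≠ 0 := by positivity
    rw [← hmn]
    field_simp
  obtain ⟨γ, δ, hγ, hδ, eB', eB⟩ := h₂ m (by
    rw [mul_rootEps_re]
    positivity) (by
    rw [mul_rootEps_sq_re, ← hpd, ← hqd, ← hn]
    have : n ≤ p + q := by
      rw [← sq_le_sq₀ hn0 (by positivity)]
      linarith [mul_nonneg hp hq, add_sq p q]
    linarith)
  rw [hm4] at eB eB'
  have e01 : -(Complex.I * airyB' z) = -(Complex.I * ((Real.sqrt 2 : ℝ) : ℂ)⁻¹ * m *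
      Complex.exp (2 / 3 * m ^ 6) * (1 + γ)) := by
    rw [eB']
    ring
  constructor
  · intro hre
    -- Re z > ζ₀ ≥ −n²/4 forces p² ≥ (3/8)n².
    have hpn : 6 / 10 * n ≤ p := by
      rw [← sq_le_sq₀ (by positivity) hp, mul_pow]
      linarith [neg_abs_le ζ₀]
    obtain ⟨α, β, hα, hβ, e1, e0⟩ := h₁ m hm1 (by
      rw [← hn, ← hpd]
      linarith)
    rw [hm4] at e1 e0
    have h := exists_eq_one_add_mul_leadingModel (P := airyPhi z) hnorm
      (hCdiv hα (by linarith)) (hCdiv hβ (by linarith)) (hCdiv hγ (by linarith))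
      (hCdiv hδ (by linarith))
      (by
        simp only [airyPhi, Matrix.of_apply, Matrix.cons_val', Matrix.cons_val_zero,
          Matrix.cons_val_fin_one, e1, neg_neg])
      (by simpa [airyPhi] using e01)
      (by
        simp only [airyPhi, Matrix.of_apply, Matrix.cons_val', Matrix.cons_val_zero,
          Matrix.cons_val_one, Matrix.cons_val_fin_one]
        linear_combination -Complex.I * e0)
      (by simpa [airyPhi] using eB)
    rwa [hfin] at h
  · intro hre
    -- Re z ≤ ζ₀ ≤ n²/4 forces q² ≥ (3/8)n² and p² ≤ (5/8)n², so that √3 q/2 − p/2 ≥ n/10.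
    have hqn : 6 / 10 * n ≤ q := by
      rw [← sq_le_sq₀ (by positivity) hq, mul_pow]
      linarith [le_abs_self ζ₀]
    have hpn : p ≤ 8 / 10 * n := by
      rw [← sq_le_sq₀ hp (by positivity), mul_pow]
      linarith [le_abs_self ζ₀]
    obtain ⟨α, β, hα, hβ, e1, e0⟩ := h₃ m (by
      rw [mul_rootEps_sq_re']
      positivity) (by
      rw [mul_rootEps_pow_four_re, ← hpd, ← hqd, ← hn]
      linarith)
    rw [hm4] at e1 e0
    -- The perturbation relative to the leading first column: the second column brings e^{(2/3)m⁶},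
    -- and dividing by e^{−(2/3)m⁶} squares it.
    have hw : ‖Complex.exp (scaledArg s T z) * Complex.exp (2 / 3 * m ^ 6) ^ 2‖ ≤
        C₄ / ‖m‖ ^ 6 := by
      have hexp : ‖Complex.exp (scaledArg s T z) * Complex.exp (2 / 3 * m ^ 6) ^ 2‖ =
          Real.exp (τ * (p ^ 2 - q ^ 2 + s) + 4 / 3 * (p ^ 3 - 3 * p * q ^ 2)) := by
        rw [← Complex.exp_nat_mul, ← Complex.exp_add, Complex.norm_exp, Complex.add_re,
          scaledArg_re, ← hx, ← h6]
        have : ((2 : ℕ) : ℂ) * (2 / 3 * m ^ 6) = ((4 / 3 : ℝ) : ℂ) * m ^ 6 := by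
          push_cast
          ring
        rw [this, Complex.re_ofReal_mul]
      rw [hexp]
      refine (h₄ p q hp (hx ▸ hre) (by linarith) (by linarith)).trans ?_
      have h8 : (p ^ 2 + q ^ 2) ^ 2 = ‖m‖ ^ 8 := by
        rw [← hr]
        ring
      rw [h8]
      refine div_le_div_of_nonneg_left hC₄ (by positivity) ?_
      exact pow_le_pow_right₀ hnorm (by norm_num)
    have hbig : ∀ {x : ℂ}, ‖x‖ ≤ C₂ / ‖m‖ ^ 6 → ‖1 + x‖ ≤ 1 + C₂ := by
      intro x hx
      refine (norm_add_le _ _).trans ?_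
      rw [norm_one]
      have : C₂ / ‖m‖ ^ 6 ≤ C₂ := div_le_self hC₂ (one_le_pow₀ hnorm)
      linarith
    have herr : ∀ {x y c : ℂ}, ‖x‖ ≤ C₃ / ‖m‖ ^ 6 → ‖y‖ ≤ C₂ / ‖m‖ ^ 6 → ‖c‖ = 1 →
        ‖x + c * (Complex.exp (scaledArg s T z) * Complex.exp (2 / 3 * m ^ 6) ^ 2) * (1 + y)‖ ≤
          C / ‖m‖ ^ 6 := by
      intro x y c hx hy hc
      refine (norm_add_le _ _).trans ?_
      rw [norm_mul, norm_mul, hc, one_mul]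
      calc _ ≤ C₃ / ‖m‖ ^ 6 + C₄ / ‖m‖ ^ 6 * (1 + C₂) :=
            add_le_add hx (mul_le_mul hw (hbig hy) (norm_nonneg _) (by positivity))
        _ = (C₃ + C₄ * (1 + C₂)) / ‖m‖ ^ 6 := by ring
        _ ≤ _ := by
          gcongr
          linarith
    have hE : Complex.exp (-(2 / 3) * m ^ 6) * Complex.exp (2 / 3 * m ^ 6) = 1 := by
      rw [← Complex.exp_add]
      simp
    rw [airyPhi_mul_jumpVertInv]
    have h := exists_eq_one_add_mul_leadingModel
      (P := !![(-(airyNorm * airyD 1 z) + Complex.I * airyB' z) +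
          Complex.I * Complex.exp (scaledArg s T z) * airyB' z, -(Complex.I * airyB' z);
        (-(airyNorm * Complex.I * airyD 0 z) - airyB z) -
          Complex.exp (scaledArg s T z) * airyB z, airyB z]) hnorm
      (herr hα hγ Complex.norm_I) (herr (c := -Complex.I) hβ hδ (by simp))
      (hCdiv hγ (by linarith)) (hCdiv hδ (by linarith))
      (by
        simp only [Matrix.of_apply, Matrix.cons_val', Matrix.cons_val_zero,
          Matrix.cons_val_fin_one]
        rw [e1, eB']
        generalize Complex.exp (-(2 / 3) * m ^ 6) = e at *
        generalize Complex.exp (2 / 3 * m ^ 6) = e' at *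
        linear_combination -(Complex.I * Complex.exp (scaledArg s T z) *
          ((Real.sqrt 2 : ℝ) : ℂ)⁻¹ * m * e' * (1 + γ)) * hE)
      (by simpa using e01)
      (by
        simp only [Matrix.of_apply, Matrix.cons_val', Matrix.cons_val_zero,
          Matrix.cons_val_one, Matrix.cons_val_fin_one]
        rw [e0, eB]
        generalize Complex.exp (-(2 / 3) * m ^ 6) = e at *
        generalize Complex.exp (2 / 3 * m ^ 6) = e' at *
        linear_combination (Complex.exp (scaledArg s T z) *
          ((Real.sqrt 2 : ℝ) : ℂ)⁻¹ * m⁻¹ * e' * (1 + δ)) * hE -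
          (Complex.exp (scaledArg s T z) * ((Real.sqrt 2 : ℝ) : ℂ)⁻¹ * m⁻¹ * e' ^ 2 * e *
            (1 + δ)) * Complex.I_sq)
      (by simpa using eB)
    rwa [hfin] at h

end

noncomputable section

/- The solution of the Riemann-Hilbert problem. -/

theorem tendsto_matrix {α : Type*} {l : Filter α} {f : α → Matrix (Fin 2) (Fin 2) ℂ}
    {A : Matrix (Fin 2) (Fin 2) ℂ} (h : ∀ i j, Tendsto (fun x => f x i j) l (𝓝 (A i j))) :
    Tendsto f l (𝓝 A) :=
  tendsto_pi_nhds.mpr fun i => tendsto_pi_nhds.mpr fun j => h i j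

/-- The map `M ↦ σ₃ (conj M) σ₃`. -/
def conjSigma (M : Matrix (Fin 2) (Fin 2) ℂ) : Matrix (Fin 2) (Fin 2) ℂ :=
  !![(starRingEnd ℂ) (M 0 0), -(starRingEnd ℂ) (M 0 1);
    -(starRingEnd ℂ) (M 1 0), (starRingEnd ℂ) (M 1 1)]

theorem conjSigma_mul (M N : Matrix (Fin 2) (Fin 2) ℂ) :
    conjSigma (M * N) = conjSigma M * conjSigma N := by
  ext i j
  fin_cases i <;> fin_cases j <;> simp [conjSigma, Matrix.mul_apply, Fin.sum_univ_two] <;> ring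

theorem norm_conjSigma_apply (M : Matrix (Fin 2) (Fin 2) ℂ) (i j : Fin 2) :
    ‖conjSigma M i j‖ = ‖M i j‖ := by
  fin_cases i <;> fin_cases j <;> simp [conjSigma]

theorem conjSigma_one_add (M : Matrix (Fin 2) (Fin 2) ℂ) :
    conjSigma (1 + M) = 1 + conjSigma M := by
  ext i j
  fin_cases i <;> fin_cases j <;> simp [conjSigma]

theorem continuous_conjSigma : Continuous conjSigma := by
  refine continuous_iff_continuousAt.mpr fun M => tendsto_matrix fun i j => ?_
  have h : ∀ i j, Tendsto (fun M : Matrix (Fin 2) (Fin 2) ℂ => (starRingEnd ℂ) (M i j)) (𝓝 M)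
      (𝓝 ((starRingEnd ℂ) (M i j))) := fun i j =>
    (Complex.continuous_conj.comp (continuous_apply_apply i j)).tendsto M
  fin_cases i <;> fin_cases j
  · exact h 0 0
  · exact (h 0 1).neg
  · exact (h 1 0).neg
  · exact h 1 1

theorem jumpVertInv_mul_jumpVert (s T : ℝ) (z : ℂ) : jumpVertInv s T z * jumpVert s T z = 1 := by
  ext i j
  fin_cases i <;> fin_cases j <;>
    simp [jumpVertInv, jumpVert, Matrix.mul_apply, Fin.sum_univ_two]

theorem conjSigma_jumpVertInv (s T : ℝ) (z : ℂ) :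
    conjSigma (jumpVertInv s T ((starRingEnd ℂ) z)) = jumpVert s T z := by
  ext i j
  fin_cases i <;> fin_cases j <;>
    simp [conjSigma, jumpVertInv, jumpVert, conj_invOneSubSigma, conj_scaledArg]

/-- The solution of the Riemann-Hilbert problem of the integrable kernel, continued from the upper
half-plane. -/
def airyY (s T : ℝ) (z : ℂ) : Matrix (Fin 2) (Fin 2) ℂ :=
  !![1 + airyCauchy s T 1 0 z, Complex.I * airyCauchy s T 1 1 z;
    Complex.I * airyCauchy s T 0 0 z, 1 - airyCauchy s T 0 1 z]

/-- The solution in the sector `Re z > ζ₀`, `Im z > 0`. -/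
def sectorRight (s T : ℝ) (z : ℂ) : Matrix (Fin 2) (Fin 2) ℂ := airyY s T z * airyPhi z

/-- The solution in the sector `Re z < ζ₀`, `Im z > 0`. -/
def sectorLeft (s T : ℝ) (z : ℂ) : Matrix (Fin 2) (Fin 2) ℂ := sectorRight s T z * jumpVertInv s T z

/-- The solution in the upper half-plane. -/
def upperSolution (s T ζ₀ : ℝ) (z : ℂ) : Matrix (Fin 2) (Fin 2) ℂ :=
  if ζ₀ < z.re then sectorRight s T z else sectorLeft s T z

/-- The solution of the Riemann-Hilbert problem. -/
def rhSolution (s T ζ₀ : ℝ) (z : ℂ) : Matrix (Fin 2) (Fin 2) ℂ :=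
  if 0 < z.im then upperSolution s T ζ₀ z
  else conjSigma (upperSolution s T ζ₀ ((starRingEnd ℂ) z))

section

variable {s T ζ₀ : ℝ}

theorem sectorRight_apply (s T : ℝ) (z : ℂ) :
    sectorRight s T z =
      !![(1 + airyCauchy s T 1 0 z) * -(airyNorm * airyD 1 z) +
          Complex.I * airyCauchy s T 1 1 z * -(airyNorm * Complex.I * airyD 0 z),
        (1 + airyCauchy s T 1 0 z) * -(Complex.I * airyB' z) +
          Complex.I * airyCauchy s T 1 1 z * airyB z;
        Complex.I * airyCauchy s T 0 0 z * -(airyNorm * airyD 1 z) +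
          (1 - airyCauchy s T 0 1 z) * -(airyNorm * Complex.I * airyD 0 z),
        Complex.I * airyCauchy s T 0 0 z * -(Complex.I * airyB' z) +
          (1 - airyCauchy s T 0 1 z) * airyB z] := by
  rw [sectorRight, airyY, airyPhi, Matrix.mul_fin_two]

theorem sectorLeft_apply (s T : ℝ) (z : ℂ) (i : Fin 2) :
    sectorLeft s T z i 0 = sectorRight s T z i 0 -
      invOneSubSigma (scaledArg s T z) * sectorRight s T z i 1 ∧
    sectorLeft s T z i 1 = sectorRight s T z i 1 := by
  constructor <;> simp [sectorLeft, jumpVertInv, Matrix.mul_apply, Fin.sum_univ_two]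
  ring

theorem differentiableAt_sectorRight (hT : 0 < T) {z : ℂ} (hz : 0 ≤ z.im) (i j : Fin 2) :
    DifferentiableAt ℂ (fun z => sectorRight s T z i j) z := by
  have h := fun k l => differentiableAt_airyCauchy s hT k l hz
  have h1 := fun k => (differentiable_airyD k) z
  have h2 := (hasDerivAt_airyB z).differentiableAt
  have h3 := (hasDerivAt_airyB' z).differentiableAt
  have h00 := h 0 0
  have h01 := h 0 1
  have h10 := h 1 0
  have h11 := h 1 1
  have a0 := h1 0
  have a1 := h1 1
  simp_rw [sectorRight_apply]
  fin_cases i <;> fin_cases j <;>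
    simp only [Matrix.of_apply, Matrix.cons_val', Matrix.cons_val_zero, Matrix.cons_val_one,
        Fin.zero_eta, Fin.mk_one, Fin.isValue, Matrix.cons_val_fin_one] <;> fun_prop

theorem differentiableAt_sectorLeft (hT : 0 < T) {z : ℂ} (hz : 0 ≤ z.im) (i j : Fin 2) :
    DifferentiableAt ℂ (fun z => sectorLeft s T z i j) z := by
  have h := fun i j => differentiableAt_sectorRight (s := s) hT hz i j
  have ha : DifferentiableAt ℂ (fun z => invOneSubSigma (scaledArg s T z)) z := by
    unfold invOneSubSigma scaledArg
    fun_prop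
  fin_cases j
  · simp only [Fin.zero_eta, (sectorLeft_apply s T _ i).1]
    exact (h i 0).sub (ha.mul (h i 1))
  · simp only [Fin.mk_one, (sectorLeft_apply s T _ i).2]
    exact h i 1

theorem continuousAt_sectorRight (hT : 0 < T) {z : ℂ} (hz : 0 ≤ z.im) :
    ContinuousAt (sectorRight s T) z :=
  tendsto_matrix fun i j => (differentiableAt_sectorRight hT hz i j).continuousAt

theorem continuousAt_sectorLeft (hT : 0 < T) {z : ℂ} (hz : 0 ≤ z.im) :
    ContinuousAt (sectorLeft s T) z :=
  tendsto_matrix fun i j => (differentiableAt_sectorLeft hT hz i j).continuousAt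

theorem sectorLeft_mul_jumpVert (s T : ℝ) (z : ℂ) :
    sectorLeft s T z * jumpVert s T z = sectorRight s T z := by
  rw [sectorLeft, mul_assoc, jumpVertInv_mul_jumpVert, mul_one]

theorem conjSigma_sectorLeft (s T : ℝ) (z : ℂ) :
    conjSigma (sectorLeft s T ((starRingEnd ℂ) z)) =
      conjSigma (sectorRight s T ((starRingEnd ℂ) z)) * jumpVert s T z := by
  rw [sectorLeft, conjSigma_mul, conjSigma_jumpVertInv]

/-- The Cauchy form of the integral equation is exactly this entry of YΦ: multiplying by the Airy
model dresses its first column. -/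
theorem sectorRight_zero_zero (hT : 0 < T) (x : ℝ) :
    sectorRight s T x 0 0 = -(airyNorm * dressedC s T 1 x) := by
  rw [sectorRight_apply, dressedC_eq_airyCauchy s hT]
  simp only [Matrix.of_apply, Matrix.cons_val', Matrix.cons_val_zero, Matrix.cons_val_fin_one]
  linear_combination -(airyCauchy s T 1 1 x * airyNorm * airyD 0 x) * Complex.I_sq

theorem sectorRight_one_zero (hT : 0 < T) (x : ℝ) :
    sectorRight s T x 1 0 = -(airyNorm * Complex.I * dressedC s T 0 x) := by
  rw [sectorRight_apply, dressedC_eq_airyCauchy s hT]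
  simp only [Matrix.of_apply, Matrix.cons_val', Matrix.cons_val_zero, Matrix.cons_val_one,
    Matrix.cons_val_fin_one]
  ring

theorem conj_dressedC_ofReal (s T : ℝ) (k : ℕ) (x : ℝ) :
    (starRingEnd ℂ) (dressedC s T k x) = dressedC s T k x := by
  rw [conj_dressedC, Complex.conj_ofReal]

theorem conj_airyCauchy_ofReal (hT : 0 < T) (k l : ℕ) (x : ℝ) :
    (starRingEnd ℂ) (airyCauchy s T k l x) = airyCauchy s T k l x -
      2 * Real.pi * Complex.I * (sigmaC (scaledArg s T x) * (dressedC s T k x * airyD l x)) := by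
  have h := airyCauchy_sub_conj s hT k l x
  rw [airyDensity] at h
  linear_combination -h

/-- The first column has no jump, since G₀ and G₁ are real on the line. In the second column the
connection formula contributes √(2π) times the dressed function, while the jump of Y contributes −w
times it after N² = 2π and the Wronskian; together they give 1 − σ. -/
theorem sectorRight_jump (hT : 0 < T) (x : ℝ) :
    sectorRight s T x = conjSigma (sectorRight s T x) * jumpRight s T x := by
  have h00 := sectorRight_zero_zero (s := s) hT x
  have h10 := sectorRight_one_zero (s := s) hT x
  have hW := airy_wronskian x
  have hr := airyNorm_sq
  have hc00 : (starRingEnd ℂ) (sectorRight s T x 0 0) = sectorRight s T x 0 0 := by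
    rw [h00, map_neg, map_mul, conj_airyNorm, conj_dressedC_ofReal]
  have hc10 : -(starRingEnd ℂ) (sectorRight s T x 1 0) = sectorRight s T x 1 0 := by
    rw [h10, map_neg, map_mul, map_mul, conj_airyNorm, conj_dressedC_ofReal, Complex.conj_I]
    ring
  have h01 : sectorRight s T x 0 1 = -(starRingEnd ℂ) (sectorRight s T x 0 1) +
      (1 - sigmaC (scaledArg s T x)) * sectorRight s T x 0 0 := by
    have hG := dressedC_eq_airyCauchy s hT 1 x
    rw [h00, sectorRight_apply]
    simp only [Matrix.of_apply, Matrix.cons_val', Matrix.cons_val_zero, Matrix.cons_val_one,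
      Matrix.cons_val_fin_one, map_add, map_mul, map_neg, map_one, Complex.conj_I, conj_airyB,
      conj_airyB', conj_airyCauchy_ofReal hT]
    set w := sigmaC (scaledArg s T x)
    set G := dressedC s T 1 x
    linear_combination airyNorm * hG -
      (w * G * (airyD 0 x * airyB' x - airyD 1 x * airyB x)) * hr + (airyNorm * w * G) * hW +
      (airyNorm * airyD 1 x * (1 + airyCauchy s T 1 0 x) -
        airyNorm * airyD 0 x * airyCauchy s T 1 1 x -
        2 * Real.pi * w * G * (airyD 0 x * airyB' x - airyD 1 x * airyB x)) * Complex.I_sq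
  have h11 : sectorRight s T x 1 1 = (starRingEnd ℂ) (sectorRight s T x 1 1) +
      (1 - sigmaC (scaledArg s T x)) * sectorRight s T x 1 0 := by
    have hG := dressedC_eq_airyCauchy s hT 0 x
    have e : sectorRight s T x 1 1 = airyCauchy s T 0 0 x * airyB' x +
        (1 - airyCauchy s T 0 1 x) * airyB x := by
      rw [sectorRight_apply]
      simp only [Matrix.of_apply, Matrix.cons_val', Matrix.cons_val_one, Matrix.cons_val_fin_one]
      linear_combination -(airyCauchy s T 0 0 x * airyB' x) * Complex.I_sq
    rw [h10, e]
    simp only [map_add, map_sub, map_mul, map_one, conj_airyB,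
      conj_airyB', conj_airyCauchy_ofReal hT]
    set w := sigmaC (scaledArg s T x)
    set G := dressedC s T 0 x
    linear_combination airyNorm * Complex.I * hG -
      (Complex.I * w * G * (airyD 0 x * airyB' x - airyD 1 x * airyB x)) * hr +
      (airyNorm * Complex.I * w * G) * hW
  ext i j
  fin_cases i <;> fin_cases j <;>
    simp only [conjSigma, jumpRight, Matrix.mul_apply, Fin.sum_univ_two, Matrix.of_apply,
      Matrix.cons_val', Matrix.cons_val_zero, Matrix.cons_val_one, Fin.zero_eta, Fin.mk_one,
      Fin.isValue, Matrix.cons_val_fin_one, hc00, hc10, mul_one, mul_zero, add_zero]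
  · linear_combination h01
  · linear_combination h11

theorem invOneSubSigma_mul_one_sub (s T x : ℝ) :
    invOneSubSigma (scaledArg s T x) * (1 - sigmaC (scaledArg s T x)) = 1 := by
  have him : |(scaledArg s T x).im| ≤ 1 := by
    rw [scaledArg_ofReal, Complex.ofReal_im, abs_zero]
    exact zero_le_one
  have h0 := one_add_exp_neg_ne_zero him
  have he : Complex.exp (scaledArg s T x) * Complex.exp (-scaledArg s T x) = 1 := by
    rw [← Complex.exp_add]
    simp
  rw [invOneSubSigma, sigmaC]
  generalize Complex.exp (scaledArg s T x) = e at *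
  generalize Complex.exp (-scaledArg s T x) = e' at *
  field_simp
  linear_combination he

/-- The left jump is the right jump conjugated by the triangular vertical jumps; the matrix identity
reduces to a(1 − σ) = 1. -/
theorem sectorLeft_jump (hT : 0 < T) (x : ℝ) :
    sectorLeft s T x = conjSigma (sectorLeft s T x) * jumpLeft s T x := by
  have h1 := conjSigma_sectorLeft s T x
  rw [Complex.conj_ofReal] at h1
  rw [h1, sectorLeft]
  conv_lhs => rw [sectorRight_jump hT]
  rw [mul_assoc, mul_assoc]
  congr 1
  have hw := invOneSubSigma_mul_one_sub s T x
  ext i j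
  fin_cases i <;> fin_cases j <;>
    simp [jumpRight, jumpLeft, jumpVert, jumpVertInv, Matrix.mul_apply, Fin.sum_univ_two] <;>
    first
    | linear_combination hw
    | linear_combination -hw

theorem rhSolution_right {z : ℂ} (h : 0 < z.im) (hr : ζ₀ < z.re) :
    rhSolution s T ζ₀ z = sectorRight s T z := by
  rw [rhSolution, if_pos h, upperSolution, if_pos hr]

theorem rhSolution_left {z : ℂ} (h : 0 < z.im) (hr : z.re < ζ₀) :
    rhSolution s T ζ₀ z = sectorLeft s T z := by
  rw [rhSolution, if_pos h, upperSolution, if_neg hr.le.not_gt]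

theorem rhSolution_right' {z : ℂ} (h : z.im < 0) (hr : ζ₀ < z.re) :
    rhSolution s T ζ₀ z = conjSigma (sectorRight s T ((starRingEnd ℂ) z)) := by
  rw [rhSolution, if_neg h.le.not_gt, upperSolution, if_pos (by simpa using hr)]

theorem rhSolution_left' {z : ℂ} (h : z.im < 0) (hr : z.re < ζ₀) :
    rhSolution s T ζ₀ z = conjSigma (sectorLeft s T ((starRingEnd ℂ) z)) := by
  rw [rhSolution, if_neg h.le.not_gt, upperSolution, if_neg (by simpa using hr.le)]

theorem continuousAt_conjSigma_conj {f : ℂ → Matrix (Fin 2) (Fin 2) ℂ} {z : ℂ}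
    (hf : ContinuousAt f ((starRingEnd ℂ) z)) :
    ContinuousAt (fun z => conjSigma (f ((starRingEnd ℂ) z))) z :=
  continuous_conjSigma.continuousAt.comp (hf.comp Complex.continuous_conj.continuousAt)

theorem differentiableAt_conjSigma_conj {f : ℂ → Matrix (Fin 2) (Fin 2) ℂ} {z : ℂ}
    (hf : ∀ i j, DifferentiableAt ℂ (fun z => f z i j) ((starRingEnd ℂ) z)) (i j : Fin 2) :
    DifferentiableAt ℂ (fun z => conjSigma (f ((starRingEnd ℂ) z)) i j) z := by
  have h : ∀ i j, DifferentiableAt ℂ (fun z => (starRingEnd ℂ) (f ((starRingEnd ℂ) z) i j)) z :=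
    fun i j => by
      have := (hf i j).conj_conj
      rwa [Complex.conj_conj] at this
  fin_cases i <;> fin_cases j
  · exact h 0 0
  · exact (h 0 1).neg
  · exact (h 1 0).neg
  · exact h 1 1

theorem tendsto_of_eqOn_inter {X Y : Type*} [TopologicalSpace X] [TopologicalSpace Y] {f g : X → Y}
    {P O : Set X} {z : X} (hO : IsOpen O) (hz : z ∈ O) (hfg : ∀ w ∈ O, w ∈ P → g w = f w)
    (hf : ContinuousAt f z) : Tendsto g (𝓝[P] z) (𝓝 (f z)) := by
  refine (hf.tendsto.mono_left nhdsWithin_le_nhds).congr' ?_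
  filter_upwards [self_mem_nhdsWithin, mem_nhdsWithin_of_mem_nhds (hO.mem_nhds hz)] with w h1 h2
  exact (hfg w h2 h1).symm

theorem differentiableOn_rhSolution (hT : 0 < T) (i j : Fin 2) :
    DifferentiableOn ℂ (fun z => rhSolution s T ζ₀ z i j) (crossContour ζ₀)ᶜ := by
  intro z hz
  simp only [crossContour, Set.mem_compl_iff, Set.mem_ofPred_eq, not_or] at hz
  refine DifferentiableAt.differentiableWithinAt ?_
  have hre : Continuous Complex.re := Complex.continuous_re
  have him : Continuous Complex.im := Complex.continuous_im
  rcases lt_or_gt_of_ne hz.1 with h1 | h1 <;> rcases lt_or_gt_of_ne hz.2 with h2 | h2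
  · refine (differentiableAt_conjSigma_conj (f := sectorLeft s T)
      (fun i j => differentiableAt_sectorLeft hT (by simpa using h1.le) i j) i j).congr_of_eventuallyEq ?_
    filter_upwards [(isOpen_lt him continuous_const).mem_nhds h1,
      (isOpen_lt hre continuous_const).mem_nhds h2] with w w1 w2
    rw [rhSolution_left' w1 w2]
  · refine (differentiableAt_conjSigma_conj (f := sectorRight s T)
      (fun i j => differentiableAt_sectorRight hT (by simpa using h1.le) i j) i j).congr_of_eventuallyEq ?_
    filter_upwards [(isOpen_lt him continuous_const).mem_nhds h1,
      (isOpen_lt continuous_const hre).mem_nhds h2] with w w1 w2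
    rw [rhSolution_right' w1 w2]
  · refine (differentiableAt_sectorLeft (s := s) hT (le_of_lt h1) i j).congr_of_eventuallyEq ?_
    filter_upwards [(isOpen_lt continuous_const him).mem_nhds h1,
      (isOpen_lt hre continuous_const).mem_nhds h2] with w w1 w2
    rw [rhSolution_left w1 w2]
  · refine (differentiableAt_sectorRight (s := s) hT (le_of_lt h1) i j).congr_of_eventuallyEq ?_
    filter_upwards [(isOpen_lt continuous_const him).mem_nhds h1,
      (isOpen_lt continuous_const hre).mem_nhds h2] with w w1 w2
    rw [rhSolution_right w1 w2]

theorem conj_cpow_quarter {z : ℂ} (hz : z.im ≠ 0) :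
    (starRingEnd ℂ) z ^ (1 / 4 : ℂ) = (starRingEnd ℂ) (z ^ (1 / 4 : ℂ)) := by
  have harg : z.arg ≠ Real.pi := fun h => hz (Complex.arg_eq_pi_iff.mp h).2
  rw [Complex.conj_cpow _ _ harg]
  simp [map_ofNat]

theorem conjSigma_leadingModel (m : ℂ) :
    conjSigma (leadingModel ((starRingEnd ℂ) m)) = leadingModel m := by
  ext i j
  fin_cases i <;> fin_cases j <;>
    simp [conjSigma, leadingModel, ← Complex.exp_conj, map_ofNat]

/-- The prescribed behaviour has the reflection symmetry used to define the solution, so upper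
half-plane estimates transfer to the lower one; principal branches commute with conjugation off the
real axis. -/
theorem conjSigma_leadingAsymp {z : ℂ} (hz : z.im ≠ 0) :
    conjSigma (leadingAsymp ((starRingEnd ℂ) z)) = leadingAsymp z := by
  rw [leadingAsymp_eq, leadingAsymp_eq, conj_cpow_quarter hz, conjSigma_leadingModel]

theorem exists_airyY_sub_one_le (s : ℝ) (hT : 0 < T) :
    ∃ C : ℝ, 0 ≤ C ∧ ∀ z : ℂ, 0 < z.im → ∀ i j, ‖(airyY s T z - 1) i j‖ ≤ C / ‖z‖ := by
  choose C hC using fun k l => exists_norm_mul_airyCauchy_le s hT k l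
  have hC0 : ∀ k l, 0 ≤ C k l := fun k l => (norm_nonneg _).trans (hC k l 0 le_rfl)
  refine ⟨C 0 0 + C 0 1 + C 1 0 + C 1 1, by linarith [hC0 0 0, hC0 0 1, hC0 1 0, hC0 1 1],
    fun z hz i j => ?_⟩
  have hz0 : 0 < ‖z‖ := norm_pos_iff.mpr (by rintro rfl; simp at hz)
  have h := fun k l => hC k l z hz.le
  simp only [norm_mul] at h
  rw [le_div_iff₀ hz0, mul_comm]
  have a00 := hC0 0 0
  have a01 := hC0 0 1
  have a10 := hC0 1 0
  have a11 := hC0 1 1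
  fin_cases i <;> fin_cases j <;> simp [airyY]
  · linarith [h 1 0]
  · linarith [h 1 1]
  · linarith [h 0 0]
  · linarith [h 0 1]

theorem norm_one_add_mul_sub_one_le {A B : Matrix (Fin 2) (Fin 2) ℂ} {a b : ℝ}
    (hA : ∀ i j, ‖A i j‖ ≤ a) (hB : ∀ i j, ‖B i j‖ ≤ b) (i j : Fin 2) :
    ‖((1 + A) * (1 + B) - 1) i j‖ ≤ a + b + 2 * a * b := by
  have h : (1 + A) * (1 + B) - 1 = A + B + A * B := by noncomm_ring
  have ha : 0 ≤ a := (norm_nonneg _).trans (hA 0 0)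
  have hm : ∀ k, ‖A i k * B k j‖ ≤ a * b := fun k => by
    rw [norm_mul]
    exact mul_le_mul (hA i k) (hB k j) (norm_nonneg _) ha
  rw [h, Matrix.add_apply, Matrix.add_apply, Matrix.mul_apply, Fin.sum_univ_two]
  calc _ ≤ ‖A i j‖ + ‖B i j‖ + (‖A i 0 * B 0 j‖ + ‖A i 1 * B 1 j‖) :=
        (norm_add_le _ _).trans (add_le_add (norm_add_le _ _) (norm_add_le _ _))
    _ ≤ _ := by linarith [hA i j, hB i j, hm 0, hm 1]

/-- Y = I + O(1/z) stands on the left of the model, so the two error factors multiply without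
interacting with the exponentials. -/
theorem exists_upperSolution_asymptotics (s ζ₀ : ℝ) (hT : 0 < T) :
    ∃ C R : ℝ, 1 ≤ R ∧ ∀ z : ℂ, 0 < z.im → R ≤ ‖z‖ →
      ∃ E : Matrix (Fin 2) (Fin 2) ℂ, upperSolution s T ζ₀ z = (1 + E) * leadingAsymp z ∧
        ∀ i j, ‖E i j‖ ≤ C / ‖z‖ := by
  obtain ⟨C, R, hR, hC, h⟩ := exists_airyPhi_asymptotics s ζ₀ hT
  obtain ⟨D, hD, hY⟩ := exists_airyY_sub_one_le s hT
  refine ⟨D + C + 2 * D * C, R, hR, fun z him hz => ?_⟩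
  have hz1 : 1 ≤ ‖z‖ := hR.trans hz
  have key : ∀ P : Matrix (Fin 2) (Fin 2) ℂ, (∃ E : Matrix (Fin 2) (Fin 2) ℂ,
      P = (1 + E) * leadingAsymp z ∧ ∀ i j, ‖E i j‖ ≤ C / ‖z‖) →
      ∃ E : Matrix (Fin 2) (Fin 2) ℂ, airyY s T z * P = (1 + E) * leadingAsymp z ∧
        ∀ i j, ‖E i j‖ ≤ (D + C + 2 * D * C) / ‖z‖ := by
    rintro P ⟨E, hE, hEb⟩
    refine ⟨(1 + (airyY s T z - 1)) * (1 + E) - 1, ?_, fun i j => ?_⟩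
    · rw [hE, add_sub_cancel, add_sub_cancel, mul_assoc]
    · refine (norm_one_add_mul_sub_one_le (hY z him) hEb i j).trans ?_
      have h1 : 2 * (D / ‖z‖) * (C / ‖z‖) ≤ 2 * D * C / ‖z‖ := by
        rw [mul_assoc, div_mul_div_comm, ← mul_div_assoc, mul_assoc]
        exact div_le_div_of_nonneg_left (by positivity) (by linarith) (by nlinarith)
      calc _ ≤ D / ‖z‖ + C / ‖z‖ + 2 * D * C / ‖z‖ := by linarith
        _ = _ := by ring
  obtain ⟨h1, h2⟩ := h z him hz
  rw [upperSolution]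
  split_ifs with hre
  · exact key _ (h1 hre)
  · rw [sectorLeft, sectorRight, mul_assoc]
    exact key _ (h2 (not_lt.mp hre))

theorem exists_rhSolution_asymptotics (s ζ₀ : ℝ) (hT : 0 < T) :
    ∃ C R : ℝ, 1 ≤ R ∧ ∀ z : ℂ, z.im ≠ 0 → R ≤ ‖z‖ →
      ∃ E : Matrix (Fin 2) (Fin 2) ℂ, rhSolution s T ζ₀ z = (1 + E) * leadingAsymp z ∧
        ∀ i j, ‖E i j‖ ≤ C / ‖z‖ := by
  obtain ⟨C, R, hR, h⟩ := exists_upperSolution_asymptotics s ζ₀ hT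
  refine ⟨C, R, hR, fun z him hz => ?_⟩
  rw [rhSolution]
  split_ifs with hpos
  · exact h z hpos hz
  · have hneg : z.im < 0 := lt_of_le_of_ne (not_lt.mp hpos) him
    obtain ⟨E, hE, hEb⟩ := h ((starRingEnd ℂ) z) (by simpa using hneg) (by simpa using hz)
    refine ⟨conjSigma E, ?_, fun i j => ?_⟩
    · rw [hE, conjSigma_mul, conjSigma_one_add, conjSigma_leadingAsymp him]
    · rw [norm_conjSigma_apply]
      simpa using hEb i j

theorem eventually_norm_apply_le {f : ℂ → Matrix (Fin 2) (Fin 2) ℂ} {z : ℂ}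
    (hf : ContinuousAt f z) :
    ∃ C : ℝ, ∀ᶠ w in 𝓝 z, ∀ i j, ‖f w i j‖ ≤ C := by
  have h : ∀ i j, Tendsto (fun w => ‖f w i j‖) (𝓝 z) (𝓝 ‖f z i j‖) := fun i j =>
    ((continuous_apply_apply i j).continuousAt.comp hf).norm
  refine ⟨∑ i, ∑ j, (‖f z i j‖ + 1), ?_⟩
  simp only [eventually_all]
  intro i j
  filter_upwards [(h i j).eventually_lt_const (lt_add_one _)] with w hw
  refine hw.le.trans ?_
  refine le_trans ?_ (Finset.single_le_sum (f := fun i => ∑ j, (‖f z i j‖ + 1))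
    (fun i _ => Finset.sum_nonneg fun j _ => by positivity) (Finset.mem_univ i))
  exact Finset.single_le_sum (f := fun j => (‖f z i j‖ + 1)) (fun j _ => by positivity)
    (Finset.mem_univ j)

/-- Each sector function is continuous on the whole closed half-plane, beyond its sector. Boundary
values and boundedness near ζ₀ are therefore immediate, and only the algebraic jump relations carry
content. -/
theorem isRHSolution_rhSolution (s ζ₀ : ℝ) (hT : 0 < T) :
    IsRHSolution s T ζ₀ (rhSolution s T ζ₀) where
  analytic i j := differentiableOn_rhSolution hT i j
  jump_up := by
    refine ⟨sectorRight s T, sectorLeft s T,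
      fun z hz => (continuousAt_sectorRight hT hz.2.le).continuousWithinAt,
      fun z hz => (continuousAt_sectorLeft hT hz.2.le).continuousWithinAt,
      fun z hz => tendsto_of_eqOn_inter (isOpen_lt continuous_const Complex.continuous_im) hz.2
        (fun w h1 h2 => rhSolution_right h1 h2) (continuousAt_sectorRight hT hz.2.le),
      fun z hz => tendsto_of_eqOn_inter (isOpen_lt continuous_const Complex.continuous_im) hz.2
        (fun w h1 h2 => rhSolution_left h1 h2) (continuousAt_sectorLeft hT hz.2.le),
      fun z _ => (sectorLeft_mul_jumpVert s T z).symm⟩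
  jump_down := by
    have hR : ∀ z : ℂ, z.im < 0 →
        ContinuousAt (fun z => conjSigma (sectorRight s T ((starRingEnd ℂ) z))) z := fun z hz =>
      continuousAt_conjSigma_conj (continuousAt_sectorRight hT (by simpa using hz.le))
    have hL : ∀ z : ℂ, z.im < 0 →
        ContinuousAt (fun z => conjSigma (sectorLeft s T ((starRingEnd ℂ) z))) z := fun z hz =>
      continuousAt_conjSigma_conj (continuousAt_sectorLeft hT (by simpa using hz.le))
    exact ⟨_, _, fun z hz => (hL z hz.2).continuousWithinAt,
      fun z hz => (hR z hz.2).continuousWithinAt,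
      fun z hz => tendsto_of_eqOn_inter (isOpen_lt Complex.continuous_im continuous_const) hz.2
        (fun w h1 h2 => rhSolution_left' h1 h2) (hL z hz.2),
      fun z hz => tendsto_of_eqOn_inter (isOpen_lt Complex.continuous_im continuous_const) hz.2
        (fun w h1 h2 => rhSolution_right' h1 h2) (hR z hz.2),
      fun z _ => conjSigma_sectorLeft s T z⟩
  jump_left := by
    have hL : ∀ z : ℂ, z.im = 0 →
        ContinuousAt (fun z => conjSigma (sectorLeft s T ((starRingEnd ℂ) z))) z := fun z hz =>
      continuousAt_conjSigma_conj (continuousAt_sectorLeft hT (by simp [hz]))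
    refine ⟨sectorLeft s T, _,
      fun z hz => (continuousAt_sectorLeft hT hz.1.ge).continuousWithinAt,
      fun z hz => (hL z hz.1).continuousWithinAt,
      fun z hz => tendsto_of_eqOn_inter (isOpen_lt Complex.continuous_re continuous_const) hz.2
        (fun w h1 h2 => rhSolution_left h2 h1) (continuousAt_sectorLeft hT hz.1.ge),
      fun z hz => tendsto_of_eqOn_inter (isOpen_lt Complex.continuous_re continuous_const) hz.2
        (fun w h1 h2 => rhSolution_left' h2 h1) (hL z hz.1), fun z hz => ?_⟩
    obtain ⟨x, rfl⟩ : ∃ x : ℝ, (x : ℂ) = z := ⟨z.re, Complex.ext (by simp) (by simp [hz.1])⟩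
    simp only [Complex.conj_ofReal]
    exact sectorLeft_jump hT x
  jump_right := by
    have hR : ∀ z : ℂ, z.im = 0 →
        ContinuousAt (fun z => conjSigma (sectorRight s T ((starRingEnd ℂ) z))) z := fun z hz =>
      continuousAt_conjSigma_conj (continuousAt_sectorRight hT (by simp [hz]))
    refine ⟨sectorRight s T, _,
      fun z hz => (continuousAt_sectorRight hT hz.1.ge).continuousWithinAt,
      fun z hz => (hR z hz.1).continuousWithinAt,
      fun z hz => tendsto_of_eqOn_inter (isOpen_lt continuous_const Complex.continuous_re) hz.2
        (fun w h1 h2 => rhSolution_right h2 h1) (continuousAt_sectorRight hT hz.1.ge),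
      fun z hz => tendsto_of_eqOn_inter (isOpen_lt continuous_const Complex.continuous_re) hz.2
        (fun w h1 h2 => rhSolution_right' h2 h1) (hR z hz.1), fun z hz => ?_⟩
    obtain ⟨x, rfl⟩ : ∃ x : ℝ, (x : ℂ) = z := ⟨z.re, Complex.ext (by simp) (by simp [hz.1])⟩
    simp only [Complex.conj_ofReal]
    exact sectorRight_jump hT x
  asymptotics := by
    obtain ⟨C, R, hR, h⟩ := exists_rhSolution_asymptotics s ζ₀ hT
    have h' : ∀ z : ℂ, ∃ E : Matrix (Fin 2) (Fin 2) ℂ, z.im ≠ 0 → R ≤ ‖z‖ →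
        rhSolution s T ζ₀ z = (1 + E) * leadingAsymp z ∧ ∀ i j, ‖E i j‖ ≤ C / ‖z‖ := by
      intro z
      by_cases hz : z.im ≠ 0 ∧ R ≤ ‖z‖
      · obtain ⟨E, hE⟩ := h z hz.1 hz.2
        exact ⟨E, fun _ _ => hE⟩
      · exact ⟨0, fun h1 h2 => absurd ⟨h1, h2⟩ hz⟩
    choose E hE using h'
    have hev : ∀ᶠ z : ℂ in Bornology.cobounded ℂ ⊓ 𝓟 (crossContour ζ₀)ᶜ, z.im ≠ 0 ∧ R ≤ ‖z‖ := by
      refine Filter.Eventually.and ?_ ?_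
      · refine Filter.Eventually.filter_mono inf_le_right (eventually_principal.mpr fun z hz => ?_)
        exact fun h0 => hz (Or.inl h0)
      · exact Filter.Eventually.filter_mono inf_le_left
          (tendsto_norm_cobounded_atTop.eventually_ge_atTop R)
    refine ⟨E, fun i j => Asymptotics.IsBigO.of_bound C ?_, ?_⟩
    · filter_upwards [hev] with z hz
      rw [norm_inv, ← div_eq_mul_inv]
      exact (hE z hz.1 hz.2).2 i j
    · filter_upwards [hev] with z hz
      exact (hE z hz.1 hz.2).1
  bounded := by
    obtain ⟨C₁, h₁⟩ := eventually_norm_apply_le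
      (continuousAt_sectorRight (s := s) hT (z := ζ₀) (by simp))
    obtain ⟨C₂, h₂⟩ := eventually_norm_apply_le
      (continuousAt_sectorLeft (s := s) hT (z := ζ₀) (by simp))
    have hconj : Tendsto (starRingEnd ℂ) (𝓝 (ζ₀ : ℂ)) (𝓝 (ζ₀ : ℂ)) := by
      have := Complex.continuous_conj.tendsto (ζ₀ : ℂ)
      rwa [Complex.conj_ofReal] at this
    refine ⟨max C₁ C₂, Filter.Eventually.filter_mono nhdsWithin_le_nhds ?_⟩
    filter_upwards [h₁, h₂, hconj.eventually h₁, hconj.eventually h₂] with z a1 a2 a3 a4 i j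
    rw [rhSolution]
    simp only [upperSolution]
    split_ifs
    · exact (a1 i j).trans (le_max_left _ _)
    · exact (a2 i j).trans (le_max_right _ _)
    · rw [norm_conjSigma_apply]
      exact (a3 i j).trans (le_max_left _ _)
    · rw [norm_conjSigma_apply]
      exact (a4 i j).trans (le_max_right _ _)

end

end

noncomputable section

/- Uniqueness. -/

/-- A continuous function on a disk which is holomorphic off a horizontal diameter is
holomorphic. -/
theorem differentiableOn_ball_of_horizontal {f : ℂ → ℂ} {c : ℂ} {r : ℝ}
    (hc : ContinuousOn f (Metric.ball c r))
    (hd : DifferentiableOn ℂ f (Metric.ball c r ∩ {z | z.im ≠ c.im})) :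
    DifferentiableOn ℂ f (Metric.ball c r) := by
  refine (Complex.isConservativeOn_and_continuousOn_iff_isDifferentiableOn Metric.isOpen_ball).mp
    ⟨fun z w hzw => ?_, hc⟩
  rw [← add_eq_zero_iff_eq_neg, Complex.wedgeIntegral_add_wedgeIntegral_eq]
  -- Morera's theorem on rectangles. Each one is cut along the diameter; projecting its corners
  -- there stays in the disk, and each half meets the diameter only on its boundary, where
  -- continuity suffices.
  have hproj : ∀ z ∈ Metric.ball c r, (⟨z.re, c.im⟩ : ℂ) ∈ Metric.ball c r := by
    intro z hz
    refine lt_of_le_of_lt ?_ (Metric.mem_ball.mp hz)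
    rw [Complex.dist_eq_re_im, Complex.dist_eq_re_im]
    exact Real.sqrt_le_sqrt (by simp [sq_nonneg])
  have hmem : ∀ a ∈ Set.uIcc z.re w.re, ∀ b ∈ Set.uIcc z.im w.im, (⟨a, b⟩ : ℂ) ∈ Metric.ball c r :=
    fun a ha b hb => hzw ⟨ha, hb⟩
  have hz : z ∈ Metric.ball c r := hmem _ Set.left_mem_uIcc _ Set.left_mem_uIcc
  have hw : w ∈ Metric.ball c r := hmem _ Set.right_mem_uIcc _ Set.right_mem_uIcc
  have hz' : (⟨w.re, z.im⟩ : ℂ) ∈ Metric.ball c r := hmem _ Set.right_mem_uIcc _ Set.left_mem_uIcc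
  have hw' : (⟨z.re, w.im⟩ : ℂ) ∈ Metric.ball c r := hmem _ Set.left_mem_uIcc _ Set.right_mem_uIcc
  have hpt : ∀ a b : ℝ, (a : ℂ) + b * Complex.I = ⟨a, b⟩ := fun a b =>
    (Complex.mk_eq_add_mul_I a b).symm
  have hrect : ∀ {b₁ b₂ : ℝ}, (⟨z.re, b₁⟩ : ℂ) ∈ Metric.ball c r →
      (⟨w.re, b₁⟩ : ℂ) ∈ Metric.ball c r → (⟨z.re, b₂⟩ : ℂ) ∈ Metric.ball c r →
      (⟨w.re, b₂⟩ : ℂ) ∈ Metric.ball c r →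
      Set.uIcc z.re w.re ×ℂ Set.uIcc b₁ b₂ ⊆ Metric.ball c r := by
    intro b₁ b₂ h1 h2 h3 h4
    have := Complex.Convex.rectangle_subset (convex_ball c r) (z := ⟨z.re, b₁⟩) (w := ⟨w.re, b₂⟩) h1 h4
      (by rw [hpt]; exact h3) (by rw [hpt]; exact h2)
    exact this
  have hone : ∀ {b₁ b₂ : ℝ}, (⟨z.re, b₁⟩ : ℂ) ∈ Metric.ball c r →
      (⟨w.re, b₁⟩ : ℂ) ∈ Metric.ball c r → (⟨z.re, b₂⟩ : ℂ) ∈ Metric.ball c r →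
      (⟨w.re, b₂⟩ : ℂ) ∈ Metric.ball c r → (b₁ = c.im ∨ b₂ = c.im) →
      (∫ x : ℝ in z.re..w.re, f (x + b₁ * Complex.I)) -
        (∫ x : ℝ in z.re..w.re, f (x + b₂ * Complex.I)) +
        Complex.I • (∫ y : ℝ in b₁..b₂, f (w.re + y * Complex.I)) -
        Complex.I • (∫ y : ℝ in b₁..b₂, f (z.re + y * Complex.I)) = 0 := by
    intro b₁ b₂ h1 h2 h3 h4 h5
    have hsub := hrect h1 h2 h3 h4
    refine Complex.integral_boundary_rect_eq_zero_of_continuousOn_of_differentiableOn f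
      ⟨z.re, b₁⟩ ⟨w.re, b₂⟩ (hc.mono hsub) (hd.mono fun u hu => ⟨hsub ⟨?_, ?_⟩, ?_⟩)
    · exact Set.Ioo_subset_Icc_self hu.1
    · exact Set.Ioo_subset_Icc_self hu.2
    · have h6 := hu.2
      simp only [Set.mem_preimage, Set.mem_Ioo, min_lt_iff, lt_max_iff] at h6
      intro h7
      rw [h7] at h6
      rcases h5 with h5 | h5 <;> rw [h5] at h6 <;> grind
  have hint : ∀ {a b₁ b₂ : ℝ}, (⟨a, b₁⟩ : ℂ) ∈ Metric.ball c r → (⟨a, b₂⟩ : ℂ) ∈ Metric.ball c r →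
      IntervalIntegrable (fun y : ℝ => f (a + y * Complex.I)) volume b₁ b₂ := by
    intro a b₁ b₂ h1 h2
    refine (hc.comp (by fun_prop) fun y hy => ?_).intervalIntegrable
    have := Complex.Convex.rectangle_subset (convex_ball c r) (z := ⟨a, b₁⟩) (w := ⟨a, b₂⟩) h1 h2
      (by rw [hpt]; exact h2) (by rw [hpt]; exact h1)
    rw [hpt]
    exact this ⟨Set.left_mem_uIcc, hy⟩
  have e1 := hone hz hz' (hproj z hz) (hproj w hw) (Or.inr rfl)
  have e2 := hone (hproj z hz) (hproj w hw) hw' hw (Or.inl rfl)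
  rw [← intervalIntegral.integral_add_adjacent_intervals (hint hz' (hproj w hw))
    (hint (hproj w hw) hw), ← intervalIntegral.integral_add_adjacent_intervals
    (hint hz (hproj z hz)) (hint (hproj z hz) hw')]
  simp only [smul_eq_mul] at e1 e2 ⊢
  linear_combination e1 + e2

/-- The horizontal case after rotation by i. -/
theorem differentiableOn_ball_of_vertical {f : ℂ → ℂ} {c : ℂ} {r : ℝ}
    (hc : ContinuousOn f (Metric.ball c r))
    (hd : DifferentiableOn ℂ f (Metric.ball c r ∩ {z | z.re ≠ c.re})) :
    DifferentiableOn ℂ f (Metric.ball c r) := by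
  have hdist : ∀ z w : ℂ, dist (Complex.I * z) (Complex.I * w) = dist z w := fun z w => by
    rw [dist_eq_norm, ← mul_sub, norm_mul, Complex.norm_I, one_mul, dist_eq_norm]
  have hI : ∀ z : ℂ, Complex.I * (-Complex.I * z) = z := fun z => by
    linear_combination -z * Complex.I_sq
  have hI' : ∀ z : ℂ, -Complex.I * (Complex.I * z) = z := fun z => by
    linear_combination -z * Complex.I_sq
  have hball : ∀ z ∈ Metric.ball (-Complex.I * c) r, Complex.I * z ∈ Metric.ball c r := by
    intro z hz
    rw [Metric.mem_ball, ← hI c, hdist]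
    exact hz
  have h := differentiableOn_ball_of_horizontal (f := fun z => f (Complex.I * z))
    (c := -Complex.I * c) (r := r) (hc.comp (by fun_prop) hball)
    (hd.comp (by fun_prop) fun z hz => ⟨hball z hz.1, fun h0 => hz.2 (by simpa using congrArg Neg.neg h0)⟩)
  have h2 := h.comp (f := fun z => -Complex.I * z) (s := Metric.ball c r) (by fun_prop) fun z hz => by
    rw [Metric.mem_ball, ← hdist, hI, hI]
    exact hz
  refine h2.congr fun z _ => ?_
  simp only [Function.comp_apply, hI]

theorem isOpen_crossContour_compl (ζ₀ : ℝ) : IsOpen (crossContour ζ₀)ᶜ := by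
  have h : (crossContour ζ₀)ᶜ = {z : ℂ | z.im ≠ 0} ∩ {z : ℂ | z.re ≠ ζ₀} := by
    ext z
    simp [crossContour]
  rw [h]
  exact (isOpen_ne_fun Complex.continuous_im continuous_const).inter
    (isOpen_ne_fun Complex.continuous_re continuous_const)

theorem dense_crossContour_compl (ζ₀ : ℝ) : Dense (crossContour ζ₀)ᶜ := by
  intro z
  rw [Metric.mem_closure_iff]
  intro ε hε
  obtain ⟨t, ht, ht1, ht2⟩ : ∃ t : ℝ, t ∈ Set.Ioo 0 (ε / 2) ∧ z.im + t ≠ 0 ∧ z.re + t ≠ ζ₀ := by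
    have hinf : (Set.Ioo (0 : ℝ) (ε / 2)).Infinite := Set.Ioo_infinite (half_pos hε)
    obtain ⟨t, h1, h2⟩ := hinf.exists_notMem_finset {-z.im, ζ₀ - z.re}
    simp only [Finset.mem_insert, Finset.mem_singleton, not_or] at h2
    exact ⟨t, h1, fun h => h2.1 (by linarith), fun h => h2.2 (by linarith)⟩
  refine ⟨z + t * (1 + Complex.I), ?_, ?_⟩
  · simp [crossContour, ht1, ht2]
  · rw [dist_eq_norm, sub_add_cancel_left, norm_neg, norm_mul, Complex.norm_real,
      Real.norm_of_nonneg ht.1.le]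
    have h1 : ‖(1 : ℂ) + Complex.I‖ ≤ 2 := by
      refine (norm_add_le _ _).trans ?_
      rw [norm_one, Complex.norm_I]
      norm_num
    have := ht.1
    have := ht.2
    nlinarith

/-- Liouville's theorem for functions holomorphic off the contour, without jumps on its arcs. -/
theorem eq_of_no_jump {ζ₀ : ℝ} {d : ℂ → ℂ} {c : ℂ} (hd : DifferentiableOn ℂ d (crossContour ζ₀)ᶜ)
    (hlim : ∀ z ∈ crossContour ζ₀, z ≠ ζ₀ → ∃ y, Tendsto d (𝓝[(crossContour ζ₀)ᶜ] z) (𝓝 y))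
    (hb : ∃ C : ℝ, ∀ᶠ z in 𝓝[(crossContour ζ₀)ᶜ] (ζ₀ : ℂ), ‖d z‖ ≤ C)
    (hc : Tendsto d (Bornology.cobounded ℂ ⊓ 𝓟 (crossContour ζ₀)ᶜ) (𝓝 c)) :
    ∀ z ∉ crossContour ζ₀, d z = c := by
  set A : Set ℂ := (crossContour ζ₀)ᶜ with hA
  have hAo : IsOpen A := isOpen_crossContour_compl ζ₀
  have hAd : Dense A := dense_crossContour_compl ζ₀
  -- Extension by limits along the dense open complement: continuous away from ζ₀, then holomorphic
  -- across the open arcs by Morera.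
  set D : ℂ → ℂ := extendFrom A d with hD
  have hex : ∀ z ∈ ({(ζ₀ : ℂ)}ᶜ : Set ℂ), ∃ y, Tendsto d (𝓝[A] z) (𝓝 y) := by
    intro z hz
    by_cases h : z ∈ A
    · exact ⟨d z, (hd.continuousOn z h).tendsto⟩
    · exact hlim z (not_not.mp h) hz
  have hDt : ∀ z : ℂ, z ≠ ζ₀ → Tendsto d (𝓝[A] z) (𝓝 (D z)) := fun z hz =>
    tendsto_extendFrom (hex z hz)
  have hne : ∀ z, (𝓝[A] z).NeBot := fun z => mem_closure_iff_nhdsWithin_neBot.mp (hAd z)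
  have hDA : ∀ z ∈ A, D z = d z := fun z hz =>
    extendFrom_eq (hAd z) (hd.continuousOn z hz).tendsto
  have hDc : ContinuousOn D {(ζ₀ : ℂ)}ᶜ := continuousOn_extendFrom (fun z _ => hAd z) hex
  have hDd : ∀ z ∈ A, DifferentiableAt ℂ D z := fun z hz =>
    ((hd z hz).differentiableAt (hAo.mem_nhds hz)).congr_of_eventuallyEq
      (by filter_upwards [hAo.mem_nhds hz] with w hw using hDA w hw)
  have hDo : ∀ z : ℂ, z ≠ ζ₀ → DifferentiableAt ℂ D z := by
    intro z hz
    by_cases him : z.im = 0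
    · have hre : 0 < |z.re - ζ₀| := abs_pos.mpr fun h => hz
        (Complex.ext (by simpa using sub_eq_zero.mp h) (by simpa using him))
      have hball : ∀ w ∈ Metric.ball z |z.re - ζ₀|, w.re ≠ ζ₀ := by
        intro w hw h
        have h1 := (Complex.abs_re_le_norm (z - w)).trans_lt (by
          rw [← dist_eq_norm, dist_comm]
          exact hw)
        rw [Complex.sub_re, h] at h1
        exact lt_irrefl _ h1
      refine (differentiableOn_ball_of_horizontal (c := z) (r := |z.re - ζ₀|)
        (hDc.mono fun w hw h => hball w hw ?_) fun w hw =>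
        (hDd w ?_).differentiableWithinAt).differentiableAt (Metric.ball_mem_nhds z hre)
      · rw [Set.mem_singleton_iff.mp h, Complex.ofReal_re]
      · rintro (h | h)
        · exact hw.2 (h.trans him.symm)
        · exact hball w hw.1 h
    · by_cases hre : z.re = ζ₀
      · have hpos : 0 < |z.im| := abs_pos.mpr him
        have hball : ∀ w ∈ Metric.ball z |z.im|, w.im ≠ 0 := by
          intro w hw h
          have h1 := (Complex.abs_im_le_norm (z - w)).trans_lt (by
            rw [← dist_eq_norm, dist_comm]
            exact hw)
          rw [Complex.sub_im, h, sub_zero] at h1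
          exact lt_irrefl _ h1
        refine (differentiableOn_ball_of_vertical (c := z) (r := |z.im|)
          (hDc.mono fun w hw h => hball w hw ?_) fun w hw =>
          (hDd w ?_).differentiableWithinAt).differentiableAt (Metric.ball_mem_nhds z hpos)
        · rw [Set.mem_singleton_iff.mp h, Complex.ofReal_im]
        · rintro (h | h)
          · exact hball w hw.1 h
          · exact hw.2 (h.trans hre.symm)
      · exact hDd z fun h => h.elim him hre
  obtain ⟨C, hC⟩ := hb
  obtain ⟨O, hO, hζ, hOC⟩ := mem_nhdsWithin.mp hC
  have hOD : ∀ z ∈ O \ {(ζ₀ : ℂ)}, ‖D z‖ ≤ C := by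
    intro z hz
    have := hne z
    refine le_of_tendsto (hDt z hz.2).norm ?_
    filter_upwards [self_mem_nhdsWithin, mem_nhdsWithin_of_mem_nhds (hO.mem_nhds hz.1)] with w h1 h2
    exact hOC ⟨h2, h1⟩
  -- Boundedness leaves only a removable singularity at ζ₀; the limit at infinity then makes the
  -- entire function constant.
  have hrem := Complex.differentiableOn_update_limUnder_of_bddAbove (hO.mem_nhds hζ)
    (fun z hz => (hDo z hz.2).differentiableWithinAt)
    ⟨C, by rintro _ ⟨z, hz, rfl⟩; exact hOD z hz⟩
  set G : ℂ → ℂ := Function.update D ζ₀ (limUnder (𝓝[≠] (ζ₀ : ℂ)) D) with hG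
  have hGD : ∀ z : ℂ, z ≠ ζ₀ → G z = D z := fun z hz => Function.update_of_ne hz _ _
  have hGd : Differentiable ℂ G := by
    intro z
    by_cases hz : z = ζ₀
    · rw [hz]
      exact hrem.differentiableAt (hO.mem_nhds hζ)
    · refine (hDo z hz).congr_of_eventuallyEq ?_
      filter_upwards [isOpen_ne.mem_nhds hz] with w hw using hGD w hw
  have hGlim : Tendsto G (cocompact ℂ) (𝓝 c) := by
    rw [← Metric.cobounded_eq_cocompact, Metric.nhds_basis_closedBall.tendsto_right_iff]
    intro ε hε
    have h1 := hc.eventually (Metric.closedBall_mem_nhds c hε)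
    rw [Filter.eventually_inf_principal] at h1
    obtain ⟨R, -, hR⟩ := (Filter.hasBasis_cobounded_norm (E := ℂ)).eventually_iff.mp h1
    have h2 : ∀ᶠ z : ℂ in Bornology.cobounded ℂ, max R |ζ₀| < ‖z‖ :=
      tendsto_norm_cobounded_atTop.eventually_gt_atTop _
    filter_upwards [h2] with z hz
    have hz0 : z ≠ ζ₀ := by
      rintro rfl
      rw [Complex.norm_real, Real.norm_eq_abs] at hz
      exact absurd ((le_max_right R |ζ₀|).trans_lt hz) (lt_irrefl _)
    rw [hGD z hz0]
    have := hne z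
    refine Metric.isClosed_closedBall.mem_of_tendsto (hDt z hz0) ?_
    have hopen : IsOpen {w : ℂ | R < ‖w‖} := isOpen_lt continuous_const continuous_norm
    filter_upwards [self_mem_nhdsWithin, mem_nhdsWithin_of_mem_nhds
      (hopen.mem_nhds ((le_max_left _ _).trans_lt hz))] with w w1 w2
    exact hR (le_of_lt w2) w1
  intro z hz
  have hz0 : z ≠ ζ₀ := fun h => hz (Or.inl (by rw [h, Complex.ofReal_im]))
  rw [← hDA z hz, ← hGD z hz0]
  exact hGd.apply_eq_of_tendsto_cocompact z hGlim

end

/-! ### Quotients of solutions, determinants and the function on the real line. -/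

noncomputable section

theorem det_leadingAsymp {z : ℂ} (hz : z ≠ 0) : (leadingAsymp z).det = 1 := by
  rw [leadingAsymp_eq]
  have hm : z ^ (1 / 4 : ℂ) ≠ 0 := by
    intro h
    have := cpow_quarter_pow_four z
    rw [h] at this
    exact hz (by rw [← this]; norm_num)
  generalize z ^ (1 / 4 : ℂ) = m at hm
  have hE : Complex.exp (-(2 / 3) * m ^ 6) * Complex.exp (2 / 3 * m ^ 6) = 1 := by
    rw [← Complex.exp_add]
    simp
  have hq : (((Real.sqrt 2 : ℝ) : ℂ)⁻¹) ^ 2 = 1 / 2 := by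
    rw [inv_pow, sqrt_two_sq]
    norm_num
  have hmi : m * m⁻¹ = 1 := mul_inv_cancel₀ hm
  rw [leadingModel, Matrix.det_fin_two_of]
  generalize Complex.exp (-(2 / 3) * m ^ 6) = e at *
  generalize Complex.exp (2 / 3 * m ^ 6) = e' at *
  generalize ((Real.sqrt 2 : ℝ) : ℂ)⁻¹ = q at *
  generalize m⁻¹ = u at *
  linear_combination -(q ^ 2 * m * u * e * e') * Complex.I_sq + 2 * (m * u * e * e') * hq +
    (m * u) * hE + hmi

theorem det_jumpVert (s T : ℝ) (z : ℂ) : (jumpVert s T z).det = 1 := by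
  rw [jumpVert, Matrix.det_fin_two_of]
  ring

theorem det_jumpRight (s T : ℝ) (z : ℂ) : (jumpRight s T z).det = 1 := by
  rw [jumpRight, Matrix.det_fin_two_of]
  ring

theorem det_jumpLeft {s T : ℝ} {z : ℂ} (hz : z.im = 0) : (jumpLeft s T z).det = 1 := by
  obtain ⟨x, rfl⟩ : ∃ x : ℝ, (x : ℂ) = z := ⟨z.re, Complex.ext (by simp) (by simp [hz])⟩
  rw [jumpLeft, Matrix.det_fin_two_of]
  linear_combination invOneSubSigma_mul_one_sub s T x

/-- If `Ψ` and `Φ` have the same jump of determinant one, then `Ψ Φ⁻¹` has no jump. -/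
theorem HasJump.exists_tendsto_mul_adjugate {Ψ Φ : ℂ → Matrix (Fin 2) (Fin 2) ℂ}
    {γ plus minus : Set ℂ} {J : ℂ → Matrix (Fin 2) (Fin 2) ℂ} (hΨ : HasJump Ψ γ plus minus J)
    (hΦ : HasJump Φ γ plus minus J) {z : ℂ} (hz : z ∈ γ) (hJ : (J z).det = 1) :
    ∃ Y : Matrix (Fin 2) (Fin 2) ℂ,
      Tendsto (fun w => Ψ w * (Φ w).adjugate) (𝓝[plus] z ⊔ 𝓝[minus] z) (𝓝 Y) := by
  obtain ⟨Ψp, Ψm, -, -, hp, hm, hj⟩ := hΨ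
  obtain ⟨Φp, Φm, -, -, hp', hm', hj'⟩ := hΦ
  have hadj : Continuous fun M : Matrix (Fin 2) (Fin 2) ℂ => M.adjugate :=
    continuous_id.matrix_adjugate
  -- A common jump J enters as J · adj(J) = det J = 1.
  have key : Ψp z * (Φp z).adjugate = Ψm z * (Φm z).adjugate := by
    rw [hj z hz, hj' z hz, Matrix.adjugate_mul_distrib, mul_assoc, ← mul_assoc (J z),
      Matrix.mul_adjugate, hJ, one_smul, one_mul]
  refine ⟨Ψp z * (Φp z).adjugate, Tendsto.sup ?_ ?_⟩
  · exact (hp z hz).mul ((hadj.tendsto _).comp (hp' z hz))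
  · rw [key]
    exact (hm z hz).mul ((hadj.tendsto _).comp (hm' z hz))

theorem nhdsWithin_le_sup {X : Type*} [TopologicalSpace X] {A O P Q : Set X} {z : X}
    (hO : IsOpen O) (hz : z ∈ O) (h : A ∩ O ⊆ P ∪ Q) : 𝓝[A] z ≤ 𝓝[P] z ⊔ 𝓝[Q] z := by
  rw [← nhdsWithin_union, ← nhdsWithin_inter_of_mem' (mem_nhdsWithin_of_mem_nhds (hO.mem_nhds hz))]
  exact nhdsWithin_mono z h

/-- Two solutions of the Riemann-Hilbert problem have no relative jumps. -/
theorem IsRHSolution.exists_tendsto_mul_adjugate {s T ζ₀ : ℝ}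
    {Ψ Φ : ℂ → Matrix (Fin 2) (Fin 2) ℂ} (hΨ : IsRHSolution s T ζ₀ Ψ)
    (hΦ : IsRHSolution s T ζ₀ Φ) {z : ℂ} (hz : z ∈ crossContour ζ₀) (hz0 : z ≠ ζ₀) :
    ∃ Y : Matrix (Fin 2) (Fin 2) ℂ,
      Tendsto (fun w => Ψ w * (Φ w).adjugate) (𝓝[(crossContour ζ₀)ᶜ] z) (𝓝 Y) := by
  have hnot : ∀ w ∈ (crossContour ζ₀)ᶜ, w.im ≠ 0 ∧ w.re ≠ ζ₀ := fun w hw =>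
    ⟨fun h => hw (Or.inl h), fun h => hw (Or.inr h)⟩
  have hre : Continuous Complex.re := Complex.continuous_re
  have him : Continuous Complex.im := Complex.continuous_im
  by_cases h0 : z.im = 0
  · have h1 : z.re ≠ ζ₀ := fun h => hz0 (Complex.ext (by simpa using h) (by simpa using h0))
    rcases lt_or_gt_of_ne h1 with h2 | h2
    · obtain ⟨Y, hY⟩ := hΨ.jump_left.exists_tendsto_mul_adjugate hΦ.jump_left ⟨h0, h2⟩
        (det_jumpLeft h0)
      refine ⟨Y, hY.mono_left (nhdsWithin_le_sup isOpen_univ trivial fun w hw => ?_)⟩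
      exact (lt_or_gt_of_ne (hnot w hw.1).1).symm
    · obtain ⟨Y, hY⟩ := hΨ.jump_right.exists_tendsto_mul_adjugate hΦ.jump_right ⟨h0, h2⟩
        (det_jumpRight s T z)
      refine ⟨Y, hY.mono_left (nhdsWithin_le_sup isOpen_univ trivial fun w hw => ?_)⟩
      exact (lt_or_gt_of_ne (hnot w hw.1).1).symm
  · have h1 : z.re = ζ₀ := hz.resolve_left h0
    rcases lt_or_gt_of_ne h0 with h2 | h2
    · obtain ⟨Y, hY⟩ := hΨ.jump_down.exists_tendsto_mul_adjugate hΦ.jump_down ⟨h1, h2⟩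
        (det_jumpVert s T z)
      refine ⟨Y, hY.mono_left (nhdsWithin_le_sup isOpen_univ trivial fun w hw => ?_)⟩
      exact lt_or_gt_of_ne (hnot w hw.1).2
    · obtain ⟨Y, hY⟩ := hΨ.jump_up.exists_tendsto_mul_adjugate hΦ.jump_up ⟨h1, h2⟩
        (det_jumpVert s T z)
      refine ⟨Y, hY.mono_left (nhdsWithin_le_sup isOpen_univ trivial fun w hw => ?_)⟩
      exact (lt_or_gt_of_ne (hnot w hw.1).2).symm

theorem mul_adjugate_apply (M N : Matrix (Fin 2) (Fin 2) ℂ) :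
    M * N.adjugate = !![M 0 0 * N 1 1 - M 0 1 * N 1 0, M 0 1 * N 0 0 - M 0 0 * N 0 1;
      M 1 0 * N 1 1 - M 1 1 * N 1 0, M 1 1 * N 0 0 - M 1 0 * N 0 1] := by
  rw [Matrix.adjugate_fin_two]
  ext i j
  fin_cases i <;> fin_cases j <;> simp [Matrix.mul_apply, Fin.sum_univ_two] <;> ring

theorem norm_mul_adjugate_apply_le {M N : Matrix (Fin 2) (Fin 2) ℂ} {a b : ℝ}
    (hM : ∀ i j, ‖M i j‖ ≤ a) (hN : ∀ i j, ‖N i j‖ ≤ b) (i j : Fin 2) :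
    ‖(M * N.adjugate) i j‖ ≤ 2 * a * b := by
  have ha : 0 ≤ a := (norm_nonneg _).trans (hM 0 0)
  have h : ∀ i j k l m n o p, ‖M i j * N k l - M m n * N o p‖ ≤ 2 * a * b := by
    intro i j k l m n o p
    have h1 : ‖M i j * N k l‖ ≤ a * b := by
      rw [norm_mul]
      exact mul_le_mul (hM _ _) (hN _ _) (norm_nonneg _) ha
    have h2 : ‖M m n * N o p‖ ≤ a * b := by
      rw [norm_mul]
      exact mul_le_mul (hM _ _) (hN _ _) (norm_nonneg _) ha
    linarith [norm_sub_le (M i j * N k l) (M m n * N o p)]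
  rw [mul_adjugate_apply]
  fin_cases i <;> fin_cases j <;> apply h

/-- Liouville's theorem for each entry. The adjugate replaces the inverse, so invertibility of Φ
need not be known beforehand. At infinity the leading factors cancel because their determinant is 1.
-/
theorem IsRHSolution.mul_adjugate_eq_one {s T ζ₀ : ℝ} {Ψ Φ : ℂ → Matrix (Fin 2) (Fin 2) ℂ}
    (hΨ : IsRHSolution s T ζ₀ Ψ) (hΦ : IsRHSolution s T ζ₀ Φ) {z : ℂ} (hz : z ∉ crossContour ζ₀) :
    Ψ z * (Φ z).adjugate = 1 := by
  ext i j
  refine eq_of_no_jump (ζ₀ := ζ₀) (d := fun z => (Ψ z * (Φ z).adjugate) i j) ?_ ?_ ?_ ?_ z hz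
  · have h1 := hΨ.analytic
    have h2 := hΦ.analytic
    simp_rw [mul_adjugate_apply]
    fin_cases i <;> fin_cases j
    · exact ((h1 0 0).mul (h2 1 1)).sub ((h1 0 1).mul (h2 1 0))
    · exact ((h1 0 1).mul (h2 0 0)).sub ((h1 0 0).mul (h2 0 1))
    · exact ((h1 1 0).mul (h2 1 1)).sub ((h1 1 1).mul (h2 1 0))
    · exact ((h1 1 1).mul (h2 0 0)).sub ((h1 1 0).mul (h2 0 1))
  · intro z hz hz0
    obtain ⟨Y, hY⟩ := hΨ.exists_tendsto_mul_adjugate hΦ hz hz0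
    exact ⟨Y i j, ((continuous_apply_apply i j).tendsto Y).comp hY⟩
  · obtain ⟨C, hC⟩ := hΨ.bounded
    obtain ⟨D, hD⟩ := hΦ.bounded
    refine ⟨2 * C * D, ?_⟩
    filter_upwards [hC, hD] with w h1 h2
    exact norm_mul_adjugate_apply_le h1 h2 i j
  · obtain ⟨E, hE, hE'⟩ := hΨ.asymptotics
    obtain ⟨F, hF, hF'⟩ := hΦ.asymptotics
    set l : Filter ℂ := Bornology.cobounded ℂ ⊓ 𝓟 (crossContour ζ₀)ᶜ with hl
    have hinv : Tendsto (fun z : ℂ => z⁻¹) l (𝓝 0) :=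
      Filter.tendsto_inv₀_cobounded.mono_left inf_le_left
    have hE0 : Tendsto E l (𝓝 0) := tendsto_matrix fun i j => (hE i j).trans_tendsto hinv
    have hF0 : Tendsto F l (𝓝 0) := tendsto_matrix fun i j => (hF i j).trans_tendsto hinv
    have hadj : Continuous fun M : Matrix (Fin 2) (Fin 2) ℂ => M.adjugate :=
      continuous_id.matrix_adjugate
    have hlim : Tendsto (fun z => (1 + E z) * (1 + F z).adjugate) l
        (𝓝 ((1 + 0) * (1 + (0 : Matrix (Fin 2) (Fin 2) ℂ)).adjugate)) :=
      (tendsto_const_nhds.add hE0).mul ((hadj.tendsto _).comp (tendsto_const_nhds.add hF0))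
    rw [add_zero, Matrix.adjugate_one, mul_one] at hlim
    have hij : Tendsto (fun z => ((1 + E z) * (1 + F z).adjugate) i j) l
        (𝓝 ((1 : Matrix (Fin 2) (Fin 2) ℂ) i j)) :=
      ((continuous_apply_apply i j).tendsto _).comp hlim
    refine hij.congr' ?_
    have hne : ∀ᶠ z : ℂ in l, z ≠ 0 :=
      Filter.Eventually.filter_mono inf_le_left (Bornology.eventually_ne_cobounded 0)
    filter_upwards [hE', hF', hne] with w h1 h2 h3
    rw [h1, h2, Matrix.adjugate_mul_distrib, mul_assoc, ← mul_assoc (leadingAsymp w),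
      Matrix.mul_adjugate, det_leadingAsymp h3, one_smul, one_mul]

/-- Compare a solution with itself: Ψ · adj Ψ is the determinant times the identity. -/
theorem IsRHSolution.det_eq_one {s T ζ₀ : ℝ} {Ψ : ℂ → Matrix (Fin 2) (Fin 2) ℂ}
    (hΨ : IsRHSolution s T ζ₀ Ψ) {z : ℂ} (hz : z ∉ crossContour ζ₀) : (Ψ z).det = 1 := by
  have h := hΨ.mul_adjugate_eq_one hΨ hz
  rw [Matrix.mul_adjugate] at h
  simpa using congrFun (congrFun h 0) 0

theorem IsRHSolution.eq {s T ζ₀ : ℝ} {Ψ Φ : ℂ → Matrix (Fin 2) (Fin 2) ℂ}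
    (hΨ : IsRHSolution s T ζ₀ Ψ) (hΦ : IsRHSolution s T ζ₀ Φ) {z : ℂ} (hz : z ∉ crossContour ζ₀) :
    Ψ z = Φ z := by
  have h := congrArg (fun M => M * Φ z) (hΨ.mul_adjugate_eq_one hΦ hz)
  simpa [mul_assoc, Matrix.adjugate_mul, hΦ.det_eq_one hz] using h

/- The function `Ψ̂`. -/

section

variable {s T ζ₀ : ℝ}

/-- YΦ does not depend on ζ₀, so moving ζ₀ to the left of a given point of the upper half-plane
makes it the value of an RH solution there. Real points follow by continuity from above. -/
theorem det_sectorRight (hT : 0 < T) {z : ℂ} (hz : 0 ≤ z.im) : (sectorRight s T z).det = 1 := by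
  have hpos : ∀ w : ℂ, 0 < w.im → (sectorRight s T w).det = 1 := by
    intro w hw
    have hre : w.re - 1 < w.re := by linarith
    rw [← rhSolution_right (ζ₀ := w.re - 1) hw hre]
    refine (isRHSolution_rhSolution s _ hT).det_eq_one ?_
    rintro (h | h)
    · exact hw.ne' h
    · linarith
  have hcont : Tendsto (fun t : ℝ => (sectorRight s T (z + t * Complex.I)).det) (𝓝[>] 0)
      (𝓝 (sectorRight s T z).det) := by
    have h1 : ContinuousAt (fun t : ℝ => z + t * Complex.I) 0 := by fun_prop
    have h2 : ContinuousAt (sectorRight s T) (z + ((0 : ℝ) : ℂ) * Complex.I) := by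
      simpa using continuousAt_sectorRight (s := s) hT hz
    have h3 := (continuous_id.matrix_det.continuousAt.comp
      (h2.comp (f := fun t : ℝ => z + t * Complex.I) h1)).tendsto
    simp only [Function.comp_apply, Complex.ofReal_zero, zero_mul, add_zero, id] at h3
    exact h3.mono_left nhdsWithin_le_nhds
  refine tendsto_nhds_unique (hcont.congr' ?_) tendsto_const_nhds
  filter_upwards [self_mem_nhdsWithin] with t ht
  refine hpos _ ?_
  have : (0 : ℝ) < t := ht
  simp
  linarith

/-- Uniqueness replaces an arbitrary solution by the constructed one. Left of ζ₀ the factor in Ψ̂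
undoes the inverse vertical jump, so a single analytic function appears on both sides and ζ₀ drops
out. -/
theorem hatPsi_eq (hT : 0 < T) {Ψ : ℂ → Matrix (Fin 2) (Fin 2) ℂ}
    {Ψp : ℝ → Matrix (Fin 2) (Fin 2) ℂ} (hΨ : IsRHSolution s T ζ₀ Ψ)
    (hp : IsUpperBoundaryValue ζ₀ Ψ Ψp) {x : ℝ} (hx : x ≠ ζ₀) :
    hatPsi s T ζ₀ Ψp x = sectorRight s T x := by
  have hsol := isRHSolution_rhSolution s ζ₀ hT
  have hnb : (𝓝[{w : ℂ | 0 < w.im}] (x : ℂ)).NeBot := by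
    rw [← mem_closure_iff_nhdsWithin_neBot, Complex.closure_setOfPred_lt_im]
    simp
  have key : ∀ (O : Set ℂ) (f : ℂ → Matrix (Fin 2) (Fin 2) ℂ), IsOpen O → (x : ℂ) ∈ O →
      (∀ w ∈ O, 0 < w.im → w ∉ crossContour ζ₀ ∧ rhSolution s T ζ₀ w = f w) →
      ContinuousAt f x → Ψp x = f x := by
    intro O f hO hxO hf hfc
    refine tendsto_nhds_unique (hp x hx) (tendsto_of_eqOn_inter hO hxO (fun w h1 h2 => ?_) hfc)
    obtain ⟨h3, h4⟩ := hf w h1 h2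
    rw [hΨ.eq hsol h3, h4]
  rw [hatPsi]
  rcases lt_or_gt_of_ne hx with h | h
  · rw [if_neg h.not_gt, key {w | w.re < ζ₀} (sectorLeft s T)
      (isOpen_lt Complex.continuous_re continuous_const) (by simpa using h)
      (fun w h1 h2 => ⟨?_, rhSolution_left h2 h1⟩) (continuousAt_sectorLeft hT (by simp)),
      sectorLeft_mul_jumpVert]
    rintro (h3 | h3)
    · exact h2.ne' h3
    · exact (ne_of_lt h1) h3
  · rw [if_pos h, key {w | ζ₀ < w.re} (sectorRight s T)
      (isOpen_lt continuous_const Complex.continuous_re) (by simpa using h)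
      (fun w h1 h2 => ⟨?_, rhSolution_right h2 h1⟩) (continuousAt_sectorRight hT (by simp))]
    rintro (h3 | h3)
    · exact h2.ne' h3
    · exact (ne_of_gt h1) h3

theorem differentiableAt_sectorRight_ofReal (hT : 0 < T) (x : ℝ) (i j : Fin 2) :
    DifferentiableAt ℝ (fun t : ℝ => sectorRight s T t i j) x :=
  ((differentiableAt_sectorRight (s := s) hT (z := x) (by simp) i j).hasDerivAt.comp_ofReal).differentiableAt

/-- With determinant 1, the (2,1) entry is the Wronskian of the first column, Ψ₁₁Ψ₂₁' − Ψ₂₁Ψ₁₁'.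
That column is −√(2π)(G₁, iG₀), which gives 2πi(G₁G₀' − G₀G₁'). -/
theorem invMulDeriv21_sectorRight (hT : 0 < T) (x : ℝ) :
    invMulDeriv21 (fun t : ℝ => sectorRight s T t) x =
      2 * Real.pi * Complex.I * airyL s T x x := by
  have hdet := det_sectorRight (s := s) hT (z := x) (by simp)
  have hd : ∀ k, HasDerivAt (fun t : ℝ => dressedC s T k t) (deriv (dressedC s T k) x) x :=
    fun k => ((differentiable_dressedC s T k) x).hasDerivAt.comp_ofReal
  have d0 : deriv (fun t : ℝ => sectorRight s T t 0 0) x =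
      -(airyNorm * deriv (dressedC s T 1) x) := by
    simp_rw [sectorRight_zero_zero hT]
    exact ((hd 1).const_mul _).neg.deriv
  have d1 : deriv (fun t : ℝ => sectorRight s T t 1 0) x =
      -(airyNorm * Complex.I * deriv (dressedC s T 0) x) := by
    simp_rw [sectorRight_one_zero hT]
    exact ((hd 0).const_mul _).neg.deriv
  rw [invMulDeriv21, Matrix.inv_def, hdet, Ring.inverse_one, one_smul, Matrix.adjugate_fin_two,
    Matrix.mul_apply, Fin.sum_univ_two]
  simp only [Matrix.of_apply, Matrix.cons_val', Matrix.cons_val_zero, Matrix.cons_val_one,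
    Matrix.cons_val_fin_one, d0, d1]
  rw [sectorRight_zero_zero hT, sectorRight_one_zero hT, ofReal_airyL_self hT]
  linear_combination (Complex.I * (dressedC s T 1 x * deriv (dressedC s T 0) x -
      dressedC s T 0 x * deriv (dressedC s T 1) x)) * airyNorm_sq

theorem hatPsi_eventuallyEq (hT : 0 < T) {Ψ : ℂ → Matrix (Fin 2) (Fin 2) ℂ}
    {Ψp : ℝ → Matrix (Fin 2) (Fin 2) ℂ} (hΨ : IsRHSolution s T ζ₀ Ψ)
    (hp : IsUpperBoundaryValue ζ₀ Ψ Ψp) {x : ℝ} (hx : x ≠ ζ₀) :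
    hatPsi s T ζ₀ Ψp =ᶠ[𝓝 x] fun t : ℝ => sectorRight s T t := by
  filter_upwards [isOpen_ne.mem_nhds hx] with t ht using hatPsi_eq hT hΨ hp ht

theorem invMulDeriv21_hatPsi (hT : 0 < T) {Ψ : ℂ → Matrix (Fin 2) (Fin 2) ℂ}
    {Ψp : ℝ → Matrix (Fin 2) (Fin 2) ℂ} (hΨ : IsRHSolution s T ζ₀ Ψ)
    (hp : IsUpperBoundaryValue ζ₀ Ψ Ψp) {x : ℝ} (hx : x ≠ ζ₀) :
    invMulDeriv21 (hatPsi s T ζ₀ Ψp) x = 2 * Real.pi * Complex.I * airyL s T x x := by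
  rw [← invMulDeriv21_sectorRight hT]
  have he := hatPsi_eventuallyEq hT hΨ hp hx
  have hd : ∀ i j, deriv (fun t => hatPsi s T ζ₀ Ψp t i j) x =
      deriv (fun t : ℝ => sectorRight s T t i j) x := fun i j =>
    Filter.EventuallyEq.deriv_eq (he.mono fun t ht => congrFun (congrFun ht i) j)
  simp only [invMulDeriv21, hd, he.eq_of_nhds]

end

end

/-! ### Assembly of solvability, determinant and derivative formulas. -/

theorem theorem2 (s T ζ₀ : ℝ) (hT : 0 < T) :
    -- The problem is uniquely solvable.
    (∃ Ψ : ℂ → Matrix (Fin 2) (Fin 2) ℂ, IsRHSolution s T ζ₀ Ψ ∧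
      ∀ Ψ' : ℂ → Matrix (Fin 2) (Fin 2) ℂ, IsRHSolution s T ζ₀ Ψ' →
        ∀ z ∉ crossContour ζ₀, Ψ' z = Ψ z) ∧
    -- The Fredholm determinant is well defined and its logarithm makes sense.
    FredholmConverges (deformedAiryKernel s T) ∧ 0 < airyQ s T ∧
    -- The formulas for the logarithmic derivatives, including that all terms are meaningful.
    ∀ (Ψ : ℂ → Matrix (Fin 2) (Fin 2) ℂ) (Ψp : ℝ → Matrix (Fin 2) (Fin 2) ℂ),
      IsRHSolution s T ζ₀ Ψ → IsUpperBoundaryValue ζ₀ Ψ Ψp →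
        (∀ x : ℝ, x ≠ ζ₀ → IsUnit (hatPsi s T ζ₀ Ψp x).det ∧
          ∀ i j, DifferentiableAt ℝ (fun t => hatPsi s T ζ₀ Ψp t i j) x) ∧
        MeasureTheory.Integrable (integrandT s T (hatPsi s T ζ₀ Ψp)) ∧
        MeasureTheory.Integrable (integrandS s T (hatPsi s T ζ₀ Ψp)) ∧
        HasDerivAt (fun t : ℝ => ((Real.log (airyQ s t) : ℝ) : ℂ))
          (-(1 / (6 * Real.pi * Complex.I * ((T ^ (2 / 3 : ℝ) : ℝ) : ℂ))) *
            ∫ x : ℝ, integrandT s T (hatPsi s T ζ₀ Ψp) x) T ∧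
        HasDerivAt (fun r : ℝ => ((Real.log (airyQ r T) : ℝ) : ℂ))
          (-(((T ^ (1 / 3 : ℝ) : ℝ) : ℂ) / (2 * Real.pi * Complex.I)) *
            ∫ x : ℝ, integrandS s T (hatPsi s T ζ₀ Ψp) x) s := by
  refine ⟨⟨rhSolution s T ζ₀, isRHSolution_rhSolution s ζ₀ hT, fun Ψ' h z hz =>
    h.eq (isRHSolution_rhSolution s ζ₀ hT) hz⟩, fredholmConverges_deformedAiryKernel s hT,
    airyQ_pos s hT, fun Ψ Ψp hΨ hp => ⟨fun x hx => ⟨?_, fun i j => ?_⟩, ?_⟩⟩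
  · rw [hatPsi_eq hT hΨ hp hx, det_sectorRight hT (by simp)]
    exact isUnit_one
  · exact (differentiableAt_sectorRight_ofReal hT x i j).congr_of_eventuallyEq
      ((hatPsi_eventuallyEq hT hΨ hp hx).mono fun t ht => congrFun (congrFun ht i) j)
  obtain ⟨iS, dS⟩ := hasDerivAt_log_airyQ_s s hT
  obtain ⟨iT, dT⟩ := hasDerivAt_log_airyQ_T s hT
  -- The point ζ₀, where Ψ̂ is not controlled, is a null set and does not affect the integrals.
  have hae : ∀ᵐ x : ℝ, x ≠ ζ₀ := by simp [ae_iff, measure_singleton]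
  have eT : integrandT s T (hatPsi s T ζ₀ Ψp) =ᵐ[volume] fun x => (2 * Real.pi * Complex.I) *
      (((x + s) * deriv Real.sigmoid (T ^ (1 / 3 : ℝ) * (x + s)) * airyL s T x x : ℝ) : ℂ) := by
    filter_upwards [hae] with x hx
    rw [integrandT, invMulDeriv21_hatPsi hT hΨ hp hx]
    push_cast
    ring
  have eS : integrandS s T (hatPsi s T ζ₀ Ψp) =ᵐ[volume] fun x => (2 * Real.pi * Complex.I) *
      ((deriv Real.sigmoid (T ^ (1 / 3 : ℝ) * (x + s)) * airyL s T x x : ℝ) : ℂ) := by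
    filter_upwards [hae] with x hx
    rw [integrandS, invMulDeriv21_hatPsi hT hΨ hp hx]
    push_cast
    ring
  have hpi : (Real.pi : ℂ) ≠ 0 := by exact_mod_cast Real.pi_ne_zero
  have hT2 : ((T ^ (2 / 3 : ℝ) : ℝ) : ℂ) ≠ 0 := by
    exact_mod_cast (Real.rpow_pos_of_pos hT _).ne'
  refine ⟨(iT.ofReal.const_mul _).congr eT.symm, (iS.ofReal.const_mul _).congr eS.symm, ?_, ?_⟩
  · refine dT.ofReal_comp.congr_deriv ?_
    rw [integral_congr_ae eT, integral_const_mul, integral_complex_ofReal, Complex.ofReal_neg,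
      Complex.ofReal_mul, Complex.ofReal_div, Complex.ofReal_mul]
    generalize ((T ^ (2 / 3 : ℝ) : ℝ) : ℂ) = τ at hT2 ⊢
    generalize (∫ x : ℝ, (x + s) * deriv Real.sigmoid (T ^ (1 / 3 : ℝ) * (x + s)) *
      airyL s T x x) = J
    have hI := Complex.I_ne_zero
    push_cast
    field_simp
    ring
  · refine dS.ofReal_comp.congr_deriv ?_
    rw [integral_congr_ae eS, integral_const_mul, integral_complex_ofReal, Complex.ofReal_neg,
      Complex.ofReal_mul]
    generalize ((T ^ (1 / 3 : ℝ) : ℝ) : ℂ) = τ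
    have hI := Complex.I_ne_zero
    field_simp
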